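/- Let $k\ge 1$ be odd and $\Gamma=\mathrm{SL}_2(\mathbb Z)$. Let $V$ be the space of traceless rational $2\times2$ matrices with $(X,Y)=\mathrm{tr}(XY)$, on which $\mathrm{SL}_2$ acts by conjugation; let $e_1=\tfrac1{\sqrt2}\begin{pmatrix}0&1\\1&0\end{pmatrix}$, $e_2=\tfrac1{\sqrt2}\begin{pmatrix}1&0\\0&-1\end{pmatrix}$, $e_3=\tfrac1{\sqrt2}\begin{pmatrix}0&1\\-1&0\end{pmatrix}$ and $u'=\begin{pmatrix}0&0\\-1&0\end{pmatrix}$. Let $\mathcal H_k(V_{\mathbb C})\subset\mathrm{Sym}^k(V_{\mathbb C})$ be the harmonic (trace-free) tensors, with the form extending $(X^k,Y^k)=(X,Y)^k$, and let $\pi_k$ be the orthogonal projection onto it. Let $X=\Gamma\backslash\mathbb H$, and let $\overline X$ be its Borel–Serre compactification, with boundary circle $\partial\overline X=\mathbb R/\mathbb Z$ and coordinates $(x,t)$, $t=1/y\ge0$, near it. Forms on $X$ are $\Gamma$-invariant $\mathcal H_k(V_{\mathbb C})$-valued forms on $\mathbb H$. Write $n(x)=\begin{pmatrix}1&x\\0&1\end{pmatrix}$,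 $\Gamma_\infty=\{n(m):m\in\mathbb Z\}$, $z=x+iy$, $g_z=n(x)\,\mathrm{diag}(\sqrt y,1/\sqrt y)$, $\tau=u+iv\in\mathbb H$. **Eisenstein class.** $\mathcal E(z,k)=\frac12\sum_{\gamma\in\Gamma_\infty\backslash\Gamma}\gamma^*\bigl(dx\otimes n(x)u'^k\bigr)$. **Theta series.** Let $L$ be the lattice of integral traceless matrices, so that $L^\#/L=\{0,1\}$, with $h$ standing for the coset of $\mathrm{diag}(\tfrac h2,-\tfrac h2)$, and let $K=\mathbb Z\,\mathrm{diag}(1,-1)$ (that is, $\mathbb Z$ with $(b,b')=2bb'$), $W=\mathbb R e_2\cong\mathbb R$, $K^\#/K=L^\#/L$. Let $\mathcal D_j=x_j-\frac1{2\pi}\partial_{x_j}$ in the coordinates with respect to $e_1,e_2,e_3$, $\varphi_0=e^{-\pi(x_1^2+x_2^2+x_3^2)}$, $\omega_1=dy/y$, $\omega_2=-dx/y$, and $$\varphi^V_{1,[k]}(X,z)=2^{-k-1/2}\sum_{\alpha=1}^2\sum_{\beta_1,\dots,\beta_k=1}^2(\mathcal D_\alpha\mathcal D_{\beta_1}\cdots\mathcal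 D_{\beta_k}\varphi_0)(g_z^{-1}Xg_z)\;\omega_\alpha\otimes g_z\pi_k(e_{\beta_1}\cdots e_{\beta_k}),$$ $$\theta_{L+h}(\tau)=v^{-k/2}\sum_{X\in L+h}\varphi^V_{1,[k]}(\sqrt vX,z)\,e^{\pi i(X,X)u}.$$ Let $H_j$ be the Hermite polynomials, $H_j(t)=(-1)^je^{t^2}\frac{d^j}{dt^j}e^{-t^2}$, $\widetilde H_j(w)=(2\pi)^{-j/2}H_j(\sqrt{2\pi}w)$, let $R$ be the infinitesimal generator of $n(x)$, and let $v_{-2}\in\mathcal H_k(V)$ be the vector of weight $-2$ for the diagonal torus with $Rv_{-2}=k\,\pi_k(\mathrm{diag}(1,-1)^k)$. Put $$\phi^N_{[k]}(w,x)=-\frac{1}{2^{3k/2+1/2}k}\widetilde H_{k+1}(w)e^{-\pi w^2}\,n(x)v_{-2},\qquad \theta_{K+h}(\tau)=v^{-(k+1)/2}\sum_{w\in K+h}\phi^N_{[k]}(\sqrt vw,x)\,e^{\pi i(w,w)u}.$$ **Pairing.** Pairs $(a,b)$ of a closed $1$-form $a$ on $\overline X$ and a function $b$ on $\partial\overline X$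 (with coefficients) with $i^*a=db$ are the $1$-cocycles of the mapping cone of restriction to the boundary, with differential $\mu\mapsto(d\mu,i^*\mu)$ on functions $\mu$ on $\overline X$. The class of $(a,b)$ is represented by pairs $(\alpha,0)$ with $\alpha$ closed and compactly supported in $X$, and for a closed $1$-form $\eta$ on $X$ one puts $\langle\eta,[a,b]\rangle=\int_X\eta\wedge\alpha$, the coefficients being paired by the form. **Half-integral weight Eisenstein series.** Let $\Gamma'$ be the inverse image of $\mathrm{SL}_2(\mathbb Z)$ in $\mathrm{Mp}_2(\mathbb R)$, the group of pairs $\gamma'=(\gamma,\phi)$ with $\gamma=\begin{pmatrix}a&b\\c&d\end{pmatrix}$, $\phi$ holomorphic on $\mathbb H$, $\phi(\tau)^2=c\tau+d$. Let $\rho_K$ be the Weil representation of $\Gamma'$ on $\mathbb C[K^\#/K]=\mathbb C\mathfrak e_0\oplus\mathbb C\mathfrak e_1$, given by $T\mathfrak e_h=e^{2\pi ih^2/4}\mathfrak e_h$ for $T=(n(1),1)$ and $S\mathfrak e_h=\frac{e^{-\pi i/4}}{\sqrt2}\sum_{h'}(-1)^{hh'}\mathfrak e_{h'}$ for $S=\bigl(\begin{pmatrix}0&-1\\1&0\end{pmatrix},\sqrt\tau\bigr)$.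 Put $$\mathcal E_{k+3/2,K}(\tau)=\frac12\sum_{\gamma'\in\langle T\rangle\backslash\Gamma'}\phi(\tau)^{-2k-3}\rho_K^{-1}(\gamma')\mathfrak e_0,$$ whose constant coefficient is $2\mathfrak e_0$. **Theorem.** All the series above converge absolutely, $\mathcal E(\cdot,k)$ is a smooth closed form on $X$, for each $h$ the pair $(\theta_{L+h}(\tau),\theta_{K+h}(\tau))$ is a cocycle of the mapping cone, its class has a compactly supported representative, and for every $\tau\in\mathbb H$ $$\sum_{h\in L^\#/L}\bigl\langle\mathcal E(\cdot,k),[\theta_{L+h}(\tau),\theta_{K+h}(\tau)]\bigr\rangle\,\mathfrak e_h=\frac12\,\frac{B_{k+1}}{k+1}\,\mathcal E_{k+3/2,K}(\tau),$$ where $B_{k+1}$ is the Bernoulli number. So the lift of the Eisenstein series is again an Eisenstein series. -/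

import Mathlib

open scoped ContDiff MatrixGroups UpperHalfPlane

noncomputable section

namespace EisLift

/-! ### The quadratic space `V` of traceless matrices and its tensors -/

/-- The orthogonal basis `e₁, e₂, e₃` of the space of real traceless `2 × 2` matrices with the form
`(X, Y) = tr (X Y)`; the lengths are `1, 1, -1`. -/
def e : Fin 3 → Matrix (Fin 2) (Fin 2) ℝ :=
  ![(1 / √2) • !![0, 1; 1, 0], (1 / √2) • !![1, 0; 0, -1], (1 / √2) • !![0, 1; -1, 0]]

/-- `ε i = (eᵢ, eᵢ)`. -/
def ε : Fin 3 → ℝ := ![1, 1, -1]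

/-- The coordinates of `X` with respect to `e₁, e₂, e₃`. -/
def coord (X : Matrix (Fin 2) (Fin 2) ℝ) : Fin 3 → ℝ := fun i => ε i * (X * e i).trace

/-- The matrix, in the basis `e`, of the isometry `X ↦ g X g⁻¹` of `V`. -/
def Ad (g : Matrix (Fin 2) (Fin 2) ℝ) : Matrix (Fin 3) (Fin 3) ℝ :=
  Matrix.of fun i j => coord (g * e j * g⁻¹) i

/-- The tensor power `V_ℂ^{⊗ k}`, a tensor being given by its components in the basis
`e_{β 1} ⊗ ⋯ ⊗ e_{β k}`. -/
abbrev Tens (k : ℕ) : Type := (Fin k → Fin 3) → ℂ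

/-- The diagonal action of `g` on `V_ℂ^{⊗ k}`. -/
def act (k : ℕ) (g : Matrix (Fin 2) (Fin 2) ℝ) : Tens k →L[ℂ] Tens k :=
  (Matrix.mulVecLin (Matrix.of fun β β' : Fin k → Fin 3 =>
    ∏ i, ((Ad g (β i) (β' i) : ℝ) : ℂ))).toContinuousLinearMap

/-- The tensor `X^k = X ⊗ ⋯ ⊗ X`. -/
def power (k : ℕ) (X : Matrix (Fin 2) (Fin 2) ℝ) : Tens k :=
  fun β => ∏ i, ((coord X (β i) : ℝ) : ℂ)

/-- The bilinear form on `V_ℂ^{⊗ k}` with `(X^k, Y^k) = (X, Y)^k`. -/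
def form (k : ℕ) : LinearMap.BilinForm ℂ (Tens k) :=
  Matrix.toBilin' (Matrix.diagonal fun β : Fin k → Fin 3 => ∏ i, ((ε (β i) : ℝ) : ℂ))

/-- The harmonic tensors `H_k(V_ℂ)`: the symmetric tensors (elements of `Sym^k V_ℂ`) that are
annihilated by the contraction with the form, i.e. by the indefinite Laplacian. -/
def harm (k : ℕ) : Submodule ℂ (Tens k) where
  carrier := {T | (∀ (σ : Equiv.Perm (Fin k)) (β), T (β ∘ σ) = T β) ∧
    ∀ i j : Fin k, i ≠ j → ∀ β, ∑ a : Fin 3,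
      ((ε a : ℝ) : ℂ) * T (Function.update (Function.update β i a) j a) = 0}
  add_mem' := by
    rintro S T ⟨hS, hS'⟩ ⟨hT, hT'⟩
    refine ⟨fun σ β => by simp [hS σ β, hT σ β], fun i j hij β => ?_⟩
    have h1 := hS' i j hij β
    have h2 := hT' i j hij β
    simp only [Pi.add_apply, mul_add, Finset.sum_add_distrib, h1, h2, add_zero]
  zero_mem' := ⟨fun _ _ => rfl, fun _ _ _ _ => by simp⟩
  smul_mem' := by
    rintro c T ⟨hT, hT'⟩
    refine ⟨fun σ β => by simp [hT σ β], fun i j hij β => ?_⟩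
    have h2 := hT' i j hij β
    simp only [Pi.smul_apply, smul_eq_mul, mul_left_comm _ c, ← Finset.mul_sum, h2, mul_zero]

lemma form_apply (k : ℕ) (S T : Tens k) :
    form k S T = ∑ β, (∏ i, ((ε (β i) : ℝ) : ℂ)) * S β * T β := by
  simp only [form, Matrix.toBilin'_apply, Matrix.diagonal_apply]
  refine Finset.sum_congr rfl fun β _ => ?_
  rw [Finset.sum_eq_single β]
  · rw [if_pos rfl]; ring
  · intro b _ hb
    simp [Ne.symm hb]
  · simp

lemma form_isRefl (k : ℕ) : (form k).IsRefl := by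
  intro S T h
  rw [form_apply] at h ⊢
  rw [← h]
  exact Finset.sum_congr rfl fun β _ => by ring

lemma ε_mul_self (a : Fin 3) : ((ε a : ℝ) : ℂ) * ((ε a : ℝ) : ℂ) = 1 := by
  fin_cases a <;> simp [ε]

/-- `V_ℂ^{⊗ k}` is the orthogonal sum of `H_k(V_ℂ)` and its orthogonal complement. -/
lemma isCompl_harm (k : ℕ) : IsCompl (harm k) ((form k).orthogonal (harm k)) := by
  rw [LinearMap.BilinForm.isCompl_orthogonal_iff_disjoint (form_isRefl k),
    Submodule.disjoint_def]
  intro T hT hT'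
  set T' : Tens k := fun β => (∏ i, ((ε (β i) : ℝ) : ℂ)) * (starRingEnd ℂ) (T β) with hdef
  have hprod : ∀ β : Fin k → Fin 3,
      (∏ i, ((ε (β i) : ℝ) : ℂ)) * (∏ i, ((ε (β i) : ℝ) : ℂ)) = 1 := fun β => by
    rw [← Finset.prod_mul_distrib]
    exact Finset.prod_eq_one fun i _ => ε_mul_self _
  have hmem : T' ∈ harm k := by
    refine ⟨fun σ β => ?_, fun i j hij β => ?_⟩
    · simp only [hdef, hT.1 σ β, Function.comp_apply]
      rw [Equiv.prod_comp σ (fun i => ((ε (β i) : ℝ) : ℂ))]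
    · have h0 := congrArg (starRingEnd ℂ) (hT.2 i j hij β)
      simp only [map_sum, map_mul, Complex.conj_ofReal, map_zero] at h0
      have key : ∀ a : Fin 3, (∏ l, ((ε (Function.update (Function.update β i a) j a l) : ℝ) : ℂ))
          = ∏ l ∈ (Finset.univ.erase j).erase i, ((ε (β l) : ℝ) : ℂ) := by
        intro a
        rw [← Finset.mul_prod_erase Finset.univ _ (Finset.mem_univ j),
          ← Finset.mul_prod_erase (Finset.univ.erase j) _
            (Finset.mem_erase.2 ⟨hij, Finset.mem_univ i⟩), ← mul_assoc]
        have : Function.update (Function.update β i a) j a j = a := by simp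
        rw [this]
        have : Function.update (Function.update β i a) j a i = a := by simp [hij]
        rw [this, ε_mul_self, one_mul]
        refine Finset.prod_congr rfl fun l hl => ?_
        simp only [Finset.mem_erase] at hl
        simp [hl.1, hl.2.1]
      simp only [hdef, key]
      rw [← mul_zero (∏ l ∈ (Finset.univ.erase j).erase i, ((ε (β l) : ℝ) : ℂ)), ← h0,
        Finset.mul_sum]
      exact Finset.sum_congr rfl fun a _ => by ring
  have h := hT' T' hmem
  change form k T' T = 0 at h
  rw [form_apply] at h
  have h2 : ∑ β, Complex.normSq (T β) = 0 := by
    have : (((∑ β, Complex.normSq (T β) : ℝ)) : ℂ) = 0 := by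
      rw [← h, Complex.ofReal_sum]
      refine Finset.sum_congr rfl fun β _ => ?_
      rw [hdef, Complex.normSq_eq_conj_mul_self, ← mul_assoc, hprod, one_mul]
    exact_mod_cast this
  funext β
  have := (Finset.sum_eq_zero_iff_of_nonneg fun β _ => Complex.normSq_nonneg (T β)).1 h2 β
    (Finset.mem_univ β)
  simpa using this

/-- The orthogonal projection `π_k` onto `H_k(V_ℂ)`. On `V_ℂ^{⊗ k}` it factors through the
symmetrisation `V_ℂ^{⊗ k} → Sym^k V_ℂ`, so that it can be applied to a product
`e_{β 1} ⋯ e_{β k}` by applying it to `e_{β 1} ⊗ ⋯ ⊗ e_{β k}`. -/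
def harmProj (k : ℕ) : Tens k →ₗ[ℂ] Tens k :=
  (harm k).projection ((form k).orthogonal (harm k)) (isCompl_harm k)

/-- The isotropic vector `u'`. -/
def u' : Matrix (Fin 2) (Fin 2) ℝ := !![0, 0; -1, 0]

/-- The unipotent element `n(x)`. -/
def n (x : ℝ) : Matrix (Fin 2) (Fin 2) ℝ := !![1, x; 0, 1]

/-- The element `g_z = n(x) a(√y)` that moves `i` to `z = x + i y`. -/
def gMat (z : ℂ) : Matrix (Fin 2) (Fin 2) ℝ := !![√z.im, z.re / √z.im; 0, 1 / √z.im]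

/-! ### Differential forms with coefficients

The upper half plane is the open set `UHP` of `ℂ`. A `1`-form with values in `V_ℂ^{⊗ k}` assigns to
`z` the `ℝ`-linear map that takes a tangent vector at `z` to its value. Forms on the orbifold
`X = SL₂(ℤ) \ UHP` with coefficients in the local system of `H_k(V_ℂ)` are the
`SL₂(ℤ)`-invariant forms on `UHP` with values in `H_k(V_ℂ)`. -/

def UHP : Set ℂ := {z | 0 < z.im}

/-- An element of `SL₂(ℤ)` as a real matrix. -/
def toR (γ : SL(2, ℤ)) : Matrix (Fin 2) (Fin 2) ℝ := Matrix.of fun i j => ((γ i j : ℤ) : ℝ)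

def moebius (γ : SL(2, ℤ)) (z : ℂ) : ℂ := (γ 0 0 * z + γ 0 1) / (γ 1 0 * z + γ 1 1)

abbrev Form0 (k : ℕ) : Type := ℂ → Tens k

abbrev Form1 (k : ℕ) : Type := ℂ → ℂ →L[ℝ] Tens k

/-- The pull-back `γ^* f` of a `0`-form; `γ` acts on the coefficients as well. -/
def pull0 {k : ℕ} (γ : SL(2, ℤ)) (f : Form0 k) : Form0 k :=
  fun z => act k (toR γ⁻¹) (f (moebius γ z))

/-- The pull-back `γ^* ξ` of a `1`-form; `γ` acts on the coefficients as well. -/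
def pull1 {k : ℕ} (γ : SL(2, ℤ)) (ξ : Form1 k) : Form1 k :=
  fun z => ((act k (toR γ⁻¹)).restrictScalars ℝ).comp
    ((ξ (moebius γ z)).comp (fderiv ℝ (moebius γ) z))

/-- Smooth `0`-forms on `X` with coefficients in `H_k(V_ℂ)`. -/
structure IsForm0 {k : ℕ} (f : Form0 k) : Prop where
  mem : ∀ z ∈ UHP, f z ∈ harm k
  smooth : ContDiffOn ℝ ∞ f UHP
  inv : ∀ γ : SL(2, ℤ), ∀ z ∈ UHP, pull0 γ f z = f z

/-- Smooth `1`-forms on `X` with coefficients in `H_k(V_ℂ)`. -/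
structure IsForm1 {k : ℕ} (ξ : Form1 k) : Prop where
  mem : ∀ z ∈ UHP, ∀ w, ξ z w ∈ harm k
  smooth : ContDiffOn ℝ ∞ ξ UHP
  inv : ∀ γ : SL(2, ℤ), ∀ z ∈ UHP, pull1 γ ξ z = ξ z

/-- `dξ = 0`. -/
def IsClosed1 {k : ℕ} (ξ : Form1 k) : Prop :=
  ∀ z ∈ UHP, ∀ v w, fderiv ℝ ξ z v w = fderiv ℝ ξ z w v

/-- `ξ` has compact support in `X`. -/
def HasCompactSupp {k : ℕ} (ξ : Form1 k) : Prop :=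
  ∃ C : Set ℂ, IsCompact C ∧ C ⊆ UHP ∧ ∀ z ∈ UHP, (∀ γ, moebius γ z ∉ C) → ξ z = 0

/-- `∫_X η ∧ ξ`, the coefficients being paired by the form on `H_k(V_ℂ)`: the integral of
`(η(∂x), ξ(∂y)) - (η(∂y), ξ(∂x))` with respect to `dx dy` over the standard fundamental domain. -/
def integralX {k : ℕ} (η ξ : Form1 k) : ℂ :=
  ∫ z in ((fun w : ℍ => (w : ℂ)) '' ModularGroup.fd),
    (form k (η z 1) (ξ z Complex.I) - form k (η z Complex.I) (ξ z 1))

/-! ### The Borel–Serre compactification and the mapping cone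

The Borel–Serre compactification `X̄` adds to the cusp of `X` the circle `ℝ / ℤ`. Near this circle
the coordinates are `(x, t)` with `t ≥ 0`, where `z = x + i / t` for `t > 0`. A form on `X̄` is a
form on `X` whose expression in these coordinates extends smoothly to `t ≥ 0`. -/

def cuspChart (p : ℝ × ℝ) : ℂ := p.1 + Complex.I / p.2

/-- `F` is the smooth extension, in the coordinates `(x, t)`, of the `0`-form `f` to `t ≥ 0`. -/
def Extends0 {k : ℕ} (f : Form0 k) (F : ℝ × ℝ → Tens k) : Prop :=
  ContDiffOn ℝ ∞ F {p | 0 ≤ p.2} ∧ ∀ p : ℝ × ℝ, 0 < p.2 → F p = f (cuspChart p)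

/-- `Ω` is the smooth extension, in the coordinates `(x, t)`, of the `1`-form `ξ` to `t ≥ 0`. -/
def Extends1 {k : ℕ} (ξ : Form1 k) (Ω : ℝ × ℝ → (ℝ × ℝ →L[ℝ] Tens k)) : Prop :=
  ContDiffOn ℝ ∞ Ω {p | 0 ≤ p.2} ∧
    ∀ p : ℝ × ℝ, 0 < p.2 → Ω p = (ξ (cuspChart p)).comp (fderiv ℝ cuspChart p)

/-- Smooth `0`-forms on the boundary circle with coefficients in `H_k(V_ℂ)`. -/
structure IsBdryForm0 {k : ℕ} (b : ℝ → Tens k) : Prop where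
  mem : ∀ x, b x ∈ harm k
  smooth : ContDiff ℝ ∞ b
  inv : ∀ x, b (x + 1) = act k (n 1) (b x)

/-- The pair `(a, b)` is a `1`-cocycle of the mapping cone of the restriction `i^*` of forms on `X̄`
to the boundary: `a` is a closed `1`-form on `X̄`, `b` is a function on `∂X̄`, and `i^* a = d b`. -/
def IsConeCocycle {k : ℕ} (a : Form1 k) (b : ℝ → Tens k) : Prop :=
  IsForm1 a ∧ IsClosed1 a ∧ IsBdryForm0 b ∧
    ∃ A, Extends1 a A ∧ ∀ x, deriv b x = A (x, 0) (1, 0)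

/-- The closed `1`-form `α` with compact support in `X` represents the class of `(a, b)` under the
isomorphism from the compactly supported cohomology of `X` to the cohomology of the mapping cone
given by `α ↦ (α, 0)`: there is a function `μ` on `X̄` with `(a, b) - (α, 0) = (dμ, i^* μ)`. -/
def Represents {k : ℕ} (α a : Form1 k) (b : ℝ → Tens k) : Prop :=
  IsForm1 α ∧ IsClosed1 α ∧ HasCompactSupp α ∧
    ∃ (μ : Form0 k) (M : ℝ × ℝ → Tens k), IsForm0 μ ∧ Extends0 μ M ∧
      (∀ z ∈ UHP, a z - α z = fderiv ℝ μ z) ∧ ∀ x, b x = M (x, 0)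

/-- The cohomological pairing of the class of `η` in `H¹(X) = H¹(X̄)` with the mapping cone class
`[a, b]` in `H¹_c(X)` is defined and equal to `c`: `η` is a closed form, `(a, b)` is a cocycle, its
class is represented by closed forms `α` with compact support, and `∫_X η ∧ α = c` for each. -/
def HasPairing {k : ℕ} (η a : Form1 k) (b : ℝ → Tens k) (c : ℂ) : Prop :=
  IsForm1 η ∧ IsClosed1 η ∧ IsConeCocycle a b ∧ (∃ α, Represents α a b) ∧
    ∀ α, Represents α a b → integralX η α = c

/-! ### The Eisenstein form -/

/-- The form `dx ⊗ u'^k` (the section `u'^k` over `x` being `n(x) u'^k`). -/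
def eisBase (k : ℕ) : Form1 k :=
  fun z => Complex.reCLM.smulRight (act k (n z.re) (power k u'))

/-- `Γ_∞ \ SL₂(ℤ)` with `Γ_∞ = {n(m) : m ∈ ℤ}`. -/
abbrev CuspCosets : Type :=
  Quotient (QuotientGroup.rightRel (Subgroup.zpowers ModularGroup.T))

/-- The term of the Eisenstein series for a coset (it does not depend on the representative). -/
def eisTerm (k : ℕ) (q : CuspCosets) : Form1 k := pull1 q.out (eisBase k)

/-- `𝓔(z, k) = ½ ∑_{γ ∈ Γ_∞ \ SL₂(ℤ)} γ^* (dx ⊗ u'^k)`. -/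
def eisForm (k : ℕ) : Form1 k := fun z => (1 / 2 : ℂ) • ∑' q : CuspCosets, eisTerm k q z

/-! ### The Schwartz forms and the theta series -/

/-- The Howe operator `D_j = x_j - (2π)⁻¹ ∂/∂x_j`. -/
def howe (j : Fin 3) (f : (Fin 3 → ℝ) → ℝ) : (Fin 3 → ℝ) → ℝ :=
  fun x => x j * f x - 1 / (2 * Real.pi) * fderiv ℝ f x (Pi.single j 1)

/-- The standard Gaussian on `V` at the base point. -/
def gauss (x : Fin 3 → ℝ) : ℝ := Real.exp (-Real.pi * (x 0 ^ 2 + x 1 ^ 2 + x 2 ^ 2))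

/-- `D_α ∘ D_{β 1} ∘ ⋯ ∘ D_{β k}` applied to the Gaussian. -/
def schwartz {k : ℕ} (α : Fin 2) (β : Fin k → Fin 2) : (Fin 3 → ℝ) → ℝ :=
  howe α.castSucc ((List.ofFn fun i => (β i).castSucc).foldr howe gauss)

/-- The left invariant forms `ω₁ = dy / y`, `ω₂ = -dx / y`, dual to `e₁ ∧ e₃`, `e₂ ∧ e₃` at the base
point. -/
def coframe (z : ℂ) : Fin 2 → (ℂ →L[ℝ] ℝ) :=
  ![(1 / z.im) • Complex.imCLM, -((1 / z.im) • Complex.reCLM)]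

/-- The Schwartz form `φ^V_{1,[k]}(X, z)`. -/
def phiV (k : ℕ) (X : Matrix (Fin 2) (Fin 2) ℝ) : Form1 k := fun z =>
  ((1 / (2 : ℝ) ^ ((k : ℝ) + 1 / 2) : ℝ) : ℂ) • ∑ α : Fin 2, ∑ β : Fin k → Fin 2,
    schwartz α β (coord ((gMat z)⁻¹ * X * gMat z)) • (coframe z α).smulRight
      (act k (gMat z) (harmProj k (Pi.single (fun i => (β i).castSucc) 1)))

/-- The vectors of the coset `L + h` of the lattice `L` of integral traceless matrices in its dual,
where `h = 0, 1` stands for the coset of `diag (h / 2, -h / 2)`. -/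
def latVec (h : Fin 2) (p : ℤ × ℤ × ℤ) : Matrix (Fin 2) (Fin 2) ℝ :=
  !![p.2.1 + (h.val : ℝ) / 2, p.2.2; p.1, -(p.2.1 + (h.val : ℝ) / 2)]

/-- The term `φ(√v X, z) e^{π i (X, X) u}` of the theta series, `τ = u + i v`. -/
def thetaTerm (k : ℕ) (h : Fin 2) (τ : ℍ) (p : ℤ × ℤ × ℤ) : Form1 k := fun z =>
  Complex.exp (Real.pi * Complex.I * ((latVec h p * latVec h p).trace : ℝ) * (τ.re : ℝ)) •
    phiV k (√τ.im • latVec h p) z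

/-- The `𝔢_h`-component `θ_{L_V + h}(τ, φ^V_{1,[k]})` of the theta series. -/
def thetaV (k : ℕ) (h : Fin 2) (τ : ℍ) : Form1 k := fun z =>
  ((τ.im ^ (-(k : ℝ) / 2) : ℝ) : ℂ) • ∑' p : ℤ × ℤ × ℤ, thetaTerm k h τ p z

/-- The Hermite polynomial `H_j(t) = (-1)^j e^{t²} (d/dt)^j e^{-t²}`. -/
def hermiteH (j : ℕ) (t : ℝ) : ℝ :=
  (-1) ^ j * Real.exp (t ^ 2) * iteratedDeriv j (fun s : ℝ => Real.exp (-s ^ 2)) t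

/-- `H̃_j(w) = (2π)^{-j/2} H_j(√(2π) w)`. -/
def hermiteT (j : ℕ) (w : ℝ) : ℝ :=
  (2 * Real.pi) ^ (-(j : ℝ) / 2) * hermiteH j (√(2 * Real.pi) * w)

/-- `v` is the vector `v_{-2}` of `H_k(V)`: it has weight `-2` for the torus of the elements
`diag (s, s⁻¹)`, and `R v = k v₀` with `v₀ = π_k(diag (1, -1)^k)`, where `R` is the infinitesimal
generator of `n`. -/
def IsWeightNegTwo (k : ℕ) (v : Tens k) : Prop :=
  v ∈ harm k ∧ (∀ s : ℝ, 0 < s → act k !![s, 0; 0, s⁻¹] v = ((s ^ 2)⁻¹ : ℝ) • v) ∧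
    HasDerivAt (fun x : ℝ => act k (n x) v) ((k : ℂ) • harmProj k (power k !![1, 0; 0, -1])) 0

/-- The weight vector `v_{-2}` (it exists and is unique for `k ≥ 1`). -/
def vNegTwo (k : ℕ) : Tens k := Classical.epsilon (IsWeightNegTwo k)

/-- The primitive `φ^N_{[k]}(w, x)` on the boundary; `W = ℝ e₂` is identified with `ℝ`. -/
def phiN (k : ℕ) (w x : ℝ) : Tens k :=
  ((-(1 / ((2 : ℝ) ^ (3 * (k : ℝ) / 2 + 1 / 2) * k)) * hermiteT (k + 1) w *
    Real.exp (-Real.pi * w ^ 2) : ℝ) : ℂ) • act k (n x) (vNegTwo k)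

/-- The vector `diag (b + h / 2, -(b + h / 2))` of `K + h` in the coordinate of `W = ℝ e₂`. -/
def unaryVec (h : Fin 2) (b : ℤ) : ℝ := √2 * (b + (h.val : ℝ) / 2)

/-- The term `φ^N_{[k]}(√v w, x) e^{π i (w, w) u}` of the boundary theta series. -/
def bdryTerm (k : ℕ) (h : Fin 2) (τ : ℍ) (x : ℝ) (b : ℤ) : Tens k :=
  Complex.exp (Real.pi * Complex.I * ((unaryVec h b ^ 2 : ℝ) : ℂ) * (τ.re : ℝ)) •
    phiN k (√τ.im * unaryVec h b) x

/-- The `𝔢_h`-component `θ_{K_W + h}(τ, φ^N_{[k]})` of the boundary theta series. -/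
def thetaN (k : ℕ) (h : Fin 2) (τ : ℍ) : ℝ → Tens k := fun x =>
  ((τ.im ^ (-((k : ℝ) + 1) / 2) : ℝ) : ℂ) • ∑' b : ℤ, bdryTerm k h τ x b

/-! ### The metaplectic group and the Weil representation -/

/-- The inverse image of `SL₂(ℤ)` in the metaplectic group: pairs `(γ, φ)` where `φ` is one of the
two continuous (equivalently, holomorphic) square roots of `τ ↦ c τ + d`. -/
@[ext]
structure Mp2Z where
  mat : SL(2, ℤ)
  root : ℍ → ℂ
  cont : Continuous root
  sq : ∀ τ : ℍ, root τ ^ 2 = (mat 1 0 : ℂ) * (τ : ℂ) + (mat 1 1 : ℂ)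

lemma sl_denom (γ : SL(2, ℤ)) (τ : ℍ) :
    UpperHalfPlane.denom γ τ = (γ 1 0 : ℂ) * (τ : ℂ) + (γ 1 1 : ℂ) := by
  simp [UpperHalfPlane.denom]

lemma sl_denom_mul (γ δ : SL(2, ℤ)) (τ : ℍ) :
    UpperHalfPlane.denom (γ * δ : SL(2, ℤ)) τ =
      UpperHalfPlane.denom γ ↑(δ • τ) * UpperHalfPlane.denom δ τ := by
  have h2 := UpperHalfPlane.coe_specialLinearGroup_apply δ τ
  have hne : (δ 1 0 : ℂ) * (τ : ℂ) + (δ 1 1 : ℂ) ≠ 0 := by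
    rw [← sl_denom]; exact UpperHalfPlane.denom_ne_zero _ _
  rw [sl_denom, sl_denom, sl_denom, h2]
  simp only [Matrix.SpecialLinearGroup.coe_mul, Matrix.mul_apply, Fin.sum_univ_two,
    algebraMap_int_eq, eq_intCast]
  push_cast
  field_simp
  ring

lemma continuous_sl_smul (γ : SL(2, ℤ)) : Continuous fun τ : ℍ => γ • τ :=
  continuous_const_smul (γ : GL (Fin 2) ℝ)

namespace Mp2Z

lemma root_ne_zero (g : Mp2Z) (τ : ℍ) : g.root τ ≠ 0 := by
  intro h
  have := g.sq τ
  rw [h, ← sl_denom] at this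
  exact UpperHalfPlane.denom_ne_zero g.mat τ (by simpa using this.symm)

/-- `(γ₁, φ₁(τ)) (γ₂, φ₂(τ)) = (γ₁ γ₂, φ₁(γ₂ τ) φ₂(τ))`. -/
instance : Mul Mp2Z where
  mul g h := ⟨g.mat * h.mat, fun τ => g.root (h.mat • τ) * h.root τ,
    (g.cont.comp (continuous_sl_smul _)).mul h.cont, fun τ => by
      rw [mul_pow, g.sq, h.sq, ← sl_denom, ← sl_denom, ← sl_denom, sl_denom_mul]⟩

instance : One Mp2Z where
  one := ⟨1, fun _ => 1, continuous_const, fun τ => by simp⟩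

instance : Inv Mp2Z where
  inv g := ⟨g.mat⁻¹, fun τ => (g.root (g.mat⁻¹ • τ))⁻¹,
    (g.cont.comp (continuous_sl_smul _)).inv₀ fun τ => g.root_ne_zero _, fun τ => by
      have h := sl_denom_mul g.mat g.mat⁻¹ τ
      rw [mul_inv_cancel] at h
      have h1 : UpperHalfPlane.denom (1 : SL(2, ℤ)) τ = 1 := by rw [sl_denom]; simp
      rw [h1] at h
      rw [inv_pow, g.sq, ← sl_denom, ← sl_denom]
      exact inv_eq_of_mul_eq_one_right h.symm⟩

@[simp] lemma mul_mat (g h : Mp2Z) : (g * h).mat = g.mat * h.mat := rfl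
@[simp] lemma mul_root (g h : Mp2Z) (τ : ℍ) :
    (g * h).root τ = g.root (h.mat • τ) * h.root τ := rfl
@[simp] lemma one_mat : (1 : Mp2Z).mat = 1 := rfl
@[simp] lemma one_root (τ : ℍ) : (1 : Mp2Z).root τ = 1 := rfl
@[simp] lemma inv_mat (g : Mp2Z) : g⁻¹.mat = g.mat⁻¹ := rfl
@[simp] lemma inv_root (g : Mp2Z) (τ : ℍ) : g⁻¹.root τ = (g.root (g.mat⁻¹ • τ))⁻¹ := rfl

instance : Group Mp2Z where
  mul_assoc a b c := by
    ext τ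
    · simp [mul_assoc]
    · simp [mul_assoc, mul_smul]
  one_mul a := by ext <;> simp
  mul_one a := by ext <;> simp
  inv_mul_cancel a := by
    ext τ
    · simp
    · simp [inv_mul_cancel₀ (a.root_ne_zero τ)]

/-- The element `T = ((1, 1; 0, 1), 1)`. -/
def T : Mp2Z := ⟨ModularGroup.T, fun _ => 1, continuous_const, fun τ => by simp [ModularGroup.T]⟩

/-- The element `S = ((0, -1; 1, 0), √τ)`. -/
def S : Mp2Z := ⟨ModularGroup.S, fun τ => (τ : ℂ) ^ (1 / 2 : ℂ),
  continuous_iff_continuousAt.2 fun τ => (continuousAt_cpow_const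
    (Or.inr τ.im_ne_zero)).comp UpperHalfPlane.continuous_coe.continuousAt, fun τ => by
      rw [← Complex.cpow_nat_mul]; simp [ModularGroup.S]⟩

end Mp2Z

/-- `ρ` is the Weil representation `ρ_K` of the lattice `K = ℤ` with `(b, b') = 2 b b'`, given on the
generators `T`, `S` by `T 𝔢_h = e((h, h) / 2) 𝔢_h` and
`S 𝔢_h = √i⁻¹ |K^#/K|^{-1/2} ∑_{h'} e(-(h, h')) 𝔢_{h'}`, with matrices taken in the basis
`𝔢₀, 𝔢₁` belonging to the cosets of `0` and `1 / 2`. -/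
def IsWeilRep (ρ : Mp2Z →* Matrix (Fin 2) (Fin 2) ℂ) : Prop :=
  ρ Mp2Z.T = !![1, 0; 0, Complex.I] ∧
  ρ Mp2Z.S = (Complex.exp (-(Real.pi * Complex.I / 4)) / (√2 : ℝ)) • !![1, 1; 1, -1]

/-- The unary theta function of `K`, which transforms with the Weil representation. -/
def thetaK (τ : ℍ) : Fin 2 → ℂ :=
  ![jacobiTheta₂ 0 (2 * τ), Complex.exp (Real.pi * Complex.I * τ / 2) * jacobiTheta₂ τ (2 * τ)]

lemma thetaK_zero (τ : ℍ) : thetaK τ 0 = jacobiTheta₂ 0 (2 * τ) := rfl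

lemma thetaK_one (τ : ℍ) : thetaK τ 1 =
    Complex.exp (Real.pi * Complex.I * τ / 2) * jacobiTheta₂ τ (2 * τ) := rfl

lemma jacobiTheta₂_split (z : ℂ) {τ : ℂ} (hτ : 0 < τ.im) :
    jacobiTheta₂ z (τ / 2) = jacobiTheta₂ (2 * z) (2 * τ) +
      Complex.exp (2 * Real.pi * Complex.I * z + Real.pi * Complex.I * τ / 2) *
        jacobiTheta₂ (2 * z + τ) (2 * τ) := by
  have h2 : 0 < (2 * τ).im := by simpa using hτ
  have h3 : 0 < (τ / 2).im := by simpa using hτ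
  have he : HasSum (fun m : ℤ => jacobiTheta₂_term (2 * m) z (τ / 2))
      (jacobiTheta₂ (2 * z) (2 * τ)) := by
    convert hasSum_jacobiTheta₂_term (2 * z) h2 using 1
    funext m
    simp only [jacobiTheta₂_term]
    congr 1
    push_cast
    ring
  have ho : HasSum (fun m : ℤ => jacobiTheta₂_term (2 * m + 1) z (τ / 2))
      (Complex.exp (2 * Real.pi * Complex.I * z + Real.pi * Complex.I * τ / 2) *
        jacobiTheta₂ (2 * z + τ) (2 * τ)) := by
    have hf : (fun m : ℤ => jacobiTheta₂_term (2 * m + 1) z (τ / 2)) = fun m : ℤ =>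
        Complex.exp (2 * Real.pi * Complex.I * z + Real.pi * Complex.I * τ / 2) *
          jacobiTheta₂_term m (2 * z + τ) (2 * τ) := by
      funext m
      simp only [jacobiTheta₂_term, ← Complex.exp_add]
      congr 1
      push_cast
      ring
    rw [hf]
    exact (hasSum_jacobiTheta₂_term (2 * z + τ) h2).mul_left _
  have inje : Function.Injective fun m : ℤ => 2 * m := fun a b h => by simpa using h
  have injo : Function.Injective fun m : ℤ => 2 * m + 1 := fun a b h => by simpa using h
  have hc : IsCompl (Set.range fun m : ℤ => 2 * m) (Set.range fun m : ℤ => 2 * m + 1) := by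
    have h1 : (Set.range fun m : ℤ => 2 * m) = {n : ℤ | Even n} := by
      ext x; simp [even_iff_exists_two_mul]
    have h2 : (Set.range fun m : ℤ => 2 * m + 1) = {n : ℤ | Odd n} := by
      ext x; simp [Odd]
    rw [h1, h2]
    exact Int.isCompl_even_odd
  exact (hasSum_jacobiTheta₂_term z h3).unique
    (((inje.hasSum_range_iff (f := fun n => jacobiTheta₂_term n z (τ / 2))).2 he).add_isCompl hc
      ((injo.hasSum_range_iff (f := fun n => jacobiTheta₂_term n z (τ / 2))).2 ho))

lemma thetaK_T (τ : ℍ) : thetaK (ModularGroup.T • τ) =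
    Matrix.mulVec !![1, 0; 0, Complex.I] (thetaK τ) := by
  have h1 : ((ModularGroup.T • τ : ℍ) : ℂ) = τ + 1 := by
    rw [UpperHalfPlane.modular_T_smul, UpperHalfPlane.coe_vadd]; push_cast; ring
  have h2 : Complex.exp (Real.pi * Complex.I * (τ + 1) / 2) =
      Complex.I * Complex.exp (Real.pi * Complex.I * τ / 2) := by
    rw [show (Real.pi * Complex.I * ((τ : ℂ) + 1) / 2 : ℂ) =
      Real.pi / 2 * Complex.I + Real.pi * Complex.I * τ / 2 by ring, Complex.exp_add,
      Complex.exp_pi_div_two_mul_I]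
  funext i
  fin_cases i
  · simp only [Fin.zero_eta]
    rw [thetaK_zero, h1, mul_add, mul_one, jacobiTheta₂_add_right]
    simp [Matrix.mulVec, dotProduct, Fin.sum_univ_two, thetaK_zero]
  · simp only [Fin.mk_one]
    rw [thetaK_one, h1, h2, mul_add, mul_one, jacobiTheta₂_add_right, jacobiTheta₂_add_left]
    simp [Matrix.mulVec, dotProduct, Fin.sum_univ_two, thetaK_one, mul_assoc]

lemma root_identity (τ : ℍ) : (-Complex.I * ((τ : ℂ) / 2)) ^ (1 / 2 : ℂ) =
    (τ : ℂ) ^ (1 / 2 : ℂ) * (Complex.exp (-(Real.pi * Complex.I / 4)) / (√2 : ℝ)) := by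
  have hτ : (τ : ℂ) ≠ 0 := τ.ne_zero
  have hpos : (0 : ℝ) < τ.im := τ.im_pos
  have harg : 0 < (τ : ℂ).arg ∧ (τ : ℂ).arg < Real.pi :=
    ⟨lt_of_le_of_ne (Complex.arg_nonneg_iff.2 hpos.le) fun h => by
      have := (Complex.arg_eq_zero_iff.1 h.symm).2
      exact hpos.ne' this,
      lt_of_le_of_ne (Complex.arg_le_pi _) fun h => by
      have := (Complex.arg_eq_pi_iff.1 h).2
      exact hpos.ne' this⟩
  have h2 : Complex.exp (Real.log 2 : ℝ) = 2 := by
    rw [← Complex.ofReal_exp, Real.exp_log two_pos]; norm_num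
  have hexp : -Complex.I * ((τ : ℂ) / 2) =
      Complex.exp (Complex.log τ - Real.pi / 2 * Complex.I - (Real.log 2 : ℝ)) := by
    rw [Complex.exp_sub, Complex.exp_sub, Complex.exp_log hτ, Complex.exp_pi_div_two_mul_I, h2,
      Complex.div_I]
    ring
  have hlog : Complex.log (-Complex.I * ((τ : ℂ) / 2)) =
      Complex.log τ - Real.pi / 2 * Complex.I - (Real.log 2 : ℝ) := by
    have him : (Complex.log τ - Real.pi / 2 * Complex.I - (Real.log 2 : ℝ)).im =
        (τ : ℂ).arg - Real.pi / 2 := by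
      rw [Complex.sub_im, Complex.sub_im, Complex.log_im, Complex.ofReal_im]
      simp
    rw [hexp, Complex.log_exp] <;> rw [him] <;> linarith [Real.pi_pos, harg.1, harg.2]
  have hs : ((√2 : ℝ) : ℂ) = Complex.exp ((Real.log 2 : ℝ) * (1 / 2)) := by
    rw [Real.sqrt_eq_rpow, Real.rpow_def_of_pos two_pos]
    push_cast
    rfl
  rw [Complex.cpow_def_of_ne_zero (by simp [hτ]), Complex.cpow_def_of_ne_zero hτ, hlog, hs,
    ← Complex.exp_sub, ← Complex.exp_add]
  congr 1
  ring

lemma thetaK_S (τ : ℍ) : thetaK (ModularGroup.S • τ) = ((τ : ℂ) ^ (1 / 2 : ℂ)) •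
    Matrix.mulVec ((Complex.exp (-(Real.pi * Complex.I / 4)) / (√2 : ℝ)) • !![1, 1; 1, -1])
      (thetaK τ) := by
  have hτ : (τ : ℂ) ≠ 0 := τ.ne_zero
  have h1 : ((ModularGroup.S • τ : ℍ) : ℂ) = -1 / τ := by
    rw [UpperHalfPlane.modular_S_smul]; simp [neg_div, inv_neg]
  have hne : (-Complex.I * ((τ : ℂ) / 2)) ^ (1 / 2 : ℂ) ≠ 0 := by
    rw [Ne, Complex.cpow_eq_zero_iff]
    simp [hτ]
  have e0 : jacobiTheta₂ 0 (2 * (-1 / τ)) =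
      (-Complex.I * ((τ : ℂ) / 2)) ^ (1 / 2 : ℂ) * (thetaK τ 0 + thetaK τ 1) := by
    have h := jacobiTheta₂_functional_equation 0 ((τ : ℂ) / 2)
    rw [jacobiTheta₂_split 0 τ.im_pos] at h
    have h4 : (-1 / ((τ : ℂ) / 2)) = 2 * (-1 / τ) := by field_simp
    rw [h4] at h
    simp only [thetaK, Matrix.cons_val_zero, Matrix.cons_val_one]
    simp only [mul_zero, zero_add, zero_div, ne_eq, OfNat.ofNat_ne_zero, not_false_eq_true,
      zero_pow, Complex.exp_zero, mul_one] at h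
    rw [h]
    field_simp
  have e1 : Complex.exp (Real.pi * Complex.I * (-1 / τ) / 2) *
      jacobiTheta₂ (-1 / τ) (2 * (-1 / τ)) =
      (-Complex.I * ((τ : ℂ) / 2)) ^ (1 / 2 : ℂ) * (thetaK τ 0 - thetaK τ 1) := by
    have h := jacobiTheta₂_functional_equation (-1 / 2) ((τ : ℂ) / 2)
    rw [jacobiTheta₂_split (-1 / 2) τ.im_pos] at h
    have h4 : (-1 / ((τ : ℂ) / 2)) = 2 * (-1 / τ) := by field_simp
    have h5 : (-1 / 2 / ((τ : ℂ) / 2)) = -1 / τ := by field_simp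
    have h6 : (-Real.pi * Complex.I * (-1 / 2) ^ 2 / ((τ : ℂ) / 2)) =
        Real.pi * Complex.I * (-1 / τ) / 2 := by field_simp
    have h7 : jacobiTheta₂ (2 * (-1 / 2)) (2 * (τ : ℂ)) = jacobiTheta₂ 0 (2 * τ) := by
      rw [← jacobiTheta₂_add_left]; norm_num
    have h8 : jacobiTheta₂ (2 * (-1 / 2) + τ) (2 * (τ : ℂ)) = jacobiTheta₂ τ (2 * τ) := by
      rw [← jacobiTheta₂_add_left]; congr 1; ring
    have h9 : Complex.exp (2 * Real.pi * Complex.I * (-1 / 2) + Real.pi * Complex.I * τ / 2) =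
        -Complex.exp (Real.pi * Complex.I * τ / 2) := by
      rw [Complex.exp_add, show (2 * Real.pi * Complex.I * (-1 / 2) : ℂ) =
        -(Real.pi * Complex.I) by ring, Complex.exp_neg, Complex.exp_pi_mul_I]
      norm_num
    rw [h4, h5, h6, h7, h8, h9] at h
    have h10 : thetaK τ 0 - thetaK τ 1 = jacobiTheta₂ 0 (2 * ↑τ) +
        -Complex.exp (Real.pi * Complex.I * τ / 2) * jacobiTheta₂ τ (2 * τ) := by
      simp only [thetaK, Matrix.cons_val_zero, Matrix.cons_val_one]; ring
    rw [h10, h]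
    field_simp
  rw [root_identity] at e0 e1
  funext i
  fin_cases i
  · simp only [Fin.zero_eta, Pi.smul_apply, Matrix.smul_mulVec, smul_eq_mul]
    rw [show thetaK (ModularGroup.S • τ) 0 = jacobiTheta₂ 0 (2 * (-1 / τ)) by
      rw [thetaK_zero, h1], e0]
    simp [Matrix.mulVec, dotProduct, Fin.sum_univ_two]; ring
  · simp only [Fin.mk_one, Pi.smul_apply, Matrix.smul_mulVec, smul_eq_mul]
    rw [show thetaK (ModularGroup.S • τ) 1 = Complex.exp (Real.pi * Complex.I * (-1 / τ) / 2) *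
      jacobiTheta₂ (-1 / τ) (2 * (-1 / τ)) by rw [thetaK_one, h1], e1]
    simp [Matrix.mulVec, dotProduct, Fin.sum_univ_two]; ring

lemma thetaK_I_ne_zero : thetaK UpperHalfPlane.I 0 ≠ 0 ∧ thetaK UpperHalfPlane.I 1 ≠ 0 := by
  have key : ∀ z τ : ℂ, 0 < τ.im → z.re = 0 → τ.re = 0 → jacobiTheta₂ z τ ≠ 0 := by
    intro z τ hτ hz hτ' h0
    have h := hasSum_jacobiTheta₂_term z hτ
    have hr : ∀ m : ℤ, jacobiTheta₂_term m z τ =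
        ((Real.exp (-(2 * Real.pi * m * z.im) - Real.pi * m ^ 2 * τ.im) : ℝ) : ℂ) := by
      intro m
      rw [jacobiTheta₂_term, Complex.ofReal_exp]
      congr 1
      apply Complex.ext <;> simp [pow_two, hz, hτ'] <;> ring
    simp only [hr, h0] at h
    have h' := Complex.hasSum_re h
    simp only [Complex.ofReal_re, Complex.zero_re] at h'
    have := h'.summable.tsum_pos (fun m => (Real.exp_pos _).le) 0 (Real.exp_pos _)
    rw [h'.tsum_eq] at this
    exact lt_irrefl _ this
  rw [thetaK_zero, thetaK_one]
  exact ⟨key _ _ (by simp) (by simp) (by simp),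
    mul_ne_zero (Complex.exp_ne_zero _) (key _ _ (by simp) (by simp) (by simp))⟩

lemma thetaK_ext {M N : Matrix (Fin 2) (Fin 2) ℂ}
    (h : ∀ τ, M.mulVec (thetaK τ) = N.mulVec (thetaK τ)) : M = N := by
  obtain ⟨h0, h1⟩ := thetaK_I_ne_zero
  have hI : (1 - Complex.I) ≠ 0 := fun h => by simpa using congrArg Complex.im h
  ext i j
  have e1 := congrFun (h UpperHalfPlane.I) i
  have e2 := congrFun (h (ModularGroup.T • UpperHalfPlane.I)) i
  rw [thetaK_T] at e2
  simp only [Matrix.mulVec, dotProduct, Fin.sum_univ_two, Matrix.of_apply, Matrix.cons_val',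
    Matrix.cons_val_zero, Matrix.cons_val_one, Matrix.cons_val_fin_one, one_mul, zero_mul,
    zero_add, add_zero] at e1 e2
  have e3 : M i 1 = N i 1 := by
    have : (1 - Complex.I) * thetaK UpperHalfPlane.I 1 * (M i 1 - N i 1) = 0 := by
      linear_combination e1 - e2
    exact sub_eq_zero.1 ((mul_eq_zero.1 this).resolve_left (mul_ne_zero hI h1))
  have e4 : M i 0 = N i 0 := by
    have : thetaK UpperHalfPlane.I 0 * (M i 0 - N i 0) = 0 := by
      rw [e3] at e1
      linear_combination e1
    exact sub_eq_zero.1 ((mul_eq_zero.1 this).resolve_left h0)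
  fin_cases j
  · exact e4
  · exact e3

/-- The elements that act on `thetaK` by an invertible matrix. -/
def thetaSubgroup : Subgroup Mp2Z where
  carrier := {g | ∃ M : (Matrix (Fin 2) (Fin 2) ℂ)ˣ, ∀ τ,
    thetaK (g.mat • τ) = g.root τ • M.val.mulVec (thetaK τ)}
  mul_mem' := by
    rintro g h ⟨M, hM⟩ ⟨N, hN⟩
    refine ⟨M * N, fun τ => ?_⟩
    rw [Mp2Z.mul_mat, mul_smul, hM, hN, Matrix.mulVec_smul, Mp2Z.mul_root, smul_smul,
      Units.val_mul, Matrix.mulVec_mulVec]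
  one_mem' := ⟨1, fun τ => by simp⟩
  inv_mem' := by
    rintro g ⟨M, hM⟩
    refine ⟨M⁻¹, fun τ => ?_⟩
    have h := hM (g.mat⁻¹ • τ)
    rw [smul_inv_smul] at h
    rw [h, Mp2Z.inv_mat, Mp2Z.inv_root, Matrix.mulVec_smul, smul_smul,
      inv_mul_cancel₀ (g.root_ne_zero _), Matrix.mulVec_mulVec, Units.inv_mul, one_smul,
      Matrix.one_mulVec]

lemma exists_theta_matrix (g : Mp2Z) : ∃ M : Matrix (Fin 2) (Fin 2) ℂ, ∀ τ,
    thetaK (g.mat • τ) = g.root τ • M.mulVec (thetaK τ) := by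
  let f : Mp2Z →* SL(2, ℤ) := ⟨⟨Mp2Z.mat, rfl⟩, fun _ _ => rfl⟩
  have hT : Mp2Z.T ∈ thetaSubgroup := by
    refine ⟨⟨!![1, 0; 0, Complex.I], !![1, 0; 0, -Complex.I], ?_, ?_⟩, fun τ => ?_⟩
    · simp [Matrix.one_fin_two]
    · simp [Matrix.one_fin_two]
    · simpa [Mp2Z.T] using thetaK_T τ
  have hS : Mp2Z.S ∈ thetaSubgroup := by
    have hc : Complex.exp (-(Real.pi * Complex.I / 4)) / (√2 : ℝ) ≠ 0 := by
      simp
    set c := Complex.exp (-(Real.pi * Complex.I / 4)) / (√2 : ℝ) with hcdef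
    refine ⟨⟨c • !![1, 1; 1, -1], (c⁻¹ / 2) • !![1, 1; 1, -1], ?_, ?_⟩, fun τ => ?_⟩
    · ext i j; fin_cases i <;> fin_cases j <;> simp [Matrix.mul_apply, Fin.sum_univ_two] <;>
        field_simp <;> norm_num
    · ext i j; fin_cases i <;> fin_cases j <;> simp [Matrix.mul_apply, Fin.sum_univ_two] <;>
        field_simp <;> norm_num
    · exact thetaK_S τ
  have htop : thetaSubgroup.map f = ⊤ := by
    rw [eq_top_iff, ← SpecialLinearGroup.SL2Z_generators, Subgroup.closure_le]
    rintro x (rfl | rfl)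
    · exact ⟨_, hS, rfl⟩
    · exact ⟨_, hT, rfl⟩
  obtain ⟨g', ⟨M, hM⟩, hg'⟩ : g.mat ∈ thetaSubgroup.map f := htop ▸ Subgroup.mem_top _
  have hg' : g'.mat = g.mat := hg'
  rcases isPreconnected_univ.eq_or_eq_neg_of_sq_eq (𝕜 := ℂ) g.cont.continuousOn
    g'.cont.continuousOn (fun τ _ => by simp [g.sq, g'.sq, hg'])
    (fun {τ} _ => g'.root_ne_zero τ) with h | h
  · exact ⟨M, fun τ => by rw [← hg', hM, h (Set.mem_univ τ)]⟩
  · refine ⟨-M, fun τ => ?_⟩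
    rw [← hg', hM, h (Set.mem_univ τ), Matrix.neg_mulVec, Pi.neg_apply, smul_neg, neg_smul,
      neg_neg]

lemma exists_weilRep : ∃ ρ, IsWeilRep ρ := by
  choose M hM using exists_theta_matrix
  have huniq : ∀ (g : Mp2Z) (N : Matrix (Fin 2) (Fin 2) ℂ),
      (∀ τ, thetaK (g.mat • τ) = g.root τ • N.mulVec (thetaK τ)) → M g = N := by
    intro g N hN
    refine thetaK_ext fun τ => ?_
    have h := (hM g τ).symm.trans (hN τ)
    exact (smul_right_injective _ (g.root_ne_zero τ)) h
  refine ⟨⟨⟨M, huniq 1 1 fun τ => by simp⟩, fun g h => huniq _ _ fun τ => ?_⟩, ?_, ?_⟩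
  · rw [Mp2Z.mul_mat, mul_smul, hM, hM, Matrix.mulVec_smul, Mp2Z.mul_root, smul_smul,
      Matrix.mulVec_mulVec]
  · exact huniq _ _ fun τ => by simpa [Mp2Z.T] using thetaK_T τ
  · exact huniq _ _ fun τ => thetaK_S τ

/-- The Weil representation `ρ_K` (it is determined by its values on the generators). -/
def weilRep : Mp2Z →* Matrix (Fin 2) (Fin 2) ℂ := exists_weilRep.choose

lemma isWeilRep_weilRep : IsWeilRep weilRep := exists_weilRep.choose_spec

/-! ### The vector valued Eisenstein series of half integral weight -/

/-- The right cosets of the group generated by `T = ((1, 1; 0, 1), 1)` in the metaplectic group. -/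
abbrev MpCosets : Type := Quotient (QuotientGroup.rightRel (Subgroup.zpowers Mp2Z.T))

/-- The term `φ(τ)^{-2k-3} ρ_K⁻¹(γ') 𝔢₀` for a coset (it does not depend on the representative
`γ' = (γ, φ)`). -/
def mpTerm (k : ℕ) (τ : ℍ) (q : MpCosets) : Fin 2 → ℂ :=
  (q.out.root τ ^ (2 * k + 3))⁻¹ • (weilRep q.out⁻¹).mulVec (Pi.single 0 1)

/-- `𝓔_{k+3/2,K}(τ) = ½ ∑_{γ'} φ(τ)^{-2k-3} ρ_K⁻¹(γ') 𝔢₀`; its constant coefficient is `2 𝔢₀` for odd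
`k`. -/
def eisHalf (k : ℕ) (τ : ℍ) : Fin 2 → ℂ := (1 / 2 : ℂ) • ∑' q : MpCosets, mpTerm k τ q

end EisLift

end

/-!
The pairing is computed by unfolding the Eisenstein form. Everything is done by hand for `SL₂(ℤ)`:
besides Poisson summation, only reduction theory and the functional equation of the Jacobi theta
function are needed.

**The cocycle.** Poisson summation in the upper right matrix entry (`tsum_scTerm_eq`) turns the
theta series into a sum over `A`, `B`, `m` of terms with the factor `exp (-π |m - A τ|² y² / v)`.
The terms with `A = m = 0` do not decay. They form the theta series of the torus, and
`thetaV_split` shows that they contribute a multiple of `dx ⊗ n(x) π_k(diag(1, -1)^k)`, which is the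
derivative of `thetaN` since `R v₋₂ = k π_k(diag(1, -1)^k)`. The other terms add up to a form that
is smooth and flat at `t = 0` (`flat_tsum_mixTerm`). Each term of the new expansion is closed
(`isClosed1_mixForm`), by the recursion of the Hermite polynomials, and a sum of closed forms that
converges locally uniformly is closed. Together these facts give `isConeCocycle_theta`.

**Representatives.** A cocycle `(a, b)` has a primitive near the cusp that is smooth up to `t = 0`
and restricts to `b` (`IsConeCocycle.exists_primitive`). Cut off and extended by equivariance, it is
a function `μ` such that `a - dμ` has compact support (`IsConeCocycle.exists_represents`).

**Unfolding.** Let `α = a - dμ` be any representative. Unfolding turns the integral of `ℰ ∧ α` into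
the integral over the strip `0 ≤ x < 1` of `α(∂/∂y)` paired with `n(x) u'^k` (`integralX_eisForm`).
The contribution of `dμ` to the inner integral is the derivative in `y` of the mean of `μ`, paired
with `n(x) u'^k`, over a horizontal line. This mean tends to zero on both sides: for `y → ∞` because
the boundary value is a multiple of `n(x) v₋₂`, which is orthogonal to `n(x) u'^k` by weights, and
for `y → 0` because the paired function is bounded by a power of the product of `y` and the height
of the translate of `z` in the fundamental domain, and this product tends to zero over every
irrational number (`tendsto_lineMean_zero`). Hence `α` may be replaced by the theta form itself
(`integralX_of_represents`).

**The constant term.** Paired with `n(x) u'^k`, only the component of the theta form with the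
Hermite polynomial `H̃_{k+1}` survives (`stripFun_thetaV`). In its constant term the pair `(A, m)`
contributes a Gaussian in `y`, the power `(m - A τ̄)^{k+1}`, and the mean over `x` of a theta
function of `K` with characteristics `(x A, x m)`. These theta functions transform with the Weil
representation, and their characteristics like a row vector (`thetaAB_smul`). So an element of `Γ'`
with bottom row `(c, d)` moves `(A, m) = N (-c, d)` to `N (0, 1)`, where the mean is `𝔢₀`, and the
mean for `(A, m)` is `φ(τ)⁻¹ ρ_K⁻¹(γ') 𝔢₀` (`integral_thetaAB`). The Mellin transform turns the
remaining factors into a constant times `(N (c τ + d))^{-k-1}` (`modeC_mul`). The sum over coprime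
pairs `(c, d)` is the Eisenstein series of weight `k + 3/2`, whose factor `1/2` accounts for the two
elements of `Γ'` over one matrix (`eisHalf_eq`). The sum over `N` is `ζ(k + 1)`, and Euler's formula
for the zeta values at even integers gives the Bernoulli number (`mellinC_mul_zeta`).
-/

open scoped ContDiff MatrixGroups UpperHalfPlane

noncomputable section

namespace EisLift

/-! ### The quadratic space and its tensors -/

lemma trace_fin_two' (X : Matrix (Fin 2) (Fin 2) ℝ) : X.trace = X 0 0 + X 1 1 := by
  simp [Matrix.trace, Fin.sum_univ_two]

lemma inv_sqrt_two_sq : (√2)⁻¹ * (√2)⁻¹ = (1 / 2 : ℝ) := by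
  rw [← mul_inv, Real.mul_self_sqrt (by norm_num)]; norm_num

lemma sqrt_two_sq : √2 * √2 = (2 : ℝ) := Real.mul_self_sqrt (by norm_num)

lemma coord_apply (X : Matrix (Fin 2) (Fin 2) ℝ) : coord X =
    ![(X 0 1 + X 1 0) / √2, (X 0 0 - X 1 1) / √2, (X 0 1 - X 1 0) / √2] := by
  funext i
  fin_cases i <;>
    simp [coord, e, ε, trace_fin_two', Matrix.mul_apply, Fin.sum_univ_two] <;> ring

lemma coord_add (X Y : Matrix (Fin 2) (Fin 2) ℝ) : coord (X + Y) = coord X + coord Y := by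
  funext i
  simp [coord, add_mul, mul_add]

lemma coord_smul (c : ℝ) (X : Matrix (Fin 2) (Fin 2) ℝ) : coord (c • X) = c • coord X := by
  funext i
  simp [coord, mul_left_comm]

lemma coord_e (i j : Fin 3) : coord (e j) i = if i = j then 1 else 0 := by
  have h := sqrt_two_sq
  have h0 : √2 ≠ 0 := by positivity
  rw [coord_apply]
  fin_cases i <;> fin_cases j <;> simp [e] <;> field_simp <;> nlinarith

lemma sum_coord_smul_e (X : Matrix (Fin 2) (Fin 2) ℝ) (hX : X.trace = 0) :
    ∑ i, coord X i • e i = X := by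
  have h0 : √2 ≠ 0 := by positivity
  have h := sqrt_two_sq
  rw [trace_fin_two'] at hX
  have h11 : X 1 1 = -X 0 0 := by linarith
  ext i j
  fin_cases i <;> fin_cases j <;>
    simp [Fin.sum_univ_three, coord_apply, e, h11] <;> field_simp <;> rw [pow_two, h] <;> ring

lemma trace_e (j : Fin 3) : (e j).trace = 0 := by
  fin_cases j <;> simp [e]

/-- `coord` as a linear map. -/
def coordL : Matrix (Fin 2) (Fin 2) ℝ →ₗ[ℝ] Fin 3 → ℝ where
  toFun := coord
  map_add' := coord_add
  map_smul' := coord_smul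

lemma coord_sum_smul (c : Fin 3 → ℝ) (Y : Fin 3 → Matrix (Fin 2) (Fin 2) ℝ) :
    coord (∑ i, c i • Y i) = ∑ i, c i • coord (Y i) := by
  change coordL _ = _
  simp only [map_sum, map_smul]; rfl

lemma trace_conj {g : Matrix (Fin 2) (Fin 2) ℝ} (hg : g.det ≠ 0)
    (X : Matrix (Fin 2) (Fin 2) ℝ) : (g * X * g⁻¹).trace = X.trace := by
  rw [Matrix.trace_mul_comm, ← mul_assoc, Matrix.nonsing_inv_mul _ (Ne.isUnit hg), one_mul]

lemma Ad_mulVec_coord (g : Matrix (Fin 2) (Fin 2) ℝ)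
    (X : Matrix (Fin 2) (Fin 2) ℝ) (hX : X.trace = 0) :
    (Ad g).mulVec (coord X) = coord (g * X * g⁻¹) := by
  conv_rhs => rw [← sum_coord_smul_e X hX]
  rw [Finset.mul_sum, Finset.sum_mul]
  simp only [mul_smul_comm, smul_mul_assoc]
  rw [coord_sum_smul]
  funext i
  simp [Matrix.mulVec, dotProduct, Ad, mul_comm]

lemma Ad_mul (g h : Matrix (Fin 2) (Fin 2) ℝ) (hh : h.det ≠ 0) : Ad (g * h) = Ad g * Ad h := by
  ext i j
  have := congrFun (Ad_mulVec_coord g (h * e j * h⁻¹) (by rw [trace_conj hh, trace_e])) i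
  rw [Matrix.mul_apply]
  simp only [Matrix.mulVec, dotProduct] at this
  calc Ad (g * h) i j = coord (g * (h * e j * h⁻¹) * g⁻¹) i := by
        simp [Ad, Matrix.mul_inv_rev, mul_assoc]
    _ = _ := by rw [← this]; rfl

lemma Ad_one : Ad 1 = 1 := by
  ext i j
  simp [Ad, coord_e, Matrix.one_apply]

/-- The form in coordinates. -/
lemma sum_ε_coord (X Y : Matrix (Fin 2) (Fin 2) ℝ) (hX : X.trace = 0) (hY : Y.trace = 0) :
    ∑ a, ε a * coord X a * coord Y a = (X * Y).trace := by
  rw [trace_fin_two'] at hX hY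
  have h11 : X 1 1 = -X 0 0 := by linarith
  have h11' : Y 1 1 = -Y 0 0 := by linarith
  have h0 : √2 ≠ 0 := by positivity
  simp only [Fin.sum_univ_three, coord_apply, ε, trace_fin_two', Matrix.mul_apply,
    Fin.sum_univ_two, h11, h11', Matrix.cons_val_zero, Matrix.cons_val_one, Matrix.cons_val]
  field_simp
  rw [Real.sq_sqrt (by norm_num)]
  ring

lemma sum_ε_Ad {g : Matrix (Fin 2) (Fin 2) ℝ} (hg : g.det ≠ 0) (b c : Fin 3) :
    ∑ a, ε a * Ad g a b * Ad g a c = if b = c then ε b else 0 := by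
  change ∑ a, ε a * coord (g * e b * g⁻¹) a * coord (g * e c * g⁻¹) a = _
  rw [sum_ε_coord _ _ (by rw [trace_conj hg, trace_e]) (by rw [trace_conj hg, trace_e])]
  have : g * e b * g⁻¹ * (g * e c * g⁻¹) = g * (e b * e c) * g⁻¹ := by
    have := Matrix.nonsing_inv_mul g (Ne.isUnit hg)
    calc g * e b * g⁻¹ * (g * e c * g⁻¹) = g * e b * (g⁻¹ * g) * (e c * g⁻¹) := by
          simp only [mul_assoc]
      _ = _ := by rw [this, mul_one]; simp only [mul_assoc]
  rw [this, trace_conj hg, ← sum_ε_coord _ _ (trace_e b) (trace_e c)]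
  simp only [coord_e]
  fin_cases b <;> fin_cases c <;> simp

lemma act_apply (k : ℕ) (g : Matrix (Fin 2) (Fin 2) ℝ) (T : Tens k) (β : Fin k → Fin 3) :
    act k g T β = ∑ β' : Fin k → Fin 3, (∏ i, ((Ad g (β i) (β' i) : ℝ) : ℂ)) * T β' := rfl

/-- The elementary tensor `X₁ ⊗ ⋯ ⊗ X_k`. -/
def elem {k : ℕ} (X : Fin k → Matrix (Fin 2) (Fin 2) ℝ) : Tens k :=
  fun β => ∏ i, ((coord (X i) (β i) : ℝ) : ℂ)

lemma power_eq_elem (k : ℕ) (X : Matrix (Fin 2) (Fin 2) ℝ) : power k X = elem fun _ => X := rfl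

lemma act_elem {k : ℕ} (g : Matrix (Fin 2) (Fin 2) ℝ) (X : Fin k → Matrix (Fin 2) (Fin 2) ℝ)
    (hX : ∀ i, (X i).trace = 0) : act k g (elem X) = elem fun i => g * X i * g⁻¹ := by
  funext β
  rw [act_apply]
  simp only [elem, ← Finset.prod_mul_distrib, ← Ad_mulVec_coord g _ (hX _)]
  rw [← Fintype.prod_sum (fun i j => ((Ad g (β i) j : ℝ) : ℂ) * ((coord (X i) j : ℝ) : ℂ))]
  refine Finset.prod_congr rfl fun i _ => ?_
  simp [Matrix.mulVec, dotProduct]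

lemma act_power (k : ℕ) (g X : Matrix (Fin 2) (Fin 2) ℝ) (hX : X.trace = 0) :
    act k g (power k X) = power k (g * X * g⁻¹) := act_elem g _ fun _ => hX

lemma act_mul (k : ℕ) (g h : Matrix (Fin 2) (Fin 2) ℝ) (hh : h.det ≠ 0) (T : Tens k) :
    act k (g * h) T = act k g (act k h T) := by
  funext β
  simp only [act_apply, Finset.mul_sum]
  rw [Finset.sum_comm]
  refine Finset.sum_congr rfl fun β' _ => ?_
  simp only [← mul_assoc, ← Finset.prod_mul_distrib]
  rw [← Finset.sum_mul,
    ← Fintype.prod_sum (fun i j => ((Ad g (β i) j : ℝ) : ℂ) * ((Ad h j (β' i) : ℝ) : ℂ))]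
  congr 1
  refine Finset.prod_congr rfl fun i _ => ?_
  rw [Ad_mul _ _ hh, Matrix.mul_apply]
  push_cast; rfl

lemma act_one (k : ℕ) (T : Tens k) : act k 1 T = T := by
  funext β
  rw [act_apply, Ad_one, Finset.sum_eq_single β]
  · simp
  · intro b _ hb
    obtain ⟨i, hi⟩ := Function.ne_iff.1 hb
    rw [Finset.prod_eq_zero (Finset.mem_univ i) (by simp [Ne.symm hi]), zero_mul]
  · simp

lemma act_act_inv (k : ℕ) (g : Matrix (Fin 2) (Fin 2) ℝ) (hg : g.det ≠ 0) (T : Tens k) :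
    act k g (act k g⁻¹ T) = T := by
  rw [← act_mul _ _ _ (by rw [Matrix.det_nonsing_inv]; simpa using hg),
    Matrix.mul_nonsing_inv _ (Ne.isUnit hg), act_one]

lemma form_act (k : ℕ) (g : Matrix (Fin 2) (Fin 2) ℝ) (hg : g.det ≠ 0) (S T : Tens k) :
    form k (act k g S) (act k g T) = form k S T := by
  simp only [form_apply, act_apply, Finset.mul_sum, Finset.sum_mul]
  rw [Finset.sum_comm]
  conv_lhs => enter [2, x]; rw [Finset.sum_comm]
  rw [Finset.sum_comm]
  refine Finset.sum_congr rfl fun β _ => ?_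
  have key : ∀ β' : Fin k → Fin 3, ∑ β'' : Fin k → Fin 3,
      (∏ i, ((ε (β'' i) : ℝ) : ℂ)) * ((∏ i, ((Ad g (β'' i) (β i) : ℝ) : ℂ)) * S β) *
        ((∏ i, ((Ad g (β'' i) (β' i) : ℝ) : ℂ)) * T β') =
      (∏ i, (((if β i = β' i then ε (β i) else 0) : ℝ) : ℂ)) * (S β * T β') := by
    intro β'
    simp only [← sum_ε_Ad hg]
    push_cast
    rw [Fintype.prod_sum (fun i a => ((ε a : ℝ) : ℂ) * ((Ad g a (β i) : ℝ) : ℂ) *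
      ((Ad g a (β' i) : ℝ) : ℂ)), Finset.sum_mul]
    refine Finset.sum_congr rfl fun β'' _ => ?_
    simp only [Finset.prod_mul_distrib]
    ring
  rw [Finset.sum_eq_single β]
  · rw [key]
    simp [mul_assoc]
  · intro b _ hb
    rw [key]
    obtain ⟨i, hi⟩ := Function.ne_iff.1 hb
    rw [Finset.prod_eq_zero (Finset.mem_univ i) (by simp [Ne.symm hi]), zero_mul]
  · simp

lemma form_comm (k : ℕ) (S T : Tens k) : form k S T = form k T S := by
  rw [form_apply, form_apply]
  exact Finset.sum_congr rfl fun β _ => by ring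

lemma sum_update (k : ℕ) (i : Fin k) (G : (Fin k → Fin 3) → ℂ) :
    ∑ β, ∑ a, G (Function.update β i a) = 3 * ∑ β, G β := by
  have h : ∑ p : (Fin k → Fin 3) × Fin 3, G (Function.update p.1 i p.2) =
      ∑ p : (Fin k → Fin 3) × Fin 3, G p.1 := by
    let f : (Fin k → Fin 3) × Fin 3 → (Fin k → Fin 3) × Fin 3 :=
      fun p => (Function.update p.1 i p.2, p.1 i)
    have hf : Function.Involutive f := fun p => by simp [f]
    exact Fintype.sum_equiv hf.toPerm _ _ fun p => rfl
  rw [Fintype.sum_prod_type, Fintype.sum_prod_type] at h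
  rw [h]
  simp [Finset.mul_sum]

/-- A sum over all multi-indices vanishes if the partial sums over two of the indices do. -/
lemma sum_eq_zero_of_update (k : ℕ) (i j : Fin k) (G : (Fin k → Fin 3) → ℂ)
    (h : ∀ β, ∑ a, ∑ b, G (Function.update (Function.update β i a) j b) = 0) : ∑ β, G β = 0 := by
  have h1 := sum_update k i fun β => ∑ b, G (Function.update β j b)
  rw [sum_update, Finset.sum_eq_zero fun β _ => h β] at h1
  have : (9 : ℂ) * ∑ β, G β = 0 := by linear_combination -h1
  exact (mul_eq_zero.1 this).resolve_left (by norm_num)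

lemma prod_update_update {k : ℕ} {i j : Fin k} (hij : i ≠ j) (β : Fin k → Fin 3) (a b : Fin 3)
    (F : Fin k → Fin 3 → ℂ) :
    ∏ l, F l (Function.update (Function.update β i a) j b l) =
      F j b * F i a * ∏ l ∈ (Finset.univ.erase j).erase i, F l (β l) := by
  rw [← Finset.mul_prod_erase Finset.univ _ (Finset.mem_univ j),
    ← Finset.mul_prod_erase (Finset.univ.erase j) _
      (Finset.mem_erase.2 ⟨hij, Finset.mem_univ i⟩), ← mul_assoc]
  congr 1
  · simp [hij]
  · refine Finset.prod_congr rfl fun l hl => ?_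
    simp only [Finset.mem_erase] at hl
    simp [hl.1, hl.2.1]

lemma act_mem_harm {k : ℕ} {g : Matrix (Fin 2) (Fin 2) ℝ} (hg : g.det ≠ 0) {T : Tens k}
    (hT : T ∈ harm k) : act k g T ∈ harm k := by
  refine ⟨fun σ β => ?_, fun i j hij β => ?_⟩
  · rw [act_apply, act_apply]
    refine (Fintype.sum_equiv (Equiv.arrowCongr σ (Equiv.refl _)) _ _ fun β' => ?_)
    have h1 : T (Equiv.arrowCongr σ (Equiv.refl _) β') = T β' := by
      rw [← hT.1 σ]
      congr 1
      funext l
      simp [Equiv.arrowCongr]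
    rw [h1]
    congr 1
    rw [← Equiv.prod_comp σ fun i => ((Ad g (β i)
      (Equiv.arrowCongr σ (Equiv.refl _) β' i) : ℝ) : ℂ)]
    refine Finset.prod_congr rfl fun l _ => ?_
    simp [Equiv.arrowCongr]
  -- `Ad g` preserves the form, so the trace of the image is the image of the trace
  · simp only [act_apply, Finset.mul_sum]
    rw [Finset.sum_comm]
    refine sum_eq_zero_of_update k i j _ fun β' => ?_
    have h1 : ∀ a b c : Fin 3, ((ε c : ℝ) : ℂ) * ((∏ l, ((Ad g
        (Function.update (Function.update β i c) j c l)
        (Function.update (Function.update β' i a) j b l) : ℝ) : ℂ)) *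
        T (Function.update (Function.update β' i a) j b)) =
        (((ε c * Ad g c a * Ad g c b : ℝ) : ℂ)) * ((∏ l ∈ (Finset.univ.erase j).erase i,
          ((Ad g (β l) (β' l) : ℝ) : ℂ)) * T (Function.update (Function.update β' i a) j b)) := by
      intro a b c
      rw [prod_update_update hij β' a b fun l x => ((Ad g
        (Function.update (Function.update β i c) j c l) x : ℝ) : ℂ)]
      have h2 : ∏ l ∈ (Finset.univ.erase j).erase i, ((Ad g
          (Function.update (Function.update β i c) j c l) (β' l) : ℝ) : ℂ) =
          ∏ l ∈ (Finset.univ.erase j).erase i, ((Ad g (β l) (β' l) : ℝ) : ℂ) := by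
        refine Finset.prod_congr rfl fun l hl => ?_
        simp only [Finset.mem_erase] at hl
        simp [hl.1, hl.2.1]
      rw [h2]
      simp only [Function.update_self, ne_eq, hij, not_false_eq_true, Function.update_of_ne]
      push_cast
      ring
    simp only [h1]
    have h3 : ∀ a b : Fin 3, ∑ c, (((ε c * Ad g c a * Ad g c b : ℝ) : ℂ)) *
        ((∏ l ∈ (Finset.univ.erase j).erase i,
          ((Ad g (β l) (β' l) : ℝ) : ℂ)) * T (Function.update (Function.update β' i a) j b)) =
        (((if a = b then ε a else 0 : ℝ) : ℂ)) * ((∏ l ∈ (Finset.univ.erase j).erase i,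
          ((Ad g (β l) (β' l) : ℝ) : ℂ)) * T (Function.update (Function.update β' i a) j b)) := by
      intro a b
      rw [← sum_ε_Ad hg, ← Finset.sum_mul]
      push_cast; rfl
    simp only [h3]
    have h4 : ∀ a : Fin 3, ∑ b, (((if a = b then ε a else 0 : ℝ) : ℂ)) *
        ((∏ l ∈ (Finset.univ.erase j).erase i,
          ((Ad g (β l) (β' l) : ℝ) : ℂ)) * T (Function.update (Function.update β' i a) j b)) =
        (∏ l ∈ (Finset.univ.erase j).erase i, ((Ad g (β l) (β' l) : ℝ) : ℂ)) *
          (((ε a : ℝ) : ℂ) * T (Function.update (Function.update β' i a) j a)) := by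
      intro a
      rw [Finset.sum_eq_single a]
      · rw [if_pos rfl]; ring
      · intro b _ hb
        rw [if_neg (Ne.symm hb)]; simp
      · simp
    simp only [h4]
    rw [← Finset.mul_sum, hT.2 i j hij, mul_zero]

/-! ### The harmonic projection -/

lemma harmProj_mem (k : ℕ) (T : Tens k) : harmProj k T ∈ harm k :=
  Submodule.projection_apply_mem _ T

lemma harmProj_of_mem {k : ℕ} {T : Tens k} (hT : T ∈ harm k) : harmProj k T = T :=
  Submodule.projection_apply_of_mem_left (isCompl_harm k) hT

lemma form_harmProj {k : ℕ} {S : Tens k} (hS : S ∈ harm k) (T : Tens k) :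
    form k S (harmProj k T) = form k S T := by
  have h : T - harmProj k T ∈ (form k).orthogonal (harm k) := by
    have := Submodule.projection_add_projection_eq_self (isCompl_harm k) T
    rw [← eq_sub_iff_add_eq'] at this
    rw [harmProj, ← this]
    exact Submodule.projection_apply_mem _ T
  have h2 : form k S (T - harmProj k T) = 0 := h S hS
  rw [map_sub, sub_eq_zero] at h2
  exact h2.symm

/-- A tensor orthogonal to the harmonic tensors projects to zero. -/
lemma harmProj_eq_zero {k : ℕ} {T : Tens k} (h : ∀ S ∈ harm k, form k S T = 0) :
    harmProj k T = 0 :=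
  (Submodule.projection_apply_eq_zero_iff (isCompl_harm k)).2 fun S hS => h S hS

lemma harmProj_act {k : ℕ} {g : Matrix (Fin 2) (Fin 2) ℝ} (hg : g.det ≠ 0) (T : Tens k) :
    harmProj k (act k g T) = act k g (harmProj k T) := by
  have hg' : (g⁻¹).det ≠ 0 := by rw [Matrix.det_nonsing_inv]; simpa using hg
  have h : harmProj k (act k g T - act k g (harmProj k T)) = 0 := by
    refine harmProj_eq_zero fun S hS => ?_
    rw [← map_sub, ← act_act_inv k g hg S, form_act k g hg, map_sub,
      form_harmProj (act_mem_harm hg' hS), sub_self]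
  rw [map_sub, sub_eq_zero] at h
  rw [h, harmProj_of_mem (act_mem_harm hg (harmProj_mem _ _))]

lemma power_mem_harm (k : ℕ) {X : Matrix (Fin 2) (Fin 2) ℝ} (hX : X.trace = 0)
    (hX' : (X * X).trace = 0) : power k X ∈ harm k := by
  refine ⟨fun σ β => ?_, fun i j hij β => ?_⟩
  · simp only [power, Function.comp_apply]
    rw [Equiv.prod_comp σ (fun i => ((coord X (β i) : ℝ) : ℂ))]
  · simp only [power]
    have h1 : ∀ a, ((ε a : ℝ) : ℂ) * ∏ l, ((coord X
        (Function.update (Function.update β i a) j a l) : ℝ) : ℂ) =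
        ((ε a * coord X a * coord X a : ℝ) : ℂ) *
          ∏ l ∈ (Finset.univ.erase j).erase i, ((coord X (β l) : ℝ) : ℂ) := by
      intro a
      rw [prod_update_update hij β a a fun _ x => ((coord X x : ℝ) : ℂ)]
      push_cast; ring
    simp only [h1]
    rw [← Finset.sum_mul, ← Complex.ofReal_sum, sum_ε_coord X X hX hX, hX']
    simp

lemma harm_isClosed (k : ℕ) : IsClosed (harm k : Set (Tens k)) :=
  Submodule.closed_of_finiteDimensional _

/-! ### Unipotent and diagonal elements, weight vectors -/

lemma det_n (x : ℝ) : (n x).det = 1 := by simp [n, Matrix.det_fin_two]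

lemma n_mul (x y : ℝ) : n x * n y = n (x + y) := by
  ext i j; fin_cases i <;> fin_cases j <;> simp [n, Matrix.mul_apply, Fin.sum_univ_two, add_comm]

lemma inv_of_det_one {g : Matrix (Fin 2) (Fin 2) ℝ} (h : g.det = 1) :
    g⁻¹ = !![g 1 1, -g 0 1; -g 1 0, g 0 0] := by
  rw [Matrix.inv_def, h, Ring.inverse_one, one_smul, Matrix.adjugate_fin_two]

lemma n_inv (x : ℝ) : (n x)⁻¹ = n (-x) := by
  rw [inv_of_det_one (det_n x)]; simp [n]

lemma act_n_add (k : ℕ) (x y : ℝ) (T : Tens k) : act k (n (x + y)) T = act k (n x) (act k (n y) T) := by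
  rw [← n_mul, act_mul _ _ _ (by simp [det_n])]

lemma det_gMat {z : ℂ} (hz : 0 < z.im) : (gMat z).det = 1 := by
  have : √z.im ≠ 0 := (Real.sqrt_pos.2 hz).ne'
  simp [gMat, Matrix.det_fin_two, this]

/-- The matrix of `X ↦ g X g⁻¹` written without inverses, for `det g = 1`. -/
def adPoly (a b c d : ℝ) (i j : Fin 3) : ℝ :=
  coord (!![a, b; c, d] * e j * !![d, -b; -c, a]) i

lemma Ad_eq_adPoly {g : Matrix (Fin 2) (Fin 2) ℝ} (h : g.det = 1) (i j : Fin 3) :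
    Ad g i j = adPoly (g 0 0) (g 0 1) (g 1 0) (g 1 1) i j := by
  rw [Ad, Matrix.of_apply, inv_of_det_one h, adPoly]
  congr 3
  exact Matrix.eta_fin_two g

lemma adPoly_apply (a b c d : ℝ) (i j : Fin 3) : adPoly a b c d i j =
    (!![(a * a + d * d - b * b - c * c) / 2, c * d - a * b, (a * a + b * b - c * c - d * d) / 2;
      b * d - a * c, a * d + b * c, -(a * c + b * d);
      (a * a + c * c - b * b - d * d) / 2, -(a * b + c * d),
        (a * a + b * b + c * c + d * d) / 2] : Matrix (Fin 3) (Fin 3) ℝ) i j := by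
  have h := sqrt_two_sq
  have h0 : √2 ≠ 0 := by positivity
  fin_cases i <;> fin_cases j <;>
    simp [adPoly, coord_apply, e] <;> field_simp <;>
    (try rw [Real.sq_sqrt (by norm_num)]) <;> ring

lemma ContDiff.adPoly {E : Type*} [NormedAddCommGroup E] [NormedSpace ℝ E] {a b c d : E → ℝ}
    (ha : ContDiff ℝ ∞ a) (hb : ContDiff ℝ ∞ b) (hc : ContDiff ℝ ∞ c) (hd : ContDiff ℝ ∞ d)
    (i j : Fin 3) : ContDiff ℝ ∞ fun x => adPoly (a x) (b x) (c x) (d x) i j := by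
  simp only [adPoly_apply]
  fin_cases i <;> fin_cases j <;> simp <;> fun_prop

lemma contDiff_act_n (k : ℕ) (T : Tens k) : ContDiff ℝ ∞ fun x : ℝ => act k (n x) T := by
  rw [contDiff_pi]
  intro β
  simp only [act_apply, Ad_eq_adPoly (det_n _)]
  refine ContDiff.sum fun β' _ => ContDiff.mul (contDiff_prod fun i _ => ?_) contDiff_const
  refine Complex.ofRealCLM.contDiff.comp ?_
  exact ContDiff.adPoly contDiff_const contDiff_id contDiff_const contDiff_const _ _

lemma elem_mul_coord (k : ℕ) (S : Tens k) (X : Fin k → Matrix (Fin 2) (Fin 2) ℝ) :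
    form k S (elem X) = ∑ β, S β * ∏ i, (((ε (β i) * coord (X i) (β i) : ℝ)) : ℂ) := by
  rw [form_apply]
  refine Finset.sum_congr rfl fun β _ => ?_
  rw [elem]
  push_cast
  rw [Finset.prod_mul_distrib]; ring

/-- The matrices `E`, `F`, `H` of the standard basis of `𝔰𝔩₂`. -/
abbrev mE : Matrix (Fin 2) (Fin 2) ℝ := !![0, 1; 0, 0]
/-- See `mE`. -/
abbrev mF : Matrix (Fin 2) (Fin 2) ℝ := !![0, 0; 1, 0]
/-- See `mE`. -/
abbrev mH : Matrix (Fin 2) (Fin 2) ℝ := !![1, 0; 0, -1]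

/-- Modulo the Casimir element, `E F = -H² / 4` in the harmonic quotient of `Sym V`. -/
lemma harmProj_elem_F_E {k : ℕ} {i j : Fin k} (hij : i ≠ j) :
    harmProj k (elem (Function.update (Function.update (fun _ => mH) i mF) j mE)) =
      (-(1 / 4) : ℂ) • harmProj k (power k mH) := by
  rw [← sub_eq_zero, ← map_smul, ← map_sub]
  refine harmProj_eq_zero fun S hS => ?_
  rw [map_sub, map_smul, power_eq_elem, elem_mul_coord, elem_mul_coord, smul_eq_mul,
    Finset.mul_sum, ← Finset.sum_sub_distrib]
  refine sum_eq_zero_of_update k i j _ fun β => ?_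
  have h1 : ∀ (Y : Fin k → Matrix (Fin 2) (Fin 2) ℝ) (a b : Fin 3),
      ∏ l, (((ε (Function.update (Function.update β i a) j b l) *
        coord (Y l) (Function.update (Function.update β i a) j b l) : ℝ)) : ℂ) =
      ((ε b * coord (Y j) b : ℝ) : ℂ) * ((ε a * coord (Y i) a : ℝ) : ℂ) *
        ∏ l ∈ (Finset.univ.erase j).erase i, ((ε (β l) * coord (Y l) (β l) : ℝ) : ℂ) :=
    fun Y a b => prod_update_update hij β a b fun l x => ((ε x * coord (Y l) x : ℝ) : ℂ)
  have h2 : ∏ l ∈ (Finset.univ.erase j).erase i, ((ε (β l) * coord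
      (Function.update (Function.update (fun _ => mH) i mF) j mE l) (β l) : ℝ) : ℂ) =
      ∏ l ∈ (Finset.univ.erase j).erase i, ((ε (β l) * coord mH (β l) : ℝ) : ℂ) := by
    refine Finset.prod_congr rfl fun l hl => ?_
    simp only [Finset.mem_erase] at hl
    simp [hl.1, hl.2.1]
  simp only [h1, h2]
  have hsym : ∀ a b, S (Function.update (Function.update β i a) j b) =
      S (Function.update (Function.update β i b) j a) := by
    intro a b
    rw [← hS.1 (Equiv.swap i j) (Function.update (Function.update β i b) j a)]
    congr 1
    funext l
    simp only [Function.comp_apply]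
    rcases eq_or_ne l i with rfl | hli
    · simp [hij]
    · rcases eq_or_ne l j with rfl | hlj
      · simp [hij]
      · rw [Equiv.swap_apply_of_ne_of_ne hli hlj]
        simp [hli, hlj]
  have hc := hS.2 i j hij β
  simp only [Fin.sum_univ_three] at hc ⊢
  rw [hsym 1 0, hsym 2 0, hsym 2 1]
  simp only [Function.update_self, ne_eq, hij, not_false_eq_true, Function.update_of_ne,
    coord_apply, ε]
  simp only [ε] at hc
  have h3 : ((√2 : ℝ) : ℂ)⁻¹ * ((√2 : ℝ) : ℂ)⁻¹ = 1 / 2 := by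
    rw [← Complex.ofReal_inv, ← Complex.ofReal_mul, inv_sqrt_two_sq]; norm_num
  generalize ((∏ l ∈ (Finset.univ.erase j).erase i, _ : ℂ)) = P
  simp [div_eq_mul_inv] at hc ⊢
  linear_combination (1 / 2 * P) * hc
    + P * (S (Function.update (Function.update β i 0) j 0) +
      S (Function.update (Function.update β i 1) j 1) -
      S (Function.update (Function.update β i 2) j 2)) * h3

lemma prod_update_erase {k : ℕ} (X : Fin k → Matrix (Fin 2) (Fin 2) ℝ) (i : Fin k)
    (Y : Matrix (Fin 2) (Fin 2) ℝ) (β : Fin k → Fin 3) :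
    elem (Function.update X i Y) β =
      (∏ j ∈ Finset.univ.erase i, ((coord (X j) (β j) : ℝ) : ℂ)) * ((coord Y (β i) : ℝ) : ℂ) := by
  rw [elem, ← Finset.mul_prod_erase Finset.univ _ (Finset.mem_univ i), mul_comm]
  congr 1
  · refine Finset.prod_congr rfl fun j hj => ?_
    rw [Function.update_of_ne (Finset.ne_of_mem_erase hj)]
  · rw [Function.update_self]

lemma elem_update_smul {k : ℕ} (X : Fin k → Matrix (Fin 2) (Fin 2) ℝ) (i : Fin k) (c : ℝ)
    (Y : Matrix (Fin 2) (Fin 2) ℝ) :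
    elem (Function.update X i (c • Y)) = (c : ℂ) • elem (Function.update X i Y) := by
  funext β
  rw [Pi.smul_apply, prod_update_erase, prod_update_erase, coord_smul]
  simp; ring

/-- The Leibniz rule for the infinitesimal action of the unipotent group. -/
lemma hasDerivAt_act_n_elem {k : ℕ} (X : Fin k → Matrix (Fin 2) (Fin 2) ℝ)
    (hX : ∀ i, (X i).trace = 0) :
    HasDerivAt (fun x : ℝ => act k (n x) (elem X))
      (∑ i, elem (Function.update X i (mE * X i - X i * mE))) 0 := by
  simp only [act_elem _ X hX]
  rw [hasDerivAt_pi]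
  intro β
  simp only [Finset.sum_apply, prod_update_erase]
  have h1 : ∀ i ∈ Finset.univ, HasDerivAt (fun x : ℝ => ((coord (n x * X i * (n x)⁻¹) (β i) : ℝ) : ℂ))
      (((coord (mE * X i - X i * mE) (β i) : ℝ) : ℂ)) 0 := by
    intro i _
    refine HasDerivAt.ofReal_comp ?_
    have hc : ∀ x, coord (n x * X i * (n x)⁻¹) (β i) = coord (X i) (β i) +
        x * coord (mE * X i - X i * mE) (β i) - x ^ 2 * coord (mE * X i * mE) (β i) := by
      intro x
      have : n x * X i * (n x)⁻¹ = X i + x • (mE * X i - X i * mE) + (-x ^ 2) • (mE * X i * mE) := by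
        rw [n_inv]
        have hn : ∀ x, n x = 1 + x • mE := fun x => by
          ext i j; fin_cases i <;> fin_cases j <;> simp [n]
        rw [hn, hn]
        simp only [add_mul, mul_add, one_mul, mul_one, neg_smul, smul_mul_assoc, mul_smul_comm,
          smul_sub, mul_neg, pow_two, mul_smul, smul_add]
        abel
      rw [this, coord_add, coord_add, coord_smul, coord_smul]
      simp only [Pi.add_apply, Pi.smul_apply, smul_eq_mul]
      ring
    simp only [hc]
    have := (((hasDerivAt_id (0 : ℝ)).mul_const (coord (mE * X i - X i * mE) (β i))).const_add
      (coord (X i) (β i))).fun_sub (((hasDerivAt_id (0 : ℝ)).fun_pow 2).mul_const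
        (coord (mE * X i * mE) (β i)))
    simpa [-Matrix.mul_apply, -Matrix.cons_mul] using this
  have h2 := HasDerivAt.fun_finsetProd h1
  refine h2.congr_deriv (Finset.sum_congr rfl fun i _ => ?_)
  have h0 : n 0 = 1 := by ext i j; fin_cases i <;> fin_cases j <;> simp [n]
  simp [h0]

/-- The vector is a multiple of the projection of `F H^{k-1}`. By the Leibniz rule `R` takes
`F H^{k-1}` to `H^k - 2 (k - 1) E F H^{k-2}`, which has the same projection as `(k + 1) / 2 * H^k`. -/
lemma exists_isWeightNegTwo {k : ℕ} (hk : k ≠ 0) : ∃ v, IsWeightNegTwo k v := by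
  let i₀ : Fin k := ⟨0, Nat.pos_of_ne_zero hk⟩
  set X : Fin k → Matrix (Fin 2) (Fin 2) ℝ := Function.update (fun _ => mH) i₀ mF with hXdef
  have hX : ∀ i, (X i).trace = 0 := by
    intro i
    rcases eq_or_ne i i₀ with rfl | h
    · simp [hXdef]
    · simp [hXdef, h]
  have hk1 : (k : ℂ) + 1 ≠ 0 := by exact_mod_cast Nat.succ_ne_zero k
  refine ⟨(2 * k / (k + 1) : ℂ) • harmProj k (elem X),
    Submodule.smul_mem _ _ (harmProj_mem _ _), fun s hs => ?_, ?_⟩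
  · have hdet : (!![s, 0; 0, s⁻¹] : Matrix (Fin 2) (Fin 2) ℝ).det = 1 := by
      simp [Matrix.det_fin_two, hs.ne']
    have h1 : (fun i => !![s, 0; 0, s⁻¹] * X i * !![s, 0; 0, s⁻¹]⁻¹) =
        Function.update (fun _ => mH) i₀ ((s ^ 2)⁻¹ • mF) := by
      funext i
      rw [inv_of_det_one hdet]
      rcases eq_or_ne i i₀ with rfl | h
      · ext a b; fin_cases a <;> fin_cases b <;> simp [hXdef, pow_two]
      · simp [hXdef, h, hs.ne']
    rw [map_smul, ← harmProj_act (by rw [hdet]; exact one_ne_zero), act_elem _ _ hX, h1,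
      elem_update_smul, ← hXdef, map_smul, smul_comm]
    norm_cast
  · have hd : HasDerivAt (fun x : ℝ => act k (n x) ((2 * k / (k + 1) : ℂ) • harmProj k (elem X)))
        ((2 * k / (k + 1) : ℂ) • (((harmProj k).toContinuousLinearMap).restrictScalars ℝ)
          (∑ i, elem (Function.update X i (mE * X i - X i * mE)))) 0 := by
      have h := ((((harmProj k).toContinuousLinearMap).restrictScalars ℝ).hasFDerivAt.comp_hasDerivAt
        (0 : ℝ) (hasDerivAt_act_n_elem X hX)).const_smul (2 * k / (k + 1) : ℂ)
      refine h.congr_of_eventuallyEq (Filter.Eventually.of_forall fun x => ?_)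
      simp only [map_smul, Function.comp_apply, Pi.smul_apply, ContinuousLinearMap.coe_restrictScalars',
        LinearMap.coe_toContinuousLinearMap']
      rw [harmProj_act (by simp [det_n])]
    refine hd.congr_deriv ?_
    simp only [ContinuousLinearMap.coe_restrictScalars', LinearMap.coe_toContinuousLinearMap',
      map_sum]
    have hi : ∀ i, harmProj k (elem (Function.update X i (mE * X i - X i * mE))) =
        (if i = i₀ then (1 / 2 : ℂ) else 0) • harmProj k (power k mH) +
          (1 / 2 : ℂ) • harmProj k (power k mH) := by
      intro i
      rcases eq_or_ne i i₀ with rfl | h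
      · have : mE * X i₀ - X i₀ * mE = mH := by
          simp [hXdef]
        rw [this, if_pos rfl, ← add_smul, hXdef, Function.update_idem]
        have h3 : (1 / 2 + 1 / 2 : ℂ) = 1 := by norm_num
        rw [h3, one_smul, power_eq_elem]
        congr 2
        exact Function.update_eq_self i₀ fun _ => mH
      · have : mE * X i - X i * mE = (-2 : ℝ) • mE := by
          simp [hXdef, h]; norm_num
        rw [this, if_neg h, elem_update_smul, map_smul, hXdef, harmProj_elem_F_E (Ne.symm h),
          smul_smul, zero_smul, zero_add]
        norm_num
    simp only [hi]
    rw [Finset.sum_add_distrib, ← Finset.sum_smul, Finset.sum_ite_eq' Finset.univ i₀,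
      if_pos (Finset.mem_univ _), Finset.sum_const, Finset.card_univ, Fintype.card_fin,
      ← Nat.cast_smul_eq_nsmul ℂ, smul_smul, ← add_smul, smul_smul,
      show (!![1, 0; 0, -1] : Matrix (Fin 2) (Fin 2) ℝ) = mH from rfl]
    congr 1
    field_simp
    ring

lemma isWeightNegTwo_vNegTwo {k : ℕ} (hk : k ≠ 0) : IsWeightNegTwo k (vNegTwo k) :=
  Classical.epsilon_spec (exists_isWeightNegTwo hk)

/-- The derivative of `x ↦ n(x) v₋₂` at an arbitrary point, by the group law. -/
lemma hasDerivAt_act_n_vNegTwo {k : ℕ} (hk : k ≠ 0) (x : ℝ) :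
    HasDerivAt (fun x : ℝ => act k (n x) (vNegTwo k))
      ((k : ℂ) • act k (n x) (harmProj k (power k mH))) x := by
  have h := (isWeightNegTwo_vNegTwo hk).2.2
  have h' : HasDerivAt (fun y : ℝ => act k (n y) (vNegTwo k))
      ((k : ℂ) • harmProj k (power k mH)) (x - x) := by rw [sub_self]; exact h
  have h2 := ((act k (n x)).restrictScalars ℝ).hasFDerivAt.comp_hasDerivAt x
    (h'.comp_sub_const x x)
  refine (h2.congr_deriv (by simp)).congr_of_eventuallyEq
    (Filter.Eventually.of_forall fun y => ?_)
  simp only [Function.comp_apply, ContinuousLinearMap.coe_restrictScalars']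
  rw [← act_n_add]; congr 2; ring_nf

lemma trace_u' : u'.trace = 0 := by simp [u']

lemma power_smul (k : ℕ) (c : ℝ) (X : Matrix (Fin 2) (Fin 2) ℝ) :
    power k (c • X) = ((c : ℂ) ^ k) • power k X := by
  funext β
  simp [power, coord_smul, Finset.prod_mul_distrib]

/-- The weights of `u'^k` and `v₋₂` do not add up to zero. -/
lemma form_u'_vNegTwo {k : ℕ} (hk : k ≠ 0) : form k (power k u') (vNegTwo k) = 0 := by
  set a : Matrix (Fin 2) (Fin 2) ℝ := !![2, 0; 0, 2⁻¹] with ha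
  have hdet : a.det = 1 := by simp [ha, Matrix.det_fin_two]
  have h1 : act k a (power k u') = ((1 / 4 : ℂ) ^ k) • power k u' := by
    rw [act_power _ _ _ trace_u', inv_of_det_one hdet]
    have : a * u' * !![a 1 1, -a 0 1; -a 1 0, a 0 0] = (1 / 4 : ℝ) • u' := by
      ext i j; fin_cases i <;> fin_cases j <;> simp [ha, u', Matrix.mul_apply] <;> norm_num
    rw [this, power_smul]; norm_num
  have h2 : act k a (vNegTwo k) = (1 / 4 : ℂ) • vNegTwo k := by
    rw [ha, (isWeightNegTwo_vNegTwo hk).2.1 2 (by norm_num)]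
    funext β
    simp; norm_num
  have h := form_act k a (by rw [hdet]; exact one_ne_zero) (power k u') (vNegTwo k)
  rw [h1, h2] at h
  simp only [map_smul, LinearMap.smul_apply, smul_eq_mul] at h
  have h3 : ((1 / 4 : ℂ) ^ k * (1 / 4) - 1) * form k (power k u') (vNegTwo k) = 0 := by
    linear_combination h
  refine (mul_eq_zero.1 h3).resolve_left fun h4 => ?_
  have h5 : ((1 / 4 : ℝ) ^ (k + 1)) = 1 := by
    have : (((1 / 4 : ℝ) ^ (k + 1) : ℝ) : ℂ) = 1 := by
      push_cast; linear_combination h4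
    exact_mod_cast this
  have h6 : ((1 / 4 : ℝ) ^ (k + 1)) < 1 := pow_lt_one₀ (by norm_num) (by norm_num) (by simp)
  linarith

/-! ### Pull-backs of forms -/

lemma isOpen_UHP : IsOpen UHP := isOpen_lt continuous_const Complex.continuous_im

lemma moebius_eq_smul (γ : SL(2, ℤ)) (τ : ℍ) : moebius γ τ = ((γ • τ : ℍ) : ℂ) := by
  rw [UpperHalfPlane.coe_specialLinearGroup_apply]
  simp [moebius]

lemma moebius_mem (γ : SL(2, ℤ)) {z : ℂ} (hz : z ∈ UHP) : moebius γ z ∈ UHP := by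
  have := moebius_eq_smul γ ⟨z, hz⟩
  change moebius γ z = _ at this
  rw [this]
  exact (γ • (⟨z, hz⟩ : ℍ)).2

lemma moebius_mul (γ δ : SL(2, ℤ)) {z : ℂ} (hz : z ∈ UHP) :
    moebius (γ * δ) z = moebius γ (moebius δ z) := by
  have h := moebius_eq_smul (γ * δ) ⟨z, hz⟩
  rw [mul_smul, ← moebius_eq_smul, ← moebius_eq_smul] at h
  exact h

lemma moebius_one (z : ℂ) : moebius 1 z = z := by simp [moebius]

lemma denom_ne_zero {p : Fin 2 → ℤ} (hp : p ≠ 0) {z : ℂ} (hz : z ∈ UHP) :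
    (p 0 : ℂ) * z + p 1 ≠ 0 := by
  intro h
  have h1 := congrArg Complex.im h
  simp only [Complex.add_im, Complex.mul_im, Complex.intCast_re, Complex.intCast_im, zero_mul,
    add_zero, Complex.zero_im, mul_eq_zero, Int.cast_eq_zero] at h1
  have h0 : p 0 = 0 := h1.resolve_right (ne_of_gt hz)
  rw [h0] at h
  simp only [Int.cast_zero, zero_mul, zero_add, Int.cast_eq_zero] at h
  exact hp (by funext i; fin_cases i <;> assumption)

/-- The bottom row of `γ`. -/
def row (γ : SL(2, ℤ)) : Fin 2 → ℤ := fun j => γ 1 j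

lemma det_eq (γ : SL(2, ℤ)) : γ 0 0 * γ 1 1 - γ 0 1 * γ 1 0 = 1 := by
  have := γ.2
  rwa [Matrix.det_fin_two] at this

lemma row_coprime (γ : SL(2, ℤ)) : IsCoprime (row γ 0) (row γ 1) :=
  ⟨-γ 0 1, γ 0 0, by have := det_eq γ; simp only [row]; linarith⟩

lemma ne_zero_of_coprime {p : Fin 2 → ℤ} (h : IsCoprime (p 0) (p 1)) : p ≠ 0 := by
  rintro rfl
  obtain ⟨a, b, h⟩ := h
  simp at h

lemma row_denom_ne_zero (γ : SL(2, ℤ)) {z : ℂ} (hz : z ∈ UHP) :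
    (γ 1 0 : ℂ) * z + γ 1 1 ≠ 0 := denom_ne_zero (ne_zero_of_coprime (row_coprime γ)) hz

lemma im_moebius (γ : SL(2, ℤ)) {z : ℂ} (hz : z ∈ UHP) :
    (moebius γ z).im = z.im / ‖(γ 1 0 : ℂ) * z + γ 1 1‖ ^ 2 := by
  have h := moebius_eq_smul γ ⟨z, hz⟩
  have h2 := ModularGroup.im_smul_eq_div_normSq γ ⟨z, hz⟩
  rw [sl_denom, Complex.normSq_eq_norm_sq] at h2
  change moebius γ z = _ at h
  rw [h]
  exact h2

lemma hasDerivAt_moebius (γ : SL(2, ℤ)) {z : ℂ} (hz : z ∈ UHP) :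
    HasDerivAt (moebius γ) (1 / ((γ 1 0 : ℂ) * z + γ 1 1) ^ 2) z := by
  have h0 := row_denom_ne_zero γ hz
  have h1 : HasDerivAt (fun z : ℂ => (γ 0 0 : ℂ) * z + γ 0 1) (γ 0 0 : ℂ) z := by
    simpa using ((hasDerivAt_id z).const_mul (γ 0 0 : ℂ)).add_const (γ 0 1 : ℂ)
  have h2 : HasDerivAt (fun z : ℂ => (γ 1 0 : ℂ) * z + γ 1 1) (γ 1 0 : ℂ) z := by
    simpa using ((hasDerivAt_id z).const_mul (γ 1 0 : ℂ)).add_const (γ 1 1 : ℂ)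
  refine (h1.fun_div h2 h0).congr_deriv ?_
  have hd : ((γ 0 0 : ℂ) * γ 1 1 - γ 0 1 * γ 1 0) = 1 := by exact_mod_cast det_eq γ
  congr 1
  linear_combination hd

lemma hasFDerivAt_moebius (γ : SL(2, ℤ)) {z : ℂ} (hz : z ∈ UHP) :
    HasFDerivAt (𝕜 := ℝ) (moebius γ) ((1 / ((γ 1 0 : ℂ) * z + γ 1 1) ^ 2) •
      (ContinuousLinearMap.id ℝ ℂ)) z := by
  have := (hasDerivAt_moebius γ hz).hasFDerivAt.restrictScalars ℝ
  refine this.congr_fderiv (ContinuousLinearMap.ext fun v => ?_)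
  simp [mul_comm]

lemma fderiv_moebius (γ : SL(2, ℤ)) {z : ℂ} (hz : z ∈ UHP) (v : ℂ) :
    fderiv ℝ (moebius γ) z v = v / ((γ 1 0 : ℂ) * z + γ 1 1) ^ 2 := by
  rw [(hasFDerivAt_moebius γ hz).fderiv]
  simp [div_eq_mul_inv, mul_comm]

lemma contDiffOn_moebius (γ : SL(2, ℤ)) : ContDiffOn ℝ ∞ (moebius γ) UHP := by
  refine ContDiffOn.restrict_scalars ℝ (𝕜' := ℂ) ?_
  refine ContDiffOn.fun_div ?_ ?_ fun z hz => row_denom_ne_zero γ hz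
  · exact (contDiff_const.mul contDiff_id |>.add contDiff_const).contDiffOn
  · exact (contDiff_const.mul contDiff_id |>.add contDiff_const).contDiffOn

lemma toR_mul (γ δ : SL(2, ℤ)) : toR (γ * δ) = toR γ * toR δ := by
  ext i j
  simp [toR, Matrix.mul_apply]

lemma det_toR (γ : SL(2, ℤ)) : (toR γ).det = 1 := by
  rw [Matrix.det_fin_two]
  simp only [toR, Matrix.of_apply]
  have := det_eq γ
  exact_mod_cast this

lemma det_toR_ne (γ : SL(2, ℤ)) : (toR γ).det ≠ 0 := by rw [det_toR]; exact one_ne_zero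

lemma toR_one : toR 1 = 1 := by
  ext i j
  fin_cases i <;> fin_cases j <;> simp [toR]

lemma toR_inv (γ : SL(2, ℤ)) : toR γ⁻¹ = (toR γ)⁻¹ := by
  refine (Matrix.inv_eq_left_inv ?_).symm
  rw [← toR_mul, inv_mul_cancel, toR_one]

lemma pull1_apply {k : ℕ} (γ : SL(2, ℤ)) (ξ : Form1 k) {z : ℂ} (hz : z ∈ UHP) (v : ℂ) :
    pull1 γ ξ z v = act k (toR γ⁻¹) (ξ (moebius γ z) (v / ((γ 1 0 : ℂ) * z + γ 1 1) ^ 2)) := by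
  simp [pull1, fderiv_moebius γ hz]

lemma pull0_mul {k : ℕ} (γ δ : SL(2, ℤ)) (f : Form0 k) {z : ℂ} (hz : z ∈ UHP) :
    pull0 (γ * δ) f z = pull0 δ (pull0 γ f) z := by
  simp only [pull0]
  rw [moebius_mul γ δ hz, mul_inv_rev, toR_mul, act_mul _ _ _ (det_toR_ne _)]

lemma pull1_mul {k : ℕ} (γ δ : SL(2, ℤ)) (ξ : Form1 k) {z : ℂ} (hz : z ∈ UHP) :
    pull1 (γ * δ) ξ z = pull1 δ (pull1 γ ξ) z := by
  refine ContinuousLinearMap.ext fun v => ?_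
  rw [pull1_apply _ _ hz, pull1_apply _ _ hz, pull1_apply _ _ (moebius_mem δ hz),
    moebius_mul γ δ hz, mul_inv_rev, toR_mul, act_mul _ _ _ (det_toR_ne _), div_div, ← mul_pow]
  congr 5
  have := sl_denom_mul γ δ ⟨z, hz⟩
  rw [sl_denom, sl_denom, sl_denom, ← moebius_eq_smul] at this
  exact this.trans (mul_comm _ _)

/-- The pull-back of a primitive is a primitive of the pull-back. -/
lemma hasFDerivAt_pull0 {k : ℕ} (γ : SL(2, ℤ)) {ξ : Form1 k} {f : Form0 k} {z : ℂ} (hz : z ∈ UHP)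
    (hf : HasFDerivAt f (ξ (moebius γ z)) (moebius γ z)) :
    HasFDerivAt (pull0 γ f) (pull1 γ ξ z) z := by
  have h := ((act k (toR γ⁻¹)).restrictScalars ℝ).hasFDerivAt.comp z
    (hf.comp z (hasFDerivAt_moebius γ hz))
  rw [pull1, (hasFDerivAt_moebius γ hz).fderiv]
  exact h

lemma contDiffOn_pull0 {k : ℕ} (γ : SL(2, ℤ)) {f : Form0 k} {s t : Set ℂ}
    (hf : ContDiffOn ℝ ∞ f t) (hs : s ⊆ UHP) (hst : ∀ z ∈ s, moebius γ z ∈ t) :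
    ContDiffOn ℝ ∞ (pull0 γ f) s := by
  have h := ((act k (toR γ⁻¹)).restrictScalars ℝ).contDiff.comp_contDiffOn (n := ∞)
    (hf.comp ((contDiffOn_moebius γ).mono hs) hst)
  exact h

lemma contDiffOn_pull1 {k : ℕ} (γ : SL(2, ℤ)) {ξ : Form1 k} (hξ : ContDiffOn ℝ ∞ ξ UHP) :
    ContDiffOn ℝ ∞ (pull1 γ ξ) UHP := by
  have h1 : ContDiffOn ℝ ∞ (fun z => fderiv ℝ (moebius γ) z) UHP :=
    (contDiffOn_moebius γ).fderiv_of_isOpen isOpen_UHP (by simp)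
  have h2 : ContDiffOn ℝ ∞ (fun z => ξ (moebius γ z)) UHP :=
    hξ.comp (contDiffOn_moebius γ) fun z hz => moebius_mem γ hz
  exact contDiffOn_const.clm_comp (h2.clm_comp h1)

/-! ### Closed forms and primitives -/

lemma exists_primitive {k : ℕ} {ξ : Form1 k} (hc : IsClosed1 ξ) (hd : DifferentiableOn ℝ ξ UHP) :
    ∃ f : Form0 k, ∀ z ∈ UHP, HasFDerivAt f (ξ z) z :=
  Convex.exists_forall_hasFDerivAt_of_fderiv_symmetric (convex_halfSpace_im_gt 0) isOpen_UHP hd hc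

lemma isClosed1_of_primitive {k : ℕ} {ξ : Form1 k} (hd : DifferentiableOn ℝ ξ UHP)
    (h : ∀ z ∈ UHP, ∃ f : Form0 k, ∀ᶠ y in nhds z, HasFDerivAt f (ξ y) y) : IsClosed1 ξ := by
  intro z hz v w
  obtain ⟨f, hf⟩ := h z hz
  exact second_derivative_symmetric_of_eventually hf
    (hd.differentiableAt (isOpen_UHP.mem_nhds hz)).hasFDerivAt v w

lemma IsClosed1.pull1 {k : ℕ} (γ : SL(2, ℤ)) {ξ : Form1 k} (hc : IsClosed1 ξ)
    (hξ : ContDiffOn ℝ ∞ ξ UHP) : IsClosed1 (pull1 γ ξ) := by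
  obtain ⟨f, hf⟩ := exists_primitive hc (hξ.differentiableOn (by simp))
  refine isClosed1_of_primitive ((contDiffOn_pull1 γ hξ).differentiableOn (by simp))
    fun z hz => ⟨pull0 γ f, ?_⟩
  filter_upwards [isOpen_UHP.mem_nhds hz] with y hy
  exact hasFDerivAt_pull0 γ hy (hf _ (moebius_mem γ hy))

/-- A locally uniformly convergent series of closed forms is closed if its sum is differentiable:
the sum of suitably normalised primitives converges to a primitive. -/
lemma isClosed1_tsum {k : ℕ} {ι : Type*} {ξ : ι → Form1 k} (hc : ∀ i, IsClosed1 (ξ i))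
    (hd : ∀ i, DifferentiableOn ℝ (ξ i) UHP)
    (hb : ∀ z ∈ UHP, ∃ s, IsOpen s ∧ IsPreconnected s ∧ z ∈ s ∧ s ⊆ UHP ∧ ∃ u : ι → ℝ, Summable u ∧
      ∀ i, ∀ y ∈ s, ‖ξ i y‖ ≤ u i)
    (hs : DifferentiableOn ℝ (fun z => ∑' i, ξ i z) UHP) : IsClosed1 fun z => ∑' i, ξ i z := by
  refine isClosed1_of_primitive hs fun z hz => ?_
  choose f hf using fun i => exists_primitive (hc i) (hd i)
  obtain ⟨s, hso, hsc, hzs, hsU, u, hu, hbd⟩ := hb z hz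
  refine ⟨fun y => ∑' i, (f i y - f i z), ?_⟩
  filter_upwards [hso.mem_nhds hzs] with y hy
  exact hasFDerivAt_tsum_of_isPreconnected hu hso hsc
    (fun i y hy => (hf i y (hsU hy)).sub_const _) hbd hzs (by simp [summable_zero]) hy

/-! ### Cosets of the stabiliser of the cusp -/

lemma row_T_zpow_mul (m : ℤ) (γ : SL(2, ℤ)) : row (ModularGroup.T ^ m * γ) = row γ := by
  funext j
  simp [row,
    Fin.sum_univ_two]

lemma row_eq_iff (γ δ : SL(2, ℤ)) : row γ = row δ ↔ ∃ m : ℤ, δ = ModularGroup.T ^ m * γ := by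
  constructor
  · intro h
    have h0 : γ 1 0 = δ 1 0 := congrFun h 0
    have h1 : γ 1 1 = δ 1 1 := congrFun h 1
    have e1 := det_eq γ
    have e2 := det_eq δ
    have hc : (δ * γ⁻¹) 1 0 = 0 := by
      simp [Matrix.SpecialLinearGroup.coe_mul, Matrix.SpecialLinearGroup.coe_inv,
        Matrix.adjugate_fin_two, Matrix.mul_apply, Fin.sum_univ_two]
      rw [← h0, ← h1]; ring
    have hd : (δ * γ⁻¹) 1 1 = 1 := by
      simp [Matrix.SpecialLinearGroup.coe_mul, Matrix.SpecialLinearGroup.coe_inv,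
        Matrix.adjugate_fin_two, Matrix.mul_apply, Fin.sum_univ_two]
      rw [← h0, ← h1]; linarith
    have ha : (δ * γ⁻¹) 0 0 = 1 := by
      have := det_eq (δ * γ⁻¹)
      rw [hc, hd] at this
      linarith
    refine ⟨(δ * γ⁻¹) 0 1, ?_⟩
    rw [← mul_inv_eq_iff_eq_mul]
    ext i j
    rw [ModularGroup.coe_T_zpow]
    fin_cases i <;> fin_cases j
    · exact ha
    · rfl
    · exact hc
    · exact hd
  · rintro ⟨m, rfl⟩
    exact (row_T_zpow_mul m γ).symm

/-- Pairs of coprime integers. -/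
abbrev Cop : Type := {p : Fin 2 → ℤ // IsCoprime (p 0) (p 1)}

lemma cuspCosets_mk_eq_iff (γ δ : SL(2, ℤ)) :
    (Quotient.mk (QuotientGroup.rightRel (Subgroup.zpowers ModularGroup.T)) γ =
      Quotient.mk (QuotientGroup.rightRel (Subgroup.zpowers ModularGroup.T)) δ) ↔
      row γ = row δ := by
  rw [Quotient.eq, QuotientGroup.rightRel_apply, row_eq_iff]
  constructor
  · rintro ⟨m, hm⟩
    exact ⟨m, by simp only at hm; rw [hm]; group⟩
  · rintro ⟨m, rfl⟩
    exact ⟨m, by simp⟩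

lemma row_surj (p : Cop) : ∃ γ, row γ = p.1 := by
  obtain ⟨γ, -, hγ⟩ := ModularGroup.bottom_row_surj (R := ℤ) (a := p.1) p.2
  exact ⟨γ, hγ⟩

/-- A coset is determined by the bottom row of its elements. -/
def cosetEquiv : CuspCosets ≃ Cop :=
  Equiv.ofBijective (fun q => ⟨row q.out, row_coprime _⟩) ⟨fun q q' h => by
    rw [← q.out_eq, ← q'.out_eq]
    exact (cuspCosets_mk_eq_iff _ _).2 (congrArg Subtype.val h), fun p => by
    obtain ⟨γ, hγ⟩ := row_surj p
    refine ⟨Quotient.mk _ γ, Subtype.ext ?_⟩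
    rw [← hγ]
    exact (cuspCosets_mk_eq_iff _ _).1 (Quotient.out_eq _)⟩

lemma cosetEquiv_apply (q : CuspCosets) : (cosetEquiv q).1 = row q.out := rfl

/-! ### The terms of the Eisenstein series -/

/-- The isotropic vector attached to a vector `(w₁, w₂)` of `ℝ²`; `u'` belongs to `(0, 1)`. -/
def isoVec (w₁ w₂ : ℝ) : Matrix (Fin 2) (Fin 2) ℝ := !![-(w₁ * w₂), w₁ ^ 2; -w₂ ^ 2, w₁ * w₂]

lemma trace_isoVec (w₁ w₂ : ℝ) : (isoVec w₁ w₂).trace = 0 := by simp [isoVec]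

lemma trace_isoVec_sq (w₁ w₂ : ℝ) : (isoVec w₁ w₂ * isoVec w₁ w₂).trace = 0 := by
  simp [isoVec]; ring

lemma power_isoVec_mem_harm (k : ℕ) (w₁ w₂ : ℝ) : power k (isoVec w₁ w₂) ∈ harm k :=
  power_mem_harm k (trace_isoVec _ _) (trace_isoVec_sq _ _)

lemma conj_isoVec {g : Matrix (Fin 2) (Fin 2) ℝ} (hg : g.det = 1) (w₁ w₂ : ℝ) :
    g * isoVec w₁ w₂ * g⁻¹ = isoVec (g 0 0 * w₁ + g 0 1 * w₂) (g 1 0 * w₁ + g 1 1 * w₂) := by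
  rw [inv_of_det_one hg]
  ext i j
  fin_cases i <;> fin_cases j <;>
    simp [isoVec, Matrix.mul_apply, Fin.sum_univ_two] <;> ring

lemma act_power_isoVec (k : ℕ) {g : Matrix (Fin 2) (Fin 2) ℝ} (hg : g.det = 1) (w₁ w₂ : ℝ) :
    act k g (power k (isoVec w₁ w₂)) =
      power k (isoVec (g 0 0 * w₁ + g 0 1 * w₂) (g 1 0 * w₁ + g 1 1 * w₂)) := by
  rw [act_power _ _ _ (trace_isoVec _ _), conj_isoVec hg]

lemma act_n_power_u' (k : ℕ) (x : ℝ) : act k (n x) (power k u') = power k (isoVec x 1) := by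
  have : u' = isoVec 0 1 := by simp [u', isoVec]
  rw [this, act_power_isoVec _ (det_n x)]
  simp [n]

/-- `1 / (c z + d)`. -/
def qf (p : Fin 2 → ℤ) (z : ℂ) : ℂ := 1 / ((p 0 : ℂ) * z + p 1)

/-- The term of the Eisenstein series that belongs to the bottom row `p = (c, d)`: the form
`Re (dz / (c z + d)²)` with the isotropic vector attached to `Re ((z, 1) / (c z + d))`. -/
def eisE (k : ℕ) (p : Fin 2 → ℤ) : Form1 k := fun z =>
  (Complex.reCLM.comp ((qf p z ^ 2) • ContinuousLinearMap.id ℝ ℂ)).smulRight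
    (power k (isoVec (z * qf p z).re (qf p z).re))

lemma eisE_apply (k : ℕ) (p : Fin 2 → ℤ) (z v : ℂ) :
    eisE k p z v = (qf p z ^ 2 * v).re • power k (isoVec (z * qf p z).re (qf p z).re) := by
  simp [eisE]

lemma pull1_eisBase (k : ℕ) (γ : SL(2, ℤ)) {z : ℂ} (hz : z ∈ UHP) :
    pull1 γ (eisBase k) z = eisE k (row γ) z := by
  refine ContinuousLinearMap.ext fun v => ?_
  have h0 := row_denom_ne_zero γ hz
  have hd : ((γ 0 0 : ℂ) * γ 1 1 - γ 0 1 * γ 1 0) = 1 := by exact_mod_cast det_eq γ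
  have hdet : (toR γ⁻¹).det = 1 := det_toR _
  rw [pull1_apply _ _ hz, eisE_apply]
  simp only [eisBase, ContinuousLinearMap.smulRight_apply, Complex.reCLM_apply, act_n_power_u']
  rw [← Complex.coe_smul, map_smul, act_power_isoVec _ hdet, Complex.coe_smul]
  obtain ⟨D, hD⟩ : ∃ D : ℂ, D = (γ 1 0 : ℂ) * z + γ 1 1 := ⟨_, rfl⟩
  have hq : qf (row γ) z = 1 / D := by rw [hD]; rfl
  have hm : moebius γ z = ((γ 0 0 : ℂ) * z + γ 0 1) / D := by rw [hD]; rfl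
  rw [← hD] at h0
  have e1 : v / D ^ 2 = qf (row γ) z ^ 2 * v := by
    rw [hq]; field_simp
  have e2 : (γ 1 1 : ℂ) * moebius γ z - γ 0 1 = z * qf (row γ) z := by
    rw [hq, hm]; field_simp; rw [hD]; linear_combination z * hd
  have e3 : -(γ 1 0 : ℂ) * moebius γ z + γ 0 0 = qf (row γ) z := by
    rw [hq, hm]; field_simp; rw [hD]; linear_combination hd
  have e2' := congrArg Complex.re e2
  have e3' := congrArg Complex.re e3
  rw [Complex.sub_re, ← Complex.ofReal_intCast, ← Complex.ofReal_intCast, Complex.re_ofReal_mul,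
    Complex.ofReal_re] at e2'
  rw [Complex.add_re, ← Complex.ofReal_intCast, ← Complex.ofReal_intCast, ← Complex.ofReal_neg,
    Complex.re_ofReal_mul, Complex.ofReal_re] at e3'
  rw [← hD, e1, ← e2', ← e3']
  congr 3
  · simp only [toR, Matrix.SpecialLinearGroup.coe_inv, Matrix.adjugate_fin_two, Matrix.of_apply]
    simp [sub_eq_add_neg]
  · simp only [toR, Matrix.SpecialLinearGroup.coe_inv, Matrix.adjugate_fin_two, Matrix.of_apply]
    simp

lemma eisTerm_eq (k : ℕ) (q : CuspCosets) {z : ℂ} (hz : z ∈ UHP) :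
    eisTerm k q z = eisE k (cosetEquiv q).1 z := by
  rw [eisTerm, pull1_eisBase k _ hz, cosetEquiv_apply]

/-! ### Convergence of the Eisenstein series -/

/-- A vertical strip around a point of the upper half plane. -/
def stripNhd (a b : ℝ) : Set ℂ := {z | |z.re| < a ∧ b < z.im ∧ z.im < a}

lemma isOpen_stripNhd (a b : ℝ) : IsOpen (stripNhd a b) :=
  (isOpen_lt (continuous_abs.comp Complex.continuous_re) continuous_const).inter
    ((isOpen_lt continuous_const Complex.continuous_im).inter
      (isOpen_lt Complex.continuous_im continuous_const))

lemma convex_stripNhd (a b : ℝ) : Convex ℝ (stripNhd a b) := by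
  have h : stripNhd a b = (Complex.reLm ⁻¹' Set.Ioo (-a) a) ∩ (Complex.imLm ⁻¹' Set.Ioo b a) := by
    ext z; simp [stripNhd, abs_lt]
  rw [h]
  exact ((convex_Ioo _ _).linear_preimage _).inter ((convex_Ioo _ _).linear_preimage _)

lemma stripNhd_subset {a b : ℝ} (hb : 0 < b) : stripNhd a b ⊆ UHP := fun _ hz => hb.trans hz.2.1

lemma mem_stripNhd {z : ℂ} (hz : z ∈ UHP) : z ∈ stripNhd (|z.re| + z.im + 1) (z.im / 2) := by
  have hz' : 0 < z.im := hz
  refine ⟨by linarith, by linarith, by have := abs_nonneg z.re; linarith⟩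

lemma exists_norm_qf_le {a b : ℝ} (hb : 0 < b) : ∃ C > 0, ∀ z ∈ stripNhd a b,
    ∀ p : Fin 2 → ℤ, p ≠ 0 → ‖qf p z‖ ≤ C * ‖p‖⁻¹ ∧ ‖(p 0 : ℂ) * qf p z‖ ≤ C := by
  set r := EisensteinSeries.r ⟨⟨a, b⟩, hb⟩ with hr
  have hr0 : 0 < r := EisensteinSeries.r_pos _
  refine ⟨max r⁻¹ b⁻¹, by positivity, fun z hz p hp => ?_⟩
  have hzU : z ∈ UHP := stripNhd_subset hb hz
  let τ : ℍ := ⟨z, hzU⟩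
  have h0 := denom_ne_zero hp hzU
  have h1 : r ≤ EisensteinSeries.r τ :=
    EisensteinSeries.r_lower_bound_on_verticalStrip τ hb ⟨hz.1.le, hz.2.1.le⟩
  have h2 := EisensteinSeries.r_mul_max_le τ hp
  have hp' : 0 < ‖p‖ := norm_pos_iff.2 hp
  have h3 : r * ‖p‖ ≤ ‖(p 0 : ℂ) * z + p 1‖ :=
    (mul_le_mul_of_nonneg_right h1 hp'.le).trans h2
  constructor
  · rw [qf, norm_div, norm_one, div_eq_mul_inv, one_mul]
    calc ‖(p 0 : ℂ) * z + p 1‖⁻¹ ≤ (r * ‖p‖)⁻¹ := inv_anti₀ (by positivity) h3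
      _ = r⁻¹ * ‖p‖⁻¹ := mul_inv _ _
      _ ≤ _ := by gcongr; exact le_max_left _ _
  · have h4 : |(p 0 : ℝ)| * b ≤ ‖(p 0 : ℂ) * z + p 1‖ := by
      refine le_trans ?_ (Complex.abs_im_le_norm _)
      simp only [Complex.add_im, Complex.mul_im, Complex.intCast_re, Complex.intCast_im, zero_mul,
        add_zero, abs_mul]
      exact mul_le_mul_of_nonneg_left (hz.2.1.le.trans (le_abs_self _)) (abs_nonneg _)
    rw [qf, norm_mul, norm_div, norm_one, mul_one_div, Complex.norm_intCast]
    have hpos : 0 < ‖(p 0 : ℂ) * z + p 1‖ := norm_pos_iff.2 h0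
    refine le_trans ?_ (le_max_right _ _)
    rw [div_le_iff₀ hpos, inv_mul_eq_div, le_div_iff₀ hb]
    exact h4

lemma one_le_norm_of_ne_zero {p : Fin 2 → ℤ} (hp : p ≠ 0) : 1 ≤ ‖p‖ := by
  rw [EisensteinSeries.norm_eq_max_natAbs]
  have : 1 ≤ max (p 0).natAbs (p 1).natAbs := by
    by_contra h
    apply hp
    funext i
    fin_cases i <;> simp <;> omega
  exact_mod_cast this

lemma summable_cop {s : ℝ} (hs : 2 < s) : Summable fun p : Cop => ‖p.1‖ ^ (-s) :=
  (EisensteinSeries.summable_one_div_norm_rpow hs).comp_injective Subtype.val_injective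

/-- The elementary function `c^m (c z + d)^{-a} (c z̄ + d)^{-b}`. -/
def eisMono (m a b : ℕ) (p : Fin 2 → ℤ) (z : ℂ) : ℂ :=
  (p 0 : ℂ) ^ m * qf p z ^ a * (starRingEnd ℂ (qf p z)) ^ b

lemma norm_eisMono (m a b : ℕ) (p : Fin 2 → ℤ) (z : ℂ) :
    ‖eisMono m a b p z‖ = ‖(p 0 : ℂ)‖ ^ m * ‖qf p z‖ ^ (a + b) := by
  rw [eisMono, norm_mul, norm_mul, norm_pow, norm_pow, norm_pow, RCLike.norm_conj, pow_add, mul_assoc]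

lemma exists_norm_eisMono_le {a' b' : ℝ} (hb : 0 < b') {m a b : ℕ} (h : m + 3 ≤ a + b) :
    ∃ C, ∀ z ∈ stripNhd a' b', ∀ p : Cop, ‖eisMono m a b p.1 z‖ ≤ C * ‖p.1‖ ^ (-3 : ℝ) := by
  obtain ⟨C, hC, hbd⟩ := exists_norm_qf_le (a := a') hb
  refine ⟨C ^ (a + b), fun z hz p => ?_⟩
  have hp := ne_zero_of_coprime p.2
  obtain ⟨h1, h2⟩ := hbd z hz p.1 hp
  have hp1 := one_le_norm_of_ne_zero hp
  obtain ⟨l, hl⟩ : ∃ l, a + b = m + (3 + l) := ⟨a + b - m - 3, by omega⟩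
  rw [norm_eisMono, hl, pow_add, ← mul_assoc, ← mul_pow, ← norm_mul, pow_add C]
  have h3 : ‖qf p.1 z‖ ^ (3 + l) ≤ C ^ (3 + l) * ‖p.1‖ ^ (-3 : ℝ) := by
    calc ‖qf p.1 z‖ ^ (3 + l) ≤ (C * ‖p.1‖⁻¹) ^ (3 + l) := by gcongr
      _ = C ^ (3 + l) * (‖p.1‖⁻¹ ^ 3 * ‖p.1‖⁻¹ ^ l) := by rw [mul_pow, pow_add ‖p.1‖⁻¹]
      _ ≤ C ^ (3 + l) * (‖p.1‖⁻¹ ^ 3 * 1) := by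
        gcongr
        exact pow_le_one₀ (by positivity) (inv_le_one_of_one_le₀ hp1)
      _ = _ := by
        rw [mul_one, Real.rpow_neg (by positivity)]
        norm_num
  rw [mul_assoc]
  gcongr

lemma hasFDerivAt_eisMono (m a b : ℕ) (p : Cop) {z : ℂ} (hz : z ∈ UHP) :
    HasFDerivAt (𝕜 := ℝ) (eisMono m a b p.1)
      ((-(a : ℂ) * eisMono (m + 1) (a + 1) b p.1 z) • (ContinuousLinearMap.id ℝ ℂ) +
        (-(b : ℂ) * eisMono (m + 1) a (b + 1) p.1 z) • (Complex.conjCLE : ℂ →L[ℝ] ℂ)) z := by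
  have h0 := denom_ne_zero (ne_zero_of_coprime p.2) hz
  have h1 : HasDerivAt (qf p.1) (-(p.1 0 : ℂ) * qf p.1 z ^ 2) z := by
    have h2 : HasDerivAt (fun z : ℂ => (p.1 0 : ℂ) * z + p.1 1) (p.1 0 : ℂ) z := by
      simpa using ((hasDerivAt_id z).const_mul (p.1 0 : ℂ)).add_const (p.1 1 : ℂ)
    refine ((hasDerivAt_const z (1 : ℂ)).fun_div h2 h0).congr_deriv ?_
    simp only [qf]; field_simp; ring
  have h2 : HasFDerivAt (𝕜 := ℝ) (qf p.1)
      ((-(p.1 0 : ℂ) * qf p.1 z ^ 2) • (ContinuousLinearMap.id ℝ ℂ)) z := by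
    refine (h1.hasFDerivAt.restrictScalars ℝ).congr_fderiv (ContinuousLinearMap.ext fun v => ?_)
    simp [mul_comm]
  have h3 : HasFDerivAt (𝕜 := ℝ) (fun z => starRingEnd ℂ (qf p.1 z))
      ((Complex.conjCLE : ℂ →L[ℝ] ℂ).comp ((-(p.1 0 : ℂ) * qf p.1 z ^ 2) •
        (ContinuousLinearMap.id ℝ ℂ))) z :=
    (Complex.conjCLE : ℂ →L[ℝ] ℂ).hasFDerivAt.comp z h2
  have h4 := ((h2.pow a).const_mul ((p.1 0 : ℂ) ^ m)).fun_mul (h3.pow b)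
  refine h4.congr_fderiv (ContinuousLinearMap.ext fun v => ?_)
  simp only [eisMono, add_apply, smul_apply,
    ContinuousLinearMap.comp_apply, ContinuousLinearMap.id_apply, smul_eq_mul,
    ContinuousLinearEquiv.coe_coe, Complex.conjCLE_apply, map_mul, map_neg, map_pow,
    map_intCast, nsmul_eq_mul]
  rcases a with _ | a <;> rcases b with _ | b <;>
    simp only [Nat.cast_zero, Nat.cast_add, Nat.cast_one, Nat.add_sub_cancel, zero_mul, neg_zero,
      mul_zero, zero_add, add_zero] <;> ring

lemma summable_eisMono {m a b : ℕ} (h : m + 3 ≤ a + b) {z : ℂ} (hz : z ∈ UHP) :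
    Summable fun p : Cop => eisMono m a b p.1 z := by
  obtain ⟨C, hC⟩ := exists_norm_eisMono_le (a' := |z.re| + z.im + 1) (b' := z.im / 2)
    (by have : 0 < z.im := hz; linarith) h
  exact Summable.of_norm_bounded ((summable_cop (by norm_num)).mul_left C)
    fun p => hC z (mem_stripNhd hz) p

lemma hasFDerivAt_tsum_eisMono {m a b : ℕ} (h : m + 3 ≤ a + b) {z : ℂ} (hz : z ∈ UHP) :
    HasFDerivAt (𝕜 := ℝ) (fun z => ∑' p : Cop, eisMono m a b p.1 z)
      ((-(a : ℂ) * ∑' p : Cop, eisMono (m + 1) (a + 1) b p.1 z) • (ContinuousLinearMap.id ℝ ℂ) +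
        (-(b : ℂ) * ∑' p : Cop, eisMono (m + 1) a (b + 1) p.1 z) •
          (Complex.conjCLE : ℂ →L[ℝ] ℂ)) z := by
  have hb : 0 < z.im / 2 := by have : 0 < z.im := hz; linarith
  have ha1 : m + 1 + 3 ≤ a + 1 + b := by omega
  have hb1 : m + 1 + 3 ≤ a + (b + 1) := by omega
  obtain ⟨C₁, h₁⟩ := exists_norm_eisMono_le (a' := |z.re| + z.im + 1) hb ha1
  obtain ⟨C₂, h₂⟩ := exists_norm_eisMono_le (a' := |z.re| + z.im + 1) hb hb1
  have hs : Summable fun p : Cop => (a * C₁ * ‖ContinuousLinearMap.id ℝ ℂ‖ +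
      b * C₂ * ‖(Complex.conjCLE : ℂ →L[ℝ] ℂ)‖) * ‖p.1‖ ^ (-3 : ℝ) :=
    (summable_cop (by norm_num)).mul_left _
  have := hasFDerivAt_tsum_of_isPreconnected hs (isOpen_stripNhd _ _)
    (convex_stripNhd (|z.re| + z.im + 1) (z.im / 2)).isPreconnected
    (fun p y hy => hasFDerivAt_eisMono m a b p (stripNhd_subset hb hy)) (fun p y hy => ?_)
    (mem_stripNhd hz) (summable_eisMono h hz) (mem_stripNhd hz)
  · refine this.congr_fderiv ?_
    have s1 : Summable fun p : Cop => (-(a : ℂ) * eisMono (m + 1) (a + 1) b p.1 z) :=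
      (summable_eisMono ha1 hz).mul_left _
    have s2 : Summable fun p : Cop => (-(b : ℂ) * eisMono (m + 1) a (b + 1) p.1 z) :=
      (summable_eisMono hb1 hz).mul_left _
    rw [Summable.tsum_add (s1.smul_const _) (s2.smul_const _), Summable.tsum_smul_const s1,
      Summable.tsum_smul_const s2, tsum_mul_left, tsum_mul_left]
  · refine (norm_add_le _ _).trans ?_
    rw [norm_smul, norm_smul, norm_mul, norm_mul, norm_neg, norm_neg, Complex.norm_natCast,
      Complex.norm_natCast, add_mul]
    have e1 := h₁ y hy p
    have e2 := h₂ y hy p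
    refine add_le_add ?_ ?_
    · calc _ ≤ (a : ℝ) * (C₁ * ‖p.1‖ ^ (-3 : ℝ)) * ‖ContinuousLinearMap.id ℝ ℂ‖ := by gcongr
        _ = _ := by ring
    · calc _ ≤ (b : ℝ) * (C₂ * ‖p.1‖ ^ (-3 : ℝ)) * ‖(Complex.conjCLE : ℂ →L[ℝ] ℂ)‖ := by gcongr
        _ = _ := by ring

lemma contDiffOn_tsum_eisMono {m a b : ℕ} (h : m + 3 ≤ a + b) :
    ContDiffOn ℝ ∞ (fun z => ∑' p : Cop, eisMono m a b p.1 z) UHP := by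
  rw [contDiffOn_infty]
  intro N
  induction N generalizing m a b with
  | zero =>
    rw [Nat.cast_zero, contDiffOn_zero]
    exact fun z hz => (hasFDerivAt_tsum_eisMono h hz).continuousAt.continuousWithinAt
  | succ N ih =>
    rw [Nat.cast_succ, contDiffOn_succ_iff_fderiv_of_isOpen isOpen_UHP]
    refine ⟨fun z hz => (hasFDerivAt_tsum_eisMono h hz).differentiableAt.differentiableWithinAt,
      by simp, ?_⟩
    have h1 := (contDiffOn_const (c := -(a : ℂ))).mul
      (ih (m := m + 1) (a := a + 1) (b := b) (by omega))
    have h2 := (contDiffOn_const (c := -(b : ℂ))).mul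
      (ih (m := m + 1) (a := a) (b := b + 1) (by omega))
    refine ((h1.smul (contDiffOn_const (c := ContinuousLinearMap.id ℝ ℂ))).add
      (h2.smul (contDiffOn_const (c := (Complex.conjCLE : ℂ →L[ℝ] ℂ))))).congr fun z hz => ?_
    exact (hasFDerivAt_tsum_eisMono h hz).fderiv

/-- `f` behaves like a homogeneous polynomial of degree `N` in `1 / (c z + d)` and its conjugate
with coefficients that are smooth in `z`: all series of `f`, multiplied by elementary functions,
that should converge do so, to smooth functions. -/
def EisNice (N : ℕ) (f : Cop → ℂ → ℂ) : Prop :=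
  ∀ m a b : ℕ, m + 3 ≤ a + b + N →
    (∀ z ∈ UHP, Summable fun p : Cop => eisMono m a b p.1 z * f p z) ∧
      ContDiffOn ℝ ∞ (fun z => ∑' p : Cop, eisMono m a b p.1 z * f p z) UHP

namespace EisNice

lemma one : EisNice 0 fun _ _ => 1 := fun m a b h => by
  simp only [mul_one]
  exact ⟨fun z hz => summable_eisMono (by omega) hz, contDiffOn_tsum_eisMono (by omega)⟩

lemma congr {N : ℕ} {f g : Cop → ℂ → ℂ} (hf : EisNice N f)
    (h : ∀ p, ∀ z ∈ UHP, g p z = f p z) : EisNice N g := fun m a b hm => by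
  obtain ⟨h1, h2⟩ := hf m a b hm
  exact ⟨fun z hz => (h1 z hz).congr fun p => by rw [h p z hz],
    h2.congr fun z hz => tsum_congr fun p => by rw [h p z hz]⟩

lemma add {N : ℕ} {f g : Cop → ℂ → ℂ} (hf : EisNice N f) (hg : EisNice N g) :
    EisNice N fun p z => f p z + g p z := fun m a b hm => by
  obtain ⟨h1, h2⟩ := hf m a b hm
  obtain ⟨h3, h4⟩ := hg m a b hm
  simp only [mul_add]
  refine ⟨fun z hz => (h1 z hz).add (h3 z hz), (h2.add h4).congr ?_⟩
  intro z hz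
  exact Summable.tsum_add (h1 z hz) (h3 z hz)

lemma smul {N : ℕ} {f : Cop → ℂ → ℂ} (hf : EisNice N f) {c : ℂ → ℂ}
    (hc : ContDiffOn ℝ ∞ c UHP) : EisNice N fun p z => c z * f p z := fun m a b hm => by
  obtain ⟨h1, h2⟩ := hf m a b hm
  simp only [mul_left_comm _ (c _)]
  refine ⟨fun z hz => (h1 z hz).mul_left _, (hc.mul h2).congr ?_⟩
  intro z _
  exact tsum_mul_left

lemma const_mul {N : ℕ} {f : Cop → ℂ → ℂ} (hf : EisNice N f) (c : ℂ) :
    EisNice N fun p z => c * f p z := hf.smul contDiffOn_const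

lemma mul_q {N : ℕ} {f : Cop → ℂ → ℂ} (hf : EisNice N f) :
    EisNice (N + 1) fun p z => qf p.1 z * f p z := fun m a b hm => by
  obtain ⟨h1, h2⟩ := hf m (a + 1) b (by omega)
  have : ∀ (p : Cop) z, eisMono m a b p.1 z * (qf p.1 z * f p z) =
      eisMono m (a + 1) b p.1 z * f p z := fun p z => by simp only [eisMono]; ring
  simpa only [this] using ⟨h1, h2⟩

lemma mul_conj_q {N : ℕ} {f : Cop → ℂ → ℂ} (hf : EisNice N f) :
    EisNice (N + 1) fun p z => starRingEnd ℂ (qf p.1 z) * f p z := fun m a b hm => by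
  obtain ⟨h1, h2⟩ := hf m a (b + 1) (by omega)
  have : ∀ (p : Cop) z, eisMono m a b p.1 z * (starRingEnd ℂ (qf p.1 z) * f p z) =
      eisMono m a (b + 1) p.1 z * f p z := fun p z => by simp only [eisMono]; ring
  simpa only [this] using ⟨h1, h2⟩

lemma mul_re_q {N : ℕ} {f : Cop → ℂ → ℂ} (hf : EisNice N f) :
    EisNice (N + 1) fun p z => (((qf p.1 z).re : ℝ) : ℂ) * f p z :=
  ((hf.mul_q.add hf.mul_conj_q).const_mul (1 / 2)).congr fun p z _ => by
    rw [Complex.re_eq_add_conj]; ring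

lemma mul_re_z_q {N : ℕ} {f : Cop → ℂ → ℂ} (hf : EisNice N f) :
    EisNice (N + 1) fun p z => (((z * qf p.1 z).re : ℝ) : ℂ) * f p z :=
  (((hf.mul_q.smul (c := fun z => z) contDiff_id.contDiffOn).add (hf.mul_conj_q.smul
    (c := fun z => starRingEnd ℂ z) Complex.conjCLE.contDiff.contDiffOn)).const_mul (1 / 2)).congr
    fun p z _ => by rw [Complex.re_eq_add_conj, map_mul]; ring

lemma mul_coord {N : ℕ} {f : Cop → ℂ → ℂ} (hf : EisNice N f) (i : Fin 3) :
    EisNice (N + 2) fun p z =>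
      ((coord (isoVec (z * qf p.1 z).re (qf p.1 z).re) i : ℝ) : ℂ) * f p z := by
  have h11 := hf.mul_re_z_q.mul_re_z_q
  have h12 := hf.mul_re_z_q.mul_re_q
  have h22 := hf.mul_re_q.mul_re_q
  fin_cases i
  · exact ((h11.add (h22.const_mul (-1))).const_mul (1 / (√2 : ℝ))).congr fun p z _ => by
      simp [coord_apply, isoVec]; ring
  · exact (h12.const_mul (-2 / (√2 : ℝ))).congr fun p z _ => by
      simp only [coord_apply, isoVec]; simp; ring
  · exact ((h11.add h22).const_mul (1 / (√2 : ℝ))).congr fun p z _ => by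
      simp [coord_apply, isoVec]; ring

lemma prod_coord {k : ℕ} {N : ℕ} {f : Cop → ℂ → ℂ} (hf : EisNice N f) (β : Fin k → Fin 3)
    (s : Finset (Fin k)) : EisNice (N + 2 * s.card) fun p z =>
      (∏ i ∈ s, ((coord (isoVec (z * qf p.1 z).re (qf p.1 z).re) (β i) : ℝ) : ℂ)) * f p z := by
  induction s using Finset.induction_on with
  | empty => simpa using hf
  | insert i s hi ih =>
    rw [Finset.card_insert_of_notMem hi]
    exact (ih.mul_coord (β i)).congr fun p z _ => by rw [Finset.prod_insert hi, mul_assoc]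

lemma re_q_sq_mul (v : ℂ) : EisNice 2 fun p z => (((qf p.1 z ^ 2 * v).re : ℝ) : ℂ) :=
  ((one.mul_q.mul_q.const_mul (v / 2)).add
    (one.mul_conj_q.mul_conj_q.const_mul (starRingEnd ℂ v / 2))).congr fun p z _ => by
    rw [Complex.re_eq_add_conj, map_mul, map_pow]; ring

end EisNice

lemma eisNice_eisE (k : ℕ) (v : ℂ) (β : Fin k → Fin 3) :
    EisNice (2 + 2 * k) fun p z => eisE k p.1 z v β := by
  have h := (EisNice.re_q_sq_mul v).prod_coord β Finset.univ
  rw [Finset.card_univ, Fintype.card_fin] at h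
  refine h.congr fun p z _ => ?_
  rw [eisE_apply, Pi.smul_apply, power, Complex.real_smul, mul_comm]

lemma norm_power_le (k : ℕ) (X : Matrix (Fin 2) (Fin 2) ℝ) : ‖power k X‖ ≤ ‖coord X‖ ^ k := by
  refine (pi_norm_le_iff_of_nonneg (by positivity)).2 fun β => ?_
  rw [power, norm_prod]
  refine (Finset.prod_le_prod (fun _ _ => norm_nonneg _) fun i _ => ?_).trans_eq
    (Finset.prod_const _ |>.trans (by rw [Finset.card_univ, Fintype.card_fin]))
  rw [Complex.norm_real]
  exact norm_le_pi_norm (coord X) (β i)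

lemma norm_coord_isoVec_le (w₁ w₂ : ℝ) : ‖coord (isoVec w₁ w₂)‖ ≤ 2 * (w₁ ^ 2 + w₂ ^ 2) := by
  have h2 : 1 ≤ √2 := Real.one_le_sqrt.2 (by norm_num)
  have key : ∀ t : ℝ, |t| ≤ 2 * (w₁ ^ 2 + w₂ ^ 2) → |t / √2| ≤ 2 * (w₁ ^ 2 + w₂ ^ 2) := by
    intro t ht
    rw [abs_div, abs_of_pos (by positivity : (0 : ℝ) < √2)]
    exact (div_le_self (abs_nonneg _) h2).trans ht
  refine (pi_norm_le_iff_of_nonneg (by positivity)).2 fun i => ?_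
  rw [coord_apply, Real.norm_eq_abs]
  fin_cases i <;> simp only [isoVec] <;> refine key _ ?_ <;> simp <;> rw [abs_le] <;>
    constructor <;> nlinarith [sq_nonneg (w₁ + w₂), sq_nonneg (w₁ - w₂), sq_nonneg w₁, sq_nonneg w₂]

lemma norm_eisE_le (k : ℕ) (p : Fin 2 → ℤ) (z : ℂ) :
    ‖eisE k p z‖ ≤ ‖qf p z‖ ^ 2 * (2 * ((‖z‖ ^ 2 + 1) * ‖qf p z‖ ^ 2)) ^ k := by
  refine ContinuousLinearMap.opNorm_le_bound _ (by positivity) fun v => ?_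
  rw [eisE_apply, norm_smul]
  have h1 : ‖(qf p z ^ 2 * v).re‖ ≤ ‖qf p z‖ ^ 2 * ‖v‖ := by
    rw [← norm_pow, ← norm_mul]; exact Complex.abs_re_le_norm _
  have h2 : ‖power k (isoVec (z * qf p z).re (qf p z).re)‖ ≤
      (2 * ((‖z‖ ^ 2 + 1) * ‖qf p z‖ ^ 2)) ^ k := by
    refine (norm_power_le _ _).trans (pow_le_pow_left₀ (norm_nonneg _)
      ((norm_coord_isoVec_le _ _).trans ?_) k)
    have h3 : (z * qf p z).re ^ 2 ≤ ‖z‖ ^ 2 * ‖qf p z‖ ^ 2 := by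
      rw [← mul_pow, ← norm_mul, ← sq_abs (z * qf p z).re]
      exact pow_le_pow_left₀ (abs_nonneg _) (Complex.abs_re_le_norm _) 2
    have h4 : (qf p z).re ^ 2 ≤ ‖qf p z‖ ^ 2 := by
      rw [← sq_abs (qf p z).re]
      exact pow_le_pow_left₀ (abs_nonneg _) (Complex.abs_re_le_norm _) 2
    nlinarith
  calc _ ≤ (‖qf p z‖ ^ 2 * ‖v‖) * (2 * ((‖z‖ ^ 2 + 1) * ‖qf p z‖ ^ 2)) ^ k := by gcongr
    _ = _ := by ring

/-- The Eisenstein series converges absolutely and locally uniformly. -/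
lemma exists_norm_eisE_le {k : ℕ} (hk : k ≠ 0) {a b : ℝ} (hb : 0 < b) :
    ∃ C, ∀ z ∈ stripNhd a b, ∀ p : Cop, ‖eisE k p.1 z‖ ≤ C * ‖p.1‖ ^ (-3 : ℝ) := by
  obtain ⟨C, hC, hbd⟩ := exists_norm_qf_le (a := a) hb
  refine ⟨C ^ 2 * (2 * (((2 * a) ^ 2 + 1) * C ^ 2)) ^ k, fun z hz p => ?_⟩
  have hp := ne_zero_of_coprime p.2
  obtain ⟨h1, -⟩ := hbd z hz p.1 hp
  have hp1 := one_le_norm_of_ne_zero hp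
  have hz' : ‖z‖ ≤ 2 * a := by
    have := Complex.norm_le_abs_re_add_abs_im z
    have h2 : |z.im| = z.im := abs_of_pos (stripNhd_subset hb hz)
    have h3 := hz.1
    have h4 := hz.2.2
    linarith
  obtain ⟨l, rfl⟩ : ∃ l, k = l + 1 := Nat.exists_eq_succ_of_ne_zero hk
  refine (norm_eisE_le _ _ _).trans ?_
  calc ‖qf p.1 z‖ ^ 2 * (2 * ((‖z‖ ^ 2 + 1) * ‖qf p.1 z‖ ^ 2)) ^ (l + 1)
      ≤ (C * ‖p.1‖⁻¹) ^ 2 * (2 * (((2 * a) ^ 2 + 1) * (C * ‖p.1‖⁻¹) ^ 2)) ^ (l + 1) := by gcongr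
    _ = C ^ 2 * (2 * (((2 * a) ^ 2 + 1) * C ^ 2)) ^ (l + 1) *
        (‖p.1‖⁻¹ ^ 3 * ‖p.1‖⁻¹ ^ (2 * l + 1)) := by
      rw [show 2 * (((2 * a) ^ 2 + 1) * (C * ‖p.1‖⁻¹) ^ 2) =
        (2 * (((2 * a) ^ 2 + 1) * C ^ 2)) * ‖p.1‖⁻¹ ^ 2 by ring, mul_pow _ (‖p.1‖⁻¹ ^ 2), ← pow_mul]
      ring
    _ ≤ C ^ 2 * (2 * (((2 * a) ^ 2 + 1) * C ^ 2)) ^ (l + 1) * (‖p.1‖⁻¹ ^ 3 * 1) := by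
      gcongr
      exact pow_le_one₀ (by positivity) (inv_le_one_of_one_le₀ hp1)
    _ = _ := by
      rw [mul_one, Real.rpow_neg (by positivity)]
      norm_num

lemma summable_norm_eisE {k : ℕ} (hk : k ≠ 0) {z : ℂ} (hz : z ∈ UHP) :
    Summable fun p : Cop => ‖eisE k p.1 z‖ := by
  have hb : 0 < z.im / 2 := by have : 0 < z.im := hz; linarith
  obtain ⟨C, hC⟩ := exists_norm_eisE_le hk (a := |z.re| + z.im + 1) hb
  exact Summable.of_nonneg_of_le (fun _ => norm_nonneg _) (fun p => hC z (mem_stripNhd hz) p)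
    ((summable_cop (by norm_num)).mul_left C)

lemma summable_eisTerm {k : ℕ} (hk : k ≠ 0) {z : ℂ} (hz : z ∈ UHP) :
    Summable fun q => eisTerm k q z := by
  simp only [eisTerm_eq k _ hz]
  exact (summable_norm_eisE hk hz).of_norm.comp_injective cosetEquiv.injective

lemma eisForm_eq (k : ℕ) {z : ℂ} (hz : z ∈ UHP) :
    eisForm k z = (1 / 2 : ℂ) • ∑' p : Cop, eisE k p.1 z := by
  rw [eisForm]
  simp only [eisTerm_eq k _ hz]
  rw [cosetEquiv.tsum_eq fun p : Cop => eisE k p.1 z]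

lemma tsum_eisE_apply {k : ℕ} (hk : k ≠ 0) {z : ℂ} (hz : z ∈ UHP) (v : ℂ) :
    (∑' p : Cop, eisE k p.1 z) v = ∑' p : Cop, eisE k p.1 z v :=
  (ContinuousLinearMap.apply ℝ (Tens k) v).map_tsum (summable_norm_eisE hk hz).of_norm

lemma contDiffOn_tsum_eisE {k : ℕ} (hk : k ≠ 0) :
    ContDiffOn ℝ ∞ (fun z => ∑' p : Cop, eisE k p.1 z) UHP := by
  rw [contDiffOn_clm_apply]
  intro v
  have h : ContDiffOn ℝ ∞ (fun z => ∑' p : Cop, eisE k p.1 z v) UHP := by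
    rw [contDiffOn_pi]
    intro β
    have h2 := (eisNice_eisE k v β 0 0 0 (by omega)).2
    refine h2.congr fun z hz => ?_
    have hs : Summable fun p : Cop => eisE k p.1 z v :=
      ((summable_norm_eisE hk hz).of_norm).mapL (ContinuousLinearMap.apply ℝ (Tens k) v)
    rw [tsum_apply hs]
    simp [eisMono]
  exact h.congr fun z hz => tsum_eisE_apply hk hz v

lemma contDiff_eisBase (k : ℕ) : ContDiff ℝ ∞ (eisBase k) := by
  rw [contDiff_clm_apply_iff]
  intro v
  exact contDiff_const.smul ((contDiff_act_n k (power k u')).comp Complex.reCLM.contDiff)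

lemma isClosed1_eisBase (k : ℕ) : IsClosed1 (eisBase k) := by
  refine isClosed1_of_primitive ((contDiff_eisBase k).differentiable (by simp)).differentiableOn
    fun z _ => ⟨fun y => ∫ s in (0 : ℝ)..y.re, act k (n s) (power k u'),
      Filter.Eventually.of_forall fun y => ?_⟩
  have hc : Continuous fun s => act k (n s) (power k u') := (contDiff_act_n k _).continuous
  have h := (hc.integral_hasStrictDerivAt 0 y.re).hasDerivAt.hasFDerivAt.comp y
    Complex.reCLM.hasFDerivAt
  refine h.congr_fderiv (ContinuousLinearMap.ext fun v => ?_)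
  simp [eisBase]

/-- The row vector `p` times `γ`. -/
def copMul (γ : SL(2, ℤ)) : Cop ≃ Cop where
  toFun p := ⟨Matrix.vecMul p.1 (γ : Matrix (Fin 2) (Fin 2) ℤ), IsCoprime.vecMulSL p.2 γ⟩
  invFun p := ⟨Matrix.vecMul p.1 ((γ⁻¹ : SL(2, ℤ)) : Matrix (Fin 2) (Fin 2) ℤ), IsCoprime.vecMulSL p.2 γ⁻¹⟩
  left_inv p := Subtype.ext (by
    simp only [Matrix.vecMul_vecMul, ← Matrix.SpecialLinearGroup.coe_mul, mul_inv_cancel,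
      Matrix.SpecialLinearGroup.coe_one, Matrix.vecMul_one])
  right_inv p := Subtype.ext (by
    simp only [Matrix.vecMul_vecMul, ← Matrix.SpecialLinearGroup.coe_mul, inv_mul_cancel,
      Matrix.SpecialLinearGroup.coe_one, Matrix.vecMul_one])

lemma row_mul (γ δ : SL(2, ℤ)) : row (γ * δ) = Matrix.vecMul (row γ) (δ : Matrix (Fin 2) (Fin 2) ℤ) := by
  funext j
  simp [row, Matrix.SpecialLinearGroup.coe_mul, Matrix.mul_apply, Matrix.vecMul, dotProduct]

lemma pull1_eisE (k : ℕ) (γ : SL(2, ℤ)) (p : Cop) {z : ℂ} (hz : z ∈ UHP) :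
    pull1 γ (eisE k p.1) z = eisE k (copMul γ p).1 z := by
  obtain ⟨δ, hδ⟩ := row_surj p
  have h1 : (copMul γ p).1 = row (δ * γ) := by rw [row_mul, hδ]; rfl
  rw [h1, ← pull1_eisBase k _ hz, pull1_mul _ _ _ hz, pull1, pull1,
    pull1_eisBase k _ (moebius_mem γ hz), hδ]

/-- `γ^*` as a continuous linear map on the values of a form. -/
def pullL (k : ℕ) (γ : SL(2, ℤ)) (z : ℂ) : (ℂ →L[ℝ] Tens k) →L[ℝ] (ℂ →L[ℝ] Tens k) :=
  (ContinuousLinearMap.compL ℝ ℂ (Tens k) (Tens k) ((act k (toR γ⁻¹)).restrictScalars ℝ)).comp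
    ((ContinuousLinearMap.compL ℝ ℂ ℂ (Tens k)).flip (fderiv ℝ (moebius γ) z))

lemma pull1_eq_pullL {k : ℕ} (γ : SL(2, ℤ)) (ξ : Form1 k) (z : ℂ) :
    pull1 γ ξ z = pullL k γ z (ξ (moebius γ z)) := rfl

lemma pull1_const_smul {k : ℕ} (γ : SL(2, ℤ)) (c : ℂ) (ξ : Form1 k) {z : ℂ} (hz : z ∈ UHP) :
    pull1 γ (fun z => c • ξ z) z = c • pull1 γ ξ z := by
  refine ContinuousLinearMap.ext fun v => ?_
  rw [smul_apply, pull1_apply _ _ hz, pull1_apply _ _ hz,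
    smul_apply, map_smul]

lemma pull1_congr {k : ℕ} (γ : SL(2, ℤ)) {ξ η : Form1 k} {z : ℂ}
    (h : ξ (moebius γ z) = η (moebius γ z)) : pull1 γ ξ z = pull1 γ η z := by
  rw [pull1, pull1, h]

lemma isForm1_eisForm {k : ℕ} (hk : k ≠ 0) : IsForm1 (eisForm k) where
  mem z hz w := by
    rw [eisForm_eq k hz, smul_apply, tsum_eisE_apply hk hz]
    refine Submodule.smul_mem _ _ ?_
    have hs : Summable fun p : Cop => eisE k p.1 z w :=
      ((summable_norm_eisE hk hz).of_norm).mapL (ContinuousLinearMap.apply ℝ (Tens k) w)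
    refine (harm_isClosed k).mem_of_tendsto hs.hasSum (Filter.Eventually.of_forall fun s =>
      Submodule.sum_mem _ fun p _ => ?_)
    rw [eisE_apply]
    exact (harm k).smul_of_tower_mem _ (power_isoVec_mem_harm _ _ _)
  smooth := ((contDiffOn_tsum_eisE hk).const_smul (1 / 2 : ℂ)).congr fun z hz => eisForm_eq k hz
  inv γ z hz := by
    rw [eisForm_eq k hz, pull1_congr (η := fun z => (1 / 2 : ℂ) • ∑' p : Cop, eisE k p.1 z) γ
      (eisForm_eq k (moebius_mem γ hz)), pull1_const_smul _ _ _ hz, pull1_eq_pullL,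
      (pullL k γ z).map_tsum (summable_norm_eisE hk (moebius_mem γ hz)).of_norm,
      ← (copMul γ).tsum_eq fun p : Cop => eisE k p.1 z]
    congr 1
    refine tsum_congr fun p => ?_
    rw [← pull1_eisE k γ p hz, pull1_eq_pullL]

lemma isClosed1_eisForm {k : ℕ} (hk : k ≠ 0) : IsClosed1 (eisForm k) := by
  have hdiff := (contDiffOn_tsum_eisE hk).differentiableOn (by simp)
  have hp : ∀ p : Cop, ∃ γ : SL(2, ℤ), ∀ z ∈ UHP, eisE k p.1 z = pull1 γ (eisBase k) z := fun p => by
    obtain ⟨γ, hγ⟩ := row_surj p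
    exact ⟨γ, fun z hz => by rw [pull1_eisBase k γ hz, hγ]⟩
  have hd : ∀ p : Cop, DifferentiableOn ℝ (eisE k p.1) UHP := fun p => by
    obtain ⟨γ, hγ⟩ := hp p
    exact ((contDiffOn_pull1 γ (contDiff_eisBase k).contDiffOn).differentiableOn
      (by simp)).congr hγ
  have hc : ∀ p : Cop, IsClosed1 (eisE k p.1) := fun p z hz v w => by
    obtain ⟨γ, hγ⟩ := hp p
    have : fderiv ℝ (eisE k p.1) z = fderiv ℝ (pull1 γ (eisBase k)) z :=
      Filter.EventuallyEq.fderiv_eq (by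
        filter_upwards [isOpen_UHP.mem_nhds hz] with y hy using hγ y hy)
    rw [this]
    exact (isClosed1_eisBase k).pull1 γ (contDiff_eisBase k).contDiffOn z hz v w
  have h := isClosed1_tsum hc hd (fun z hz => by
    have hb : 0 < z.im / 2 := by have : 0 < z.im := hz; linarith
    obtain ⟨C, hC⟩ := exists_norm_eisE_le hk (a := |z.re| + z.im + 1) hb
    exact ⟨_, isOpen_stripNhd _ _, (convex_stripNhd _ _).isPreconnected, mem_stripNhd hz,
      stripNhd_subset hb, _, (summable_cop (by norm_num)).mul_left C, fun p y hy => hC y hy p⟩) hdiff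
  intro z hz v w
  have he : eisForm k =ᶠ[nhds z] fun z => (1 / 2 : ℂ) • ∑' p : Cop, eisE k p.1 z := by
    filter_upwards [isOpen_UHP.mem_nhds hz] with y hy using eisForm_eq k hy
  have hda := hdiff.differentiableAt (isOpen_UHP.mem_nhds hz)
  rw [he.fderiv_eq, fderiv_fun_const_smul hda]
  simp only [smul_apply]
  rw [h z hz v w]

/-! ### Hermite polynomials and the Schwartz functions -/

/-- The polynomials `H̃_j`, defined by the recursion that comes from the Howe operator. -/
def hp : ℕ → Polynomial ℝ
  | 0 => 1
  | j + 1 => Polynomial.C 2 * Polynomial.X * hp j -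
      Polynomial.C (1 / (2 * Real.pi)) * Polynomial.derivative (hp j)

lemma hp_succ (j : ℕ) : hp (j + 1) = Polynomial.C 2 * Polynomial.X * hp j -
      Polynomial.C (1 / (2 * Real.pi)) * Polynomial.derivative (hp j) := rfl

lemma derivative_hp (j : ℕ) :
    Polynomial.derivative (hp (j + 1)) = Polynomial.C (2 * (j + 1 : ℝ)) * hp j := by
  induction j with
  | zero => simp [hp]
  | succ j ih =>
    have h : Polynomial.C (2 * ((j : ℝ) + 1)) * Polynomial.C (1 / (2 * Real.pi)) =
        (Polynomial.C (1 / (2 * Real.pi)) * Polynomial.C (2 * ((j : ℝ) + 1))) := mul_comm _ _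
    have h2 := hp_succ j
    rw [hp_succ (j + 1)]
    simp only [Polynomial.derivative_sub, Polynomial.derivative_mul, Polynomial.derivative_C,
      Polynomial.derivative_X, zero_mul, zero_add, mul_one, ih]
    rw [show Polynomial.C (2 * (((j + 1 : ℕ) : ℝ) + 1)) =
      Polynomial.C 2 + Polynomial.C (2 * ((j : ℝ) + 1)) by rw [← Polynomial.C_add]; push_cast; ring_nf]
    rw [add_mul]
    linear_combination (-Polynomial.C (2 * ((j : ℝ) + 1))) * h2

lemma derivative_hp' (j : ℕ) :
    Polynomial.derivative (hp j) = Polynomial.C (2 * (j : ℝ)) * hp (j - 1) := by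
  cases j with
  | zero => simp [hp]
  | succ j => rw [derivative_hp]; simp

lemma hermiteT_eq (j : ℕ) (w : ℝ) : hermiteT j w = (hp j).eval w := by
  have hpi : 0 < 2 * Real.pi := by positivity
  set s := √(2 * Real.pi) with hs
  have hs0 : 0 < s := Real.sqrt_pos.2 hpi
  have hss : s * s = 2 * Real.pi := Real.mul_self_sqrt hpi.le
  have key : ∀ j (t : ℝ), iteratedDeriv j (fun s : ℝ => Real.exp (-s ^ 2)) t =
      (-1) ^ j * s ^ j * (hp j).eval (t / s) * Real.exp (-t ^ 2) := by
    intro j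
    induction j with
    | zero => intro t; simp [hp]
    | succ j ih =>
      intro t
      rw [iteratedDeriv_succ, funext ih]
      have hds : HasDerivAt (fun t : ℝ => t / s) (1 / s) t := (hasDerivAt_id' t).div_const s
      have h1 : HasDerivAt (fun t : ℝ => (hp j).eval (t / s))
          ((Polynomial.derivative (hp j)).eval (t / s) * (1 / s)) t :=
        HasDerivAt.comp (h₂ := fun t => (hp j).eval t) t ((hp j).hasDerivAt (t / s)) hds
      have h2 : HasDerivAt (fun t : ℝ => Real.exp (-t ^ 2)) (Real.exp (-t ^ 2) * -(2 * t)) t := by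
        simpa using ((hasDerivAt_id t).fun_pow 2).fun_neg.exp
      rw [((h1.const_mul ((-1) ^ j * s ^ j)).fun_mul h2).deriv, hp_succ]
      simp only [Polynomial.eval_sub, Polynomial.eval_mul, Polynomial.eval_C, Polynomial.eval_X]
      rw [← hss]
      field_simp
      ring
  rw [hermiteT, hermiteH, key, ← hs, mul_div_cancel_left₀ _ hs0.ne']
  have h1 : Real.exp ((s * w) ^ 2) * Real.exp (-(s * w) ^ 2) = 1 := by
    rw [← Real.exp_add]; simp
  have h2 : (2 * Real.pi) ^ (-(j : ℝ) / 2) * s ^ j = 1 := by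
    rw [hs, Real.sqrt_eq_rpow, ← Real.rpow_natCast, ← Real.rpow_mul hpi.le, ← Real.rpow_add hpi]
    rw [show -(j : ℝ) / 2 + 1 / 2 * j = 0 by ring, Real.rpow_zero]
  have h3 : ((-1 : ℝ)) ^ j * (-1) ^ j = 1 := by rw [← mul_pow]; norm_num
  calc _ = ((2 * Real.pi) ^ (-(j : ℝ) / 2) * s ^ j) * (((-1 : ℝ)) ^ j * (-1) ^ j) *
        (Real.exp ((s * w) ^ 2) * Real.exp (-(s * w) ^ 2)) * (hp j).eval w := by ring
    _ = _ := by rw [h1, h2, h3]; ring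

lemma hasFDerivAt_eval_proj (P : Polynomial ℝ) (i : Fin 3) (x : Fin 3 → ℝ) :
    HasFDerivAt (fun x : Fin 3 → ℝ => P.eval (x i))
      ((Polynomial.derivative P).eval (x i) • ContinuousLinearMap.proj (R := ℝ) (φ := fun _ => ℝ) i)
      x := by
  have h : HasFDerivAt (fun x : Fin 3 → ℝ => x i)
    (ContinuousLinearMap.proj (R := ℝ) (φ := fun _ => ℝ) i) x :=
    (ContinuousLinearMap.proj (R := ℝ) (φ := fun _ => ℝ) i).hasFDerivAt
  exact (P.hasDerivAt (x i)).comp_hasFDerivAt x h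

lemma hasFDerivAt_gauss (x : Fin 3 → ℝ) :
    HasFDerivAt gauss (∑ i, (-(2 * Real.pi * x i) * gauss x) •
      ContinuousLinearMap.proj (R := ℝ) (φ := fun _ => ℝ) i) x := by
  have h : ∀ i : Fin 3, HasFDerivAt (fun x : Fin 3 → ℝ => x i)
    (ContinuousLinearMap.proj (R := ℝ) (φ := fun _ => ℝ) i) x := fun i =>
    (ContinuousLinearMap.proj (R := ℝ) (φ := fun _ => ℝ) i).hasFDerivAt
  have h1 := (((((h 0).pow 2).fun_add ((h 1).pow 2)).fun_add ((h 2).pow 2)).const_mul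
    (-Real.pi)).exp
  refine h1.congr_fderiv (ContinuousLinearMap.ext fun v => ?_)
  simp [gauss, Fin.sum_univ_three]
  ring

/-- The products of polynomials in the first two coordinates with the Gaussian. -/
def polyGauss (P Q : Polynomial ℝ) (x : Fin 3 → ℝ) : ℝ :=
  P.eval (x 0) * Q.eval (x 1) * gauss x

lemma hasFDerivAt_polyGauss (P Q : Polynomial ℝ) (x : Fin 3 → ℝ) :
    HasFDerivAt (polyGauss P Q)
      ((P.eval (x 0) * Q.eval (x 1)) • (∑ i, (-(2 * Real.pi * x i) * gauss x) •
          ContinuousLinearMap.proj (R := ℝ) (φ := fun _ => ℝ) i) +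
        gauss x • (P.eval (x 0) • (Polynomial.derivative Q).eval (x 1) •
            ContinuousLinearMap.proj (R := ℝ) (φ := fun _ => ℝ) 1 +
          Q.eval (x 1) • (Polynomial.derivative P).eval (x 0) •
            ContinuousLinearMap.proj (R := ℝ) (φ := fun _ => ℝ) 0)) x :=
  ((hasFDerivAt_eval_proj P 0 x).fun_mul (hasFDerivAt_eval_proj Q 1 x)).fun_mul (hasFDerivAt_gauss x)

lemma howe_polyGauss_zero (j : ℕ) (Q : Polynomial ℝ) :
    howe 0 (polyGauss (hp j) Q) = polyGauss (hp (j + 1)) Q := by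
  funext x
  have hpi := Real.pi_ne_zero
  rw [howe, (hasFDerivAt_polyGauss _ _ x).fderiv]
  simp [polyGauss, hp_succ, Fin.sum_univ_three]
  field_simp
  ring

lemma howe_polyGauss_one (j : ℕ) (P : Polynomial ℝ) :
    howe 1 (polyGauss P (hp j)) = polyGauss P (hp (j + 1)) := by
  funext x
  have hpi := Real.pi_ne_zero
  rw [howe, (hasFDerivAt_polyGauss _ _ x).fderiv]
  simp [polyGauss, hp_succ, Fin.sum_univ_three]
  field_simp
  ring

/-- The number of indices `i` with `β i = j`. -/
def cnt {n : ℕ} (j : Fin 2) (β : Fin n → Fin 2) : ℕ := ∑ i, if β i = j then 1 else 0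

lemma foldr_howe {m : ℕ} (β : Fin m → Fin 2) :
    (List.ofFn fun i => (β i).castSucc).foldr howe gauss =
      polyGauss (hp (cnt 0 β)) (hp (cnt 1 β)) := by
  induction m with
  | zero => funext x; simp [cnt, polyGauss, hp]
  | succ m ih =>
    rw [List.ofFn_succ, List.foldr_cons, ih]
    simp only [cnt, Fin.sum_univ_succ]
    generalize β 0 = a
    fin_cases a
    · simp only [Fin.zero_eta, Fin.castSucc_zero, howe_polyGauss_zero]
      simp [add_comm]
    · simp only [Fin.mk_one, Fin.castSucc_one, howe_polyGauss_one]
      simp [add_comm]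

lemma schwartz_eq {k : ℕ} (α : Fin 2) (β : Fin k → Fin 2) : schwartz α β =
    polyGauss (hp ((if α = 0 then 1 else 0) + cnt 0 β)) (hp ((if α = 1 then 1 else 0) + cnt 1 β)) := by
  rw [schwartz, foldr_howe]
  fin_cases α
  · simp only [Fin.zero_eta, Fin.castSucc_zero, howe_polyGauss_zero]
    simp [add_comm]
  · simp only [Fin.mk_one, Fin.castSucc_one, howe_polyGauss_one]
    simp [add_comm]

/-! ### Covariance under rotations -/

/-- A rotation of the first two coordinates, as a matrix. -/
structure IsRot (A : Matrix (Fin 3) (Fin 3) ℝ) : Prop where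
  mul_transpose : A * A.transpose = 1
  left : ∀ a : Fin 2, A a.castSucc 2 = 0
  right : ∀ a : Fin 2, A 2 a.castSucc = 0
  last : A 2 2 = 1

lemma gauss_mulVec {A : Matrix (Fin 3) (Fin 3) ℝ} (hA : IsRot A) (x : Fin 3 → ℝ) :
    gauss (A.mulVec x) = gauss x := by
  have h1 : A.transpose * A = 1 := mul_eq_one_comm.1 hA.mul_transpose
  have h2 : A.mulVec x ⬝ᵥ A.mulVec x = x ⬝ᵥ x := by
    rw [Matrix.dotProduct_mulVec, ← Matrix.mulVec_transpose, Matrix.mulVec_mulVec, h1,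
      Matrix.one_mulVec]
  simp only [dotProduct, Fin.sum_univ_three] at h2
  simp only [gauss]
  congr 2
  linear_combination h2

/-- Rotations permute the Howe operators. -/
lemma howe_mulVec {A : Matrix (Fin 3) (Fin 3) ℝ} (hA : IsRot A) {f : (Fin 3 → ℝ) → ℝ}
    (hf : Differentiable ℝ f) (a : Fin 2) (x : Fin 3 → ℝ) :
    howe a.castSucc f (A.mulVec x) =
      ∑ b : Fin 2, A a.castSucc b.castSucc * howe b.castSucc (fun y => f (A.mulVec y)) x := by
  have h1 : ∀ b : Fin 3, fderiv ℝ (fun y => f (A.mulVec y)) x (Pi.single b 1) =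
      fderiv ℝ f (A.mulVec x) (A.mulVec (Pi.single b 1)) := by
    intro b
    have h := (hf (A.mulVec x)).hasFDerivAt.comp x
      (A.mulVecLin.toContinuousLinearMap.hasFDerivAt (x := x))
    rw [HasFDerivAt.fderiv (f := fun y => f (A.mulVec y)) h]
    rfl
  have h2 : ∑ b : Fin 3, A a.castSucc b * fderiv ℝ (fun y => f (A.mulVec y)) x (Pi.single b 1) =
      fderiv ℝ f (A.mulVec x) (Pi.single a.castSucc 1) := by
    simp only [h1]
    simp only [← smul_eq_mul, ← map_smul]
    rw [← map_sum]
    congr 1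
    simp only [← Matrix.mulVec_smul]
    rw [← Matrix.mulVec_sum]
    have h3 : ∑ b : Fin 3, A a.castSucc b • (Pi.single b 1 : Fin 3 → ℝ) =
        A.transpose.mulVec (Pi.single a.castSucc 1) := by
      funext c
      simp [Finset.sum_apply, Pi.single_apply, Matrix.mulVec, dotProduct]
    rw [h3, Matrix.mulVec_mulVec, hA.mul_transpose, Matrix.one_mulVec]
  have h4 : (A.mulVec x) a.castSucc = ∑ b : Fin 2, A a.castSucc b.castSucc * x b.castSucc := by
    rw [Matrix.mulVec, dotProduct, Fin.sum_univ_castSucc]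
    rw [show A a.castSucc (Fin.last 2) = 0 from hA.left a]
    simp
  rw [Fin.sum_univ_castSucc, show A a.castSucc (Fin.last 2) = 0 from hA.left a] at h2
  simp only [howe]
  rw [← h2, h4, zero_mul, add_zero, Finset.sum_mul, Finset.mul_sum, ← Finset.sum_sub_distrib]
  refine Finset.sum_congr rfl fun b _ => ?_
  ring

lemma howe_sum {ι : Type*} (s : Finset ι) (b : Fin 3) (c : ι → ℝ) (f : ι → (Fin 3 → ℝ) → ℝ)
    (hf : ∀ i, Differentiable ℝ (f i)) (x : Fin 3 → ℝ) :
    howe b (fun y => ∑ i ∈ s, c i * f i y) x = ∑ i ∈ s, c i * howe b (f i) x := by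
  simp only [howe]
  rw [fderiv_fun_sum fun i _ => ((hf i).const_mul (c i)).differentiableAt]
  simp only [fderiv_const_mul (hf _).differentiableAt, sum_apply,
    smul_apply, smul_eq_mul]
  rw [Finset.mul_sum, Finset.mul_sum, ← Finset.sum_sub_distrib]
  exact Finset.sum_congr rfl fun i _ => by ring

lemma differentiable_foldr_howe {m : ℕ} (β : Fin m → Fin 2) :
    Differentiable ℝ ((List.ofFn fun i => (β i).castSucc).foldr howe gauss) := by
  rw [foldr_howe]
  exact fun x => (hasFDerivAt_polyGauss _ _ x).differentiableAt

lemma foldr_howe_mulVec {A : Matrix (Fin 3) (Fin 3) ℝ} (hA : IsRot A) {m : ℕ} (β : Fin m → Fin 2)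
    (x : Fin 3 → ℝ) : (List.ofFn fun i => (β i).castSucc).foldr howe gauss (A.mulVec x) =
      ∑ β' : Fin m → Fin 2, (∏ i, A (β i).castSucc (β' i).castSucc) *
        (List.ofFn fun i => (β' i).castSucc).foldr howe gauss x := by
  induction m generalizing x with
  | zero => simp [gauss_mulVec hA]
  | succ m ih =>
    rw [List.ofFn_succ, List.foldr_cons, howe_mulVec hA (differentiable_foldr_howe _),
      funext (ih fun i => β i.succ)]
    simp only [howe_sum _ _ _ _ fun β' => differentiable_foldr_howe (β' : Fin m → Fin 2)]
    rw [← (Fin.consEquiv fun _ : Fin (m + 1) => Fin 2).sum_comp, Fintype.sum_prod_type]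
    refine Finset.sum_congr rfl fun b _ => ?_
    rw [Finset.mul_sum]
    refine Finset.sum_congr rfl fun β' _ => ?_
    simp [Fin.consEquiv, Fin.prod_univ_succ, List.ofFn_succ, mul_assoc]

lemma schwartz_mulVec {A : Matrix (Fin 3) (Fin 3) ℝ} (hA : IsRot A) {k : ℕ} (α : Fin 2)
    (β : Fin k → Fin 2) (x : Fin 3 → ℝ) : schwartz α β (A.mulVec x) =
      ∑ α' : Fin 2, ∑ β' : Fin k → Fin 2, A α.castSucc α'.castSucc *
        ((∏ i, A (β i).castSucc (β' i).castSucc) * schwartz α' β' x) := by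
  rw [schwartz, howe_mulVec hA (differentiable_foldr_howe _), funext (foldr_howe_mulVec hA β)]
  simp only [howe_sum _ _ _ _ fun β' => differentiable_foldr_howe (β' : Fin k → Fin 2)]
  simp only [Finset.mul_sum]
  rfl

/-- The basis tensor of a multi-index in `{1, 2}`. -/
def basisT {k : ℕ} (β : Fin k → Fin 2) : Tens k := Pi.single (fun i => (β i).castSucc) 1

lemma act_basisT {k : ℕ} {κ : Matrix (Fin 2) (Fin 2) ℝ} (hA : IsRot (Ad κ)) (β' : Fin k → Fin 2) :
    act k κ (basisT β') = ∑ β : Fin k → Fin 2,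
      ((∏ i, Ad κ (β i).castSucc (β' i).castSucc : ℝ) : ℂ) • basisT β := by
  funext δ
  rw [act_apply, Finset.sum_apply, Finset.sum_eq_single fun i => (β' i).castSucc]
  · by_cases hδ : ∃ β : Fin k → Fin 2, δ = fun i => (β i).castSucc
    · obtain ⟨β, rfl⟩ := hδ
      rw [Finset.sum_eq_single β]
      · simp [basisT]
      · intro b _ hb
        have : (fun i => (β i).castSucc) ≠ fun i => (b i).castSucc := fun h =>
          hb (funext fun i => (Fin.castSucc_injective _ (congrFun h i)).symm)
        simp [basisT, this]
      · simp
    · have h0 : ∃ i, δ i = 2 := by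
        by_contra! h
        refine hδ ⟨fun i => (δ i).castPred (h i), ?_⟩
        funext i; simp
      obtain ⟨i, hi⟩ := h0
      rw [Finset.prod_eq_zero (Finset.mem_univ i) (by rw [hi, hA.right]; simp), zero_mul]
      refine (Finset.sum_eq_zero fun β _ => ?_).symm
      have : δ ≠ fun i => (β i).castSucc := fun h => hδ ⟨β, h⟩
      simp [basisT, this]
  · intro b _ hb
    rw [basisT, Pi.single_eq_of_ne hb, mul_zero]
  · simp

/-! ### Equivariance of the Schwartz form -/

lemma phiV_apply (k : ℕ) (X : Matrix (Fin 2) (Fin 2) ℝ) (z v : ℂ) : phiV k X z v =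
    ((1 / (2 : ℝ) ^ ((k : ℝ) + 1 / 2) : ℝ) : ℂ) • ∑ α : Fin 2, ∑ β : Fin k → Fin 2,
      (schwartz α β (coord ((gMat z)⁻¹ * X * gMat z)) * coframe z α v) •
        act k (gMat z) (harmProj k (basisT β)) := by
  simp [phiV, basisT, smul_smul]

/-- The rotation that compares the frames at `z` and at `γ z`. -/
def rotM (γ : SL(2, ℤ)) (z : ℂ) : Matrix (Fin 2) (Fin 2) ℝ :=
  (gMat (moebius γ z))⁻¹ * toR γ * gMat z

/-- `rotM γ z` is the rotation by the argument of `c z + d`, and the coframe rotates by twice this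
angle. -/
lemma rotM_eq (γ : SL(2, ℤ)) {z : ℂ} (hz : z ∈ UHP) : ∃ C S : ℝ, C ^ 2 + S ^ 2 = 1 ∧
    rotM γ z = !![C, -S; S, C] ∧ ∀ v, (coframe (moebius γ z) 0 (v / ((γ 1 0 : ℂ) * z + γ 1 1) ^ 2) =
      (C ^ 2 - S ^ 2) * coframe z 0 v + 2 * C * S * coframe z 1 v) ∧
      coframe (moebius γ z) 1 (v / ((γ 1 0 : ℂ) * z + γ 1 1) ^ 2) =
      -(2 * C * S) * coframe z 0 v + (C ^ 2 - S ^ 2) * coframe z 1 v := by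
  have hy : 0 < z.im := hz
  set j : ℂ := (γ 1 0 : ℂ) * z + γ 1 1 with hj
  have hj0 : j ≠ 0 := row_denom_ne_zero γ hz
  have hre : j.re = γ 1 0 * z.re + γ 1 1 := by simp [hj]
  have him : j.im = γ 1 0 * z.im := by simp [hj]
  have hr0 : 0 < ‖j‖ := norm_pos_iff.2 hj0
  have hN : j.re ^ 2 + j.im ^ 2 = ‖j‖ ^ 2 := by
    rw [← Complex.normSq_eq_norm_sq, Complex.normSq_apply]; ring
  have hyi : (moebius γ z).im = z.im / ‖j‖ ^ 2 := im_moebius γ hz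
  have hy' : 0 < (moebius γ z).im := moebius_mem γ hz
  have hsq : √(moebius γ z).im = √z.im / ‖j‖ := by
    rw [hyi, Real.sqrt_div hy.le, Real.sqrt_sq hr0.le]
  have hd : ((γ 0 0 : ℝ) * γ 1 1 - γ 0 1 * γ 1 0) = 1 := by exact_mod_cast det_eq γ
  have hxr : (moebius γ z).re * ‖j‖ ^ 2 = (γ 0 0 * z.re + γ 0 1) * j.re + γ 0 0 * z.im * j.im := by
    have h : moebius γ z * j = (γ 0 0 : ℂ) * z + γ 0 1 := by
      rw [moebius, ← hj]; field_simp
    have h1 := congrArg Complex.re h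
    have h2 := congrArg Complex.im h
    simp at h1 h2
    rw [← hN]
    linear_combination j.re * h1 + j.im * h2
  have hs0 : 0 < √z.im := Real.sqrt_pos.2 hy
  have hss : √z.im * √z.im = z.im := Real.mul_self_sqrt hy.le
  refine ⟨j.re / ‖j‖, j.im / ‖j‖, by rw [div_pow, div_pow, ← add_div, hN]; field_simp, ?_, ?_⟩
  · rw [rotM, mul_assoc, inv_of_det_one (det_gMat hy')]
    have hg : gMat z = !![√z.im, z.re / √z.im; 0, 1 / √z.im] := rfl
    have hg' : gMat (moebius γ z) = !![√z.im / ‖j‖, (moebius γ z).re / (√z.im / ‖j‖); 0,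
      1 / (√z.im / ‖j‖)] := by rw [← hsq]; rfl
    have hx : (moebius γ z).re =
        ((γ 0 0 * z.re + γ 0 1) * j.re + γ 0 0 * z.im * j.im) / ‖j‖ ^ 2 := by
      rw [← hxr]; field_simp
    rw [hg, hg', hx]
    ext a b
    fin_cases a <;> fin_cases b <;>
      simp [Matrix.mul_apply, Fin.sum_univ_two, toR] <;> field_simp
    · rw [← hN, him, hre]
      linear_combination (z.re * γ 1 0 + γ 1 1) * hd
    · rw [Real.sq_sqrt hy.le, ← hN, him, hre]
      linear_combination (-(γ 1 0 : ℝ) * z.im ^ 2) * hd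
    · rw [Real.sq_sqrt hy.le, him]; ring
    · exact hre.symm
  · intro v
    have hvj : v / j ^ 2 * ((‖j‖ ^ 4 : ℝ) : ℂ) = v * (starRingEnd ℂ j) ^ 2 := by
      have : ((‖j‖ ^ 4 : ℝ) : ℂ) = (j * starRingEnd ℂ j) ^ 2 := by
        rw [Complex.mul_conj, Complex.normSq_eq_norm_sq]; push_cast; ring
      rw [this]; field_simp
    have h1 := congrArg Complex.re hvj
    have h2 := congrArg Complex.im hvj
    rw [Complex.re_mul_ofReal] at h1
    rw [Complex.im_mul_ofReal] at h2
    simp [pow_two] at h1 h2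
    have e1 : (v / j ^ 2).re = (v.re * (j.re * j.re - j.im * j.im) +
      2 * v.im * (j.re * j.im)) / ‖j‖ ^ 4 := by
      rw [eq_div_iff (by positivity), pow_two]; linear_combination h1
    have e2 : (v / j ^ 2).im = (v.im * (j.re * j.re - j.im * j.im) -
      2 * v.re * (j.re * j.im)) / ‖j‖ ^ 4 := by
      rw [eq_div_iff (by positivity), pow_two]; linear_combination h2
    constructor <;> simp [coframe, hyi, -Complex.div_re, -Complex.div_im, e1, e2] <;> field_simp <;>
      ring

lemma rotM_isRot (γ : SL(2, ℤ)) {z : ℂ} (hz : z ∈ UHP) : IsRot (Ad (rotM γ z)) := by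
  obtain ⟨C, S, h, hM, -⟩ := rotM_eq γ hz
  have hdet : (!![C, -S; S, C] : Matrix (Fin 2) (Fin 2) ℝ).det = 1 := by
    rw [Matrix.det_fin_two]; simp; linarith
  have hA : Ad (rotM γ z) = !![C ^ 2 - S ^ 2, 2 * C * S, 0; -(2 * C * S), C ^ 2 - S ^ 2, 0; 0, 0, 1] := by
    ext i j
    rw [hM, Ad_eq_adPoly hdet, adPoly_apply]
    fin_cases i <;> fin_cases j <;> simp <;> linarith
  rw [hA]
  refine ⟨?_, ?_, ?_, ?_⟩
  · ext i j
    fin_cases i <;> fin_cases j <;> simp [Matrix.mul_apply, Fin.sum_univ_three] <;> try ring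
    · linear_combination (C ^ 2 + S ^ 2 + 1) * h
    · linear_combination (C ^ 2 + S ^ 2 + 1) * h
  · intro a; fin_cases a <;> simp
  · intro a; fin_cases a <;> simp
  · simp

lemma coframe_moebius (γ : SL(2, ℤ)) {z : ℂ} (hz : z ∈ UHP) (α' : Fin 2) (v : ℂ) :
    ∑ α : Fin 2, Ad (rotM γ z) α.castSucc α'.castSucc *
      coframe (moebius γ z) α (v / ((γ 1 0 : ℂ) * z + γ 1 1) ^ 2) = coframe z α' v := by
  obtain ⟨C, S, h, hM, hc⟩ := rotM_eq γ hz
  have hdet : (!![C, -S; S, C] : Matrix (Fin 2) (Fin 2) ℝ).det = 1 := by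
    rw [Matrix.det_fin_two]; simp; linarith
  obtain ⟨h1, h2⟩ := hc v
  rw [Fin.sum_univ_two, h1, h2, hM]
  simp only [Ad_eq_adPoly hdet, adPoly_apply]
  have h4 : (C ^ 2 - S ^ 2) ^ 2 + (2 * C * S) ^ 2 = 1 := by
    linear_combination (C ^ 2 + S ^ 2 + 1) * h
  fin_cases α' <;> simp
  · linear_combination coframe z 0 v * h4
  · linear_combination coframe z 1 v * h4

lemma coord_eq_zero_of_trace {X : Matrix (Fin 2) (Fin 2) ℝ} {g : Matrix (Fin 2) (Fin 2) ℝ}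
    (hg : g.det = 1) (hX : X.trace = 0) : (g⁻¹ * X * g).trace = 0 := by
  have h : g⁻¹.det ≠ 0 := by
    rw [Matrix.det_nonsing_inv, hg]; simp
  have := trace_conj h X
  rwa [Matrix.nonsing_inv_nonsing_inv g (by rw [hg]; exact isUnit_one), hX] at this

/-- The Schwartz form is equivariant: `γ^* φ(X) = φ(γ⁻¹ X γ)`. -/
lemma pull1_phiV (k : ℕ) (γ : SL(2, ℤ)) {X : Matrix (Fin 2) (Fin 2) ℝ} (hX : X.trace = 0) {z : ℂ}
    (hz : z ∈ UHP) : pull1 γ (phiV k X) z = phiV k ((toR γ)⁻¹ * X * toR γ) z := by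
  have hz' := moebius_mem γ hz
  have hg : (gMat z).det = 1 := det_gMat hz
  have hg' : (gMat (moebius γ z)).det = 1 := det_gMat hz'
  have hγ := det_toR γ
  have hu : IsUnit (gMat (moebius γ z)).det := by rw [hg']; exact isUnit_one
  have huγ : IsUnit (toR γ).det := by rw [hγ]; exact isUnit_one
  have hug : IsUnit (gMat z).det := by rw [hg]; exact isUnit_one
  set κ := rotM γ z with hκ
  have hκdet : κ.det = 1 := by
    rw [hκ, rotM, Matrix.det_mul, Matrix.det_mul, Matrix.det_nonsing_inv, hg, hg', hγ]; simp
  have hrot := rotM_isRot γ hz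
  rw [← hκ] at hrot
  set Y := (gMat z)⁻¹ * ((toR γ)⁻¹ * X * toR γ) * gMat z with hY
  have hYt : Y.trace = 0 := coord_eq_zero_of_trace hg (coord_eq_zero_of_trace hγ hX)
  have hκinv : κ⁻¹ = (gMat z)⁻¹ * (toR γ)⁻¹ * gMat (moebius γ z) := by
    rw [hκ, rotM, Matrix.mul_inv_rev, Matrix.mul_inv_rev, Matrix.nonsing_inv_nonsing_inv _ hu,
      mul_assoc]
  have hconj : (gMat (moebius γ z))⁻¹ * X * gMat (moebius γ z) = κ * Y * κ⁻¹ := by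
    rw [hκinv, hY, hκ, rotM]
    simp only [mul_assoc]
    rw [Matrix.mul_nonsing_inv_cancel_left _ _ hug, Matrix.mul_nonsing_inv_cancel_left _ _ huγ,
      Matrix.mul_nonsing_inv_cancel_left _ _ hug, Matrix.mul_nonsing_inv_cancel_left _ _ huγ]
  have hact : ∀ T, act k (toR γ⁻¹) (act k (gMat (moebius γ z)) (act k κ T)) =
      act k (gMat z) T := by
    intro T
    rw [← act_mul _ _ _ (by rw [hg']; exact one_ne_zero),
      ← act_mul _ _ _ (by rw [hκdet]; exact one_ne_zero), hκ, rotM, toR_inv]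
    congr 2
    simp only [mul_assoc]
    rw [Matrix.mul_nonsing_inv_cancel_left _ _ hu, Matrix.nonsing_inv_mul_cancel_left _ _ huγ]
  refine ContinuousLinearMap.ext fun v => ?_
  rw [pull1_apply γ _ hz, phiV_apply, phiV_apply, hconj, ← Ad_mulVec_coord _ _ hYt, map_smul]
  congr 1
  -- functions, coframe and tensors all rotate by `κ`; the sum over the frame is invariant
  set W : (Fin k → Fin 2) → Tens k := fun β =>
    act k (toR γ⁻¹) (act k (gMat (moebius γ z)) (harmProj k (basisT β))) with hW
  have hWg : ∀ β' : Fin k → Fin 2, act k (gMat z) (harmProj k (basisT β')) = ∑ β : Fin k → Fin 2,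
      (∏ i, Ad κ (β i).castSucc (β' i).castSucc) • W β := by
    intro β'
    rw [← hact, ← harmProj_act (by rw [hκdet]; exact one_ne_zero), act_basisT hrot]
    simp only [map_sum, map_smul, hW]
    simp only [Complex.coe_smul]
  have hcf := fun α' => coframe_moebius γ hz α' v
  rw [← hκ] at hcf
  simp only [hWg, ← hcf, map_sum]
  set cf : Fin 2 → ℝ := fun α => coframe (moebius γ z) α (v / ((γ 1 0 : ℂ) * z + γ 1 1) ^ 2)
    with hcfd
  have hl : ∀ α β, act k (toR γ⁻¹) ((schwartz α β ((Ad κ).mulVec (coord Y)) * cf α) •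
      act k (gMat (moebius γ z)) (harmProj k (basisT β))) =
      ∑ α' : Fin 2, ∑ β' : Fin k → Fin 2, (Ad κ α.castSucc α'.castSucc *
        ((∏ i, Ad κ (β i).castSucc (β' i).castSucc) * schwartz α' β' (coord Y)) * cf α) • W β := by
    intro α β
    rw [← Complex.coe_smul, map_smul, Complex.coe_smul, schwartz_mulVec hrot, Finset.sum_mul,
      Finset.sum_smul]
    refine Finset.sum_congr rfl fun α' _ => ?_
    rw [Finset.sum_mul, Finset.sum_smul]
  have hr : ∀ α' β', (schwartz α' β' (coord Y) * ∑ α, Ad κ α.castSucc α'.castSucc * cf α) •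
      ∑ β : Fin k → Fin 2, (∏ i, Ad κ (β i).castSucc (β' i).castSucc) • W β =
      ∑ α : Fin 2, ∑ β : Fin k → Fin 2, (Ad κ α.castSucc α'.castSucc *
        ((∏ i, Ad κ (β i).castSucc (β' i).castSucc) * schwartz α' β' (coord Y)) * cf α) • W β := by
    intro α' β'
    rw [Finset.mul_sum, Finset.sum_smul]
    refine Finset.sum_congr rfl fun α _ => ?_
    rw [Finset.smul_sum]
    refine Finset.sum_congr rfl fun β _ => ?_
    rw [smul_smul]
    congr 1
    ring
  rw [Finset.sum_congr rfl fun α _ => Finset.sum_congr rfl fun β _ => hl α β,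
    Finset.sum_congr rfl fun α _ => Finset.sum_congr rfl fun β _ => hr α β]
  rw [Finset.sum_congr rfl fun α _ => Finset.sum_comm, Finset.sum_comm]
  refine Finset.sum_congr rfl fun α' _ => ?_
  rw [Finset.sum_congr rfl fun α _ => Finset.sum_comm, Finset.sum_comm]

lemma exists_latVec_conj (γ : SL(2, ℤ)) (h : Fin 2) (p : ℤ × ℤ × ℤ) :
    ∃ p', latVec h p' = (toR γ)⁻¹ * latVec h p * toR γ := by
  obtain ⟨A, B, C⟩ := p
  have hd := det_eq γ
  have hdR : ((γ 0 0 : ℝ) * γ 1 1 - γ 0 1 * γ 1 0) = 1 := by exact_mod_cast hd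
  refine ⟨(-2 * γ 0 0 * γ 1 0 * B - γ 0 0 * γ 1 0 * h.val - γ 1 0 ^ 2 * C + γ 0 0 ^ 2 * A,
    (γ 0 0 * γ 1 1 + γ 0 1 * γ 1 0) * B + γ 0 1 * γ 1 0 * h.val + γ 1 0 * γ 1 1 * C
      - γ 0 0 * γ 0 1 * A,
    2 * γ 0 1 * γ 1 1 * B + γ 0 1 * γ 1 1 * h.val + γ 1 1 ^ 2 * C - γ 0 1 ^ 2 * A), ?_⟩
  rw [inv_of_det_one (det_toR γ)]
  ext i j
  fin_cases i <;> fin_cases j <;>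
    simp [latVec, Matrix.mul_apply, Fin.sum_univ_two, toR]
  · linear_combination (-(h.val : ℝ) / 2) * hdR
  · ring
  · ring
  · linear_combination ((h.val : ℝ) / 2) * hdR

lemma latVec_injective (h : Fin 2) : Function.Injective (latVec h) := by
  rintro ⟨A, B, C⟩ ⟨A', B', C'⟩ he
  have h1 := congrFun (congrFun he 0) 0
  have h2 := congrFun (congrFun he 0) 1
  have h3 := congrFun (congrFun he 1) 0
  simp [latVec] at h1 h2 h3
  simp [h1, h2, h3]

/-- Conjugation by `γ⁻¹` on a coset of the lattice. -/
def latConj (γ : SL(2, ℤ)) (h : Fin 2) : ℤ × ℤ × ℤ ≃ ℤ × ℤ × ℤ where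
  toFun p := (exists_latVec_conj γ h p).choose
  invFun p := (exists_latVec_conj γ⁻¹ h p).choose
  left_inv p := by
    have hu : IsUnit (toR γ).det := by rw [det_toR γ]; exact isUnit_one
    apply latVec_injective h
    rw [(exists_latVec_conj γ⁻¹ h _).choose_spec, (exists_latVec_conj γ h p).choose_spec, toR_inv,
      Matrix.nonsing_inv_nonsing_inv _ hu]
    simp only [mul_assoc]
    rw [Matrix.mul_nonsing_inv_cancel_left _ _ hu, Matrix.mul_nonsing_inv _ hu, mul_one]
  right_inv p := by
    have hu : IsUnit (toR γ).det := by rw [det_toR γ]; exact isUnit_one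
    apply latVec_injective h
    rw [(exists_latVec_conj γ h _).choose_spec, (exists_latVec_conj γ⁻¹ h p).choose_spec, toR_inv,
      Matrix.nonsing_inv_nonsing_inv _ hu]
    simp only [mul_assoc]
    rw [Matrix.nonsing_inv_mul_cancel_left _ _ hu, Matrix.nonsing_inv_mul _ hu, mul_one]

lemma latVec_latConj (γ : SL(2, ℤ)) (h : Fin 2) (p : ℤ × ℤ × ℤ) :
    latVec h (latConj γ h p) = (toR γ)⁻¹ * latVec h p * toR γ :=
  (exists_latVec_conj γ h p).choose_spec

lemma trace_latVec (h : Fin 2) (p : ℤ × ℤ × ℤ) : (latVec h p).trace = 0 := by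
  simp [latVec, Matrix.trace_fin_two]

lemma pull1_thetaTerm (k : ℕ) (h : Fin 2) (τ : ℍ) (γ : SL(2, ℤ)) (p : ℤ × ℤ × ℤ) {z : ℂ}
    (hz : z ∈ UHP) : pull1 γ (thetaTerm k h τ p) z = thetaTerm k h τ (latConj γ h p) z := by
  have hu : IsUnit (toR γ).det := by rw [det_toR γ]; exact isUnit_one
  have ht : (latVec h (latConj γ h p) * latVec h (latConj γ h p)).trace =
      (latVec h p * latVec h p).trace := by
    rw [latVec_latConj]
    simp only [mul_assoc]
    rw [Matrix.mul_nonsing_inv_cancel_left _ _ hu, Matrix.trace_mul_comm]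
    simp only [mul_assoc]
    rw [Matrix.mul_nonsing_inv _ hu, mul_one]
  unfold thetaTerm
  rw [pull1_const_smul γ _ _ hz, pull1_phiV k γ _ hz, ht, latVec_latConj]
  · simp
  · rw [Matrix.trace_smul, trace_latVec, smul_zero]

/-! ### Convergence of the theta series -/

/-- Polynomials grow more slowly than Gaussians. -/
lemma exists_poly_le (P : Polynomial ℝ) {δ : ℝ} (hδ : 0 < δ) :
    ∃ C, 0 ≤ C ∧ ∀ t : ℝ, |P.eval t| ≤ C * Real.exp (δ * t ^ 2) := by
  induction P using Polynomial.induction_on' with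
  | add P Q hP hQ =>
    obtain ⟨C, hC, h1⟩ := hP
    obtain ⟨D, hD, h2⟩ := hQ
    refine ⟨C + D, by positivity, fun t => ?_⟩
    rw [Polynomial.eval_add, add_mul]
    exact (abs_add_le _ _).trans (add_le_add (h1 t) (h2 t))
  | monomial m a =>
    refine ⟨|a| * (1 + m.factorial / δ ^ m), by positivity, fun t => ?_⟩
    rw [Polynomial.eval_monomial, abs_mul, mul_assoc]
    refine mul_le_mul_of_nonneg_left ?_ (abs_nonneg a)
    have h1 : |t ^ m| ≤ 1 + (t ^ 2) ^ m := by
      rw [← pow_mul, mul_comm 2 m, pow_mul, ← sq_abs (t ^ m)]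
      nlinarith [sq_nonneg (|t ^ m| - 1), abs_nonneg (t ^ m)]
    have h2 := Real.pow_div_factorial_le_exp (δ * t ^ 2) (by positivity) m
    have h3 : (t ^ 2) ^ m = m.factorial / δ ^ m * ((δ * t ^ 2) ^ m / m.factorial) := by
      rw [mul_pow]; field_simp
    have h4 : 1 ≤ Real.exp (δ * t ^ 2) := Real.one_le_exp (by positivity)
    rw [add_mul, one_mul]
    refine h1.trans (add_le_add h4 ?_)
    rw [h3]
    exact mul_le_mul_of_nonneg_left h2 (by positivity)

lemma exists_polyGauss_le (P Q : Polynomial ℝ) : ∃ C, 0 ≤ C ∧ ∀ x,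
    |polyGauss P Q x| ≤ C * Real.exp (-(Real.pi / 2) * (x 0 ^ 2 + x 1 ^ 2 + x 2 ^ 2)) := by
  obtain ⟨C, hC, h1⟩ := exists_poly_le P (δ := Real.pi / 2) (by positivity)
  obtain ⟨D, hD, h2⟩ := exists_poly_le Q (δ := Real.pi / 2) (by positivity)
  refine ⟨C * D, by positivity, fun x => ?_⟩
  rw [polyGauss, abs_mul, abs_mul, gauss, Real.abs_exp]
  calc _ ≤ (C * Real.exp (Real.pi / 2 * x 0 ^ 2)) * (D * Real.exp (Real.pi / 2 * x 1 ^ 2)) *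
        Real.exp (-Real.pi * (x 0 ^ 2 + x 1 ^ 2 + x 2 ^ 2)) := by
        gcongr
        · exact h1 _
        · exact h2 _
    _ = C * D * Real.exp (Real.pi / 2 * x 0 ^ 2 + Real.pi / 2 * x 1 ^ 2 +
        -Real.pi * (x 0 ^ 2 + x 1 ^ 2 + x 2 ^ 2)) := by
        rw [Real.exp_add, Real.exp_add]; ring
    _ ≤ _ := by
        gcongr
        nlinarith [Real.pi_pos, sq_nonneg (x 2)]

lemma summable_exp_neg_sq {δ : ℝ} (hδ : 0 < δ) : Summable fun m : ℤ => Real.exp (-δ * m ^ 2) := by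
  have h := summable_pow_mul_jacobiTheta₂_term_bound 0 (T := δ / Real.pi) (by positivity) 0
  refine h.congr fun m => ?_
  simp
  field_simp

lemma summable_exp_neg_sq₃ {δ : ℝ} (hδ : 0 < δ) : Summable fun p : ℤ × ℤ × ℤ =>
    Real.exp (-δ * ((p.1 : ℝ) ^ 2 + p.2.1 ^ 2 + p.2.2 ^ 2)) := by
  have h := summable_exp_neg_sq hδ
  have h2 := h.mul_of_nonneg (h.mul_of_nonneg h (fun _ => (Real.exp_pos _).le)
    fun _ => (Real.exp_pos _).le) (fun _ => (Real.exp_pos _).le)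
    fun _ => mul_nonneg (Real.exp_pos _).le (Real.exp_pos _).le
  refine h2.congr fun p => ?_
  rw [← Real.exp_add, ← Real.exp_add]
  congr 1
  ring

/-- The squared length of `X` in the frame at `z` bounds the size of `X`. -/
lemma exists_le_sum_sq_coord (h : Fin 2) {r : ℝ} (hr : 0 < r) {z : ℂ} (hz : z ∈ UHP) :
    ∃ δ > 0, ∃ D, ∀ p : ℤ × ℤ × ℤ, δ * ((p.1 : ℝ) ^ 2 + p.2.1 ^ 2 + p.2.2 ^ 2) - D ≤
      ∑ i, coord ((gMat z)⁻¹ * (r • latVec h p) * gMat z) i ^ 2 := by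
  have hg : (gMat z).det = 1 := det_gMat hz
  have hu : IsUnit (gMat z).det := by rw [hg]; exact isUnit_one
  set K := ∑ i, ∑ j, Ad (gMat z) i j ^ 2 with hK
  have hK0 : 0 ≤ K := Finset.sum_nonneg fun i _ => Finset.sum_nonneg fun j _ => sq_nonneg _
  have key : ∀ X : Matrix (Fin 2) (Fin 2) ℝ, X.trace = 0 → ∑ i, coord X i ^ 2 ≤
      (K + 1) * ∑ i, coord ((gMat z)⁻¹ * X * gMat z) i ^ 2 := by
    intro X hX
    have h1 := Ad_mulVec_coord (gMat z) ((gMat z)⁻¹ * X * gMat z) (coord_eq_zero_of_trace hg hX)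
    have h2 : gMat z * ((gMat z)⁻¹ * X * gMat z) * (gMat z)⁻¹ = X := by
      simp only [mul_assoc]
      rw [Matrix.mul_nonsing_inv _ hu, mul_one, Matrix.mul_nonsing_inv_cancel_left _ _ hu]
    rw [h2] at h1
    rw [← h1]
    set y := coord ((gMat z)⁻¹ * X * gMat z)
    have h0 : 0 ≤ ∑ i, y i ^ 2 := Finset.sum_nonneg fun i _ => sq_nonneg _
    calc ∑ i, ((Ad (gMat z)).mulVec y) i ^ 2 ≤ ∑ i, (∑ j, Ad (gMat z) i j ^ 2) * ∑ j, y j ^ 2 :=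
          Finset.sum_le_sum fun i _ => Finset.sum_mul_sq_le_sq_mul_sq Finset.univ (Ad (gMat z) i) y
      _ = K * ∑ i, y i ^ 2 := by rw [← Finset.sum_mul]
      _ ≤ _ := by nlinarith
  refine ⟨r ^ 2 / (K + 1), by positivity, r ^ 2 / (K + 1), fun p => ?_⟩
  have h1 := key (r • latVec h p) (by rw [Matrix.trace_smul, trace_latVec, smul_zero])
  have h2 : r ^ 2 * ((p.1 : ℝ) ^ 2 + p.2.1 ^ 2 + p.2.2 ^ 2) - r ^ 2 ≤
      ∑ i, coord (r • latVec h p) i ^ 2 := by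
    have hs : √2 * √2 = (2 : ℝ) := sqrt_two_sq
    have hs0 : √2 ≠ 0 := by positivity
    have ht : ((h.val : ℝ) / 2) ^ 2 ≤ 1 / 4 := by fin_cases h <;> norm_num
    set t : ℝ := (h.val : ℝ) / 2
    have e1 : ∑ i, coord (r • latVec h p) i ^ 2 =
        r ^ 2 * (p.1 ^ 2 + p.2.2 ^ 2 + 2 * (p.2.1 + t) ^ 2) := by
      rw [coord_smul, coord_apply]
      simp [Fin.sum_univ_three, latVec, mul_pow, div_pow]
      ring
    rw [e1, ← mul_sub_one]
    refine mul_le_mul_of_nonneg_left ?_ (sq_nonneg r)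
    nlinarith [sq_nonneg ((p.2.1 : ℝ) + 2 * t)]
  rw [div_mul_eq_mul_div, div_sub_div_same, div_le_iff₀ (by positivity)]
  linarith

/-- The scalar terms of the theta series: `P(x₁) Q(x₂) e^{-π |x|²}` at `x = √v g_z⁻¹ X g_z`, with
`P = H̃_a` and `Q = H̃_b`, times `e^{π i (X, X) u}`. -/
def scTerm (a b : ℕ) (h : Fin 2) (τ : ℍ) (z : ℂ) (p : ℤ × ℤ × ℤ) : ℂ :=
  Complex.exp (Real.pi * Complex.I * ((latVec h p * latVec h p).trace : ℝ) * (τ.re : ℝ)) *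
    (polyGauss (hp a) (hp b) (coord ((gMat z)⁻¹ * (√τ.im • latVec h p) * gMat z)) : ℝ)

lemma norm_scTerm (a b : ℕ) (h : Fin 2) (τ : ℍ) (z : ℂ) (p : ℤ × ℤ × ℤ) : ‖scTerm a b h τ z p‖ =
    |polyGauss (hp a) (hp b) (coord ((gMat z)⁻¹ * (√τ.im • latVec h p) * gMat z))| := by
  rw [scTerm, norm_mul, Complex.norm_real, Real.norm_eq_abs, Complex.norm_exp]
  simp

lemma summable_norm_scTerm (a b : ℕ) (h : Fin 2) (τ : ℍ) {z : ℂ} (hz : z ∈ UHP) :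
    Summable fun p => ‖scTerm a b h τ z p‖ := by
  obtain ⟨δ, hδ, D, hD⟩ := exists_le_sum_sq_coord h (Real.sqrt_pos.2 τ.im_pos) hz
  obtain ⟨C, hC, h1⟩ := exists_polyGauss_le (hp a) (hp b)
  refine Summable.of_nonneg_of_le (fun p => norm_nonneg _) (fun p => ?_)
    ((summable_exp_neg_sq₃ (δ := Real.pi / 2 * δ) (by positivity)).mul_left
      (C * Real.exp (Real.pi / 2 * D)))
  rw [norm_scTerm, mul_assoc C, ← Real.exp_add]
  refine (h1 _).trans (mul_le_mul_of_nonneg_left (Real.exp_le_exp.2 ?_) hC)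
  have := hD p
  rw [Fin.sum_univ_three] at this
  nlinarith [Real.pi_pos]

/-- The constant form `ω_α ⊗ g_z π_k(e_{β 1} ⋯ e_{β k})`. -/
def frameT (k : ℕ) (z : ℂ) (α : Fin 2) (β : Fin k → Fin 2) : ℂ →L[ℝ] Tens k :=
  (coframe z α).smulRight (act k (gMat z) (harmProj k (basisT β)))

/-- The degrees of the Hermite polynomials in `D_α D_{β 1} ⋯ D_{β k} φ₀`. -/
def deg {k : ℕ} (j α : Fin 2) (β : Fin k → Fin 2) : ℕ := (if α = j then 1 else 0) + cnt j β

lemma thetaTerm_eq (k : ℕ) (h : Fin 2) (τ : ℍ) (p : ℤ × ℤ × ℤ) (z : ℂ) : thetaTerm k h τ p z =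
    ((1 / (2 : ℝ) ^ ((k : ℝ) + 1 / 2) : ℝ) : ℂ) • ∑ α : Fin 2, ∑ β : Fin k → Fin 2,
      scTerm (deg 0 α β) (deg 1 α β) h τ z p • frameT k z α β := by
  rw [thetaTerm, phiV, smul_comm]
  congr 1
  rw [Finset.smul_sum]
  refine Finset.sum_congr rfl fun α _ => ?_
  rw [Finset.smul_sum]
  refine Finset.sum_congr rfl fun β _ => ?_
  rw [scTerm, schwartz_eq, mul_smul]
  congr 1

lemma summable_thetaTerm (k : ℕ) (h : Fin 2) (τ : ℍ) {z : ℂ} (hz : z ∈ UHP) :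
    Summable fun p => thetaTerm k h τ p z := by
  simp only [thetaTerm_eq]
  refine Summable.const_smul _ (summable_sum fun α _ => summable_sum fun β _ => ?_)
  exact (summable_norm_scTerm _ _ h τ hz).of_norm.smul_const _

lemma thetaV_eq (k : ℕ) (h : Fin 2) (τ : ℍ) {z : ℂ} (hz : z ∈ UHP) : thetaV k h τ z =
    (((τ.im ^ (-(k : ℝ) / 2) : ℝ) : ℂ) * ((1 / (2 : ℝ) ^ ((k : ℝ) + 1 / 2) : ℝ) : ℂ)) •
      ∑ α : Fin 2, ∑ β : Fin k → Fin 2,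
        (∑' p, scTerm (deg 0 α β) (deg 1 α β) h τ z p) • frameT k z α β := by
  have hs : ∀ α β, Summable fun p =>
      scTerm (deg 0 α β) (deg 1 α β) h τ z p • frameT k z α β := fun α β =>
    (summable_norm_scTerm _ _ h τ hz).of_norm.smul_const _
  rw [thetaV]
  simp only [thetaTerm_eq]
  rw [tsum_const_smul'', smul_smul, Summable.tsum_finsetSum fun α _ => summable_sum fun β _ => hs α β]
  congr 1
  refine Finset.sum_congr rfl fun α _ => ?_
  rw [Summable.tsum_finsetSum fun β _ => hs α β]
  refine Finset.sum_congr rfl fun β _ => ?_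
  exact ((summable_norm_scTerm _ _ h τ hz).of_norm.tsum_smul_const _)

lemma frameT_mem_harm (k : ℕ) {z : ℂ} (hz : z ∈ UHP) (α : Fin 2) (β : Fin k → Fin 2) (w : ℂ) :
    frameT k z α β w ∈ harm k := by
  have h : (gMat z).det ≠ 0 := by rw [det_gMat hz]; exact one_ne_zero
  have := (harm k).smul_mem ((coframe z α w : ℝ) : ℂ) (act_mem_harm h (harmProj_mem k (basisT β)))
  rwa [Complex.coe_smul] at this

lemma thetaV_mem_harm (k : ℕ) (h : Fin 2) (τ : ℍ) {z : ℂ} (hz : z ∈ UHP) (w : ℂ) :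
    thetaV k h τ z w ∈ harm k := by
  rw [thetaV_eq k h τ hz]
  simp only [smul_apply, sum_apply]
  exact (harm k).smul_mem _ (Submodule.sum_mem _ fun α _ => Submodule.sum_mem _ fun β _ =>
    (harm k).smul_mem _ (frameT_mem_harm k hz α β w))

lemma pull1_thetaV (k : ℕ) (h : Fin 2) (τ : ℍ) (γ : SL(2, ℤ)) {z : ℂ} (hz : z ∈ UHP) :
    pull1 γ (thetaV k h τ) z = thetaV k h τ z := by
  unfold thetaV
  rw [pull1_const_smul γ _ _ hz, pull1_eq_pullL,
    (pullL k γ z).map_tsum (summable_thetaTerm k h τ (moebius_mem γ hz))]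
  congr 1
  rw [← (latConj γ h).tsum_eq fun p => thetaTerm k h τ p z]
  refine tsum_congr fun p => ?_
  rw [← pull1_thetaTerm k h τ γ p hz, pull1_eq_pullL]

open FourierTransform

/-! ### Poisson summation -/

/-- The products of a polynomial in `α + β s` with a Gaussian. -/
def polyExp (P : Polynomial ℝ) (α β b : ℝ) (c : ℂ) (s : ℝ) : ℂ :=
  ((P.eval (α + β * s) : ℝ) : ℂ) * Complex.exp (-Real.pi * b * s ^ 2 + 2 * Real.pi * c * s)

lemma exists_norm_polyExp_le (P : Polynomial ℝ) (α β : ℝ) {b : ℝ} (hb : 0 < b) (c : ℂ) :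
    ∃ C, ∀ s : ℝ, ‖polyExp P α β b c s‖ ≤
      C * ‖Complex.exp ((-(Real.pi * b / 2) : ℂ) * s ^ 2 + 2 * Real.pi * c * s)‖ := by
  obtain ⟨C, hC, h⟩ := exists_poly_le (P.comp (Polynomial.C α + Polynomial.C β * Polynomial.X))
    (δ := Real.pi * b / 2) (by positivity)
  refine ⟨C, fun s => ?_⟩
  have h1 := h s
  simp only [Polynomial.eval_comp, Polynomial.eval_add, Polynomial.eval_mul, Polynomial.eval_C,
    Polynomial.eval_X] at h1
  rw [polyExp, norm_mul, Complex.norm_real, Real.norm_eq_abs, Complex.norm_exp, Complex.norm_exp]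
  refine (mul_le_mul_of_nonneg_right h1 (Real.exp_pos _).le).trans (le_of_eq ?_)
  rw [mul_assoc, ← Real.exp_add]
  congr 2
  simp [pow_two]
  ring

lemma continuous_polyExp (P : Polynomial ℝ) (α β b : ℝ) (c : ℂ) :
    Continuous (polyExp P α β b c) := by
  unfold polyExp
  have : Continuous fun s : ℝ => P.eval (α + β * s) := P.continuous.comp (by fun_prop)
  fun_prop

lemma integrable_polyExp (P : Polynomial ℝ) (α β : ℝ) {b : ℝ} (hb : 0 < b) (c : ℂ) :
    MeasureTheory.Integrable (polyExp P α β b c) := by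
  obtain ⟨C, hC⟩ := exists_norm_polyExp_le P α β hb c
  have h2 := (integrable_cexp_quadratic' (b := -(Real.pi * b / 2 : ℂ)) (by
    simp; positivity) (2 * Real.pi * c) 0).norm.const_mul C
  refine h2.mono' (continuous_polyExp P α β b c).aestronglyMeasurable
    (Filter.Eventually.of_forall fun s => ?_)
  simpa using hC s

lemma isBigO_polyExp (P : Polynomial ℝ) (α β : ℝ) {b : ℝ} (hb : 0 < b) (c : ℂ) :
    (polyExp P α β b c) =O[Filter.cocompact ℝ] fun s : ℝ => |s| ^ (-2 : ℝ) := by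
  obtain ⟨C, hC⟩ := exists_norm_polyExp_le P α β hb c
  have h := cexp_neg_quadratic_isLittleO_abs_rpow_cocompact (a := -(Real.pi * b / 2 : ℂ)) (by
    simp; positivity) (2 * Real.pi * c) (-2)
  exact (Asymptotics.IsBigO.of_bound C (Filter.Eventually.of_forall hC)).trans h.isBigO

lemma hasDerivAt_polyExp (P : Polynomial ℝ) (α β b : ℝ) (c : ℂ) (s : ℝ) :
    HasDerivAt (polyExp P α β b c) (polyExp (Polynomial.C β * Polynomial.derivative P) α β b c s +
      (-(2 * Real.pi * b * s) + 2 * Real.pi * c) * polyExp P α β b c s) s := by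
  have h0 : HasDerivAt (fun s : ℝ => α + β * s) β s := by
    simpa using ((hasDerivAt_id s).const_mul β).const_add α
  have h1 : HasDerivAt (fun s : ℝ => P.eval (α + β * s))
      ((Polynomial.derivative P).eval (α + β * s) * β) s :=
    HasDerivAt.comp (h₂ := fun t => P.eval t) s (P.hasDerivAt _) h0
  have h2 : HasDerivAt (fun s : ℝ => -Real.pi * b * (s : ℂ) ^ 2 + 2 * Real.pi * c * s)
      (-Real.pi * b * (2 * s) + 2 * Real.pi * c) s := by
    have := Complex.ofRealCLM.hasDerivAt (x := s)
    simp only [Complex.ofRealCLM_apply, Complex.ofReal_one] at this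
    have h3 := ((this.fun_pow 2).const_mul (-Real.pi * b : ℂ)).fun_add
      (this.const_mul (2 * Real.pi * c))
    refine h3.congr_deriv ?_
    simp
  refine (h1.ofReal_comp.fun_mul h2.cexp).congr_deriv ?_
  simp only [polyExp, Polynomial.eval_mul, Polynomial.eval_C]
  push_cast
  ring

lemma polyExp_hp_succ (j : ℕ) {α β : ℝ} (hβ : β ≠ 0) (c : ℂ) :
    polyExp (hp (j + 1)) α β (2 * β ^ 2) c = fun s => (2 * α + c / β) *
      polyExp (hp j) α β (2 * β ^ 2) c s -
        1 / (2 * Real.pi * β) * deriv (polyExp (hp j) α β (2 * β ^ 2) c) s := by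
  funext s
  rw [(hasDerivAt_polyExp _ α β _ c s).deriv]
  simp only [polyExp, hp_succ, Polynomial.eval_mul, Polynomial.eval_sub, Polynomial.eval_C,
    Polynomial.eval_X]
  have hpi : (Real.pi : ℂ) ≠ 0 := by exact_mod_cast Real.pi_ne_zero
  have hβ' : (β : ℂ) ≠ 0 := by exact_mod_cast hβ
  push_cast
  field_simp
  ring

/-- The recursion of the `H̃_j` becomes multiplication by a linear function under the Fourier transform,
so that the Hermite polynomial is replaced by a power. -/
lemma fourier_polyExp (j : ℕ) (α : ℝ) {β : ℝ} (hβ : β ≠ 0) (c : ℂ) (t : ℝ) :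
    𝓕 (polyExp (hp j) α β (2 * β ^ 2) c) t = ((2 * α * β + c - Complex.I * t) / β) ^ j *
      (1 / ((2 * β ^ 2 : ℝ) : ℂ) ^ (1 / 2 : ℂ) *
        Complex.exp (-Real.pi / (2 * β ^ 2 : ℝ) * (t + Complex.I * c) ^ 2)) := by
  have hb : 0 < 2 * β ^ 2 := by positivity
  have hβ' : (β : ℂ) ≠ 0 := by exact_mod_cast hβ
  have hpi : (Real.pi : ℂ) ≠ 0 := by exact_mod_cast Real.pi_ne_zero
  induction j generalizing t with
  | zero =>
    have h := fourier_gaussian_pi' (b := ((2 * β ^ 2 : ℝ) : ℂ)) (by rw [Complex.ofReal_re]; exact hb) c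
    have h0 : polyExp (hp 0) α β (2 * β ^ 2) c = fun x : ℝ =>
        Complex.exp (-Real.pi * ((2 * β ^ 2 : ℝ) : ℂ) * x ^ 2 + 2 * Real.pi * c * x) := by
      funext s
      simp [polyExp, hp]
    rw [pow_zero, one_mul, ← congrFun h t, h0]
  | succ j ih =>
    have hi := integrable_polyExp (hp j) α β hb c
    have hd : Differentiable ℝ (polyExp (hp j) α β (2 * β ^ 2) c) := fun s =>
      (hasDerivAt_polyExp _ _ _ _ _ s).differentiableAt
    have hi' : MeasureTheory.Integrable (deriv (polyExp (hp j) α β (2 * β ^ 2) c)) := by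
      have h1 := polyExp_hp_succ j (α := α) hβ c
      have h2 : deriv (polyExp (hp j) α β (2 * β ^ 2) c) = fun s => 2 * Real.pi * β *
          ((2 * α + c / β) * polyExp (hp j) α β (2 * β ^ 2) c s -
            polyExp (hp (j + 1)) α β (2 * β ^ 2) c s) := by
        funext s
        rw [congrFun h1 s]
        field_simp
        ring
      rw [h2]
      exact ((hi.const_mul _).sub (integrable_polyExp _ α β hb c)).const_mul _
    have hF := congrFun (Real.fourier_deriv hi hd hi') t
    have h3 : 𝓕 (polyExp (hp (j + 1)) α β (2 * β ^ 2) c) t = (2 * α + c / β) *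
        𝓕 (polyExp (hp j) α β (2 * β ^ 2) c) t -
          1 / (2 * Real.pi * β) * 𝓕 (deriv (polyExp (hp j) α β (2 * β ^ 2) c)) t := by
      rw [polyExp_hp_succ j hβ c]
      simp only [Real.fourier_eq, smul_sub]
      rw [MeasureTheory.integral_sub]
      · simp only [← MeasureTheory.integral_const_mul]
        congr 1 <;>
        · congr 1
          funext s
          simp only [Circle.smul_def, smul_eq_mul]
          ring
      · exact (Real.fourierIntegral_convergent_iff t).2 (hi.const_mul _)
      · exact (Real.fourierIntegral_convergent_iff t).2 (hi'.const_mul _)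
    have hκ : 2 * α + c / β - 1 / (2 * Real.pi * β) * (2 * Real.pi * Complex.I * t) =
        (2 * α * β + c - Complex.I * t) / β := by
      field_simp
    rw [h3, hF, ih, pow_succ, smul_eq_mul]
    have gen : ∀ D : ℂ, (2 * α + c / β) * D - 1 / (2 * Real.pi * β) *
        (2 * Real.pi * Complex.I * t * D) = (2 * α * β + c - Complex.I * t) / β * D := by
      intro D
      rw [← hκ]
      ring
    rw [gen]
    ring

lemma poisson_polyExp (j : ℕ) (α : ℝ) {β : ℝ} (hβ : β ≠ 0) (c : ℂ) (s : ℝ) :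
    ∑' C : ℤ, polyExp (hp j) α β (2 * β ^ 2) c (s + C) = ∑' m : ℤ,
      ((2 * α * β + c - Complex.I * m) / β) ^ j * (1 / ((2 * β ^ 2 : ℝ) : ℂ) ^ (1 / 2 : ℂ) *
        Complex.exp (-Real.pi / (2 * β ^ 2 : ℝ) * (m + Complex.I * c) ^ 2)) *
        Complex.exp (2 * Real.pi * Complex.I * m * s) := by
  have hb : 0 < 2 * β ^ 2 := by positivity
  have hβ' : (β : ℂ) ≠ 0 := by exact_mod_cast hβ
  have hF : 𝓕 (polyExp (hp j) α β (2 * β ^ 2) c) =O[Filter.cocompact ℝ] (|·| ^ (-2 : ℝ)) := by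
    have h1 : (fun t : ℝ => ((2 * α * β + c - Complex.I * t) / β)) =O[Filter.cocompact ℝ]
        fun t : ℝ => |t| ^ (1 : ℝ) := by
      have ht : Filter.Tendsto (fun t : ℝ => |t|) (Filter.cocompact ℝ) Filter.atTop :=
        tendsto_norm_cocompact_atTop
      refine Asymptotics.IsBigO.of_bound (2 / |β|) ?_
      filter_upwards [ht.eventually_ge_atTop ‖2 * α * β + c‖] with t ht
      rw [norm_div, Real.rpow_one, Real.norm_eq_abs, abs_abs, Complex.norm_real, Real.norm_eq_abs,
        div_mul_eq_mul_div]
      gcongr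
      refine (norm_sub_le _ _).trans ?_
      rw [norm_mul, Complex.norm_I, Complex.norm_real, Real.norm_eq_abs]
      linarith
    have h2 := cexp_neg_quadratic_isLittleO_abs_rpow_cocompact
      (a := -Real.pi / (2 * β ^ 2 : ℝ)) (by
        rw [Complex.div_ofReal_re]
        exact div_neg_of_neg_of_pos (by simpa using Real.pi_pos) hb) (-2 * Real.pi * Complex.I * c / (2 * β ^ 2 : ℝ)) (-2 - j)
    have h3 := ((h1.pow j).mul h2.isBigO).const_mul_left
      (1 / ((2 * β ^ 2 : ℝ) : ℂ) ^ (1 / 2 : ℂ) *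
        Complex.exp (Real.pi * c ^ 2 / (2 * β ^ 2 : ℝ)))
    refine (h3.congr' (Filter.Eventually.of_forall fun t => ?_) ?_)
    · rw [fourier_polyExp j α hβ c t]
      have : Complex.exp (-Real.pi / (2 * β ^ 2 : ℝ) * (t + Complex.I * c) ^ 2) =
          Complex.exp (Real.pi * c ^ 2 / (2 * β ^ 2 : ℝ)) *
          Complex.exp (-Real.pi / (2 * β ^ 2 : ℝ) * t ^ 2 +
            -2 * Real.pi * Complex.I * c / (2 * β ^ 2 : ℝ) * t) := by
        rw [← Complex.exp_add]
        congr 1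
        linear_combination (-Real.pi / ((2 * β ^ 2 : ℝ) : ℂ) * c ^ 2) * Complex.I_sq
      rw [this]
      ring
    · have h0 : ∀ᶠ t : ℝ in Filter.cocompact ℝ, t ≠ 0 := by
        have ht : Filter.Tendsto (fun t : ℝ => |t|) (Filter.cocompact ℝ) Filter.atTop :=
          tendsto_norm_cocompact_atTop
        filter_upwards [ht.eventually_gt_atTop 0] with t ht using abs_pos.1 ht
      filter_upwards [h0] with t ht
      rw [Real.rpow_one, ← Real.rpow_natCast, ← Real.rpow_add (abs_pos.2 ht)]
      congr 1
      ring
  have h := Real.tsum_eq_tsum_fourier_of_rpow_decay (continuous_polyExp (hp j) α β (2 * β ^ 2) c)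
    one_lt_two (isBigO_polyExp (hp j) α β hb c) hF s
  rw [h]
  refine tsum_congr fun m => ?_
  rw [fourier_polyExp j α hβ c, fourier_coe_apply]
  simp

/-! ### The mixed model of the theta series -/

/-- The coordinate `B + h/2 - x A` of a lattice vector along the torus, after translation to the
imaginary axis. -/
def torC (h : Fin 2) (A B : ℤ) (x : ℝ) : ℝ := B + (h.val : ℝ) / 2 - x * A

lemma coord_frame (h : Fin 2) (r : ℝ) {z : ℂ} (hz : z ∈ UHP) (A B C : ℤ) :
    coord ((gMat z)⁻¹ * (r • latVec h (A, B, C)) * gMat z) =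
      ![r / √2 * (z.im * A) + r / √2 / z.im *
          (2 * z.re * (B + (h.val : ℝ) / 2) - z.re ^ 2 * A + C),
        r * √2 * torC h A B z.re,
        r / √2 / z.im * (2 * z.re * (B + (h.val : ℝ) / 2) - z.re ^ 2 * A + C) -
          r / √2 * (z.im * A)] := by
  have hy : 0 < z.im := hz
  have hs0 : 0 < √z.im := Real.sqrt_pos.2 hy
  have hss : √z.im ^ 2 = z.im := Real.sq_sqrt hy.le
  have h2 : √2 ^ 2 = (2 : ℝ) := Real.sq_sqrt (by norm_num)
  rw [inv_of_det_one (det_gMat hz), coord_apply]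
  have e1 : z.re / √z.im * √z.im = z.re := by field_simp
  funext i
  fin_cases i <;> simp [gMat, latVec, Matrix.mul_apply, Fin.sum_univ_two, torC]
  · field_simp
    rw [show √z.im ^ 4 = (√z.im ^ 2) ^ 2 by ring, hss]
    ring
  · field_simp
    rw [h2]
    ring
  · field_simp
    rw [show √z.im ^ 4 = (√z.im ^ 2) ^ 2 by ring, hss]
    ring

/-- The linear form `-i √2 (m - A τ̄) / √v`. -/
def linC (τ : ℍ) (A m : ℤ) : ℂ :=
  -Complex.I * √2 * (m - A * starRingEnd ℂ (τ : ℂ)) / √τ.im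

/-- The rate `π |m - A τ|² / v` of decay of the terms at the cusp. -/
def rate (τ : ℍ) (A m : ℤ) : ℝ := Real.pi * ‖(m : ℂ) - A * τ‖ ^ 2 / τ.im

/-- The part of the terms of the mixed model that does not depend on `y`. -/
def phase (h : Fin 2) (τ : ℍ) (A B m : ℤ) (x : ℝ) : ℂ :=
  Complex.exp (2 * Real.pi * Complex.I * τ * torC h A B x ^ 2 +
    2 * Real.pi * Complex.I * m * (2 * x * (B + (h.val : ℝ) / 2 : ℝ) - x ^ 2 * A))

/-- The terms of the theta series after Poisson summation in the upper right entry. -/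
def mixTerm (a b : ℕ) (h : Fin 2) (τ : ℍ) (z : ℂ) (p : ℤ × ℤ × ℤ) : ℂ :=
  z.im / √τ.im * (linC τ p.1 p.2.2 * z.im) ^ a *
    ((hp b).eval (√τ.im * √2 * torC h p.1 p.2.1 z.re) : ℝ) *
    (Real.exp (-rate τ p.1 p.2.2 * z.im ^ 2) : ℝ) * phase h τ p.1 p.2.1 p.2.2 z.re

/-- Poisson summation over the upper right entry `C`. The Hermite polynomial of the first coordinate
becomes the power `(linC · y)^a`, and the Gaussians in `A` and `m` combine to the rate. -/
lemma tsum_scTerm_eq (a b : ℕ) (h : Fin 2) (τ : ℍ) {z : ℂ} (hz : z ∈ UHP) (A B : ℤ) :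
    ∑' C : ℤ, scTerm a b h τ z (A, B, C) = ∑' m : ℤ, mixTerm a b h τ z (A, B, m) := by
  have hy : 0 < z.im := hz
  have hv : 0 < τ.im := τ.im_pos
  have hsv : 0 < √τ.im := Real.sqrt_pos.2 hv
  have hvv : √τ.im ^ 2 = τ.im := Real.sq_sqrt hv.le
  have h2 : √2 ^ 2 = (2 : ℝ) := Real.sq_sqrt (by norm_num)
  have hs2 : √2 ≠ (0 : ℝ) := by positivity
  have hτ : (τ : ℂ) = τ.re + τ.im * Complex.I := (Complex.re_add_im _).symm
  set β : ℝ := √τ.im / √2 / z.im with hβ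
  have hβ0 : β ≠ 0 := by positivity
  have hb : 2 * β ^ 2 = τ.im / z.im ^ 2 := by
    rw [hβ, div_pow, div_pow, h2, hvv]; field_simp
  set α : ℝ := √τ.im / √2 * (z.im * A) with hα
  set c : ℂ := Complex.I * (τ.re * A : ℝ) with hc
  set s₀ : ℝ := 2 * z.re * (B + (h.val : ℝ) / 2) - z.re ^ 2 * A with hs₀
  -- `K` collects what does not depend on `C`; the rest is a function of `s₀ + C`
  set K : ℂ := ((hp b).eval (√τ.im * √2 * torC h A B z.re) : ℝ) *
    Complex.exp (2 * Real.pi * Complex.I * τ * torC h A B z.re ^ 2) *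
    (Real.exp (-Real.pi * τ.im * (z.im * A) ^ 2) : ℝ) with hK
  have hl : ∀ C : ℤ, scTerm a b h τ z (A, B, C) = K * polyExp (hp a) α β (2 * β ^ 2) c (s₀ + C) := by
    intro C
    have htr : (latVec h (A, B, C) * latVec h (A, B, C)).trace =
        2 * torC h A B z.re ^ 2 + 2 * A * (s₀ + C) := by
      simp [latVec, Matrix.trace_fin_two, torC, hs₀]
      ring
    have hq : (α + β * (s₀ + C)) ^ 2 + (√τ.im * √2 * torC h A B z.re) ^ 2 +
        (β * (s₀ + C) - α) ^ 2 = τ.im * (z.im * A) ^ 2 + 2 * β ^ 2 * (s₀ + C) ^ 2 +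
          2 * τ.im * torC h A B z.re ^ 2 := by
      have hα2 : 2 * α ^ 2 = τ.im * (z.im * A) ^ 2 := by
        rw [hα, mul_pow, div_pow, h2, hvv]; ring
      rw [mul_pow, mul_pow, hvv, h2, ← hα2]
      ring
    have hexp : Complex.exp (Real.pi * Complex.I *
          ((latVec h (A, B, C) * latVec h (A, B, C)).trace : ℝ) * (τ.re : ℝ)) *
        (Real.exp (-Real.pi * ((α + β * (s₀ + C)) ^ 2 + (√τ.im * √2 * torC h A B z.re) ^ 2 +
          (β * (s₀ + C) - α) ^ 2)) : ℝ) =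
        Complex.exp (2 * Real.pi * Complex.I * τ * torC h A B z.re ^ 2) *
        (Real.exp (-Real.pi * τ.im * (z.im * A) ^ 2) : ℝ) *
        Complex.exp (-Real.pi * (2 * β ^ 2 : ℝ) * (s₀ + C : ℝ) ^ 2 +
          2 * Real.pi * c * (s₀ + C : ℝ)) := by
      rw [htr, hq, Complex.ofReal_exp, Complex.ofReal_exp, ← Complex.exp_add, ← Complex.exp_add,
        ← Complex.exp_add, hτ, hc]
      congr 1
      push_cast
      linear_combination (-2 * Real.pi * τ.im * torC h A B z.re ^ 2 : ℂ) * Complex.I_sq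
    rw [scTerm, coord_frame h _ hz, polyGauss, gauss, polyExp, hK]
    simp only [Matrix.cons_val_zero, Matrix.cons_val_one, Matrix.cons_val]
    rw [← hα, ← hs₀, ← hβ, Complex.ofReal_mul, Complex.ofReal_mul]
    linear_combination (((hp a).eval (α + β * (s₀ + C)) : ℝ) : ℂ) *
      (((hp b).eval (√τ.im * √2 * torC h A B z.re) : ℝ) : ℂ) * hexp
  have hr : ∀ m : ℤ, mixTerm a b h τ z (A, B, m) = K *
      (((2 * α * β + c - Complex.I * m) / β) ^ a * (1 / ((2 * β ^ 2 : ℝ) : ℂ) ^ (1 / 2 : ℂ) *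
        Complex.exp (-Real.pi / (2 * β ^ 2 : ℝ) * (m + Complex.I * c) ^ 2)) *
        Complex.exp (2 * Real.pi * Complex.I * m * s₀)) := by
    intro m
    have hyC : (z.im : ℂ) ≠ 0 := by exact_mod_cast hy.ne'
    have hvC : (τ.im : ℂ) ≠ 0 := by exact_mod_cast hv.ne'
    have hsC : ((√τ.im : ℝ) : ℂ) ≠ 0 := by exact_mod_cast hsv.ne'
    have hs2C : ((√2 : ℝ) : ℂ) ≠ 0 := by exact_mod_cast hs2
    have hvvC : ((√τ.im : ℝ) : ℂ) ^ 2 = τ.im := by exact_mod_cast hvv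
    have h2C : ((√2 : ℝ) : ℂ) ^ 2 = 2 := by exact_mod_cast h2
    have e1 : (2 * α * β + c - Complex.I * m) / β = linC τ A m * z.im := by
      have hab : (2 * α * β : ℂ) = τ.im * A := by
        have : 2 * α * β = τ.im * A := by
          rw [hα, hβ]; field_simp; rw [hvv, h2]; ring
        exact_mod_cast this
      rw [hab, linC, hc, hβ, hτ]
      simp only [map_add, map_mul, Complex.conj_ofReal, Complex.conj_I]
      push_cast
      field_simp
      linear_combination ((A : ℂ) * τ.im) * Complex.I_sq
    have e2 : (1 : ℂ) / ((2 * β ^ 2 : ℝ) : ℂ) ^ (1 / 2 : ℂ) = z.im / √τ.im := by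
      rw [hb, show ((1 : ℂ) / 2) = ((1 / 2 : ℝ) : ℂ) by push_cast; ring,
        ← Complex.ofReal_cpow (by positivity), ← Real.sqrt_eq_rpow, Real.sqrt_div hv.le,
        Real.sqrt_sq hy.le]
      push_cast
      field_simp
    have e3 : ((Real.exp (-rate τ A m * z.im ^ 2) : ℝ) : ℂ) =
        (Real.exp (-Real.pi * τ.im * (z.im * A) ^ 2) : ℝ) *
        Complex.exp (-Real.pi / (2 * β ^ 2 : ℝ) * (m + Complex.I * c) ^ 2) := by
      have hn : ‖(m : ℂ) - A * τ‖ ^ 2 = (m - A * τ.re) ^ 2 + (A * τ.im) ^ 2 := by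
        rw [← Complex.normSq_eq_norm_sq, Complex.normSq_apply]
        simp
        ring
      rw [hb, hc, rate, hn, Complex.ofReal_exp, Complex.ofReal_exp, ← Complex.exp_add]
      congr 1
      push_cast
      field_simp
      linear_combination (2 * A * m * τ.re + A ^ 2 * τ.re ^ 2 * (Complex.I ^ 2 - 1) : ℂ) *
        Complex.I_sq
    have e4 : phase h τ A B m z.re =
        Complex.exp (2 * Real.pi * Complex.I * τ * torC h A B z.re ^ 2) *
        Complex.exp (2 * Real.pi * Complex.I * m * s₀) := by
      rw [phase, ← Complex.exp_add, hs₀]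
      congr 1
      push_cast
      ring
    rw [e1, e2, mixTerm, e3, e4]
    ring
  rw [tsum_congr hl, tsum_congr hr, tsum_mul_left, tsum_mul_left, poisson_polyExp a α hβ0 c s₀]

/-! ### Smoothness at the cusp -/

/-- The function `t^{-b} e^{-s/t²}`, extended by zero to `t ≤ 0`. -/
def flatExp (b : ℕ) (s t : ℝ) : ℝ := if 0 < t then t⁻¹ ^ b * Real.exp (-s * t⁻¹ ^ 2) else 0

lemma flatExp_of_pos (b : ℕ) (s : ℝ) {t : ℝ} (ht : 0 < t) :
    flatExp b s t = t⁻¹ ^ b * Real.exp (-s * t⁻¹ ^ 2) := if_pos ht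

lemma flatExp_of_nonpos (b : ℕ) (s : ℝ) {t : ℝ} (ht : t ≤ 0) : flatExp b s t = 0 :=
  if_neg (not_lt.2 ht)

lemma flatExp_nonneg (b : ℕ) (s t : ℝ) : 0 ≤ flatExp b s t := by
  unfold flatExp
  split_ifs <;> positivity

lemma pow_mul_exp_neg_le (b : ℕ) {s : ℝ} (hs : 0 < s) {y : ℝ} (hy : 0 ≤ y) :
    y ^ b * Real.exp (-s * y ^ 2) ≤ 1 + b.factorial / s ^ b := by
  have h2 := Real.pow_div_factorial_le_exp (s * y ^ 2) (by positivity) b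
  have h1 : y ^ b ≤ 1 + (y ^ b) ^ 2 := by nlinarith [sq_nonneg (y ^ b - 1), pow_nonneg hy b]
  have h3 : (y ^ b) ^ 2 = b.factorial / s ^ b * ((s * y ^ 2) ^ b / b.factorial) := by
    rw [mul_pow]; field_simp; ring
  have h4 : 1 ≤ Real.exp (s * y ^ 2) := Real.one_le_exp (by positivity)
  have h5 : y ^ b ≤ (1 + b.factorial / s ^ b) * Real.exp (s * y ^ 2) := by
    rw [add_mul, one_mul]
    refine h1.trans (add_le_add h4 ?_)
    rw [h3]
    exact mul_le_mul_of_nonneg_left h2 (by positivity)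
  rw [neg_mul, Real.exp_neg, ← div_eq_mul_inv, div_le_iff₀ (Real.exp_pos _)]
  exact h5

/-- For rates bounded below the functions `t^{-b} e^{-s/t²}` decay exponentially in the rate,
uniformly for bounded `t`. -/
lemma exists_flatExp_le (b : ℕ) {s₀ T : ℝ} (hs : 0 < s₀) (hT : 0 < T) :
    ∃ C, 0 ≤ C ∧ ∀ s t, s₀ ≤ s → t ≤ T → flatExp b s t ≤ C * Real.exp (-s / (2 * T ^ 2)) := by
  refine ⟨1 + b.factorial / (s₀ / 2) ^ b, by positivity, fun s t hss ht => ?_⟩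
  rcases le_or_gt t 0 with h | h
  · rw [flatExp_of_nonpos b s h]
    positivity
  · rw [flatExp_of_pos b s h]
    have h1 := pow_mul_exp_neg_le b (half_pos hs) (inv_nonneg.2 h.le)
    have h2 : T⁻¹ ^ 2 ≤ t⁻¹ ^ 2 := by gcongr
    calc t⁻¹ ^ b * Real.exp (-s * t⁻¹ ^ 2) ≤
          t⁻¹ ^ b * (Real.exp (-(s₀ / 2) * t⁻¹ ^ 2) * Real.exp (-s / (2 * T ^ 2))) := by
          refine mul_le_mul_of_nonneg_left ?_ (by positivity)
          rw [← Real.exp_add, Real.exp_le_exp]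
          have e1 : -s / (2 * T ^ 2) = -(s / 2) * T⁻¹ ^ 2 := by
            rw [inv_pow]; field_simp
          rw [e1]
          nlinarith [sq_nonneg t⁻¹]
      _ ≤ _ := by
          rw [← mul_assoc]
          exact mul_le_mul_of_nonneg_right h1 (Real.exp_pos _).le

lemma hasDerivAt_flatExp (b : ℕ) {s : ℝ} (hs : 0 < s) (t : ℝ) : HasDerivAt (flatExp b s)
    (-b * flatExp (b + 1) s t + 2 * s * flatExp (b + 3) s t) t := by
  rcases lt_trichotomy t 0 with h | h | h
  · have h1 : flatExp b s =ᶠ[nhds t] fun _ => 0 := by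
      filter_upwards [Iio_mem_nhds h] with t' ht' using flatExp_of_nonpos b s (le_of_lt ht')
    rw [flatExp_of_nonpos _ _ h.le, flatExp_of_nonpos _ _ h.le, mul_zero, mul_zero, add_zero]
    exact (hasDerivAt_const t (0 : ℝ)).congr_of_eventuallyEq h1
  · subst h
    obtain ⟨C, hC, h1⟩ := exists_flatExp_le (b + 2) hs one_pos
    rw [flatExp_of_nonpos _ _ le_rfl, flatExp_of_nonpos _ _ le_rfl, mul_zero, mul_zero, add_zero,
      hasDerivAt_iff_isLittleO_nhds_zero]
    have hO : (fun u : ℝ => flatExp b s (0 + u) - flatExp b s 0 - u • (0 : ℝ)) =O[nhds 0]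
        fun u => u ^ 2 := by
      refine Asymptotics.IsBigO.of_bound (C * Real.exp (-s / (2 * 1 ^ 2))) ?_
      filter_upwards [Iio_mem_nhds one_pos] with u hu
      rw [zero_add, flatExp_of_nonpos _ _ le_rfl, smul_zero, sub_zero, sub_zero, Real.norm_eq_abs,
        abs_of_nonneg (flatExp_nonneg _ _ _), Real.norm_eq_abs, abs_of_nonneg (sq_nonneg u)]
      rcases le_or_gt u 0 with hu0 | hu0
      · rw [flatExp_of_nonpos b s hu0]
        positivity
      · have h2 := h1 s u le_rfl (le_of_lt hu)
        have h3 : flatExp b s u = flatExp (b + 2) s u * u ^ 2 := by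
          rw [flatExp_of_pos _ _ hu0, flatExp_of_pos _ _ hu0, pow_add]
          field_simp
        rw [h3]
        exact mul_le_mul_of_nonneg_right h2 (sq_nonneg u)
    refine hO.trans_isLittleO ?_
    have := Asymptotics.isLittleO_pow_pow (𝕜 := ℝ) (m := 1) (n := 2) one_lt_two
    simpa using this
  · have h1 : flatExp b s =ᶠ[nhds t] fun t => t⁻¹ ^ b * Real.exp (-s * t⁻¹ ^ 2) := by
      filter_upwards [Ioi_mem_nhds h] with t' ht' using flatExp_of_pos b s ht'
    rw [flatExp_of_pos _ _ h, flatExp_of_pos _ _ h]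
    refine HasDerivAt.congr_of_eventuallyEq ?_ h1
    have h2 : HasDerivAt (fun t : ℝ => t⁻¹) (-(t ^ 2)⁻¹) t := hasDerivAt_inv h.ne'
    refine ((h2.fun_pow b).fun_mul ((h2.fun_pow 2).const_mul (-s)).exp).congr_deriv ?_
    cases b with
    | zero => simp; field_simp
    | succ b =>
      simp
      field_simp
      ring

/-- The size of the index of a term. -/
def size (p : ℤ × ℤ × ℤ) : ℝ := (p.1 : ℝ) ^ 2 + p.2.1 ^ 2 + p.2.2 ^ 2

lemma size_nonneg (p : ℤ × ℤ × ℤ) : 0 ≤ size p := by unfold size; positivity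

lemma exists_rate_ge (τ : ℍ) : ∃ c > 0, ∀ A m : ℤ, c * ((A : ℝ) ^ 2 + m ^ 2) ≤ rate τ A m := by
  have hv := τ.im_pos
  set K : ℝ := 2 + (2 * τ.re ^ 2 + 1) / τ.im ^ 2 with hK
  have hK0 : 0 < K := by positivity
  refine ⟨Real.pi / (K * τ.im), by positivity, fun A m => ?_⟩
  have hn : ‖(m : ℂ) - A * τ‖ ^ 2 = (m - A * τ.re) ^ 2 + (A * τ.im) ^ 2 := by
    rw [← Complex.normSq_eq_norm_sq, Complex.normSq_apply]
    simp
    ring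
  have h1 : (A : ℝ) ^ 2 + m ^ 2 ≤ K * ((m - A * τ.re) ^ 2 + (A * τ.im) ^ 2) := by
    have e : K * (A * τ.im) ^ 2 = 2 * (A * τ.im) ^ 2 + (2 * τ.re ^ 2 + 1) * A ^ 2 := by
      rw [hK, add_mul]; field_simp
    have e2 : 2 * ((m : ℝ) - A * τ.re) ^ 2 ≤ K * (m - A * τ.re) ^ 2 := by
      refine mul_le_mul_of_nonneg_right ?_ (sq_nonneg _)
      rw [hK]
      have : 0 ≤ (2 * τ.re ^ 2 + 1) / τ.im ^ 2 := by positivity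
      linarith
    rw [mul_add, e]
    nlinarith [sq_nonneg ((m : ℝ) - 2 * (A * τ.re)), sq_nonneg (A * τ.im)]
  rw [rate, hn, div_mul_eq_mul_div, div_le_div_iff₀ (by positivity) hv]
  have := mul_le_mul_of_nonneg_left h1 (show 0 ≤ Real.pi * τ.im by positivity)
  nlinarith

lemma exists_exponent_ge (h : Fin 2) (τ : ℍ) (R : ℝ) {κ : ℝ} (hκ : 0 < κ) : ∃ δ > 0, ∃ D,
    ∀ (p : ℤ × ℤ × ℤ) (x : ℝ), |x| ≤ R →
      δ * size p - D ≤ rate τ p.1 p.2.2 * κ + 2 * Real.pi * τ.im * torC h p.1 p.2.1 x ^ 2 := by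
  obtain ⟨c, hc, hr⟩ := exists_rate_ge τ
  have hv := τ.im_pos
  set l : ℝ := min (2 * Real.pi * τ.im) (κ * c / (2 * (R ^ 2 + 1))) with hl
  have hl0 : 0 < l := lt_min (by positivity) (by positivity)
  have hlR : l * R ^ 2 ≤ κ * c / 2 := by
    have h1 : l * (2 * (R ^ 2 + 1)) ≤ κ * c := by
      rw [← le_div_iff₀ (by positivity)]
      exact min_le_right _ _
    nlinarith
  refine ⟨min (κ * c / 2) (l / 3), lt_min (by positivity) (by positivity), l / 4, fun p x hx => ?_⟩
  obtain ⟨A, B, m⟩ := p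
  simp only [size]
  have h1 := hr A m
  set δ := min (κ * c / 2) (l / 3) with hδ
  have hd1 : δ ≤ κ * c / 2 := min_le_left _ _
  have hd2 : δ ≤ l / 3 := min_le_right _ _
  have hl1 : l ≤ 2 * Real.pi * τ.im := min_le_left _ _
  have ht : ((h.val : ℝ) / 2) ^ 2 ≤ 1 / 4 := by fin_cases h <;> norm_num
  have hB : (B : ℝ) = torC h A B x - (h.val : ℝ) / 2 + x * A := by rw [torC]; ring
  set t := torC h A B x
  set w : ℝ := (h.val : ℝ) / 2
  have hxA : (x * A) ^ 2 ≤ R ^ 2 * A ^ 2 := by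
    rw [mul_pow]
    exact mul_le_mul_of_nonneg_right (sq_le_sq' (by linarith [neg_abs_le x]) ((le_abs_self x).trans hx))
      (sq_nonneg _)
  have hB2 : (B : ℝ) ^ 2 ≤ 3 * (t ^ 2 + 1 / 4 + R ^ 2 * A ^ 2) := by
    rw [hB]
    nlinarith [sq_nonneg (t + w), sq_nonneg (t - x * A), sq_nonneg (w + x * A)]
  have e1 : δ * (A : ℝ) ^ 2 ≤ κ * c / 2 * A ^ 2 := mul_le_mul_of_nonneg_right hd1 (sq_nonneg _)
  have e2 : δ * (m : ℝ) ^ 2 ≤ κ * c / 2 * m ^ 2 := mul_le_mul_of_nonneg_right hd1 (sq_nonneg _)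
  have e3 : δ * (B : ℝ) ^ 2 ≤ l / 3 * B ^ 2 := mul_le_mul_of_nonneg_right hd2 (sq_nonneg _)
  have e4 : l / 3 * (B : ℝ) ^ 2 ≤ l / 3 * (3 * (t ^ 2 + 1 / 4 + R ^ 2 * A ^ 2)) :=
    mul_le_mul_of_nonneg_left hB2 (by positivity)
  have e5 : l * R ^ 2 * (A : ℝ) ^ 2 ≤ κ * c / 2 * A ^ 2 :=
    mul_le_mul_of_nonneg_right hlR (sq_nonneg _)
  have e6 : l * t ^ 2 ≤ 2 * Real.pi * τ.im * t ^ 2 := mul_le_mul_of_nonneg_right hl1 (sq_nonneg _)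
  have e7 : κ * c * ((A : ℝ) ^ 2 + m ^ 2) ≤ rate τ A m * κ := by nlinarith
  have e8 : 0 ≤ κ * c * (m : ℝ) ^ 2 := by positivity
  nlinarith

lemma norm_phase (h : Fin 2) (τ : ℍ) (A B m : ℤ) (x : ℝ) :
    ‖phase h τ A B m x‖ = Real.exp (-(2 * Real.pi * τ.im * torC h A B x ^ 2)) := by
  rw [phase, Complex.norm_exp]
  congr 1
  simp [pow_two]

/-- Coefficients of polynomial growth that vanish at the terms without decay at the cusp. -/
def PolyBdd (c : ℤ × ℤ × ℤ → ℂ) : Prop :=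
  (∀ p : ℤ × ℤ × ℤ, p.1 = 0 → p.2.2 = 0 → c p = 0) ∧
    ∃ (C : ℝ) (M : ℕ), ∀ p, ‖c p‖ ≤ C * (1 + size p) ^ M

/-- Coefficients of polynomial growth. -/
def PolyGrowth (d : ℤ × ℤ × ℤ → ℂ) : Prop :=
  ∃ (C : ℝ) (M : ℕ), ∀ p, ‖d p‖ ≤ C * (1 + size p) ^ M

lemma PolyGrowth.const (a : ℂ) : PolyGrowth fun _ => a := ⟨‖a‖, 0, fun _ => by simp⟩

lemma PolyGrowth.mul {d e : ℤ × ℤ × ℤ → ℂ} (hd : PolyGrowth d) (he : PolyGrowth e) :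
    PolyGrowth fun p => d p * e p := by
  obtain ⟨C, M, h1⟩ := hd
  obtain ⟨D, N, h2⟩ := he
  refine ⟨C * D, M + N, fun p => ?_⟩
  rw [norm_mul, pow_add]
  calc ‖d p‖ * ‖e p‖ ≤ (C * (1 + size p) ^ M) * (D * (1 + size p) ^ N) :=
        mul_le_mul (h1 p) (h2 p) (norm_nonneg _) ((norm_nonneg _).trans (h1 p))
    _ = _ := by ring

lemma PolyGrowth.add {d e : ℤ × ℤ × ℤ → ℂ} (hd : PolyGrowth d) (he : PolyGrowth e) :
    PolyGrowth fun p => d p + e p := by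
  obtain ⟨C, M, h1⟩ := hd
  obtain ⟨D, N, h2⟩ := he
  refine ⟨|C| + |D|, M + N, fun p => (norm_add_le _ _).trans ?_⟩
  have hs : 1 ≤ 1 + size p := by linarith [size_nonneg p]
  rw [add_mul]
  refine add_le_add ((h1 p).trans ?_) ((h2 p).trans ?_)
  · exact mul_le_mul (le_abs_self C) (pow_le_pow_right₀ hs (by omega)) (by positivity) (abs_nonneg C)
  · exact mul_le_mul (le_abs_self D) (pow_le_pow_right₀ hs (by omega)) (by positivity) (abs_nonneg D)

lemma PolyGrowth.of_abs_le {f : ℤ × ℤ × ℤ → ℤ} (h : ∀ p, (f p : ℝ) ^ 2 ≤ size p) :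
    PolyGrowth fun p => (f p : ℂ) := by
  refine ⟨1, 1, fun p => ?_⟩
  change ‖((f p : ℤ) : ℂ)‖ ≤ _
  rw [one_mul, pow_one, ← Complex.ofReal_intCast, Complex.norm_real, Real.norm_eq_abs]
  have := h p
  rw [← sq_abs] at this
  nlinarith [sq_nonneg (|(f p : ℝ)| - 1), abs_nonneg (f p : ℝ)]

lemma PolyGrowth.A : PolyGrowth fun p => (p.1 : ℂ) :=
  PolyGrowth.of_abs_le (f := fun p => p.1) fun p => by
    unfold size; nlinarith [sq_nonneg (p.2.1 : ℝ), sq_nonneg (p.2.2 : ℝ)]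

lemma PolyGrowth.B : PolyGrowth fun p => (p.2.1 : ℂ) :=
  PolyGrowth.of_abs_le (f := fun p => p.2.1) fun p => by
    unfold size; nlinarith [sq_nonneg (p.1 : ℝ), sq_nonneg (p.2.2 : ℝ)]

lemma PolyGrowth.m : PolyGrowth fun p => (p.2.2 : ℂ) :=
  PolyGrowth.of_abs_le (f := fun p => p.2.2) fun p => by
    unfold size; nlinarith [sq_nonneg (p.2.1 : ℝ), sq_nonneg (p.1 : ℝ)]

lemma PolyGrowth.pow {d : ℤ × ℤ × ℤ → ℂ} (hd : PolyGrowth d) (a : ℕ) :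
    PolyGrowth fun p => d p ^ a := by
  induction a with
  | zero => simpa using PolyGrowth.const 1
  | succ a ih => simpa [pow_succ] using ih.mul hd

lemma PolyBdd.mul {c d : ℤ × ℤ × ℤ → ℂ} (hd : PolyGrowth d) (hc : PolyBdd c) :
    PolyBdd fun p => d p * c p :=
  ⟨fun p h1 h2 => by change d p * c p = 0; rw [hc.1 p h1 h2, mul_zero], PolyGrowth.mul hd hc.2⟩

lemma PolyGrowth.linear (τ : ℍ) : PolyGrowth fun p => (p.2.2 : ℂ) - p.1 * τ := by
  have := PolyGrowth.m.add (PolyGrowth.A.mul (PolyGrowth.const (-(τ : ℂ))))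
  refine this.imp fun C hC => ?_
  simpa [sub_eq_add_neg] using hC

lemma PolyGrowth.linear_conj (τ : ℍ) :
    PolyGrowth fun p => (p.2.2 : ℂ) - p.1 * starRingEnd ℂ (τ : ℂ) := by
  have := PolyGrowth.m.add (PolyGrowth.A.mul (PolyGrowth.const (-(starRingEnd ℂ (τ : ℂ)))))
  refine this.imp fun C hC => ?_
  simpa [sub_eq_add_neg] using hC

lemma PolyGrowth.rate (τ : ℍ) : PolyGrowth fun p => ((rate τ p.1 p.2.2 : ℝ) : ℂ) := by
  have h := ((PolyGrowth.linear τ).mul (PolyGrowth.linear_conj τ)).mul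
    (PolyGrowth.const (Real.pi / τ.im))
  convert h using 2 with p
  have : (p.2.2 : ℂ) - p.1 * starRingEnd ℂ (τ : ℂ) = starRingEnd ℂ ((p.2.2 : ℂ) - p.1 * τ) := by
    simp
  rw [this, Complex.mul_conj, Complex.normSq_eq_norm_sq, EisLift.rate]
  push_cast
  ring

/-- The building blocks of the theta series near the cusp. -/
def cuspTerm (h : Fin 2) (τ : ℍ) (c : ℤ × ℤ × ℤ → ℂ) (e b : ℕ) (p : ℤ × ℤ × ℤ) (q : ℝ × ℝ) : ℂ :=
  c p * (q.1 : ℂ) ^ e * (flatExp b (rate τ p.1 p.2.2) q.2 : ℝ) * phase h τ p.1 p.2.1 p.2.2 q.1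

lemma one_add_pow_le (M : ℕ) {ε : ℝ} (hε : 0 < ε) : ∃ K, 0 ≤ K ∧ ∀ s : ℝ, 0 ≤ s →
    (1 + s) ^ M ≤ K * Real.exp (ε * s) := by
  refine ⟨M.factorial / ε ^ M * Real.exp ε, by positivity, fun s hs => ?_⟩
  have h2 := Real.pow_div_factorial_le_exp (ε * (1 + s)) (by positivity) M
  have h3 : (1 + s) ^ M = M.factorial / ε ^ M * ((ε * (1 + s)) ^ M / M.factorial) := by
    rw [mul_pow]; field_simp
  rw [h3, mul_assoc, ← Real.exp_add, show ε + ε * s = ε * (1 + s) by ring]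
  exact mul_le_mul_of_nonneg_left h2 (by positivity)

lemma exists_cuspTerm_le (h : Fin 2) (τ : ℍ) {c : ℤ × ℤ × ℤ → ℂ} (hc : PolyBdd c) (e b : ℕ)
    {R T : ℝ} (hR : 0 < R) (hT : 0 < T) : ∃ u : ℤ × ℤ × ℤ → ℝ, Summable u ∧
      ∀ p (q : ℝ × ℝ), |q.1| ≤ R → q.2 ≤ T → ‖cuspTerm h τ c e b p q‖ ≤ u p := by
  obtain ⟨c₀, hc₀, hr⟩ := exists_rate_ge τ
  obtain ⟨G, hG, h1⟩ := exists_flatExp_le b hc₀ hT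
  obtain ⟨δ, hδ, D, h2⟩ := exists_exponent_ge h τ R (κ := 1 / (2 * T ^ 2)) (by positivity)
  obtain ⟨hc0, C, M, h3⟩ := hc
  obtain ⟨K, hK, h4⟩ := one_add_pow_le M (half_pos hδ)
  refine ⟨fun p => |C| * K * R ^ e * G * Real.exp D * Real.exp (-(δ / 2) * size p),
    (summable_exp_neg_sq₃ (half_pos hδ)).mul_left _, fun p q hx ht => ?_⟩
  by_cases hp : p.1 = 0 ∧ p.2.2 = 0
  · rw [cuspTerm, hc0 p hp.1 hp.2]
    simp only [zero_mul, norm_zero]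
    positivity
  · have hrate : c₀ ≤ rate τ p.1 p.2.2 := by
      refine le_trans ?_ (hr p.1 p.2.2)
      have : (1 : ℝ) ≤ (p.1 : ℝ) ^ 2 + p.2.2 ^ 2 := by
        have h5 : (1 : ℤ) ≤ p.1 ^ 2 + p.2.2 ^ 2 := by
          by_contra hlt
          have h6 : p.1 ^ 2 + p.2.2 ^ 2 ≤ 0 := by omega
          have h7 : p.1 = 0 := by nlinarith [sq_nonneg p.1, sq_nonneg p.2.2]
          have h8 : p.2.2 = 0 := by nlinarith [sq_nonneg p.1, sq_nonneg p.2.2]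
          exact hp ⟨h7, h8⟩
        exact_mod_cast h5
      nlinarith
    have e1 := h1 _ q.2 hrate ht
    have e2 := h2 p q.1 hx
    have e3 : ‖c p‖ ≤ |C| * (K * Real.exp (δ / 2 * size p)) :=
      ((h3 p).trans (mul_le_mul_of_nonneg_right (le_abs_self C)
        (pow_nonneg (by linarith [size_nonneg p]) _))).trans
        (mul_le_mul_of_nonneg_left (h4 _ (size_nonneg p)) (abs_nonneg C))
    rw [cuspTerm, norm_mul, norm_mul, norm_mul, norm_pow, Complex.norm_real, Complex.norm_real,
      Real.norm_eq_abs, Real.norm_eq_abs, norm_phase, abs_of_nonneg (flatExp_nonneg _ _ _)]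
    calc _ ≤ (|C| * (K * Real.exp (δ / 2 * size p))) * R ^ e *
          (G * Real.exp (-rate τ p.1 p.2.2 / (2 * T ^ 2))) *
          Real.exp (-(2 * Real.pi * τ.im * torC h p.1 p.2.1 q.1 ^ 2)) := by
          gcongr
          exact flatExp_nonneg _ _ _
      _ = |C| * K * R ^ e * G * Real.exp (δ / 2 * size p + -rate τ p.1 p.2.2 / (2 * T ^ 2) +
          -(2 * Real.pi * τ.im * torC h p.1 p.2.1 q.1 ^ 2)) := by
          rw [Real.exp_add, Real.exp_add]; ring
      _ ≤ |C| * K * R ^ e * G * Real.exp (D + -(δ / 2) * size p) := by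
          refine mul_le_mul_of_nonneg_left (Real.exp_le_exp.2 ?_) (by positivity)
          have : -rate τ p.1 p.2.2 / (2 * T ^ 2) = -(rate τ p.1 p.2.2 * (1 / (2 * T ^ 2))) := by
            ring
          rw [this]
          linarith
      _ = _ := by rw [Real.exp_add]; ring

lemma summable_cuspTerm (h : Fin 2) (τ : ℍ) {c : ℤ × ℤ × ℤ → ℂ} (hc : PolyBdd c) (e b : ℕ)
    (q : ℝ × ℝ) : Summable fun p => cuspTerm h τ c e b p q := by
  obtain ⟨u, hu, h1⟩ := exists_cuspTerm_le h τ hc e b (R := |q.1| + 1) (T := |q.2| + 1)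
    (by positivity) (by positivity)
  exact Summable.of_norm_bounded hu fun p => h1 p q (by linarith) (by linarith [le_abs_self q.2])

/-- A real-linear map on the plane, from its components. -/
def ofComp {E : Type*} [NormedAddCommGroup E] [NormedSpace ℝ E] (u v : E) : ℝ × ℝ →L[ℝ] E :=
  (ContinuousLinearMap.fst ℝ ℝ ℝ).smulRight u + (ContinuousLinearMap.snd ℝ ℝ ℝ).smulRight v

lemma ofComp_apply {E : Type*} [NormedAddCommGroup E] [NormedSpace ℝ E] (u v : E) (w : ℝ × ℝ) :
    ofComp u v w = w.1 • u + w.2 • v := rfl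

lemma norm_ofComp_le {E : Type*} [NormedAddCommGroup E] [NormedSpace ℝ E] (u v : E) :
    ‖ofComp u v‖ ≤ ‖u‖ + ‖v‖ := by
  refine ContinuousLinearMap.opNorm_le_bound _ (by positivity) fun w => ?_
  rw [ofComp_apply]
  refine (norm_add_le _ _).trans ?_
  rw [norm_smul, norm_smul, mul_comm, add_mul, mul_comm ‖w.2‖]
  gcongr
  · exact norm_fst_le w
  · exact norm_snd_le w

lemma hasDerivAt_phase (h : Fin 2) (τ : ℍ) (A B m : ℤ) (x : ℝ) : HasDerivAt (phase h τ A B m)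
    ((4 * Real.pi * Complex.I * (m - A * τ) * torC h A B x) * phase h τ A B m x) x := by
  have h1 : HasDerivAt (fun x : ℝ => (x : ℂ)) 1 x := Complex.ofRealCLM.hasDerivAt
  have h2 : HasDerivAt (fun x : ℝ => ((torC h A B x : ℝ) : ℂ)) (-(A : ℂ)) x := by
    have : (fun x : ℝ => ((torC h A B x : ℝ) : ℂ)) =
        fun x : ℝ => ((B + (h.val : ℝ) / 2 : ℝ) : ℂ) - (x : ℂ) * A := by
      funext x; simp [torC]
    rw [this]
    simpa using (h1.mul_const (A : ℂ)).const_sub ((B + (h.val : ℝ) / 2 : ℝ) : ℂ)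
  have h3 := (((h2.fun_pow 2).const_mul (2 * Real.pi * Complex.I * τ)).fun_add
    ((((h1.const_mul 2).mul_const (((B + (h.val : ℝ) / 2 : ℝ) : ℂ))).fun_sub
      ((h1.fun_pow 2).mul_const (A : ℂ))).const_mul (2 * Real.pi * Complex.I * m))).cexp
  refine h3.congr_deriv ?_
  rw [mul_comm, phase]
  congr 1
  simp only [torC]
  push_cast
  ring

/-- The `x`-derivative of a building block. -/
def cuspTermX (h : Fin 2) (τ : ℍ) (c : ℤ × ℤ × ℤ → ℂ) (e b : ℕ) (p : ℤ × ℤ × ℤ) (q : ℝ × ℝ) : ℂ :=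
  cuspTerm h τ (fun p => (e : ℂ) * c p) (e - 1) b p q +
    cuspTerm h τ (fun p => (4 * Real.pi * Complex.I * (p.2.2 - p.1 * τ) * (p.2.1 + (h.val : ℂ) / 2)) *
      c p) e b p q +
    cuspTerm h τ (fun p => (4 * Real.pi * Complex.I * (p.2.2 - p.1 * τ) * (-p.1)) * c p) (e + 1) b p q

/-- The `t`-derivative of a building block. -/
def cuspTermT (h : Fin 2) (τ : ℍ) (c : ℤ × ℤ × ℤ → ℂ) (e b : ℕ) (p : ℤ × ℤ × ℤ) (q : ℝ × ℝ) : ℂ :=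
  cuspTerm h τ (fun p => (-b : ℂ) * c p) e (b + 1) p q +
    cuspTerm h τ (fun p => (2 * rate τ p.1 p.2.2 : ℂ) * c p) e (b + 3) p q

lemma rate_pos (τ : ℍ) {A m : ℤ} (h : ¬(A = 0 ∧ m = 0)) : 0 < rate τ A m := by
  have hv := τ.im_pos
  have : (m : ℂ) - A * τ ≠ 0 := by
    intro h0
    have h1 := congrArg Complex.im h0
    have h2 := congrArg Complex.re h0
    simp [hv.ne'] at h1
    simp [h1] at h2
    exact h ⟨h1, h2⟩
  unfold rate
  have := norm_pos_iff.2 this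
  positivity

lemma hasFDerivAt_cuspTerm (h : Fin 2) (τ : ℍ) {c : ℤ × ℤ × ℤ → ℂ} (hc : PolyBdd c) (e b : ℕ)
    (p : ℤ × ℤ × ℤ) (q : ℝ × ℝ) : HasFDerivAt (cuspTerm h τ c e b p)
      (ofComp (cuspTermX h τ c e b p q) (cuspTermT h τ c e b p q)) q := by
  by_cases hp : p.1 = 0 ∧ p.2.2 = 0
  · have h0 := hc.1 p hp.1 hp.2
    have h1 : cuspTerm h τ c e b p = fun _ => 0 := by
      funext q; simp [cuspTerm, h0]
    rw [h1]
    refine (hasFDerivAt_const (0 : ℂ) q).congr_fderiv (ContinuousLinearMap.ext fun w => ?_)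
    simp [ofComp_apply, cuspTermX, cuspTermT, cuspTerm, h0]
  · have hfst : HasFDerivAt (fun q : ℝ × ℝ => q.1) (ContinuousLinearMap.fst ℝ ℝ ℝ) q :=
      (ContinuousLinearMap.fst ℝ ℝ ℝ).hasFDerivAt
    have hsnd : HasFDerivAt (fun q : ℝ × ℝ => q.2) (ContinuousLinearMap.snd ℝ ℝ ℝ) q :=
      (ContinuousLinearMap.snd ℝ ℝ ℝ).hasFDerivAt
    have h1 : HasFDerivAt (fun q : ℝ × ℝ => ((q.1 : ℝ) : ℂ)) _ q :=
      (Complex.ofRealCLM.comp (ContinuousLinearMap.fst ℝ ℝ ℝ)).hasFDerivAt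
    have h2 : HasFDerivAt (fun q : ℝ × ℝ => (((flatExp b (rate τ p.1 p.2.2) q.2 : ℝ)) : ℂ)) _ q :=
      Complex.ofRealCLM.hasFDerivAt.comp q
        ((hasDerivAt_flatExp b (rate_pos τ hp) q.2).comp_hasFDerivAt q hsnd)
    have h3 : HasFDerivAt (fun q : ℝ × ℝ => phase h τ p.1 p.2.1 p.2.2 q.1) _ q :=
      (hasDerivAt_phase h τ p.1 p.2.1 p.2.2 q.1).hasFDerivAt.comp q hfst
    have h4 := (((h1.pow e).const_mul (c p)).fun_mul h2).fun_mul h3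
    refine h4.congr_fderiv (ContinuousLinearMap.ext fun w => ?_)
    simp [ofComp_apply, cuspTermX, cuspTermT, cuspTerm, torC]
    ring

lemma PolyBdd.x1 {c : ℤ × ℤ × ℤ → ℂ} (hc : PolyBdd c) (e : ℕ) :
    PolyBdd fun p => (e : ℂ) * c p := hc.mul (PolyGrowth.const _)

lemma PolyBdd.x2 {c : ℤ × ℤ × ℤ → ℂ} (hc : PolyBdd c) (h : Fin 2) (τ : ℍ) : PolyBdd fun p =>
    (4 * Real.pi * Complex.I * (p.2.2 - p.1 * τ) * (p.2.1 + (h.val : ℂ) / 2)) * c p :=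
  hc.mul (((PolyGrowth.const _).mul (PolyGrowth.linear τ)).mul
    (PolyGrowth.B.add (PolyGrowth.const _)))

lemma PolyBdd.x3 {c : ℤ × ℤ × ℤ → ℂ} (hc : PolyBdd c) (τ : ℍ) : PolyBdd fun p =>
    (4 * Real.pi * Complex.I * (p.2.2 - p.1 * τ) * (-p.1)) * c p := by
  refine hc.mul (((PolyGrowth.const _).mul (PolyGrowth.linear τ)).mul ?_)
  simpa using (PolyGrowth.const (-1)).mul PolyGrowth.A

lemma PolyBdd.t1 {c : ℤ × ℤ × ℤ → ℂ} (hc : PolyBdd c) (b : ℕ) :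
    PolyBdd fun p => (-b : ℂ) * c p := hc.mul (PolyGrowth.const _)

lemma PolyBdd.t2 {c : ℤ × ℤ × ℤ → ℂ} (hc : PolyBdd c) (τ : ℍ) :
    PolyBdd fun p => (2 * rate τ p.1 p.2.2 : ℂ) * c p :=
  hc.mul ((PolyGrowth.const _).mul (PolyGrowth.rate τ))

lemma exists_cuspTermXT_le (h : Fin 2) (τ : ℍ) {c : ℤ × ℤ × ℤ → ℂ} (hc : PolyBdd c) (e b : ℕ)
    {R T : ℝ} (hR : 0 < R) (hT : 0 < T) : ∃ u : ℤ × ℤ × ℤ → ℝ, Summable u ∧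
      ∀ p (q : ℝ × ℝ), |q.1| ≤ R → q.2 ≤ T →
        ‖ofComp (cuspTermX h τ c e b p q) (cuspTermT h τ c e b p q)‖ ≤ u p := by
  obtain ⟨u1, s1, b1⟩ := exists_cuspTerm_le h τ (hc.x1 e) (e - 1) b hR hT
  obtain ⟨u2, s2, b2⟩ := exists_cuspTerm_le h τ (hc.x2 h τ) e b hR hT
  obtain ⟨u3, s3, b3⟩ := exists_cuspTerm_le h τ (hc.x3 τ) (e + 1) b hR hT
  obtain ⟨u4, s4, b4⟩ := exists_cuspTerm_le h τ (hc.t1 b) e (b + 1) hR hT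
  obtain ⟨u5, s5, b5⟩ := exists_cuspTerm_le h τ (hc.t2 τ) e (b + 3) hR hT
  refine ⟨_, ((s1.add s2).add s3).add (s4.add s5), fun p q hx ht => (norm_ofComp_le _ _).trans ?_⟩
  exact add_le_add ((norm_add_le _ _).trans (add_le_add ((norm_add_le _ _).trans
    (add_le_add (b1 p q hx ht) (b2 p q hx ht))) (b3 p q hx ht)))
    ((norm_add_le _ _).trans (add_le_add (b4 p q hx ht) (b5 p q hx ht)))

lemma summable_cuspTermX (h : Fin 2) (τ : ℍ) {c : ℤ × ℤ × ℤ → ℂ} (hc : PolyBdd c) (e b : ℕ)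
    (q : ℝ × ℝ) : Summable fun p => cuspTermX h τ c e b p q :=
  ((summable_cuspTerm h τ (hc.x1 e) _ _ q).add (summable_cuspTerm h τ (hc.x2 h τ) _ _ q)).add
    (summable_cuspTerm h τ (hc.x3 τ) _ _ q)

lemma summable_cuspTermT (h : Fin 2) (τ : ℍ) {c : ℤ × ℤ × ℤ → ℂ} (hc : PolyBdd c) (e b : ℕ)
    (q : ℝ × ℝ) : Summable fun p => cuspTermT h τ c e b p q :=
  (summable_cuspTerm h τ (hc.t1 b) _ _ q).add (summable_cuspTerm h τ (hc.t2 τ) _ _ q)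

lemma hasFDerivAt_tsum_cuspTerm (h : Fin 2) (τ : ℍ) {c : ℤ × ℤ × ℤ → ℂ} (hc : PolyBdd c) (e b : ℕ)
    (q : ℝ × ℝ) : HasFDerivAt (fun q => ∑' p, cuspTerm h τ c e b p q)
      (ofComp (∑' p, cuspTermX h τ c e b p q) (∑' p, cuspTermT h τ c e b p q)) q := by
  set R := |q.1| + 1
  set T := |q.2| + 1
  obtain ⟨u, hu, h1⟩ := exists_cuspTermXT_le h τ hc e b (R := R) (T := T) (by positivity)
    (by positivity)
  have hs : IsOpen (Set.Ioo (-R) R ×ˢ Set.Iio T) := isOpen_Ioo.prod isOpen_Iio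
  have hconv : Convex ℝ (Set.Ioo (-R) R ×ˢ Set.Iio T) := (convex_Ioo _ _).prod (convex_Iio _)
  have hq : q ∈ Set.Ioo (-R) R ×ˢ Set.Iio T := by
    refine ⟨⟨?_, ?_⟩, ?_⟩
    · have := neg_abs_le q.1; simp only [R]; linarith
    · have := le_abs_self q.1; simp only [R]; linarith
    · have := le_abs_self q.2; simp only [T, Set.mem_Iio]; linarith
  have h2 := hasFDerivAt_tsum_of_isPreconnected hu hs hconv.isPreconnected
    (fun p q _ => hasFDerivAt_cuspTerm h τ hc e b p q)
    (fun p q hq => h1 p q (abs_le.2 ⟨hq.1.1.le, hq.1.2.le⟩) (le_of_lt hq.2)) hq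
    (summable_cuspTerm h τ hc e b q) hq
  refine h2.congr_fderiv (ContinuousLinearMap.ext fun w => ?_)
  have hsum : Summable fun p => ofComp (cuspTermX h τ c e b p q) (cuspTermT h τ c e b p q) :=
    Summable.of_norm_bounded hu fun p =>
      h1 p q (abs_le.2 ⟨hq.1.1.le, hq.1.2.le⟩) (le_of_lt hq.2)
  have h3 := (ContinuousLinearMap.apply ℝ ℂ w).map_tsum hsum
  simp only [ContinuousLinearMap.apply_apply] at h3
  rw [h3]
  simp only [ofComp_apply]
  have hX := summable_cuspTermX h τ hc e b q
  have hT := summable_cuspTermT h τ hc e b q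
  rw [(hX.const_smul w.1).tsum_add (hT.const_smul w.2), hX.tsum_const_smul, hT.tsum_const_smul]

lemma contDiff_ofComp {E F : Type*} [NormedAddCommGroup E] [NormedSpace ℝ E]
    [NormedAddCommGroup F] [NormedSpace ℝ F] {n : WithTop ℕ∞} {u v : F → E}
    (hu : ContDiff ℝ n u) (hv : ContDiff ℝ n v) : ContDiff ℝ n fun q => ofComp (u q) (v q) :=
  (contDiff_const.smulRight hu).add (contDiff_const.smulRight hv)

lemma contDiff_tsum_cuspTerm (h : Fin 2) (τ : ℍ) {c : ℤ × ℤ × ℤ → ℂ} (hc : PolyBdd c) (e b : ℕ) :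
    ContDiff ℝ ∞ fun q => ∑' p, cuspTerm h τ c e b p q := by
  refine contDiff_infty.2 fun n => ?_
  induction n generalizing c e b with
  | zero =>
    refine contDiff_zero.2 (continuous_iff_continuousAt.2 fun q => ?_)
    exact (hasFDerivAt_tsum_cuspTerm h τ hc e b q).continuousAt
  | succ n ih =>
    refine contDiff_succ_iff_hasFDerivAt.2 ⟨_, ?_, hasFDerivAt_tsum_cuspTerm h τ hc e b⟩
    refine contDiff_ofComp ?_ ?_
    · have : (fun q => ∑' p, cuspTermX h τ c e b p q) = fun q => _ := funext fun q =>
        (((summable_cuspTerm h τ (hc.x1 e) _ _ q).add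
          (summable_cuspTerm h τ (hc.x2 h τ) _ _ q)).tsum_add
          (summable_cuspTerm h τ (hc.x3 τ) _ _ q)).trans
          (congrArg (· + _) ((summable_cuspTerm h τ (hc.x1 e) _ _ q).tsum_add
          (summable_cuspTerm h τ (hc.x2 h τ) _ _ q)))
      rw [this]
      exact ((ih (hc.x1 e) _ _).add (ih (hc.x2 h τ) _ _)).add (ih (hc.x3 τ) _ _)
    · have : (fun q => ∑' p, cuspTermT h τ c e b p q) = fun q => _ := funext fun q =>
        (summable_cuspTerm h τ (hc.t1 b) _ _ q).tsum_add (summable_cuspTerm h τ (hc.t2 τ) _ _ q)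
      rw [this]
      exact (ih (hc.t1 b) _ _).add (ih (hc.t2 τ) _ _)

/-- Functions of the index and of `x` that can be multiplied to the building blocks without
destroying smoothness and summability. -/
def CuspNice (h : Fin 2) (τ : ℍ) (f : ℤ × ℤ × ℤ → ℝ → ℂ) : Prop :=
  ∀ c, PolyBdd c → ∀ b : ℕ,
    ContDiff ℝ ∞ (fun q : ℝ × ℝ => ∑' p, f p q.1 * cuspTerm h τ c 0 b p q) ∧
    ∀ R T : ℝ, 0 < R → 0 < T → ∃ u : ℤ × ℤ × ℤ → ℝ, Summable u ∧
      ∀ p (q : ℝ × ℝ), |q.1| ≤ R → q.2 ≤ T → ‖f p q.1 * cuspTerm h τ c 0 b p q‖ ≤ u p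

namespace CuspNice

variable {h : Fin 2} {τ : ℍ} {f g : ℤ × ℤ × ℤ → ℝ → ℂ}

lemma summable (hf : CuspNice h τ f) {c : ℤ × ℤ × ℤ → ℂ} (hc : PolyBdd c) (b : ℕ) (q : ℝ × ℝ) :
    Summable fun p => f p q.1 * cuspTerm h τ c 0 b p q := by
  obtain ⟨u, hu, h1⟩ := (hf c hc b).2 (|q.1| + 1) (|q.2| + 1) (by positivity) (by positivity)
  exact Summable.of_norm_bounded hu fun p => h1 p q (by linarith) (by linarith [le_abs_self q.2])

lemma one : CuspNice h τ fun _ _ => 1 := by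
  intro c hc b
  simp only [one_mul]
  exact ⟨contDiff_tsum_cuspTerm h τ hc 0 b, fun R T hR hT => exists_cuspTerm_le h τ hc 0 b hR hT⟩

lemma add (hf : CuspNice h τ f) (hg : CuspNice h τ g) : CuspNice h τ fun p x => f p x + g p x := by
  intro c hc b
  refine ⟨?_, fun R T hR hT => ?_⟩
  · convert (hf c hc b).1.add (hg c hc b).1 using 2 with q
    rw [← (hf.summable hc b q).tsum_add (hg.summable hc b q)]
    exact tsum_congr fun p => add_mul _ _ _
  · obtain ⟨u, hu, h1⟩ := (hf c hc b).2 R T hR hT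
    obtain ⟨w, hw, h2⟩ := (hg c hc b).2 R T hR hT
    refine ⟨_, hu.add hw, fun p q hx ht => ?_⟩
    rw [add_mul]
    exact (norm_add_le _ _).trans (add_le_add (h1 p q hx ht) (h2 p q hx ht))

lemma mul_const (hf : CuspNice h τ f) {d : ℤ × ℤ × ℤ → ℂ} (hd : PolyGrowth d) :
    CuspNice h τ fun p x => d p * f p x := by
  intro c hc b
  have e : ∀ p (q : ℝ × ℝ), d p * f p q.1 * cuspTerm h τ c 0 b p q =
      f p q.1 * cuspTerm h τ (fun p => d p * c p) 0 b p q := by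
    intro p q; simp only [cuspTerm]; ring
  simp only [e]
  exact hf _ (hc.mul hd) b

lemma mul_x (hf : CuspNice h τ f) : CuspNice h τ fun p x => (x : ℂ) * f p x := by
  intro c hc b
  refine ⟨?_, fun R T hR hT => ?_⟩
  · have h1 : ContDiff ℝ ∞ fun q : ℝ × ℝ => ((q.1 : ℝ) : ℂ) :=
      Complex.ofRealCLM.contDiff.comp contDiff_fst
    have h2 : (fun q : ℝ × ℝ => ∑' p, (q.1 : ℂ) * f p q.1 * cuspTerm h τ c 0 b p q) =
        fun q => (q.1 : ℂ) * ∑' p, f p q.1 * cuspTerm h τ c 0 b p q := by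
      funext q
      rw [← tsum_mul_left]
      exact tsum_congr fun p => mul_assoc _ _ _
    rw [h2]
    exact h1.mul (hf c hc b).1
  · obtain ⟨u, hu, h1⟩ := (hf c hc b).2 R T hR hT
    refine ⟨_, hu.mul_left R, fun p q hx ht => ?_⟩
    rw [mul_assoc, norm_mul, Complex.norm_real, Real.norm_eq_abs]
    exact mul_le_mul hx (h1 p q hx ht) (norm_nonneg _) hR.le

lemma eval_torC (r : ℝ) (P : Polynomial ℝ) :
    CuspNice h τ fun p x => ((P.eval (r * torC h p.1 p.2.1 x) : ℝ) : ℂ) := by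
  induction P using Polynomial.induction_on' with
  | add P Q hP hQ => simpa only [Polynomial.eval_add, Complex.ofReal_add] using hP.add hQ
  | monomial m a =>
    have hm : CuspNice h τ fun p x => (((r * torC h p.1 p.2.1 x) ^ m : ℝ) : ℂ) := by
      induction m with
      | zero => simpa using CuspNice.one
      | succ m ih =>
        have h1 := (ih.mul_const ((PolyGrowth.const (r : ℂ)).mul
          (PolyGrowth.B.add (PolyGrowth.const ((h.val : ℂ) / 2))))).add
          ((ih.mul_const ((PolyGrowth.const (-r : ℂ)).mul PolyGrowth.A)).mul_x)
        convert h1 using 3 with p x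
        simp only [torC]
        push_cast
        ring
    simpa only [Polynomial.eval_monomial, Complex.ofReal_mul] using
      hm.mul_const (PolyGrowth.const (a : ℂ))

end CuspNice

/-- Functions on the half plane that extend, together with all multiples by powers of `y = 1/t`,
smoothly and by zero to the boundary `t = 0`. -/
def Flat (f : ℝ × ℝ → ℂ) : Prop :=
  ∀ j : ℕ, ∃ F : ℝ × ℝ → ℂ, ContDiff ℝ ∞ F ∧ (∀ q : ℝ × ℝ, 0 < q.2 → F q = (q.2⁻¹ : ℂ) ^ j * f q) ∧
    ∀ x, F (x, 0) = 0

namespace Flat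

variable {f g : ℝ × ℝ → ℂ}

lemma zero : Flat fun _ => 0 := fun _ => ⟨fun _ => 0, contDiff_const, by simp, by simp⟩

lemma add (hf : Flat f) (hg : Flat g) : Flat fun q => f q + g q := by
  intro j
  obtain ⟨F, h1, h2, h3⟩ := hf j
  obtain ⟨G, h4, h5, h6⟩ := hg j
  exact ⟨_, h1.add h4, fun q hq => by rw [h2 q hq, h5 q hq, mul_add], fun x => by
    rw [h3, h6, add_zero]⟩

lemma sum {ι : Type*} (s : Finset ι) {f : ι → ℝ × ℝ → ℂ} (hf : ∀ i ∈ s, Flat (f i)) :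
    Flat fun q => ∑ i ∈ s, f i q := by
  classical
  induction s using Finset.induction_on with
  | empty => simpa using Flat.zero
  | insert i s hi ih =>
    simp only [Finset.sum_insert hi]
    exact (hf i (Finset.mem_insert_self i s)).add
      (ih fun j hj => hf j (Finset.mem_insert_of_mem hj))

lemma mul (hf : Flat f) {c : ℝ × ℝ → ℂ} (hc : ContDiff ℝ ∞ c) : Flat fun q => c q * f q := by
  intro j
  obtain ⟨F, h1, h2, h3⟩ := hf j
  exact ⟨_, hc.mul h1, fun q hq => by rw [h2 q hq]; ring, fun x => by rw [h3, mul_zero]⟩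

lemma mul_inv (hf : Flat f) : Flat fun q => (q.2⁻¹ : ℂ) * f q := by
  intro j
  obtain ⟨F, h1, h2, h3⟩ := hf (j + 1)
  exact ⟨F, h1, fun q hq => by rw [h2 q hq, pow_succ, mul_assoc], h3⟩

end Flat

/-- The indicator of the terms that decay at the cusp. -/
def decays (p : ℤ × ℤ × ℤ) : ℂ := if p.1 = 0 ∧ p.2.2 = 0 then 0 else 1

/-- The coefficients that do not depend on the point. -/
def mixC (a : ℕ) (τ : ℍ) (p : ℤ × ℤ × ℤ) : ℂ := linC τ p.1 p.2.2 ^ a / √τ.im * decays p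

lemma polyBdd_mixC (a : ℕ) (τ : ℍ) : PolyBdd (mixC a τ) := by
  refine ⟨fun p h1 h2 => by simp [mixC, decays, h1, h2], ?_⟩
  have hd : PolyGrowth decays := ⟨1, 0, fun p => by
    unfold decays; split_ifs <;> simp⟩
  have h1 : PolyGrowth fun p => linC τ p.1 p.2.2 := by
    have := ((PolyGrowth.const (-Complex.I * √2)).mul (PolyGrowth.linear_conj τ)).mul
      (PolyGrowth.const (((√τ.im : ℝ) : ℂ)⁻¹))
    exact this
  have := ((h1.pow a).mul (PolyGrowth.const (((√τ.im : ℝ) : ℂ)⁻¹))).mul hd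
  exact this

lemma cuspChart_re (q : ℝ × ℝ) : (cuspChart q).re = q.1 := by
  simp [cuspChart, Complex.div_ofReal_re]

lemma cuspChart_im (q : ℝ × ℝ) : (cuspChart q).im = q.2⁻¹ := by
  simp [cuspChart, Complex.div_ofReal_im]

lemma mixTerm_cuspChart (a b j : ℕ) (h : Fin 2) (τ : ℍ) (p : ℤ × ℤ × ℤ) {q : ℝ × ℝ} (hq : 0 < q.2) :
    (q.2⁻¹ : ℂ) ^ j * (mixTerm a b h τ (cuspChart q) p * decays p) =
      (((hp b).eval (√τ.im * √2 * torC h p.1 p.2.1 q.1) : ℝ) : ℂ) *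
        cuspTerm h τ (mixC a τ) 0 (j + a + 1) p q := by
  rw [mixTerm, cuspTerm, flatExp_of_pos _ _ hq, cuspChart_re, cuspChart_im, mixC]
  push_cast
  ring

/-- The part of the theta series that decays at the cusp is smooth and flat at the boundary. -/
lemma flat_tsum_mixTerm (a b : ℕ) (h : Fin 2) (τ : ℍ) :
    Flat fun q => ∑' p, mixTerm a b h τ (cuspChart q) p * decays p := by
  intro j
  refine ⟨_, (CuspNice.eval_torC (h := h) (τ := τ) (√τ.im * √2) (hp b) _ (polyBdd_mixC a τ)
    (j + a + 1)).1, fun q hq => ?_, fun x => ?_⟩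
  · rw [← tsum_mul_left]
    exact tsum_congr fun p => (mixTerm_cuspChart a b j h τ p hq).symm
  · simp [cuspTerm, flatExp_of_nonpos]

lemma exists_mixTerm_le (a b : ℕ) (h : Fin 2) (τ : ℍ) {R y₀ : ℝ} (hR : 0 < R) (hy : 0 < y₀) :
    ∃ u : ℤ × ℤ × ℤ → ℝ, Summable u ∧ ∀ p (z : ℂ), |z.re| ≤ R → y₀ ≤ z.im →
      ‖mixTerm a b h τ z p * decays p‖ ≤ u p := by
  obtain ⟨u, hu, h1⟩ := (CuspNice.eval_torC (h := h) (τ := τ) (√τ.im * √2) (hp b) _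
    (polyBdd_mixC a τ) (0 + a + 1)).2 R y₀⁻¹ hR (by positivity)
  refine ⟨u, hu, fun p z hx hz => ?_⟩
  have hz0 : 0 < z.im := hy.trans_le hz
  have h2 := h1 p (z.re, z.im⁻¹) hx (by simpa using inv_anti₀ hy hz)
  rw [← mixTerm_cuspChart a b 0 h τ p (q := (z.re, z.im⁻¹)) (inv_pos.2 hz0), pow_zero, one_mul] at h2
  have h3 : cuspChart (z.re, z.im⁻¹) = z := by
    apply Complex.ext
    · rw [cuspChart_re]
    · rw [cuspChart_im, inv_inv]
  rwa [h3] at h2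

/-! ### Closedness of the terms of the mixed model -/

open Polynomial in
/-- The linear functional on polynomials that takes `X ^ n` to `F n`. -/
def umbral (F : ℕ → ℂ) : ℂ[X] →ₗ[ℂ] ℂ := Polynomial.lsum fun n => F n • LinearMap.id

lemma umbral_X_pow (F : ℕ → ℂ) (n : ℕ) : umbral F (Polynomial.X ^ n) = F n := by
  rw [umbral, Polynomial.lsum_apply, Polynomial.X_pow_eq_monomial, Polynomial.sum_monomial_index]
  · simp
  · simp

lemma umbral_C_mul (F : ℕ → ℂ) (a : ℂ) (P : Polynomial ℂ) :
    umbral F (Polynomial.C a * P) = a * umbral F P := by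
  rw [← Polynomial.smul_eq_C_mul, map_smul, smul_eq_mul]

lemma umbral_ext {L : Polynomial ℂ →ₗ[ℂ] ℂ} {F : ℕ → ℂ}
    (h : ∀ n, L (Polynomial.X ^ n) = F n) (P : Polynomial ℂ) : L P = umbral F P := by
  have : L = umbral F := by
    refine Polynomial.lhom_ext' fun n => LinearMap.ext_ring ?_
    change L (Polynomial.monomial n 1) = umbral F (Polynomial.monomial n 1)
    rw [← Polynomial.X_pow_eq_monomial, h, umbral_X_pow]
  rw [this]

/-- The product rule for the umbral functional of a product of linear polynomials. -/
lemma exists_hasFDerivAt_umbral {ι : Type*} [DecidableEq ι] (s : Finset ι) {F : ℕ → ℂ → ℂ}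
    {F' : ℕ → ℂ →L[ℝ] ℂ} {a b : ι → ℂ → ℂ} {a' b' : ι → ℂ →L[ℝ] ℂ} {z : ℂ}
    (hF : ∀ n, HasFDerivAt (F n) (F' n) z) (ha : ∀ l, HasFDerivAt (a l) (a' l) z)
    (hb : ∀ l, HasFDerivAt (b l) (b' l) z) (Q : Polynomial ℂ) : ∃ D : ℂ →L[ℝ] ℂ,
    HasFDerivAt (fun z => umbral (fun n => F n z)
      (Q * ∏ l ∈ s, (Polynomial.C (a l z) + Polynomial.C (b l z) * Polynomial.X))) D z ∧
    ∀ w, D w = umbral (fun n => F' n w)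
      (Q * ∏ l ∈ s, (Polynomial.C (a l z) + Polynomial.C (b l z) * Polynomial.X)) +
      umbral (fun n => F n z) (Q * ∑ l ∈ s, (Polynomial.C (a' l w) +
        Polynomial.C (b' l w) * Polynomial.X) *
        ∏ j ∈ s.erase l, (Polynomial.C (a j z) + Polynomial.C (b j z) * Polynomial.X)) := by
  induction s using Finset.induction_on generalizing Q with
  | empty =>
    simp only [Finset.prod_empty, mul_one, Finset.sum_empty, mul_zero, map_zero, add_zero]
    induction Q using Polynomial.induction_on' with
    | add P Q hP hQ =>
      obtain ⟨D, h1, h2⟩ := hP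
      obtain ⟨E, h3, h4⟩ := hQ
      refine ⟨D + E, ?_, fun w => ?_⟩
      · simpa only [map_add] using h1.fun_add h3
      · rw [add_apply, h2, h4, map_add]
    | monomial n c =>
      have e : ∀ G : ℕ → ℂ, umbral G (Polynomial.monomial n c) = c * G n := fun G => by
        rw [← Polynomial.C_mul_X_pow_eq_monomial, umbral_C_mul, umbral_X_pow]
      simp only [e]
      exact ⟨c • F' n, (hF n).const_mul c, fun w => rfl⟩
  | insert i s hi ih =>
    obtain ⟨D, h1, h2⟩ := ih Q
    obtain ⟨E, h3, h4⟩ := ih (Q * Polynomial.X)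
    have e : ∀ (G : ℕ → ℂ) (u v : ℂ) (P : Polynomial ℂ),
        umbral G (Q * ((Polynomial.C u + Polynomial.C v * Polynomial.X) * P)) =
          u * umbral G (Q * P) + v * umbral G (Q * Polynomial.X * P) := by
      intro G u v P
      rw [← umbral_C_mul, ← umbral_C_mul, ← map_add]
      congr 1
      ring
    have hsum : ∀ w, ∑ l ∈ insert i s, (Polynomial.C (a' l w) +
        Polynomial.C (b' l w) * Polynomial.X) * ∏ j ∈ (insert i s).erase l,
          (Polynomial.C (a j z) + Polynomial.C (b j z) * Polynomial.X) =
        (Polynomial.C (a' i w) + Polynomial.C (b' i w) * Polynomial.X) *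
          ∏ j ∈ s, (Polynomial.C (a j z) + Polynomial.C (b j z) * Polynomial.X) +
        (Polynomial.C (a i z) + Polynomial.C (b i z) * Polynomial.X) *
          ∑ l ∈ s, (Polynomial.C (a' l w) + Polynomial.C (b' l w) * Polynomial.X) *
            ∏ j ∈ s.erase l, (Polynomial.C (a j z) + Polynomial.C (b j z) * Polynomial.X) := by
      intro w
      rw [Finset.sum_insert hi, Finset.erase_insert hi, Finset.mul_sum]
      congr 1
      refine Finset.sum_congr rfl fun l hl => ?_
      have hil : i ≠ l := fun h => hi (h ▸ hl)
      rw [Finset.erase_insert_of_ne hil, Finset.prod_insert fun h => hi (Finset.mem_of_mem_erase h)]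
      ring
    have h5 := ((ha i).fun_mul h1).fun_add ((hb i).fun_mul h3)
    refine ⟨_, h5.congr_of_eventuallyEq (Filter.Eventually.of_forall fun z => ?_), fun w => ?_⟩
    · simp only [Finset.prod_insert hi, e]
    · simp only [add_apply, smul_apply, smul_eq_mul,
        hsum, Finset.prod_insert hi, e, h2, h4, mul_add, map_add]
      ring

/-- The factor of the mixed model that belongs to the Hermite polynomial of the torus. -/
def mixF (h : Fin 2) (τ : ℍ) (p : ℤ × ℤ × ℤ) (j : ℕ) (z : ℂ) : ℂ :=
  ((hp j).eval (√τ.im * √2 * torC h p.1 p.2.1 z.re) : ℝ) *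
    (Real.exp (-rate τ p.1 p.2.2 * z.im ^ 2) : ℝ) * phase h τ p.1 p.2.1 p.2.2 z.re

lemma mixTerm_eq (a b : ℕ) (h : Fin 2) (τ : ℍ) (z : ℂ) (p : ℤ × ℤ × ℤ) : mixTerm a b h τ z p =
    z.im / √τ.im * (linC τ p.1 p.2.2 * z.im) ^ a * mixF h τ p b z := by
  rw [mixTerm, mixF]; ring

/-- A real-linear map on `ℂ`, from its values at `1` and `i`. -/
def ofReIm {E : Type*} [NormedAddCommGroup E] [NormedSpace ℝ E] (u v : E) : ℂ →L[ℝ] E :=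
  Complex.reCLM.smulRight u + Complex.imCLM.smulRight v

lemma ofReIm_apply {E : Type*} [NormedAddCommGroup E] [NormedSpace ℝ E] (u v : E) (w : ℂ) :
    ofReIm u v w = w.re • u + w.im • v := rfl

lemma hasFDerivAt_mixF (h : Fin 2) (τ : ℍ) (p : ℤ × ℤ × ℤ) (j : ℕ) (z : ℂ) :
    HasFDerivAt (mixF h τ p j) (ofReIm
      (-linC τ p.1 p.2.2 * j * mixF h τ p (j - 1) z +
        Real.pi * starRingEnd ℂ (linC τ p.1 p.2.2) * mixF h τ p (j + 1) z)
      (-Real.pi * z.im * (linC τ p.1 p.2.2 * starRingEnd ℂ (linC τ p.1 p.2.2)) *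
        mixF h τ p j z)) z := by
  obtain ⟨A, B, m⟩ := p
  have hv := τ.im_pos
  have hsv : ((√τ.im : ℝ) : ℂ) ≠ 0 := by exact_mod_cast (Real.sqrt_pos.2 hv).ne'
  have hvC : (τ.im : ℂ) ≠ 0 := by exact_mod_cast hv.ne'
  have hvvC : ((√τ.im : ℝ) : ℂ) ^ 2 = τ.im := by exact_mod_cast Real.sq_sqrt hv.le
  have h2C : ((√2 : ℝ) : ℂ) ^ 2 = 2 := by exact_mod_cast Real.sq_sqrt (by norm_num : (0 : ℝ) ≤ 2)
  have hpi : (Real.pi : ℂ) ≠ 0 := by exact_mod_cast Real.pi_ne_zero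
  have hτ : (τ : ℂ) = τ.re + τ.im * Complex.I := (Complex.re_add_im _).symm
  have hre : HasFDerivAt (fun z : ℂ => z.re) Complex.reCLM z := Complex.reCLM.hasFDerivAt
  have him : HasFDerivAt (fun z : ℂ => z.im) Complex.imCLM z := Complex.imCLM.hasFDerivAt
  have h1 : HasFDerivAt (fun z : ℂ => √τ.im * √2 * torC h A B z.re) _ z :=
    ((hre.mul_const (A : ℝ)).const_sub ((B : ℝ) + (h.val : ℝ) / 2)).const_mul (√τ.im * √2)
  have h2 : HasFDerivAt (fun z : ℂ => (((hp j).eval (√τ.im * √2 * torC h A B z.re) : ℝ) : ℂ)) _ z :=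
    Complex.ofRealCLM.hasFDerivAt.comp z (((hp j).hasDerivAt _).comp_hasFDerivAt z h1)
  have h3 : HasFDerivAt (fun z : ℂ => ((Real.exp (-rate τ A m * z.im ^ 2) : ℝ) : ℂ)) _ z :=
    Complex.ofRealCLM.hasFDerivAt.comp z (((him.pow 2).const_mul (-rate τ A m)).exp)
  have h4 : HasFDerivAt (fun z : ℂ => phase h τ A B m z.re) _ z :=
    (hasDerivAt_phase h τ A B m z.re).hasFDerivAt.comp z hre
  have h5 := (h2.fun_mul h3).fun_mul h4
  have hrec : (hp (j + 1)).eval (√τ.im * √2 * torC h A B z.re) =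
      2 * (√τ.im * √2 * torC h A B z.re) * (hp j).eval (√τ.im * √2 * torC h A B z.re) -
        j / Real.pi * (hp (j - 1)).eval (√τ.im * √2 * torC h A B z.re) := by
    rw [hp_succ, derivative_hp']
    simp only [Polynomial.eval_sub, Polynomial.eval_mul, Polynomial.eval_C, Polynomial.eval_X]
    field_simp
  have hconj : starRingEnd ℂ (linC τ A m) = Complex.I * √2 * (m - A * τ) / √τ.im := by
    simp [linC]
  have hn : (linC τ A m) * starRingEnd ℂ (linC τ A m) = 2 * (rate τ A m / Real.pi : ℝ) := by
    have e : (m : ℂ) - A * starRingEnd ℂ (τ : ℂ) = starRingEnd ℂ ((m : ℂ) - A * τ) := by simp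
    have e2 : ((rate τ A m / Real.pi : ℝ) : ℂ) = ((m : ℂ) - A * τ) *
        starRingEnd ℂ ((m : ℂ) - A * τ) / τ.im := by
      rw [Complex.mul_conj, Complex.normSq_eq_norm_sq, rate]
      push_cast
      field_simp
    rw [hconj, e2, linC, ← e, ← hvvC]
    field_simp
    rw [h2C]
    linear_combination (-2 * ((m : ℂ) - A * τ) * (m - A * starRingEnd ℂ (τ : ℂ))) * Complex.I_sq
  have hsum : linC τ A m + starRingEnd ℂ (linC τ A m) = 2 * √2 * √τ.im * A := by
    rw [hconj, linC, hτ]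
    simp only [map_add, map_mul, Complex.conj_ofReal, Complex.conj_I]
    field_simp
    rw [hvvC]
    linear_combination (-2 * (A : ℂ) * τ.im) * Complex.I_sq
  have hpc : starRingEnd ℂ (linC τ A m) * (√τ.im * √2) = 2 * Complex.I * (m - A * τ) := by
    rw [hconj]
    field_simp
    rw [h2C]
    ring
  refine h5.congr_fderiv (ContinuousLinearMap.ext fun w => ?_)
  rw [hn]
  simp [ofReIm_apply, mixF, derivative_hp', hrec]
  have hpp : (Real.pi : ℂ) * (Real.pi : ℂ)⁻¹ = 1 := mul_inv_cancel₀ hpi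
  generalize (((hp j).eval (√τ.im * √2 * torC h A B z.re) : ℝ) : ℂ) = P
  generalize (((hp (j - 1)).eval (√τ.im * √2 * torC h A B z.re) : ℝ) : ℂ) = P'
  generalize Complex.exp (-(↑(rate τ A m) * ↑z.im ^ 2)) = E
  generalize phase h τ A B m z.re = u
  linear_combination (-(2 * Real.pi * w.re * torC h A B z.re * P * E * u) : ℂ) * hpc +
    (w.re * j * P' * E * u : ℂ) * hsum +
    (w.re * starRingEnd ℂ (linC τ A m) * j * P' * E * u +
      2 * rate τ A m * z.im * w.im * P * E * u : ℂ) * hpp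

/-- A form with components `U dy - W dx` is closed if `∂U/∂x + ∂W/∂y = 0`. -/
lemma isClosed1_of_hasFDerivAt {k : ℕ} {U W : ℂ → Tens k} {U' W' : ℂ → ℂ →L[ℝ] Tens k}
    (hU : ∀ z ∈ UHP, HasFDerivAt U (U' z) z) (hW : ∀ z ∈ UHP, HasFDerivAt W (W' z) z)
    (h : ∀ z ∈ UHP, U' z 1 + W' z Complex.I = 0) :
    IsClosed1 fun z => ofReIm (-W z) (U z) := by
  intro z hz v w
  have h1 : HasFDerivAt (fun z => ofReIm (-W z) (U z)) _ z :=
    (((ContinuousLinearMap.smulRightL ℝ ℂ (Tens k) Complex.reCLM).hasFDerivAt.comp z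
      (hW z hz).neg).add
      ((ContinuousLinearMap.smulRightL ℝ ℂ (Tens k) Complex.imCLM).hasFDerivAt.comp z (hU z hz)))
  rw [h1.fderiv]
  have e : ∀ (D : ℂ →L[ℝ] Tens k) (v : ℂ), D v = v.re • D 1 + v.im • D Complex.I := by
    intro D v
    rw [← map_smul, ← map_smul, ← map_add]
    congr 1
    apply Complex.ext <;> simp
  have h2 : U' z 1 = -W' z Complex.I := eq_neg_of_add_eq_zero_left (h z hz)
  have h3 : ∀ (c : ℂ →L[ℝ] ℝ) (D : ℂ →L[ℝ] Tens k) (x y : ℂ),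
      ((ContinuousLinearMap.smulRightL ℝ ℂ (Tens k)) c ∘SL D) x y = c y • D x :=
    fun _ _ _ _ => rfl
  simp only [add_apply, h3, neg_apply,
    Complex.reCLM_apply, Complex.imCLM_apply]
  rw [e (W' z) v, e (W' z) w, e (U' z) v, e (U' z) w, h2]
  module

/-- The terms of the theta series in the mixed model, before projection to harmonic tensors. -/
def mixForm (k : ℕ) (h : Fin 2) (τ : ℍ) (p : ℤ × ℤ × ℤ) : Form1 k := fun z =>
  ∑ α : Fin 2, ∑ β : Fin k → Fin 2, mixTerm (deg 0 α β) (deg 1 α β) h τ z p •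
    (coframe z α).smulRight (act k (gMat z) (basisT β))

/-- The entries of `Ad (g_z)`. -/
def frameC (j d : Fin 3) (z : ℂ) : ℝ :=
  !![(z.im + 1 / z.im - z.re ^ 2 / z.im) / 2, -z.re, (z.im + z.re ^ 2 / z.im - 1 / z.im) / 2;
    z.re / z.im, 1, -(z.re / z.im);
    (z.im - z.re ^ 2 / z.im - 1 / z.im) / 2, -z.re,
      (z.im + z.re ^ 2 / z.im + 1 / z.im) / 2] d j

lemma Ad_gMat {z : ℂ} (hz : z ∈ UHP) (d j : Fin 3) : Ad (gMat z) d j = frameC j d z := by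
  have hy : 0 < z.im := hz
  have hs0 : 0 < √z.im := Real.sqrt_pos.2 hy
  have hss : √z.im * √z.im = z.im := Real.mul_self_sqrt hy.le
  have e1 : √z.im * (z.re / √z.im) = z.re := by field_simp
  have e2 : z.re / √z.im * (z.re / √z.im) = z.re ^ 2 / z.im := by
    rw [div_mul_div_comm, hss, pow_two]
  have e3 : 1 / √z.im * (1 / √z.im) = 1 / z.im := by rw [div_mul_div_comm, hss, one_mul]
  have e4 : z.re / √z.im * (1 / √z.im) = z.re / z.im := by rw [div_mul_div_comm, hss, mul_one]
  have e5 : √z.im * (1 / √z.im) = 1 := by field_simp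
  rw [Ad_eq_adPoly (det_gMat hz), adPoly_apply]
  have g00 : gMat z 0 0 = √z.im := rfl
  have g01 : gMat z 0 1 = z.re / √z.im := rfl
  have g10 : gMat z 1 0 = 0 := rfl
  have g11 : gMat z 1 1 = 1 / √z.im := rfl
  rw [g00, g01, g10, g11]
  simp only [hss, e1, e2, e3, e4, e5, zero_mul, mul_zero, frameC]
  fin_cases d <;> fin_cases j <;> simp

lemma prod_umbral {k : ℕ} (F : ℕ → ℂ) (c : ℂ) (a b : Fin k → ℂ) (j : ℕ) :
    ∑ β : Fin k → Fin 2, c ^ cnt 0 β * F (j + cnt 1 β) * ∏ i, (if β i = 0 then a i else b i) =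
      umbral F (Polynomial.X ^ j *
        ∏ i, (Polynomial.C (c * a i) + Polynomial.C (b i) * Polynomial.X)) := by
  have h1 : ∀ i, Polynomial.C (c * a i) + Polynomial.C (b i) * Polynomial.X =
      ∑ e : Fin 2, if e = 0 then Polynomial.C (c * a i) else Polynomial.C (b i) * Polynomial.X := by
    intro i; simp [Fin.sum_univ_two]
  simp only [h1]
  rw [Finset.prod_univ_sum, Finset.mul_sum, map_sum, Fintype.piFinset_univ]
  refine Finset.sum_congr rfl fun β _ => ?_
  have h2 : Polynomial.X ^ j * ∏ i, (if β i = 0 then Polynomial.C (c * a i) else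
      Polynomial.C (b i) * Polynomial.X) = Polynomial.C (c ^ cnt 0 β *
        ∏ i, (if β i = 0 then a i else b i)) * Polynomial.X ^ (j + cnt 1 β) := by
    rw [pow_add, cnt, cnt, ← Finset.prod_pow_eq_pow_sum, ← Finset.prod_pow_eq_pow_sum,
      ← Finset.prod_mul_distrib, map_prod, mul_left_comm, ← Finset.prod_mul_distrib]
    congr 1
    refine Finset.prod_congr rfl fun i _ => ?_
    generalize β i = e
    fin_cases e <;> simp
  rw [h2, umbral_C_mul, umbral_X_pow]
  ring

/-- The components `U` of the term `U dy - W dx` of the mixed model. -/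
def mixU (k : ℕ) (h : Fin 2) (τ : ℍ) (p : ℤ × ℤ × ℤ) (z : ℂ) : Tens k := fun δ =>
  linC τ p.1 p.2.2 * z.im * umbral (fun n => mixF h τ p n z) (Polynomial.X ^ 0 *
    ∏ i, (Polynomial.C (linC τ p.1 p.2.2 * z.im * frameC 0 (δ i) z) +
      Polynomial.C ((frameC 1 (δ i) z : ℝ) : ℂ) * Polynomial.X))

/-- The components `W` of the term `U dy - W dx` of the mixed model. -/
def mixW (k : ℕ) (h : Fin 2) (τ : ℍ) (p : ℤ × ℤ × ℤ) (z : ℂ) : Tens k := fun δ =>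
  umbral (fun n => mixF h τ p n z) (Polynomial.X ^ 1 *
    ∏ i, (Polynomial.C (linC τ p.1 p.2.2 * z.im * frameC 0 (δ i) z) +
      Polynomial.C ((frameC 1 (δ i) z : ℝ) : ℂ) * Polynomial.X))

lemma act_gMat_basisT {k : ℕ} {z : ℂ} (hz : z ∈ UHP) (β : Fin k → Fin 2) (δ : Fin k → Fin 3) :
    act k (gMat z) (basisT β) δ = ∏ i, (if β i = 0 then ((frameC 0 (δ i) z : ℝ) : ℂ) else
      ((frameC 1 (δ i) z : ℝ) : ℂ)) := by
  rw [act_apply, Finset.sum_eq_single fun i => (β i).castSucc]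
  · rw [basisT, Pi.single_eq_same, mul_one]
    have h1 : ∀ (c : Fin 2) (d : Fin 3), ((Ad (gMat z) d c.castSucc : ℝ) : ℂ) =
        if c = 0 then ((frameC 0 d z : ℝ) : ℂ) else ((frameC 1 d z : ℝ) : ℂ) := by
      intro c d
      rw [Ad_gMat hz]
      fin_cases c <;> simp
    exact Finset.prod_congr rfl fun i _ => h1 (β i) (δ i)
  · intro b _ hb
    rw [basisT, Pi.single_eq_of_ne hb, mul_zero]
  · simp

lemma mixForm_eq (k : ℕ) (h : Fin 2) (τ : ℍ) (p : ℤ × ℤ × ℤ) {z : ℂ} (hz : z ∈ UHP) :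
    mixForm k h τ p z =
      (1 / √τ.im : ℂ) • ofReIm (-mixW k h τ p z) (mixU k h τ p z) := by
  have hy : (z.im : ℂ) ≠ 0 := by exact_mod_cast (show 0 < z.im from hz).ne'
  refine ContinuousLinearMap.ext fun v => ?_
  funext δ
  have hs : ∀ s : (Fin k → Fin 2) → ℂ →L[ℝ] Tens k, (∑ x, s x) v δ = ∑ x, s x v δ := by
    intro s
    rw [sum_apply, Finset.sum_apply]
  have ht : ∀ (c : ℂ) (l : ℂ →L[ℝ] ℝ) (T : Tens k), (c • l.smulRight T) v δ = c * (l v * T δ) :=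
    fun c l T => rfl
  rw [mixForm, Fin.sum_univ_two]
  change (∑ x, _ : ℂ →L[ℝ] Tens k) v δ + (∑ x, _ : ℂ →L[ℝ] Tens k) v δ =
    (1 / √τ.im : ℂ) * (v.re * -(mixW k h τ p z δ) + v.im * mixU k h τ p z δ)
  rw [hs, hs, mixU, mixW, ← prod_umbral (fun n => mixF h τ p n z) (linC τ p.1 p.2.2 * z.im)
    (fun i => ((frameC 0 (δ i) z : ℝ) : ℂ)) (fun i => ((frameC 1 (δ i) z : ℝ) : ℂ)) 0,
    ← prod_umbral (fun n => mixF h τ p n z) (linC τ p.1 p.2.2 * z.im)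
    (fun i => ((frameC 0 (δ i) z : ℝ) : ℂ)) (fun i => ((frameC 1 (δ i) z : ℝ) : ℂ)) 1]
  simp only [ht, act_gMat_basisT hz, mixTerm_eq]
  rw [add_comm, mul_add]
  simp only [mul_neg, Finset.mul_sum, ← Finset.sum_neg_distrib]
  congr 1
  · refine Finset.sum_congr rfl fun β _ => ?_
    simp only [deg, coframe]
    simp
    field_simp
  · refine Finset.sum_congr rfl fun β _ => ?_
    simp only [deg, coframe]
    simp
    field_simp
    rw [pow_add]
    ring

lemma hasFDerivAt_frameC_zero (d : Fin 3) {z : ℂ} (hz : z ∈ UHP) :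
    HasFDerivAt (fun z => frameC 0 d z)
      (ofReIm (frameC 1 d z / z.im) (frameC 2 d z / z.im)) z := by
  have hy : z.im ≠ 0 := (show 0 < z.im from hz).ne'
  have hre : HasFDerivAt (fun z : ℂ => z.re) Complex.reCLM z := Complex.reCLM.hasFDerivAt
  have him : HasFDerivAt (fun z : ℂ => z.im) Complex.imCLM z := Complex.imCLM.hasFDerivAt
  have hinv := (hasDerivAt_inv hy).comp_hasFDerivAt z him
  have hq := hre.fun_mul hinv
  have hq2 := (hre.pow 2).fun_mul hinv
  fin_cases d
  · have h1 := ((him.fun_add hinv).fun_sub hq2).mul_const (1 / 2 : ℝ)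
    refine (h1.congr_of_eventuallyEq (Filter.Eventually.of_forall fun z => ?_)).congr_fderiv
      (ContinuousLinearMap.ext fun w => ?_)
    · simp [frameC]; ring
    · simp [ofReIm_apply, frameC]; field_simp; ring
  · refine (hq.congr_of_eventuallyEq (Filter.Eventually.of_forall fun z => ?_)).congr_fderiv
      (ContinuousLinearMap.ext fun w => ?_)
    · simp [frameC]; ring
    · simp [ofReIm_apply, frameC]; field_simp; ring
  · have h1 := ((him.fun_sub hinv).fun_sub hq2).mul_const (1 / 2 : ℝ)
    refine (h1.congr_of_eventuallyEq (Filter.Eventually.of_forall fun z => ?_)).congr_fderiv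
      (ContinuousLinearMap.ext fun w => ?_)
    · simp [frameC]; ring
    · simp [ofReIm_apply, frameC]; field_simp; ring

lemma hasFDerivAt_frameC_one (d : Fin 3) {z : ℂ} (hz : z ∈ UHP) :
    HasFDerivAt (fun z => frameC 1 d z)
      (ofReIm (-(frameC 0 d z + frameC 2 d z) / z.im) 0) z := by
  have hy : z.im ≠ 0 := (show 0 < z.im from hz).ne'
  have hre : HasFDerivAt (fun z : ℂ => z.re) Complex.reCLM z := Complex.reCLM.hasFDerivAt
  fin_cases d
  · refine (hre.neg.congr_of_eventuallyEq (Filter.Eventually.of_forall fun z => ?_)).congr_fderiv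
      (ContinuousLinearMap.ext fun w => ?_)
    · simp [frameC]
    · simp [ofReIm_apply, frameC]; field_simp; ring
  · refine ((hasFDerivAt_const (1 : ℝ) z).congr_of_eventuallyEq
      (Filter.Eventually.of_forall fun z => ?_)).congr_fderiv
      (ContinuousLinearMap.ext fun w => ?_)
    · simp [frameC]
    · simp [ofReIm_apply, frameC]
  · refine (hre.neg.congr_of_eventuallyEq (Filter.Eventually.of_forall fun z => ?_)).congr_fderiv
      (ContinuousLinearMap.ext fun w => ?_)
    · simp [frameC]
    · simp [ofReIm_apply, frameC]; field_simp; ring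

lemma umbral_shift (G : ℕ → ℂ) (a b : ℂ) (P : Polynomial ℂ) :
    umbral (fun n => -a * n * G (n - 1) + b * G (n + 1)) P =
      umbral G (Polynomial.C (-a) * Polynomial.derivative P + Polynomial.C b * (Polynomial.X * P)) := by
  refine (umbral_ext (L := umbral G ∘ₗ (LinearMap.mulLeft ℂ (Polynomial.C (-a)) ∘ₗ
    Polynomial.derivative + LinearMap.mulLeft ℂ (Polynomial.C b) ∘ₗ
      LinearMap.mulLeft ℂ Polynomial.X)) (fun n => ?_) P).symm
  simp only [LinearMap.comp_apply, LinearMap.add_apply, LinearMap.mulLeft_apply, map_add,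
    umbral_C_mul, Polynomial.derivative_X_pow, ← pow_succ', umbral_X_pow]
  ring

lemma umbral_mul_left (G : ℕ → ℂ) (c : ℂ) (P : Polynomial ℂ) :
    umbral (fun n => c * G n) P = umbral G (Polynomial.C c * P) := by
  refine (umbral_ext (L := umbral G ∘ₗ LinearMap.mulLeft ℂ (Polynomial.C c))
    (fun n => ?_) P).symm
  simp only [LinearMap.comp_apply, LinearMap.mulLeft_apply, umbral_C_mul, umbral_X_pow]

/-- The equation `∂U/∂x + ∂W/∂y = 0`. Both components are values of the umbral functional, in which
`X ^ n` stands for the Hermite polynomial of degree `n`. The recursion of the Hermite polynomials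
makes differentiation an operator on polynomials in `X`, and the tensor factors obey the Leibniz
rule. -/
lemma exists_hasFDerivAt_mix (k : ℕ) (h : Fin 2) (τ : ℍ) (p : ℤ × ℤ × ℤ) {z : ℂ} (hz : z ∈ UHP)
    (δ : Fin k → Fin 3) : ∃ D E : ℂ →L[ℝ] ℂ,
      HasFDerivAt (fun z => mixU k h τ p z δ) D z ∧ HasFDerivAt (fun z => mixW k h τ p z δ) E z ∧
      D 1 + E Complex.I = 0 := by
  classical
  have hy : (z.im : ℂ) ≠ 0 := by exact_mod_cast (show 0 < z.im from hz).ne'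
  set lc := linC τ p.1 p.2.2 with hlc
  have him : HasFDerivAt (fun z : ℂ => ((z.im : ℝ) : ℂ)) (Complex.ofRealCLM.comp Complex.imCLM) z :=
    (Complex.ofRealCLM.comp Complex.imCLM).hasFDerivAt
  have hc : HasFDerivAt (fun z : ℂ => lc * ((z.im : ℝ) : ℂ)) _ z := him.const_mul lc
  have ha : ∀ i : Fin k, HasFDerivAt (fun z : ℂ => lc * z.im * ((frameC 0 (δ i) z : ℝ) : ℂ)) _ z :=
    fun i => hc.fun_mul (Complex.ofRealCLM.hasFDerivAt.comp z (hasFDerivAt_frameC_zero (δ i) hz))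
  have hb : ∀ i : Fin k, HasFDerivAt (fun z : ℂ => ((frameC 1 (δ i) z : ℝ) : ℂ)) _ z :=
    fun i => Complex.ofRealCLM.hasFDerivAt.comp z (hasFDerivAt_frameC_one (δ i) hz)
  obtain ⟨D, hD, hD'⟩ := exists_hasFDerivAt_umbral Finset.univ (fun n => hasFDerivAt_mixF h τ p n z)
    ha hb (Polynomial.X ^ 0)
  obtain ⟨E, hE, hE'⟩ := exists_hasFDerivAt_umbral Finset.univ (fun n => hasFDerivAt_mixF h τ p n z)
    ha hb (Polynomial.X ^ 1)
  refine ⟨_, E, hc.fun_mul hD, hE, ?_⟩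
  set G : ℕ → ℂ := fun n => mixF h τ p n z with hG
  set cb := starRingEnd ℂ lc with hcb
  set Pr : Polynomial ℂ := ∏ i, (Polynomial.C (lc * z.im * frameC 0 (δ i) z) +
    Polynomial.C ((frameC 1 (δ i) z : ℝ) : ℂ) * Polynomial.X) with hPr
  set Pr' : Fin k → Polynomial ℂ := fun i => ∏ j ∈ Finset.univ.erase i,
    (Polynomial.C (lc * z.im * frameC 0 (δ j) z) +
      Polynomial.C ((frameC 1 (δ j) z : ℝ) : ℂ) * Polynomial.X) with hPr'
  set f : Fin 3 → Fin k → ℂ := fun j i => ((frameC j (δ i) z : ℝ) : ℂ) with hf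
  set S₁ := ∑ i, Polynomial.C (f 1 i) * Pr' i with hS₁
  set S₂ := ∑ i, Polynomial.C (f 0 i + f 2 i) * Pr' i with hS₂
  have hder : Polynomial.derivative Pr = S₁ := by
    rw [hPr, Polynomial.derivative_prod_finset]
    refine Finset.sum_congr rfl fun i _ => ?_
    simp only [Polynomial.derivative_add, Polynomial.derivative_C, zero_add,
      Polynomial.derivative_C_mul, Polynomial.derivative_X, mul_one, hPr', hf]
    ring
  have hD1 : D 1 = umbral G (Polynomial.C (-lc) * S₁ +
      Polynomial.C (Real.pi * cb) * (Polynomial.X * Pr)) + umbral G (Polynomial.C lc * S₁ -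
        Polynomial.C (z.im : ℂ)⁻¹ * (Polynomial.X * S₂)) := by
    rw [hD' 1, pow_zero, one_mul, one_mul, ← hder, ← umbral_shift, hder]
    congr 1
    · simp [ofReIm_apply, hG, hlc]
    · congr 1
      rw [hS₁, hS₂, Finset.mul_sum, Finset.mul_sum, Finset.mul_sum, ← Finset.sum_sub_distrib]
      refine Finset.sum_congr rfl fun i _ => ?_
      have h1 : ((lc * z.im) • Complex.ofRealCLM ∘SL ofReIm (frameC 1 (δ i) z / z.im)
          (frameC 2 (δ i) z / z.im) + ((frameC 0 (δ i) z : ℝ) : ℂ) • lc •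
            Complex.ofRealCLM ∘SL Complex.imCLM) 1 = lc * f 1 i := by
        simp [ofReIm_apply, hf]
        field_simp
      have h2 : (Complex.ofRealCLM ∘SL ofReIm (-(frameC 0 (δ i) z + frameC 2 (δ i) z) / z.im) 0) 1 =
          (z.im : ℂ)⁻¹ * -(f 0 i + f 2 i) := by
        simp [ofReIm_apply, hf]
        field_simp
      rw [h1, h2, map_mul, map_mul, map_neg]
      ring
  have hE1 : E Complex.I = umbral G (Polynomial.C (-Real.pi * z.im * (lc * cb)) *
      (Polynomial.X * Pr)) + umbral G (Polynomial.C lc * (Polynomial.X * S₂)) := by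
    rw [hE' Complex.I, pow_one, ← umbral_mul_left]
    congr 1
    · simp [ofReIm_apply, hG, hlc]
    · congr 1
      rw [mul_left_comm, hS₂, Finset.mul_sum _ _ (Polynomial.C lc)]
      congr 1
      refine Finset.sum_congr rfl fun i _ => ?_
      have h1 : ((lc * z.im) • Complex.ofRealCLM ∘SL ofReIm (frameC 1 (δ i) z / z.im)
          (frameC 2 (δ i) z / z.im) + ((frameC 0 (δ i) z : ℝ) : ℂ) • lc •
            Complex.ofRealCLM ∘SL Complex.imCLM) Complex.I = lc * (f 0 i + f 2 i) := by
        simp [ofReIm_apply, hf]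
        field_simp
        ring
      have h2 : (Complex.ofRealCLM ∘SL ofReIm (-(frameC 0 (δ i) z + frameC 2 (δ i) z) / z.im) 0)
          Complex.I = 0 := by
        simp [ofReIm_apply]
      rw [h1, h2, map_mul, map_zero]
      ring
  simp only [add_apply, smul_apply, smul_eq_mul, hD1, hE1,
    ContinuousLinearMap.comp_apply, Complex.imCLM_apply, Complex.one_im, map_zero, mul_zero,
    map_add, map_sub, umbral_C_mul]
  field_simp
  ring

/-- The terms of the mixed model are closed forms. -/
lemma isClosed1_mixForm (k : ℕ) (h : Fin 2) (τ : ℍ) (p : ℤ × ℤ × ℤ) :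
    IsClosed1 (mixForm k h τ p) := by
  classical
  have key : ∀ z ∈ UHP, ∃ D E : ℂ →L[ℝ] Tens k, HasFDerivAt (mixU k h τ p) D z ∧
      HasFDerivAt (mixW k h τ p) E z ∧ D 1 + E Complex.I = 0 := by
    intro z hz
    choose D E h1 h2 h3 using exists_hasFDerivAt_mix k h τ p hz
    exact ⟨ContinuousLinearMap.pi D, ContinuousLinearMap.pi E, hasFDerivAt_pi.2 h1,
      hasFDerivAt_pi.2 h2, funext h3⟩
  choose! D E h1 h2 h3 using key
  have h4 := isClosed1_of_hasFDerivAt h1 h2 h3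
  have h5 : ∀ z ∈ UHP, DifferentiableAt ℝ (fun z => ofReIm (-mixW k h τ p z) (mixU k h τ p z)) z := by
    intro z hz
    exact ((((ContinuousLinearMap.smulRightL ℝ ℂ (Tens k) Complex.reCLM).hasFDerivAt.comp z
      (h2 z hz).neg).add ((ContinuousLinearMap.smulRightL ℝ ℂ (Tens k)
        Complex.imCLM).hasFDerivAt.comp z (h1 z hz)))).differentiableAt
  intro z hz v w
  have e : mixForm k h τ p =ᶠ[nhds z] fun z =>
      (1 / √τ.im : ℂ) • ofReIm (-mixW k h τ p z) (mixU k h τ p z) :=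
    Filter.eventually_of_mem (isOpen_UHP.mem_nhds hz) fun z hz => mixForm_eq k h τ p hz
  rw [e.fderiv_eq, fderiv_fun_const_smul (h5 z hz)]
  simp only [smul_apply, h4 z hz v w]

/-! ### The theta series as a cocycle of the mapping cone -/

/-- The terms of the theta series of the torus, with the Hermite polynomial of degree `b`. -/
def torTerm (b : ℕ) (h : Fin 2) (τ : ℍ) (B : ℤ) : ℂ :=
  ((hp b).eval (√τ.im * √2 * (B + (h.val : ℝ) / 2)) : ℝ) *
    Complex.exp (2 * Real.pi * Complex.I * τ * ((B + (h.val : ℝ) / 2 : ℝ) : ℂ) ^ 2)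

lemma summable_torTerm (b : ℕ) (h : Fin 2) (τ : ℍ) : Summable (torTerm b h τ) := by
  have hv := τ.im_pos
  obtain ⟨C, hC, hb⟩ := exists_poly_le (hp b) (δ := Real.pi / 2) (by positivity)
  set r : ℝ := (h.val : ℝ) / 2 with hr
  refine Summable.of_norm_bounded ((summable_exp_neg_sq (δ := Real.pi * τ.im / 2)
    (by positivity)).mul_left (C * Real.exp (Real.pi * τ.im * r ^ 2))) fun B => ?_
  have h1 : ‖Complex.exp (2 * Real.pi * Complex.I * τ * ((B + r : ℝ) : ℂ) ^ 2)‖ =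
      Real.exp (-(2 * Real.pi * τ.im * (B + r) ^ 2)) := by
    rw [Complex.norm_exp]
    congr 1
    have : (2 * Real.pi * Complex.I * τ * ((B + r : ℝ) : ℂ) ^ 2) =
        ((2 * Real.pi * (B + r) ^ 2 : ℝ) : ℂ) * (Complex.I * τ) := by push_cast; ring
    rw [this, Complex.re_ofReal_mul]
    simp
    ring
  rw [torTerm, norm_mul, h1, Complex.norm_real, Real.norm_eq_abs]
  refine (mul_le_mul_of_nonneg_right (hb _) (Real.exp_pos _).le).trans ?_
  rw [mul_assoc C, mul_assoc C, ← Real.exp_add, ← Real.exp_add]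
  refine mul_le_mul_of_nonneg_left (Real.exp_le_exp.2 ?_) hC
  have h2 : (√τ.im * √2 * (B + r)) ^ 2 = τ.im * 2 * (B + r) ^ 2 := by
    rw [mul_pow, mul_pow, Real.sq_sqrt hv.le, Real.sq_sqrt (by norm_num)]
  rw [h2]
  have h3 : 0 ≤ Real.pi * τ.im * (B + 2 * r) ^ 2 := by positivity
  nlinarith

/-- The part of the partial Poisson sum that decays at the cusp. -/
def flatSum (a b : ℕ) (h : Fin 2) (τ : ℍ) (z : ℂ) : ℂ := ∑' p, mixTerm a b h τ z p * decays p

lemma summable_mixTerm_decays (a b : ℕ) (h : Fin 2) (τ : ℍ) {z : ℂ} (hz : z ∈ UHP) :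
    Summable fun p => mixTerm a b h τ z p * decays p := by
  obtain ⟨u, hu, hb⟩ := exists_mixTerm_le a b h τ (R := |z.re| + 1) (by positivity)
    (show 0 < z.im from hz)
  exact Summable.of_norm_bounded hu fun p => hb p z (by linarith) le_rfl

lemma mixTerm_torus (a b : ℕ) (h : Fin 2) (τ : ℍ) (z : ℂ) (B : ℤ) :
    mixTerm a b h τ z (0, B, 0) = (if a = 0 then (z.im / √τ.im : ℂ) else 0) * torTerm b h τ B := by
  have h1 : linC τ 0 0 = 0 := by simp [linC]
  have h2 : rate τ 0 0 = 0 := by simp [rate]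
  rw [mixTerm, h1, h2, torTerm, phase]
  split_ifs with ha
  · simp [ha, torC]
    ring
  · simp [ha]

/-- After Poisson summation the theta series is the sum of the contribution of the torus, which
survives on the boundary, and of a part that decays. -/
lemma tsum_scTerm (a b : ℕ) (h : Fin 2) (τ : ℍ) {z : ℂ} (hz : z ∈ UHP) :
    ∑' p, scTerm a b h τ z p =
      (if a = 0 then (z.im / √τ.im : ℂ) else 0) * ∑' B, torTerm b h τ B + flatSum a b h τ z := by
  have hinj : Function.Injective fun B : ℤ => ((0, B, 0) : ℤ × ℤ × ℤ) := fun B C hBC => by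
    simpa using hBC
  have h0 : ∀ p, p ∉ Set.range (fun B : ℤ => ((0, B, 0) : ℤ × ℤ × ℤ)) → decays p = 1 := by
    rintro ⟨A, B, m⟩ hp
    rw [decays, if_neg]
    rintro ⟨h1, h2⟩
    exact hp ⟨B, by simp only at h1 h2; rw [h1, h2]⟩
  have h1 : Summable fun p => mixTerm a b h τ z p * (1 - decays p) := by
    rw [← hinj.summable_iff fun p hp => by rw [h0 p hp, sub_self, mul_zero]]
    refine ((summable_torTerm b h τ).mul_left (if a = 0 then (z.im / √τ.im : ℂ) else 0)).congr
      fun B => ?_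
    simp only [Function.comp_apply, mixTerm_torus, decays]
    simp
  have h2 := summable_mixTerm_decays a b h τ hz
  have h3 : ∀ p, mixTerm a b h τ z p * (1 - decays p) + mixTerm a b h τ z p * decays p =
      mixTerm a b h τ z p := fun p => by ring
  have h4 : Summable (mixTerm a b h τ z) := (h1.add h2).congr h3
  have h5 : ∑' p, mixTerm a b h τ z p * (1 - decays p) =
      (if a = 0 then (z.im / √τ.im : ℂ) else 0) * ∑' B, torTerm b h τ B := by
    rw [← hinj.tsum_eq, ← tsum_mul_left]
    · refine tsum_congr fun B => ?_
      simp only [mixTerm_torus, decays]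
      simp
    · intro p hp
      by_contra hp'
      exact hp (by simp only [h0 p hp', sub_self, mul_zero])
  have h6 := (summable_norm_scTerm a b h τ hz).of_norm
  rw [flatSum, ← h5, ← h1.tsum_add h2, tsum_congr h3, h6.tsum_prod, h4.tsum_prod]
  refine tsum_congr fun A => ?_
  rw [(h6.prod_factor A).tsum_prod, (h4.prod_factor A).tsum_prod]
  exact tsum_congr fun B => tsum_scTerm_eq a b h τ hz A B

/-- The frame of the Schwartz form before projection to harmonic tensors. -/
def frameS (k : ℕ) (z : ℂ) (α : Fin 2) (β : Fin k → Fin 2) : ℂ →L[ℝ] Tens k :=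
  (coframe z α).smulRight (act k (gMat z) (basisT β))

/-- The part of the theta series that decays at the cusp, before projection to harmonic tensors. -/
def flatForm (k : ℕ) (h : Fin 2) (τ : ℍ) : Form1 k := fun z =>
  ∑ α : Fin 2, ∑ β : Fin k → Fin 2, flatSum (deg 0 α β) (deg 1 α β) h τ z • frameS k z α β

/-- The normalising factor of the theta series. -/
def thetaC (k : ℕ) (τ : ℍ) : ℂ :=
  ((τ.im ^ (-(k : ℝ) / 2) : ℝ) : ℂ) * ((1 / (2 : ℝ) ^ ((k : ℝ) + 1 / 2) : ℝ) : ℂ)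

/-- The factor of the restriction of the theta series to the boundary. -/
def bdryC (k : ℕ) (h : Fin 2) (τ : ℍ) : ℂ :=
  -(((τ.im ^ (-((k : ℝ) + 1) / 2) : ℝ) : ℂ) *
    ((1 / (2 : ℝ) ^ (3 * (k : ℝ) / 2 + 1 / 2) : ℝ) : ℂ) * ∑' B, torTerm (k + 1) h τ B)

/-- The projection to harmonic tensors as a continuous real-linear map. -/
def harmProjR (k : ℕ) : Tens k →L[ℝ] Tens k :=
  ((harmProj k).toContinuousLinearMap).restrictScalars ℝ

/-- The form `dx ⊗ n(x) π_k(diag(1, -1)^k)`. -/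
def bdryBase (k : ℕ) : Form1 k := fun z =>
  Complex.reCLM.smulRight (act k (n z.re) (harmProj k (power k mH)))

lemma frameT_eq (k : ℕ) {z : ℂ} (hz : z ∈ UHP) (α : Fin 2) (β : Fin k → Fin 2) :
    frameT k z α β = (harmProjR k).comp (frameS k z α β) := by
  refine ContinuousLinearMap.ext fun w => ?_
  change coframe z α w • act k (gMat z) (harmProj k (basisT β)) =
    harmProjR k (coframe z α w • act k (gMat z) (basisT β))
  rw [map_smul]
  congr 1
  exact (harmProj_act (by rw [det_gMat hz]; exact one_ne_zero) _).symm

lemma act_gMat_basisT_one (k : ℕ) {z : ℂ} (hz : z ∈ UHP) :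
    act k (gMat z) (basisT fun _ => 1) = (((1 / √2) ^ k : ℝ) : ℂ) • act k (n z.re) (power k mH) := by
  have h1 : gMat (z.re + Complex.I) = n z.re := by
    ext i j; fin_cases i <;> fin_cases j <;> simp [gMat, n]
  have hz' : (z.re + Complex.I : ℂ) ∈ UHP := by simp [UHP]
  have h2 : power k mH = (((√2) ^ k : ℝ) : ℂ) • basisT fun _ => 1 := by
    funext δ
    have hc : coord mH = ![0, √2, 0] := by
      rw [coord_apply]
      have : (1 + 1 : ℝ) / √2 = √2 := by
        rw [div_eq_iff (by positivity), Real.mul_self_sqrt (by norm_num)]; norm_num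
      simp [mH, this]
    by_cases hδ : δ = fun _ => 1
    · subst hδ
      simp [power, hc, basisT]
    · obtain ⟨i, hi⟩ : ∃ i, δ i ≠ 1 := by
        by_contra hcon
        push Not at hcon
        exact hδ (funext hcon)
      have hz : coord mH (δ i) = 0 := by
        rw [hc]
        generalize δ i = d at hi
        fin_cases d <;> simp_all
      rw [power, Finset.prod_eq_zero (Finset.mem_univ i) (by rw [hz]; simp), Pi.smul_apply, basisT,
        Pi.single_eq_of_ne, smul_zero]
      intro hh
      exact hδ (by rw [hh]; rfl)
  have h3 : ((((1 / √2) ^ k : ℝ) : ℂ)) * (((√2) ^ k : ℝ) : ℂ) = 1 := by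
    rw [← Complex.ofReal_mul, ← mul_pow, one_div, inv_mul_cancel₀ (by positivity)]
    simp
  rw [h2, map_smul, smul_smul, h3, one_smul, ← h1]
  funext δ
  rw [act_gMat_basisT hz, act_gMat_basisT hz']
  refine Finset.prod_congr rfl fun i _ => ?_
  generalize δ i = d
  fin_cases d <;> simp [frameC]

lemma deg_zero_eq_zero_iff {k : ℕ} (α : Fin 2) (β : Fin k → Fin 2) :
    deg 0 α β = 0 ↔ α = 1 ∧ β = fun _ => 1 := by
  have h2 : ∀ c : Fin 2, (if c = 0 then 1 else 0) = 0 ↔ c = 1 := by decide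
  rw [deg, cnt, Nat.add_eq_zero_iff, Finset.sum_eq_zero_iff, h2, funext_iff]
  simp only [Finset.mem_univ, true_imp_iff, h2]

lemma deg_one_one {k : ℕ} : deg 1 1 (fun _ : Fin k => 1) = k + 1 := by
  simp [deg, cnt, add_comm]

lemma thetaC_mul (k : ℕ) (h : Fin 2) (τ : ℍ) :
    thetaC k τ * ((1 / √τ.im : ℝ) : ℂ) * (((1 / √2) ^ k : ℝ) : ℂ) =
      ((τ.im ^ (-((k : ℝ) + 1) / 2) : ℝ) : ℂ) *
        ((1 / (2 : ℝ) ^ (3 * (k : ℝ) / 2 + 1 / 2) : ℝ) : ℂ) := by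
  have hv := τ.im_pos
  rw [thetaC, ← Complex.ofReal_mul, ← Complex.ofReal_mul, ← Complex.ofReal_mul,
    ← Complex.ofReal_mul]
  congr 1
  have e1 : 1 / √τ.im = τ.im ^ (-(1 / 2 : ℝ)) := by
    rw [Real.sqrt_eq_rpow, Real.rpow_neg hv.le, one_div]
  have e2 : (1 / √2) ^ k = (2 : ℝ) ^ (-((k : ℝ) / 2)) := by
    rw [Real.sqrt_eq_rpow, one_div, ← Real.rpow_neg (by norm_num), ← Real.rpow_natCast,
      ← Real.rpow_mul (by norm_num)]
    congr 1; ring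
  have e3 : ∀ s : ℝ, 1 / (2 : ℝ) ^ s = 2 ^ (-s) := fun s => by
    rw [one_div, Real.rpow_neg (by norm_num)]
  have e4 : -((k : ℝ) + 1) / 2 = -(k : ℝ) / 2 + -(1 / 2) := by ring
  have e5 : -(3 * (k : ℝ) / 2 + 1 / 2) = -((k : ℝ) + 1 / 2) + -((k : ℝ) / 2) := by ring
  rw [e1, e2, e3, e3, e4, e5, Real.rpow_add hv, Real.rpow_add (by norm_num)]
  ring

lemma thetaV_split (k : ℕ) (h : Fin 2) (τ : ℍ) {z : ℂ} (hz : z ∈ UHP) : thetaV k h τ z =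
    bdryC k h τ • bdryBase k z + thetaC k τ • (harmProjR k).comp (flatForm k h τ z) := by
  have hy : z.im ≠ 0 := (show 0 < z.im from hz).ne'
  have hzero : ∀ T : ℂ →L[ℝ] Tens k, (0 : ℂ) • T = 0 :=
    fun T => ContinuousLinearMap.ext fun w => zero_smul ℂ (T w)
  have h1 : ∑ α : Fin 2, ∑ β : Fin k → Fin 2, ((if deg 0 α β = 0 then (z.im / √τ.im : ℂ) else 0) *
      ∑' B, torTerm (deg 1 α β) h τ B) • frameT k z α β =
      ((z.im / √τ.im : ℂ) * ∑' B, torTerm (k + 1) h τ B) • frameT k z 1 fun _ => 1 := by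
    rw [Finset.sum_eq_single 1, Finset.sum_eq_single fun _ => 1]
    · rw [if_pos ((deg_zero_eq_zero_iff _ _).2 ⟨rfl, rfl⟩), deg_one_one]
    · intro β _ hβ
      rw [if_neg fun hh => hβ ((deg_zero_eq_zero_iff _ _).1 hh).2, zero_mul]
      exact hzero _
    · simp
    · intro α _ hα
      refine Finset.sum_eq_zero fun β _ => ?_
      rw [if_neg fun hh => hα ((deg_zero_eq_zero_iff _ _).1 hh).1, zero_mul]
      exact hzero _
    · simp
  have h2 : frameT k z 1 (fun _ => 1) =
      (-((1 / z.im : ℝ) : ℂ) * (((1 / √2) ^ k : ℝ) : ℂ)) • bdryBase k z := by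
    rw [frameT_eq k hz]
    refine ContinuousLinearMap.ext fun w => ?_
    change harmProjR k (coframe z 1 w • act k (gMat z) (basisT fun _ => 1)) =
      (-((1 / z.im : ℝ) : ℂ) * (((1 / √2) ^ k : ℝ) : ℂ)) •
        (w.re • act k (n z.re) (harmProj k (power k mH)))
    rw [act_gMat_basisT_one k hz, map_smul, ← harmProj_act (by simp [det_n])]
    change _ • harmProj k (_ • _) = _
    rw [map_smul]
    have : coframe z 1 w = -((1 / z.im) * w.re) := rfl
    rw [this]
    funext δ
    simp only [Pi.smul_apply, smul_eq_mul, Complex.real_smul]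
    push_cast
    ring
  have h3 : (harmProjR k).comp (flatForm k h τ z) = ∑ α : Fin 2, ∑ β : Fin k → Fin 2,
      flatSum (deg 0 α β) (deg 1 α β) h τ z • frameT k z α β := by
    refine ContinuousLinearMap.ext fun w => ?_
    change harmProj k ((∑ α : Fin 2, ∑ β : Fin k → Fin 2, _ : ℂ →L[ℝ] Tens k) w) = _
    simp only [sum_apply, map_sum, frameT_eq k hz,
      smul_apply, map_smul]
    rfl
  have hadd : ∀ (a b : ℂ) (T : ℂ →L[ℝ] Tens k), (a + b) • T = a • T + b • T :=
    fun a b T => add_smul a b T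
  have hsadd : ∀ (a : ℂ) (S T : ℂ →L[ℝ] Tens k), a • (S + T) = a • S + a • T :=
    fun a b T => smul_add a b T
  have hss : ∀ (a b : ℂ) (T : ℂ →L[ℝ] Tens k), a • (b • T) = (a * b) • T :=
    fun a b T => smul_smul a b T
  rw [thetaV_eq k h τ hz, h3, ← thetaC]
  simp only [tsum_scTerm _ _ h τ hz, hadd, Finset.sum_add_distrib]
  rw [hsadd, h1, h2, hss, hss]
  congr 2
  rw [bdryC, ← thetaC_mul k h τ]
  have hyC : (z.im : ℂ) ≠ 0 := by exact_mod_cast hy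
  push_cast
  field_simp

lemma Flat.congr {f g : ℝ × ℝ → ℂ} (hf : Flat f) (h : ∀ q : ℝ × ℝ, 0 < q.2 → g q = f q) :
    Flat g := by
  intro j
  obtain ⟨F, h1, h2, h3⟩ := hf j
  exact ⟨F, h1, fun q hq => by rw [h q hq, h2 q hq], h3⟩

lemma cuspChart_mem {q : ℝ × ℝ} (hq : 0 < q.2) : cuspChart q ∈ UHP := by
  change 0 < (cuspChart q).im
  rw [cuspChart_im]
  exact inv_pos.2 hq

lemma Flat.mul_frameC {f : ℝ × ℝ → ℂ} (hf : Flat f) (j : Fin 2) (d : Fin 3) :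
    Flat fun q => ((frameC j.castSucc d (cuspChart q) : ℝ) : ℂ) * f q := by
  have hx : ContDiff ℝ ∞ fun q : ℝ × ℝ => (q.1 : ℂ) :=
    Complex.ofRealCLM.contDiff.comp contDiff_fst
  have ht : ContDiff ℝ ∞ fun q : ℝ × ℝ => (q.2 : ℂ) :=
    Complex.ofRealCLM.contDiff.comp contDiff_snd
  fin_cases j
  · fin_cases d
    · refine ((hf.mul (c := fun q => ((q.2 : ℂ) - q.1 ^ 2 * q.2) / 2)
        ((ht.sub ((hx.pow 2).mul ht)).div_const 2)).add
        (hf.mul_inv.mul (c := fun _ => 1 / 2) contDiff_const)).congr fun q hq => ?_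
      simp [frameC, cuspChart_re, cuspChart_im]
      ring
    · refine (hf.mul (hx.mul ht)).congr fun q hq => ?_
      simp [frameC, cuspChart_re, cuspChart_im]
    · refine ((hf.mul (c := fun q => (-(q.2 : ℂ) - q.1 ^ 2 * q.2) / 2)
        ((ht.neg.sub ((hx.pow 2).mul ht)).div_const 2)).add
        (hf.mul_inv.mul (c := fun _ => 1 / 2) contDiff_const)).congr fun q hq => ?_
      simp [frameC, cuspChart_re, cuspChart_im]
      ring
  · fin_cases d
    · refine (hf.mul hx.neg).congr fun q hq => ?_
      simp [frameC, cuspChart_re]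
    · refine hf.congr fun q hq => ?_
      simp [frameC]
    · refine (hf.mul hx.neg).congr fun q hq => ?_
      simp [frameC, cuspChart_re]

lemma Flat.mul_act_basisT {f : ℝ × ℝ → ℂ} (hf : Flat f) {k : ℕ} (β : Fin k → Fin 2)
    (δ : Fin k → Fin 3) : Flat fun q => act k (gMat (cuspChart q)) (basisT β) δ * f q := by
  classical
  have h1 : ∀ s : Finset (Fin k), Flat fun q =>
      (∏ i ∈ s, ((frameC (β i).castSucc (δ i) (cuspChart q) : ℝ) : ℂ)) * f q := by
    intro s
    induction s using Finset.induction_on with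
    | empty => simpa using hf
    | insert i s hi ih =>
      refine (ih.mul_frameC (β i) (δ i)).congr fun q _ => ?_
      rw [Finset.prod_insert hi, mul_assoc]
  refine (h1 Finset.univ).congr fun q hq => ?_
  rw [act_gMat_basisT (cuspChart_mem hq)]
  congr 1
  refine Finset.prod_congr rfl fun i _ => ?_
  generalize β i = c
  fin_cases c <;> simp

lemma Flat.mul_coframe {f : ℝ × ℝ → ℂ} (hf : Flat f) (α : Fin 2) (w : ℂ) :
    Flat fun q => ((coframe (cuspChart q) α w : ℝ) : ℂ) * f q := by
  have ht : ContDiff ℝ ∞ fun q : ℝ × ℝ => (q.2 : ℂ) :=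
    Complex.ofRealCLM.contDiff.comp contDiff_snd
  fin_cases α
  · refine (hf.mul (ht.mul (contDiff_const (c := (w.im : ℂ))))).congr fun q hq => ?_
    simp [coframe, cuspChart_im]
  · refine (hf.mul (ht.mul (contDiff_const (c := (-w.re : ℂ))))).congr fun q hq => ?_
    simp [coframe, cuspChart_im]

lemma flat_flatForm (k : ℕ) (h : Fin 2) (τ : ℍ) (w : ℂ) (δ : Fin k → Fin 3) :
    Flat fun q => flatForm k h τ (cuspChart q) w δ := by
  refine (Flat.sum Finset.univ fun α _ => Flat.sum Finset.univ fun β _ =>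
    (((flat_tsum_mixTerm (deg 0 α β) (deg 1 α β) h τ).mul_act_basisT β δ).mul_coframe α w)).congr
    fun q _ => ?_
  simp only [flatForm, sum_apply, Finset.sum_apply]
  refine Finset.sum_congr rfl fun α _ => Finset.sum_congr rfl fun β _ => ?_
  change flatSum _ _ h τ (cuspChart q) * (coframe (cuspChart q) α w *
    act k (gMat (cuspChart q)) (basisT β) δ) = _
  rw [flatSum]
  ring

/-- The inverse of the chart at the cusp. -/
def cuspCoord (z : ℂ) : ℝ × ℝ := (z.re, z.im⁻¹)

lemma cuspChart_cuspCoord (z : ℂ) : cuspChart (cuspCoord z) = z := by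
  apply Complex.ext
  · rw [cuspChart_re, cuspCoord]
  · rw [cuspChart_im, cuspCoord, inv_inv]

lemma contDiffOn_cuspCoord : ContDiffOn ℝ ∞ cuspCoord UHP :=
  Complex.reCLM.contDiff.contDiffOn.prodMk
    (Complex.imCLM.contDiff.contDiffOn.inv fun z hz => (show 0 < z.im from hz).ne')

lemma exists_flat_components (k : ℕ) (h : Fin 2) (τ : ℍ) (w : ℂ) : ∃ P : ℝ × ℝ → Tens k,
    ContDiff ℝ ∞ P ∧ (∀ q : ℝ × ℝ, 0 < q.2 → P q =
      ((q.2⁻¹ : ℝ) ^ 2 : ℝ) • flatForm k h τ (cuspChart q) w) ∧ ∀ x, P (x, 0) = 0 := by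
  choose F h1 h2 h3 using fun δ => flat_flatForm k h τ w δ 2
  refine ⟨fun q δ => F δ q, contDiff_pi.2 h1, fun q hq => funext fun δ => ?_,
    fun x => funext fun δ => h3 δ x⟩
  change F δ q = _
  rw [h2 δ q hq, Pi.smul_apply, Complex.real_smul]
  push_cast
  rfl

/-- The extension of a form at the cusp with the given components. -/
lemma exists_thetaV_components (k : ℕ) (h : Fin 2) (τ : ℍ) : ∃ P Q : ℝ × ℝ → Tens k,
    ContDiff ℝ ∞ P ∧ ContDiff ℝ ∞ Q ∧
    (∀ q : ℝ × ℝ, 0 < q.2 → P q = thetaV k h τ (cuspChart q) 1) ∧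
    (∀ q : ℝ × ℝ, 0 < q.2 → Q q = -((q.2⁻¹ ^ 2 : ℝ) • thetaV k h τ (cuspChart q) Complex.I)) ∧
    ∀ x, P (x, 0) = bdryC k h τ • act k (n x) (harmProj k (power k mH)) := by
  obtain ⟨P, hP, hP1, hP2⟩ := exists_flat_components k h τ 1
  obtain ⟨Q, hQ, hQ1, hQ2⟩ := exists_flat_components k h τ Complex.I
  have hb : ContDiff ℝ ∞ fun q : ℝ × ℝ =>
      bdryC k h τ • act k (n q.1) (harmProj k (power k mH)) :=
    ((contDiff_act_n k _).comp contDiff_fst).const_smul _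
  refine ⟨fun q => bdryC k h τ • act k (n q.1) (harmProj k (power k mH)) +
    (q.2 ^ 2 : ℝ) • thetaC k τ • harmProjR k (P q), fun q => -(thetaC k τ • harmProjR k (Q q)),
    hb.add ((contDiff_snd.pow 2).smul (((harmProjR k).contDiff.comp hP).const_smul _)),
    ((((harmProjR k).contDiff.comp hQ).const_smul _)).neg, fun q hq => ?_, fun q hq => ?_,
    fun x => by simp⟩
  · beta_reduce
    rw [thetaV_split k h τ (cuspChart_mem hq), hP1 q hq, map_smul]
    have h1 : bdryBase k (cuspChart q) 1 = act k (n q.1) (harmProj k (power k mH)) := by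
      rw [bdryBase, cuspChart_re]
      change (1 : ℝ) • (_ : Tens k) = _
      rw [one_smul]
    change _ = bdryC k h τ • bdryBase k (cuspChart q) 1 + thetaC k τ •
      harmProjR k (flatForm k h τ (cuspChart q) 1)
    rw [h1, smul_comm (thetaC k τ), smul_smul, ← mul_pow, mul_inv_cancel₀ hq.ne', one_pow, one_smul]
  · beta_reduce
    rw [thetaV_split k h τ (cuspChart_mem hq), hQ1 q hq, map_smul]
    have h1 : bdryBase k (cuspChart q) Complex.I = 0 := by
      change (0 : ℝ) • _ = (0 : Tens k)
      rw [zero_smul]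
    change _ = -((q.2⁻¹ ^ 2 : ℝ) • (bdryC k h τ • bdryBase k (cuspChart q) Complex.I +
      thetaC k τ • harmProjR k (flatForm k h τ (cuspChart q) Complex.I)))
    rw [h1, smul_zero, zero_add, smul_comm (thetaC k τ)]

lemma clm_ext_re_im {E : Type*} [NormedAddCommGroup E] [NormedSpace ℝ E] (D : ℂ →L[ℝ] E) :
    D = ofReIm (D 1) (D Complex.I) := by
  refine ContinuousLinearMap.ext fun v => ?_
  rw [ofReIm_apply, ← map_smul, ← map_smul, ← map_add]
  congr 1
  apply Complex.ext <;> simp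

lemma contDiffOn_ofReIm {E F : Type*} [NormedAddCommGroup E] [NormedSpace ℝ E]
    [NormedAddCommGroup F] [NormedSpace ℝ F] {N : WithTop ℕ∞} {s : Set F} {u v : F → E}
    (hu : ContDiffOn ℝ N u s) (hv : ContDiffOn ℝ N v s) :
    ContDiffOn ℝ N (fun q => ofReIm (u q) (v q)) s :=
  (contDiffOn_const.smulRight hu).add (contDiffOn_const.smulRight hv)

lemma contDiffOn_thetaV (k : ℕ) (h : Fin 2) (τ : ℍ) : ContDiffOn ℝ ∞ (thetaV k h τ) UHP := by
  obtain ⟨P, Q, hP, hQ, hP1, hQ1, -⟩ := exists_thetaV_components k h τ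
  have him : ContDiffOn ℝ ∞ (fun z : ℂ => z.im⁻¹ ^ 2) UHP :=
    (Complex.imCLM.contDiff.contDiffOn.inv fun z hz => (show 0 < z.im from hz).ne').pow 2
  refine (contDiffOn_ofReIm (hP.comp_contDiffOn contDiffOn_cuspCoord)
    (him.smul (hQ.comp_contDiffOn contDiffOn_cuspCoord)).neg).congr fun z hz => ?_
  have hy : 0 < z.im := hz
  have hq : 0 < (cuspCoord z).2 := inv_pos.2 hy
  rw [clm_ext_re_im (thetaV k h τ z)]
  congr 1
  · rw [Function.comp_apply, hP1 _ hq, cuspChart_cuspCoord]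
  · change _ = -(z.im⁻¹ ^ 2 • Q (cuspCoord z))
    have hc : (cuspCoord z).2⁻¹ = z.im := inv_inv _
    rw [hQ1 _ hq, cuspChart_cuspCoord, smul_neg, neg_neg, smul_smul, hc, ← mul_pow, inv_mul_cancel₀ hy.ne', one_pow, one_smul]

lemma fderiv_cuspChart {q : ℝ × ℝ} (hq : 0 < q.2) :
    fderiv ℝ cuspChart q = ofComp 1 (-((q.2⁻¹ ^ 2 : ℝ) • Complex.I)) := by
  have h1 : HasFDerivAt (fun q : ℝ × ℝ => (q.1 : ℂ)) _ q :=
    Complex.ofRealCLM.hasFDerivAt.comp q hasFDerivAt_fst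
  have h2 : HasFDerivAt (fun q : ℝ × ℝ => ((q.2⁻¹ : ℝ) : ℂ)) _ q :=
    Complex.ofRealCLM.hasFDerivAt.comp q
      ((hasDerivAt_inv hq.ne').comp_hasFDerivAt q hasFDerivAt_snd)
  have h3 := h1.add (h2.const_mul Complex.I)
  have h4 : HasFDerivAt cuspChart _ q := h3.congr_of_eventuallyEq
    (Filter.Eventually.of_forall fun q => by
      simp [cuspChart, div_eq_mul_inv])
  rw [h4.fderiv]
  refine ContinuousLinearMap.ext fun w => ?_
  simp [ofComp_apply]
  ring

lemma extends1_of_components {k : ℕ} {ξ : Form1 k} {P Q : ℝ × ℝ → Tens k} (hP : ContDiff ℝ ∞ P)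
    (hQ : ContDiff ℝ ∞ Q) (h1 : ∀ q : ℝ × ℝ, 0 < q.2 → P q = ξ (cuspChart q) 1)
    (h2 : ∀ q : ℝ × ℝ, 0 < q.2 → Q q = -((q.2⁻¹ ^ 2 : ℝ) • ξ (cuspChart q) Complex.I)) :
    Extends1 ξ fun q => ofComp (P q) (Q q) := by
  refine ⟨(contDiff_ofComp hP hQ).contDiffOn, fun q hq => ContinuousLinearMap.ext fun w => ?_⟩
  rw [ContinuousLinearMap.comp_apply, fderiv_cuspChart hq, ofComp_apply, ofComp_apply, map_add,
    map_smul, map_smul, map_neg, map_smul, h1 q hq, h2 q hq]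

/-! ### Closedness of the theta series -/

lemma continuousOn_frameS (k : ℕ) (α : Fin 2) (β : Fin k → Fin 2) :
    ContinuousOn (fun z => frameS k z α β) UHP := by
  have h1 : ContinuousOn (fun z => act k (gMat z) (basisT β)) UHP := by
    refine continuousOn_pi.2 fun δ => ?_
    refine ContinuousOn.congr (f := fun z => ∏ i, (if β i = 0 then
      ((frameC 0 (δ i) z : ℝ) : ℂ) else ((frameC 1 (δ i) z : ℝ) : ℂ))) ?_
      fun z hz => act_gMat_basisT hz β δ
    refine continuousOn_finsetProd _ fun i _ => ?_
    split_ifs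
    · exact Complex.continuous_ofReal.comp_continuousOn fun z hz =>
        (hasFDerivAt_frameC_zero (δ i) hz).continuousAt.continuousWithinAt
    · exact Complex.continuous_ofReal.comp_continuousOn fun z hz =>
        (hasFDerivAt_frameC_one (δ i) hz).continuousAt.continuousWithinAt
  have h2 : ContinuousOn (fun z => coframe z α) UHP := by
    have h3 : ContinuousOn (fun z : ℂ => 1 / z.im) UHP :=
      continuousOn_const.div Complex.continuous_im.continuousOn
        fun z hz => (show 0 < z.im from hz).ne'
    fin_cases α
    · exact h3.smul continuousOn_const
    · exact (h3.smul continuousOn_const).neg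
  exact ((ContinuousLinearMap.smulRightL ℝ ℂ (Tens k)).continuous.comp_continuousOn h2).clm_apply h1

lemma decays_smul_mixForm (k : ℕ) (h : Fin 2) (τ : ℍ) (p : ℤ × ℤ × ℤ) (z : ℂ) :
    decays p • mixForm k h τ p z = ∑ α : Fin 2, ∑ β : Fin k → Fin 2,
      (mixTerm (deg 0 α β) (deg 1 α β) h τ z p * decays p) • frameS k z α β := by
  refine ContinuousLinearMap.ext fun w => ?_
  rw [mixForm]
  change decays p • ((∑ α : Fin 2, ∑ β : Fin k → Fin 2, _ : ℂ →L[ℝ] Tens k) w) = _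
  simp only [sum_apply, Finset.smul_sum]
  refine Finset.sum_congr rfl fun α _ => Finset.sum_congr rfl fun β _ => ?_
  rw [mul_comm]
  exact smul_smul (decays p) _ (frameS k z α β w)

lemma norm_decays_smul_mixForm_le (k : ℕ) (h : Fin 2) (τ : ℍ) (p : ℤ × ℤ × ℤ) (z : ℂ) :
    ‖decays p • mixForm k h τ p z‖ ≤ ∑ α : Fin 2, ∑ β : Fin k → Fin 2,
      ‖mixTerm (deg 0 α β) (deg 1 α β) h τ z p * decays p‖ * ‖frameS k z α β‖ := by
  have hn : ∀ (c : ℂ) (T : ℂ →L[ℝ] Tens k), ‖c • T‖ ≤ ‖c‖ * ‖T‖ := fun c T => norm_smul_le c T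
  rw [decays_smul_mixForm]
  refine (norm_sum_le _ _).trans (Finset.sum_le_sum fun α _ => ?_)
  exact (norm_sum_le _ _).trans (Finset.sum_le_sum fun β _ => hn _ _)

lemma flatForm_eq_tsum (k : ℕ) (h : Fin 2) (τ : ℍ) {z : ℂ} (hz : z ∈ UHP) :
    flatForm k h τ z = ∑' p, decays p • mixForm k h τ p z := by
  have hs : ∀ α β, Summable fun p => (mixTerm (deg 0 α β) (deg 1 α β) h τ z p * decays p) •
      frameS k z α β := fun α β => (summable_mixTerm_decays _ _ h τ hz).smul_const _
  simp only [decays_smul_mixForm]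
  rw [Summable.tsum_finsetSum fun α _ => summable_sum fun β _ => hs α β, flatForm]
  refine Finset.sum_congr rfl fun α _ => ?_
  rw [Summable.tsum_finsetSum fun β _ => hs α β]
  refine Finset.sum_congr rfl fun β _ => ?_
  rw [flatSum, (summable_mixTerm_decays _ _ h τ hz).tsum_smul_const]

lemma differentiableOn_flatForm (k : ℕ) (h : Fin 2) (τ : ℍ) :
    DifferentiableOn ℝ (flatForm k h τ) UHP := by
  have key : ∀ w, ContDiffOn ℝ ∞ (fun z => flatForm k h τ z w) UHP := by
    intro w
    obtain ⟨P, hP, hP1, -⟩ := exists_flat_components k h τ w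
    have him : ContDiffOn ℝ ∞ (fun z : ℂ => z.im⁻¹ ^ 2) UHP :=
      (Complex.imCLM.contDiff.contDiffOn.inv fun z hz => (show 0 < z.im from hz).ne').pow 2
    refine (him.smul (hP.comp_contDiffOn contDiffOn_cuspCoord)).congr fun z hz => ?_
    have hy : 0 < z.im := hz
    have hc : (cuspCoord z).2⁻¹ = z.im := inv_inv _
    change _ = z.im⁻¹ ^ 2 • P (cuspCoord z)
    rw [hP1 _ (inv_pos.2 hy), cuspChart_cuspCoord, smul_smul, hc, ← mul_pow,
      inv_mul_cancel₀ hy.ne', one_pow, one_smul]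
  refine ((contDiffOn_ofReIm (key 1) (key Complex.I)).congr
    fun z _ => clm_ext_re_im (flatForm k h τ z)).differentiableOn (by simp)

lemma differentiableOn_mixForm (k : ℕ) (h : Fin 2) (τ : ℍ) (p : ℤ × ℤ × ℤ) :
    DifferentiableOn ℝ (mixForm k h τ p) UHP := by
  have key : ∀ z ∈ UHP, DifferentiableAt ℝ (mixU k h τ p) z ∧
      DifferentiableAt ℝ (mixW k h τ p) z := by
    intro z hz
    choose D E h1 h2 h3 using exists_hasFDerivAt_mix k h τ p hz
    exact ⟨(hasFDerivAt_pi.2 h1).differentiableAt, (hasFDerivAt_pi.2 h2).differentiableAt⟩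
  intro z hz
  have h5 : DifferentiableAt ℝ (fun z => ofReIm (-mixW k h τ p z) (mixU k h τ p z)) z :=
    ((((ContinuousLinearMap.smulRightL ℝ ℂ (Tens k) Complex.reCLM).hasFDerivAt.comp z
      (key z hz).2.hasFDerivAt.neg).add ((ContinuousLinearMap.smulRightL ℝ ℂ (Tens k)
        Complex.imCLM).hasFDerivAt.comp z (key z hz).1.hasFDerivAt))).differentiableAt
  refine ((h5.const_smul (1 / √τ.im : ℂ)).congr_of_eventuallyEq ?_).differentiableWithinAt
  exact Filter.eventually_of_mem (isOpen_UHP.mem_nhds hz) fun z hz => mixForm_eq k h τ p hz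

lemma isClosed1_flatForm (k : ℕ) (h : Fin 2) (τ : ℍ) : IsClosed1 (flatForm k h τ) := by
  have hc : ∀ p, IsClosed1 fun z => decays p • mixForm k h τ p z := by
    intro p z hz v w
    rw [fderiv_fun_const_smul ((differentiableOn_mixForm k h τ p).differentiableAt
      (isOpen_UHP.mem_nhds hz))]
    simp only [smul_apply, isClosed1_mixForm k h τ p z hz v w]
  have hs : DifferentiableOn ℝ (fun z => ∑' p, decays p • mixForm k h τ p z) UHP :=
    (differentiableOn_flatForm k h τ).congr fun z hz => (flatForm_eq_tsum k h τ hz).symm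
  have h1 := isClosed1_tsum hc (fun p => (differentiableOn_mixForm k h τ p).fun_const_smul _)
    (fun z hz => ?_) hs
  · intro z hz v w
    have e : flatForm k h τ =ᶠ[nhds z] fun z => ∑' p, decays p • mixForm k h τ p z :=
      Filter.eventually_of_mem (isOpen_UHP.mem_nhds hz) fun z hz => flatForm_eq_tsum k h τ hz
    rw [e.fderiv_eq]
    exact h1 z hz v w
  · have hy : 0 < z.im := hz
    have hb : ∀ y ∈ Metric.closedBall z (z.im / 2), z.im / 2 ≤ y.im ∧ |y.re| ≤ |z.re| + z.im := by
      intro y hy'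
      rw [Metric.mem_closedBall, dist_eq_norm] at hy'
      have h2 := (Complex.abs_im_le_norm (y - z)).trans hy'
      have h3 := (Complex.abs_re_le_norm (y - z)).trans hy'
      rw [Complex.sub_im, abs_le] at h2
      rw [Complex.sub_re] at h3
      refine ⟨by linarith [h2.1], ?_⟩
      have := abs_add_le (y.re - z.re) z.re
      rw [sub_add_cancel] at this
      linarith
    have hsub : Metric.closedBall z (z.im / 2) ⊆ UHP := fun y hy' =>
      show 0 < y.im by have := (hb y hy').1; linarith
    have hM : ∀ α β, ∃ M, ∀ y ∈ Metric.closedBall z (z.im / 2), ‖frameS k y α β‖ ≤ M :=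
      fun α β => (isCompact_closedBall z (z.im / 2)).exists_bound_of_continuousOn
        ((continuousOn_frameS k α β).mono hsub)
    choose M hM using hM
    choose u hu hu1 using fun (α : Fin 2) (β : Fin k → Fin 2) =>
      exists_mixTerm_le (deg 0 α β) (deg 1 α β) h τ (R := |z.re| + z.im) (y₀ := z.im / 2)
        (by positivity) (by positivity)
    refine ⟨Metric.ball z (z.im / 2), Metric.isOpen_ball, (convex_ball z _).isPreconnected,
      Metric.mem_ball_self (by positivity), Metric.ball_subset_closedBall.trans hsub,
      fun p => ∑ α : Fin 2, ∑ β : Fin k → Fin 2, u α β p * M α β,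
      summable_sum fun α _ => summable_sum fun β _ => (hu α β).mul_right _, fun p y hy' => ?_⟩
    have hy2 := Metric.ball_subset_closedBall hy'
    refine (norm_decays_smul_mixForm_le k h τ p y).trans (Finset.sum_le_sum fun α _ =>
      Finset.sum_le_sum fun β _ => ?_)
    have h3 := hu1 α β p y (hb y hy2).2 (hb y hy2).1
    exact mul_le_mul h3 (hM α β y hy2) (norm_nonneg _) ((norm_nonneg _).trans h3)

lemma contDiff_bdryBase (k : ℕ) : ContDiff ℝ ∞ (bdryBase k) :=
  contDiff_const.smulRight ((contDiff_act_n k _).comp Complex.reCLM.contDiff)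

lemma isClosed1_bdryBase (k : ℕ) : IsClosed1 (bdryBase k) := by
  set g : ℝ → Tens k := fun x => act k (n x) (harmProj k (power k mH)) with hg
  have h1 : ∀ z ∈ UHP, HasFDerivAt (fun z : ℂ => -g z.re)
      (-((fderiv ℝ g z.re).comp Complex.reCLM)) z := fun z _ =>
    ((((contDiff_act_n k _).differentiable (by simp) z.re).hasFDerivAt).comp z
      Complex.reCLM.hasFDerivAt).neg
  have h2 := isClosed1_of_hasFDerivAt (fun z _ => hasFDerivAt_const (0 : Tens k) z) h1
    fun z _ => by simp
  have h3 : bdryBase k = fun z : ℂ => ofReIm (-(-g z.re)) (0 : Tens k) := by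
    funext z
    refine ContinuousLinearMap.ext fun w => ?_
    rw [ofReIm_apply, neg_neg, smul_zero, add_zero]
    rfl
  rw [h3]
  exact h2

lemma isClosed1_thetaV (k : ℕ) (h : Fin 2) (τ : ℍ) : IsClosed1 (thetaV k h τ) := by
  obtain ⟨f, hf⟩ := exists_primitive (isClosed1_bdryBase k)
    ((contDiff_bdryBase k).contDiffOn.differentiableOn (by simp))
  obtain ⟨g, hg⟩ := exists_primitive (isClosed1_flatForm k h τ) (differentiableOn_flatForm k h τ)
  refine isClosed1_of_primitive ((contDiffOn_thetaV k h τ).differentiableOn (by simp))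
    fun z hz => ⟨fun z => bdryC k h τ • f z + thetaC k τ • harmProjR k (g z), ?_⟩
  filter_upwards [isOpen_UHP.mem_nhds hz] with y hy
  rw [thetaV_split k h τ hy]
  exact ((hf y hy).const_smul (bdryC k h τ)).add
    (((harmProjR k).hasFDerivAt.comp y (hg y hy)).const_smul (thetaC k τ))

lemma isForm1_thetaV (k : ℕ) (h : Fin 2) (τ : ℍ) : IsForm1 (thetaV k h τ) where
  mem _ hz w := thetaV_mem_harm k h τ hz w
  smooth := contDiffOn_thetaV k h τ
  inv γ _ hz := pull1_thetaV k h τ γ hz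

/-! ### The boundary theta series -/

lemma bdryTerm_eq (k : ℕ) (h : Fin 2) (τ : ℍ) (x : ℝ) (B : ℤ) : bdryTerm k h τ x B =
    (((-(1 / ((2 : ℝ) ^ (3 * (k : ℝ) / 2 + 1 / 2) * k)) : ℝ) : ℂ) * torTerm (k + 1) h τ B) •
      act k (n x) (vNegTwo k) := by
  have hv := τ.im_pos
  have h2 : (√2 : ℝ) ^ 2 = 2 := Real.sq_sqrt (by norm_num)
  rw [bdryTerm, phiN, smul_smul, torTerm, hermiteT_eq, unaryVec]
  congr 1
  have e1 : Complex.exp (2 * Real.pi * Complex.I * τ * ((B + (h.val : ℝ) / 2 : ℝ) : ℂ) ^ 2) =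
      Complex.exp (Real.pi * Complex.I * (((√2 * (B + (h.val : ℝ) / 2)) ^ 2 : ℝ) : ℂ) * (τ.re : ℝ)) *
        ((Real.exp (-Real.pi * (√τ.im * (√2 * (B + (h.val : ℝ) / 2))) ^ 2) : ℝ) : ℂ) := by
    rw [Complex.ofReal_exp, ← Complex.exp_add, mul_pow √2, mul_pow √τ.im, Real.sq_sqrt hv.le,
      mul_pow √2, h2]
    congr 1
    have hτ : (τ : ℂ) = τ.re + τ.im * Complex.I := (Complex.re_add_im _).symm
    rw [hτ]
    push_cast
    linear_combination (2 * Real.pi * τ.im * ((B : ℂ) + (h.val : ℂ) / 2) ^ 2) * Complex.I_sq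
  rw [e1, mul_assoc √τ.im]
  push_cast
  ring

lemma summable_bdryTerm (k : ℕ) (h : Fin 2) (τ : ℍ) (x : ℝ) : Summable (bdryTerm k h τ x) := by
  refine (((summable_torTerm (k + 1) h τ).mul_left _).smul_const _).congr fun B =>
    (bdryTerm_eq k h τ x B).symm

lemma thetaN_eq {k : ℕ} (hk : k ≠ 0) (h : Fin 2) (τ : ℍ) (x : ℝ) :
    thetaN k h τ x = (bdryC k h τ / k) • act k (n x) (vNegTwo k) := by
  have hkC : (k : ℂ) ≠ 0 := by exact_mod_cast hk
  rw [thetaN]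
  simp only [bdryTerm_eq]
  rw [((summable_torTerm (k + 1) h τ).mul_left _).tsum_smul_const, tsum_mul_left, smul_smul, bdryC]
  congr 1
  push_cast
  field_simp

/-- The two theta series form a cocycle of the mapping cone. -/
lemma isConeCocycle_theta {k : ℕ} (hk : k ≠ 0) (h : Fin 2) (τ : ℍ) :
    IsConeCocycle (thetaV k h τ) (thetaN k h τ) := by
  have hkC : (k : ℂ) ≠ 0 := by exact_mod_cast hk
  have hw := isWeightNegTwo_vNegTwo hk
  have hN : thetaN k h τ = fun x => (bdryC k h τ / k) • act k (n x) (vNegTwo k) :=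
    funext fun x => thetaN_eq hk h τ x
  obtain ⟨P, Q, hP, hQ, hP1, hQ1, hP0⟩ := exists_thetaV_components k h τ
  refine ⟨isForm1_thetaV k h τ, isClosed1_thetaV k h τ, ⟨fun x => ?_, ?_, fun x => ?_⟩, _,
    extends1_of_components hP hQ hP1 hQ1, fun x => ?_⟩
  · rw [hN]
    exact (harm k).smul_mem _ (act_mem_harm (by simp [det_n]) hw.1)
  · rw [hN]
    exact (contDiff_act_n k _).const_smul _
  · rw [hN]
    simp only [map_smul]
    rw [add_comm, act_n_add]
  · rw [hN, ((hasDerivAt_act_n_vNegTwo hk x).fun_const_smul (bdryC k h τ / k)).deriv, ofComp_apply, hP0,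
      smul_smul, div_mul_cancel₀ _ hkC]
    simp

/-! ### Primitives up to the boundary -/

/-- The half plane `t ≥ 0` on which the coordinates at the cusp live. -/
def cuspHalf : Set (ℝ × ℝ) := {p | 0 ≤ p.2}

lemma convex_cuspHalf : Convex ℝ cuspHalf := by
  have h := (convex_Ici (0 : ℝ)).linear_preimage (LinearMap.snd ℝ ℝ ℝ)
  exact h

lemma isOpen_cuspPos : IsOpen {p : ℝ × ℝ | 0 < p.2} := isOpen_lt continuous_const continuous_snd

lemma cuspHalf_mem_nhds {q : ℝ × ℝ} (hq : 0 < q.2) : cuspHalf ∈ nhds q :=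
  Filter.mem_of_superset (isOpen_cuspPos.mem_nhds hq) fun p hp => (show 0 < p.2 from hp).le

lemma uniqueDiffOn_cuspHalf : UniqueDiffOn ℝ cuspHalf :=
  uniqueDiffOn_convex convex_cuspHalf ⟨(0, 1), mem_interior_iff_mem_nhds.2
    (cuspHalf_mem_nhds (by norm_num))⟩

/-- A continuous function on the half plane that vanishes in the interior vanishes. -/
lemma eq_zero_of_eq_zero_pos {E : Type*} [NormedAddCommGroup E] {g : ℝ × ℝ → E}
    (hg : ContinuousOn g cuspHalf) (h0 : ∀ q : ℝ × ℝ, 0 < q.2 → g q = 0) {q : ℝ × ℝ}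
    (hq : q ∈ cuspHalf) : g q = 0 := by
  have hcl : q ∈ closure {p : ℝ × ℝ | 0 < p.2} := by
    have h1 := isOpenMap_snd.preimage_closure_eq_closure_preimage
      (continuous_snd : Continuous (Prod.snd : ℝ × ℝ → ℝ)) (Set.Ioi 0)
    rw [closure_Ioi] at h1
    have h2 : q ∈ (Prod.snd : ℝ × ℝ → ℝ) ⁻¹' Set.Ici 0 := hq
    rw [h1] at h2
    exact h2
  have hne : (nhdsWithin q {p : ℝ × ℝ | 0 < p.2}).NeBot := mem_closure_iff_nhdsWithin_neBot.1 hcl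
  have h2 := (hg q hq).mono_left (nhdsWithin_mono q (s := {p : ℝ × ℝ | 0 < p.2})
    fun p hp => (show 0 < p.2 from hp).le)
  refine tendsto_nhds_unique h2 (tendsto_const_nhds.congr' ?_)
  filter_upwards [self_mem_nhdsWithin] with p hp using (h0 p hp).symm

/-- A function on the half plane whose derivative vanishes in the interior is constant. -/
lemma eq_of_hasFDerivWithinAt_zero {E : Type*} [NormedAddCommGroup E] [NormedSpace ℝ E]
    {g : ℝ × ℝ → E} {A : ℝ × ℝ → ℝ × ℝ →L[ℝ] E} (hA : ContinuousOn A cuspHalf)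
    (hg : ∀ q ∈ cuspHalf, HasFDerivWithinAt g (A q) cuspHalf q)
    (h0 : ∀ q : ℝ × ℝ, 0 < q.2 → A q = 0) {p q : ℝ × ℝ} (hp : p ∈ cuspHalf) (hq : q ∈ cuspHalf) :
    g p = g q := by
  refine convex_cuspHalf.is_const_of_fderivWithin_eq_zero (𝕜 := ℝ)
    (fun x hx => (hg x hx).differentiableWithinAt) (fun x hx => ?_) hp hq
  rw [(hg x hx).fderivWithin (uniqueDiffOn_cuspHalf x hx), eq_zero_of_eq_zero_pos hA h0 hx]

lemma differentiableAt_cuspChart {q : ℝ × ℝ} (hq : 0 < q.2) : DifferentiableAt ℝ cuspChart q := by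
  by_contra h
  have h1 := fderiv_cuspChart hq
  rw [fderiv_zero_of_not_differentiableAt h] at h1
  have h2 := DFunLike.congr_fun h1 (1, 0)
  simp [ofComp_apply] at h2

lemma cuspCoord_cuspChart (q : ℝ × ℝ) : cuspCoord (cuspChart q) = q := by
  rw [cuspCoord, cuspChart_re, cuspChart_im, inv_inv]

lemma differentiableAt_cuspCoord {z : ℂ} (hz : z ∈ UHP) : DifferentiableAt ℝ cuspCoord z :=
  (contDiffOn_cuspCoord.differentiableOn (by simp)).differentiableAt (isOpen_UHP.mem_nhds hz)

/-- The first component of a cocycle has a primitive on `t ≥ 0` that restricts to the second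
component. -/
lemma IsConeCocycle.exists_primitive {k : ℕ} {a : Form1 k} {b : ℝ → Tens k}
    (h : IsConeCocycle a b) : ∃ (f : Form0 k) (M : ℝ × ℝ → Tens k),
      (∀ z ∈ UHP, HasFDerivAt f (a z) z) ∧ Extends0 f M ∧ (∀ x, b x = M (x, 0)) ∧
      (∀ z ∈ UHP, f z ∈ harm k) ∧ ∀ z ∈ UHP, f (z + 1) = act k (n 1) (f z) := by
  obtain ⟨ha, hcl, hb, A, ⟨hA1, hA2⟩, hAb⟩ := h
  obtain ⟨f₀, hf₀⟩ := EisLift.exists_primitive hcl (ha.smooth.differentiableOn (by simp))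
  have hA1' : ContDiffOn ℝ ∞ A cuspHalf := hA1
  have hAd : DifferentiableOn ℝ A cuspHalf := hA1'.differentiableOn (by simp)
  have hint : ∀ q : ℝ × ℝ, 0 < q.2 → HasFDerivAt (f₀ ∘ cuspChart) (A q) q := fun q hq => by
    rw [hA2 q hq]
    exact (hf₀ _ (cuspChart_mem hq)).comp q (differentiableAt_cuspChart hq).hasFDerivAt
  -- `A` is a derivative in the interior, so its derivative is symmetric there, and by continuity up
  -- to the boundary; the Poincaré lemma on the convex set `cuspHalf` applies
  have hsymm : ∀ q ∈ cuspHalf, ∀ v w, fderivWithin ℝ A cuspHalf q v w =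
      fderivWithin ℝ A cuspHalf q w v := by
    intro q hq v w
    have hc : ContinuousOn (fun q => fderivWithin ℝ A cuspHalf q) cuspHalf :=
      hA1'.continuousOn_fderivWithin uniqueDiffOn_cuspHalf (by simp)
    have hc2 : ContinuousOn (fun q => fderivWithin ℝ A cuspHalf q v w -
        fderivWithin ℝ A cuspHalf q w v) cuspHalf :=
      ((hc.clm_apply continuousOn_const).clm_apply continuousOn_const).sub
        ((hc.clm_apply continuousOn_const).clm_apply continuousOn_const)
    refine sub_eq_zero.1 (eq_zero_of_eq_zero_pos hc2 (fun q hq => ?_) hq)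
    rw [fderivWithin_of_mem_nhds (cuspHalf_mem_nhds hq), sub_eq_zero]
    refine second_derivative_symmetric_of_eventually (f := f₀ ∘ cuspChart) (f' := A) ?_
      (hAd.differentiableAt (cuspHalf_mem_nhds hq)).hasFDerivAt v w
    filter_upwards [isOpen_cuspPos.mem_nhds hq] with p hp using hint p hp
  obtain ⟨M₁, hM₁⟩ := convex_cuspHalf.exists_forall_hasFDerivWithinAt_of_fderivWithin_symmetric hAd
    fun q hq v _ w _ => hsymm q hq v w
  -- normalised to agree with `b` at `0`, hence on the whole boundary since `i^* A = db`
  set M : ℝ × ℝ → Tens k := fun q => M₁ q - M₁ (0, 0) + b 0 with hM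
  have hMd : ∀ q ∈ cuspHalf, HasFDerivWithinAt M (A q) cuspHalf q := fun q hq =>
    ((hM₁ q hq).sub_const _).add_const _
  have h0 : ∀ x : ℝ, (x, (0 : ℝ)) ∈ cuspHalf := fun x => le_refl (0 : ℝ)
  have hMb : ∀ x, b x = M (x, 0) := by
    have h1 : ∀ x, HasDerivAt (fun x => b x - M (x, 0)) (deriv b x - A (x, 0) (1, 0)) x := by
      intro x
      have h2 : HasDerivAt (fun x : ℝ => (x, (0 : ℝ))) (1, 0) x :=
        (hasDerivAt_id x).prodMk (hasDerivAt_const x 0)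
      have h3 := (hMd _ (h0 x)).comp_hasDerivWithinAt x h2.hasDerivWithinAt
        (fun y _ => h0 y : Set.MapsTo _ Set.univ _)
      exact (((hb.smooth.differentiable (by simp)) x).hasDerivAt).sub
        (hasDerivWithinAt_univ.1 h3)
    intro x
    have h4 := is_const_of_deriv_eq_zero (fun x => (h1 x).differentiableAt)
      (fun x => by rw [(h1 x).deriv, hAb, sub_self]) x 0
    rw [← sub_eq_zero, h4]
    simp [hM]
  have hMs : ContDiffOn ℝ ∞ M cuspHalf := by
    rw [contDiffOn_infty_iff_fderivWithin uniqueDiffOn_cuspHalf]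
    refine ⟨fun q hq => (hMd q hq).differentiableWithinAt, hA1'.congr fun q hq => ?_⟩
    exact (hMd q hq).fderivWithin (uniqueDiffOn_cuspHalf q hq)
  have hpos : ∀ z ∈ UHP, 0 < (cuspCoord z).2 := fun z hz => inv_pos.2 hz
  have hAc := hA1'.continuousOn
  refine ⟨fun z => M (cuspCoord z), M, fun z hz => ?_, ⟨hMs, fun q hq => ?_⟩, hMb,
    fun z hz => ?_, fun z hz => ?_⟩
  · have h1 := ((hMd _ (hpos z hz).le).hasFDerivAt (cuspHalf_mem_nhds (hpos z hz))).comp z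
      (differentiableAt_cuspCoord hz).hasFDerivAt
    refine h1.congr_fderiv ?_
    rw [hA2 _ (hpos z hz), ContinuousLinearMap.comp_assoc, cuspChart_cuspCoord]
    have h2 := (differentiableAt_cuspChart (hpos z hz)).hasFDerivAt.comp z
      (differentiableAt_cuspCoord hz).hasFDerivAt
    have h3 : cuspChart ∘ cuspCoord = id := funext cuspChart_cuspCoord
    rw [h3] at h2
    rw [h2.unique (hasFDerivAt_id z)]
    rfl
  · beta_reduce
    rw [cuspCoord_cuspChart]
  -- the non-harmonic part of `M` is constant and vanishes on the boundary
  · set Λ : Tens k →L[ℝ] Tens k := ContinuousLinearMap.id ℝ _ - harmProjR k with hΛ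
    have hΛ0 : ∀ T ∈ harm k, Λ T = 0 := fun T hT => by
      change T - harmProj k T = 0
      rw [harmProj_of_mem hT, sub_self]
    have h1 := eq_of_hasFDerivWithinAt_zero (g := fun q => Λ (M q)) (A := fun q => Λ.comp (A q))
      (continuousOn_const.clm_comp hAc)
      (fun q hq => Λ.hasFDerivAt.comp_hasFDerivWithinAt q (hMd q hq)) (fun q hq => by
        rw [hA2 q hq]
        exact ContinuousLinearMap.ext fun w => hΛ0 _ (ha.mem _ (cuspChart_mem hq) _))
      (hpos z hz).le (h0 0)
    simp only [← hMb, hΛ0 _ (hb.mem 0)] at h1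
    have h2 : M (cuspCoord z) = harmProj k (M (cuspCoord z)) := sub_eq_zero.1 h1
    beta_reduce
    rw [h2]
    exact harmProj_mem k _
  -- the failure of equivariance under translation is constant and vanishes on the boundary
  · set Λ : Tens k →L[ℝ] Tens k := (act k (n 1)).restrictScalars ℝ with hΛ
    have hs : ∀ q ∈ cuspHalf, q + (1, 0) ∈ cuspHalf := fun q hq => by
      change 0 ≤ q.2 + 0
      rw [add_zero]
      exact hq
    have hd : ∀ q ∈ cuspHalf, HasFDerivWithinAt (fun q => M (q + (1, 0)) - Λ (M q))
        (A (q + (1, 0)) - Λ.comp (A q)) cuspHalf q := fun q hq => by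
      have h1 : HasFDerivWithinAt (fun q : ℝ × ℝ => q + (1, 0)) (ContinuousLinearMap.id ℝ _)
        cuspHalf q := ((hasFDerivWithinAt_id q _).add_const _)
      exact ((hMd _ (hs q hq)).comp q h1 hs).sub
        (Λ.hasFDerivAt.comp_hasFDerivWithinAt q (hMd q hq))
    have hc : ContinuousOn (fun q => A (q + (1, 0)) - Λ.comp (A q)) cuspHalf :=
      (hAc.comp (continuous_id.add continuous_const).continuousOn hs).sub
        (continuousOn_const.clm_comp hAc)
    have hchart : ∀ q : ℝ × ℝ, cuspChart (q + (1, 0)) = cuspChart q + 1 := fun q => by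
      simp [cuspChart]
      ring
    have hT : ∀ z ∈ UHP, ∀ w, a (z + 1) w = act k (n 1) (a z w) := by
      intro z hz w
      have h1 := DFunLike.congr_fun (ha.inv ModularGroup.T z hz) w
      rw [pull1_apply _ _ hz] at h1
      have h2 : moebius ModularGroup.T z = z + 1 := by
        simp [moebius, ModularGroup.T]
      have h3 : toR ModularGroup.T⁻¹ = n (-1) := by
        ext i j
        fin_cases i <;> fin_cases j <;> simp [toR, n]
      rw [h2, h3] at h1
      rw [← h1, ← act_mul _ _ _ (by simp [det_n]), n_mul, add_neg_cancel]
      have h4 : n 0 = 1 := by ext i j; fin_cases i <;> fin_cases j <;> simp [n]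
      rw [h4, act_one]
      simp [ModularGroup.T]
    have h1 := eq_of_hasFDerivWithinAt_zero hc hd (fun q hq => by
      have hq' : 0 < (q + (1, 0)).2 := by simpa using hq
      have hf : fderiv ℝ cuspChart (q + (1, 0)) = fderiv ℝ cuspChart q := by
        rw [fderiv_cuspChart hq, fderiv_cuspChart hq']
        simp
      rw [hA2 q hq, hA2 _ hq', hf, hchart, sub_eq_zero]
      exact ContinuousLinearMap.ext fun w => hT _ (cuspChart_mem hq) _) (hpos z hz).le (h0 0)
    have h2 : M ((0, 0) + (1, 0)) - Λ (M (0, 0)) = 0 := by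
      have e : ((0, 0) + (1, 0) : ℝ × ℝ) = (0 + 1, 0) := by simp
      rw [e, ← hMb, ← hMb, hb.inv, sub_eq_zero]
      rfl
    have h3 : cuspCoord (z + 1) = cuspCoord z + (1, 0) := by simp [cuspCoord]
    simp only [h2, sub_eq_zero] at h1
    beta_reduce
    rw [h3]
    exact h1

/-! ### Equivariant extension from the cusp -/

lemma act_neg (k : ℕ) (g : Matrix (Fin 2) (Fin 2) ℝ) : act k (-g) = act k g := by
  have h : ∀ i j, Ad (-g) i j = Ad g i j := by
    intro i j
    have hn : (-g)⁻¹ = -g⁻¹ := by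
      rcases eq_or_ne g.det 0 with h0 | h0
      · have h0' : (-g).det = 0 := by simp [Matrix.det_neg, h0]
        rw [Matrix.nonsing_inv_apply_not_isUnit _ (by simp [h0']),
          Matrix.nonsing_inv_apply_not_isUnit _ (by simp [h0]), neg_zero]
      · refine Matrix.inv_eq_left_inv ?_
        rw [neg_mul_neg, Matrix.nonsing_inv_mul _ (isUnit_iff_ne_zero.2 h0)]
    simp only [Ad, Matrix.of_apply, hn, neg_mul, mul_neg, neg_neg]
  refine ContinuousLinearMap.ext fun T => funext fun β => ?_
  simp only [act_apply, h]

lemma toR_neg (γ : SL(2, ℤ)) : toR (-γ) = -toR γ := by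
  ext i j
  simp [toR]

lemma moebius_neg (γ : SL(2, ℤ)) (z : ℂ) : moebius (-γ) z = moebius γ z := by
  simp only [moebius, Matrix.SpecialLinearGroup.coe_neg, Matrix.neg_apply, Int.cast_neg]
  rw [neg_mul, neg_mul, ← neg_add, ← neg_add, neg_div_neg_eq]

lemma pull0_neg {k : ℕ} (γ : SL(2, ℤ)) (f : Form0 k) (z : ℂ) : pull0 (-γ) f z = pull0 γ f z := by
  rw [pull0, pull0, moebius_neg]
  have h : toR (-γ)⁻¹ = -toR γ⁻¹ := by
    rw [← toR_neg]
    congr 1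
    exact inv_neg
  rw [h, act_neg]

lemma moebius_T (z : ℂ) : moebius ModularGroup.T z = z + 1 := by
  simp [moebius, ModularGroup.T]

lemma toR_T : toR ModularGroup.T = n 1 := by
  ext i j
  fin_cases i <;> fin_cases j <;> simp [toR, n, ModularGroup.T]

lemma toR_T_inv : toR ModularGroup.T⁻¹ = n (-1) := by
  ext i j
  fin_cases i <;> fin_cases j <;> simp [toR, n]

lemma pull0_T {k : ℕ} {φ : Form0 k} (hT : ∀ z ∈ UHP, φ (z + 1) = act k (n 1) (φ z)) {z : ℂ}
    (hz : z ∈ UHP) : pull0 ModularGroup.T φ z = φ z := by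
  have h4 : n 0 = 1 := by ext i j; fin_cases i <;> fin_cases j <;> simp [n]
  rw [pull0, moebius_T, hT z hz, toR_T_inv, ← act_n_add, neg_add_cancel, h4, act_one]

lemma pull0_T_zpow {k : ℕ} {φ : Form0 k} (hT : ∀ z ∈ UHP, φ (z + 1) = act k (n 1) (φ z)) (m : ℤ)
    {z : ℂ} (hz : z ∈ UHP) : pull0 (ModularGroup.T ^ m) φ z = φ z := by
  have hone : ∀ z, pull0 1 φ z = φ z := fun z => by
    rw [pull0, moebius_one, inv_one, toR_one, act_one]
  have hinv : ∀ z ∈ UHP, pull0 ModularGroup.T⁻¹ φ z = φ z := fun z hz => by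
    have h1 := pull0_mul ModularGroup.T ModularGroup.T⁻¹ φ hz
    rw [mul_inv_cancel, hone] at h1
    rw [h1, pull0, pull0, pull0_T hT (moebius_mem _ hz)]
  induction m using Int.induction_on generalizing z with
  | zero => rw [zpow_zero, hone]
  | succ m ih => rw [zpow_add_one, pull0_mul _ _ _ hz, pull0, ih (moebius_mem _ hz)]
                 exact pull0_T hT hz
  | pred m ih => rw [zpow_sub_one, pull0_mul _ _ _ hz, pull0, ih (moebius_mem _ hz)]
                 exact hinv z hz

/-- Two points above height `1` that are equivalent differ by a translation. -/
lemma eq_T_zpow_of_one_lt_im {ε : SL(2, ℤ)} {w : ℂ} (hw : 1 < w.im) (h : 1 < (moebius ε w).im) :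
    ∃ m : ℤ, ε = ModularGroup.T ^ m ∨ ε = -(ModularGroup.T ^ m) := by
  have hwU : w ∈ UHP := show 0 < w.im by linarith
  rw [im_moebius ε hwU] at h
  have hc : ε 1 0 = 0 := by
    by_contra hc
    have h1 : (1 : ℝ) ≤ |(ε 1 0 : ℝ)| := by
      exact_mod_cast Int.one_le_abs hc
    have h2 : w.im ≤ ‖(ε 1 0 : ℂ) * w + ε 1 1‖ := by
      refine le_trans ?_ (Complex.abs_im_le_norm _)
      have : ((ε 1 0 : ℂ) * w + ε 1 1).im = ε 1 0 * w.im := by simp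
      rw [this, abs_mul, abs_of_pos (by linarith : 0 < w.im)]
      nlinarith
    rw [lt_div_iff₀ (pow_pos (lt_of_lt_of_le (by linarith : 0 < w.im) h2) 2), one_mul] at h
    nlinarith
  have hd : ε 1 1 = 1 ∨ ε 1 1 = -1 := by
    have := det_eq ε
    rw [hc, mul_zero, sub_zero] at this
    exact Int.isUnit_iff.1 (IsUnit.of_mul_eq_one_right _ this)
  rcases hd with hd | hd
  · obtain ⟨m, hm⟩ := (row_eq_iff 1 ε).1 (by
      funext j; fin_cases j <;> simp [row, hc, hd])
    exact ⟨m, Or.inl (by rw [hm, mul_one])⟩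
  · obtain ⟨m, hm⟩ := (row_eq_iff 1 (-ε)).1 (by
      funext j; fin_cases j <;> simp [row, hc, hd])
    exact ⟨m, Or.inr (by rw [← neg_neg ε, hm, mul_one])⟩

lemma pull0_eq_of_one_lt_im {k : ℕ} {φ : Form0 k}
    (hT : ∀ z ∈ UHP, φ (z + 1) = act k (n 1) (φ z)) {γ δ : SL(2, ℤ)} {z : ℂ} (hz : z ∈ UHP)
    (hγ : 1 < (moebius γ z).im) (hδ : 1 < (moebius δ z).im) : pull0 γ φ z = pull0 δ φ z := by
  have h1 : δ = δ * γ⁻¹ * γ := by group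
  have hw := moebius_mem γ hz
  have h2 : moebius (δ * γ⁻¹) (moebius γ z) = moebius δ z := by
    rw [← moebius_mul _ _ hz, ← h1]
  have h3 : pull0 (δ * γ⁻¹) φ (moebius γ z) = φ (moebius γ z) := by
    obtain ⟨m, hm | hm⟩ := eq_T_zpow_of_one_lt_im hγ (h2.symm ▸ hδ)
    · rw [hm, pull0_T_zpow hT m hw]
    · rw [hm, pull0_neg, pull0_T_zpow hT m hw]
  rw [h1, pull0_mul _ _ _ hz]
  rw [pull0, pull0, h3]

/-- Points near a point whose orbit stays below height `1` have orbits below height `2`. -/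
lemma eventually_im_moebius_le {z : ℂ} (hz : z ∈ UHP) (h : ∀ γ, (moebius γ z).im ≤ 1) :
    ∀ᶠ y in nhds z, ∀ γ, (moebius γ y).im ≤ 2 := by
  have hz0 : 0 < z.im := hz
  filter_upwards [Metric.ball_mem_nhds z (show 0 < z.im / 10 by positivity)] with y hy γ
  rw [Metric.mem_ball, dist_eq_norm] at hy
  have hyim := (Complex.abs_im_le_norm (y - z)).trans hy.le
  rw [Complex.sub_im, abs_le] at hyim
  have hy0 : 0 < y.im := by linarith [hyim.1]
  have h1 := h γ
  rw [im_moebius γ hz] at h1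
  rw [im_moebius γ (show y ∈ UHP from hy0)]
  set c : ℂ := (γ 1 0 : ℂ)
  set N := ‖c * z + γ 1 1‖ with hN
  have hN0 : 0 < N := norm_pos_iff.2 (row_denom_ne_zero γ hz)
  have h2 : ‖c‖ * z.im ≤ N := by
    have h3 : |(c * z + γ 1 1).im| = ‖c‖ * z.im := by
      have : (c * z + γ 1 1).im = γ 1 0 * z.im := by simp [c]
      rw [this, abs_mul, abs_of_pos hz0]
      congr 1
      rw [Complex.norm_intCast]
    rw [← h3]
    exact Complex.abs_im_le_norm _
  have h4 : N * (9 / 10) ≤ ‖c * y + γ 1 1‖ := by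
    have e : c * z + γ 1 1 = (c * y + γ 1 1) - c * (y - z) := by ring
    have h5 : N ≤ ‖c * y + γ 1 1‖ + ‖c‖ * ‖y - z‖ := by
      rw [hN, e, ← norm_mul]
      exact norm_sub_le _ _
    have h6 : ‖c‖ * ‖y - z‖ ≤ ‖c‖ * (z.im / 10) := mul_le_mul_of_nonneg_left hy.le (norm_nonneg _)
    linarith
  have h7 : 0 < ‖c * y + γ 1 1‖ := by linarith [mul_pos hN0 (show (0 : ℝ) < 9 / 10 by norm_num)]
  rw [div_le_iff₀ (by positivity)] at h1 ⊢
  nlinarith [hyim.2, mul_self_le_mul_self (by positivity) h4]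

/-- A function near the cusp that is invariant under translation extends to an invariant function. -/
lemma exists_isForm0_of_cusp {k : ℕ} {φ : Form0 k} (hmem : ∀ z ∈ UHP, φ z ∈ harm k)
    (hs : ContDiffOn ℝ ∞ φ UHP) (hT : ∀ z ∈ UHP, φ (z + 1) = act k (n 1) (φ z))
    (h0 : ∀ z ∈ UHP, z.im ≤ 2 → φ z = 0) :
    ∃ μ : Form0 k, IsForm0 μ ∧ ∀ z, 1 < z.im → μ z = φ z := by
  classical
  set μ : Form0 k := fun z => if h : ∃ γ, 1 < (moebius γ z).im then pull0 h.choose φ z else 0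
    with hμ
  have hval : ∀ z ∈ UHP, ∀ γ, 1 < (moebius γ z).im → μ z = pull0 γ φ z := by
    intro z hz γ hγ
    have hex : ∃ γ, 1 < (moebius γ z).im := ⟨γ, hγ⟩
    simp only [hμ, dif_pos hex]
    exact pull0_eq_of_one_lt_im hT hz hex.choose_spec hγ
  have hzero : ∀ z, (∀ γ, (moebius γ z).im ≤ 1) → μ z = 0 := by
    intro z h
    have hex : ¬∃ γ, 1 < (moebius γ z).im := fun ⟨γ, hγ⟩ => absurd (h γ) (not_le.2 hγ)
    simp only [hμ, dif_neg hex]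
  refine ⟨μ, ⟨fun z hz => ?_, fun z hz => ?_, fun γ z hz => ?_⟩, fun z hz => ?_⟩
  · by_cases hex : ∃ γ, 1 < (moebius γ z).im
    · obtain ⟨γ, hγ⟩ := hex
      rw [hval z hz γ hγ]
      exact act_mem_harm (det_toR_ne _) (hmem _ (moebius_mem γ hz))
    · rw [hzero z fun γ => not_lt.1 fun hγ => hex ⟨γ, hγ⟩]
      exact zero_mem _
  · by_cases hex : ∃ γ, 1 < (moebius γ z).im
    · obtain ⟨γ, hγ⟩ := hex
      have hcd := contDiffOn_pull0 γ hs subset_rfl fun z hz => moebius_mem γ hz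
      have hcont : ContinuousAt (fun z => (moebius γ z).im) z :=
        Complex.continuous_im.continuousAt.comp
          ((contDiffOn_moebius γ).continuousOn.continuousAt (isOpen_UHP.mem_nhds hz))
      refine ((hcd.contDiffAt (isOpen_UHP.mem_nhds hz)).congr_of_eventuallyEq
        ?_).contDiffWithinAt
      filter_upwards [isOpen_UHP.mem_nhds hz, hcont.eventually (lt_mem_nhds hγ)] with y hy hy'
      exact hval y hy γ hy'
    · have hle : ∀ γ, (moebius γ z).im ≤ 1 := fun γ => not_lt.1 fun hγ => hex ⟨γ, hγ⟩
      refine (contDiffAt_const (c := (0 : Tens k)).congr_of_eventuallyEq ?_).contDiffWithinAt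
      filter_upwards [isOpen_UHP.mem_nhds hz, eventually_im_moebius_le hz hle] with y hy hy'
      by_cases hex : ∃ γ, 1 < (moebius γ y).im
      · obtain ⟨γ, hγ⟩ := hex
        rw [hval y hy γ hγ, pull0, h0 _ (moebius_mem γ hy) (hy' γ), map_zero]
      · exact hzero y fun γ => not_lt.1 fun hγ => hex ⟨γ, hγ⟩
  · by_cases hex : ∃ δ, 1 < (moebius δ (moebius γ z)).im
    · obtain ⟨δ, hδ⟩ := hex
      have hδ' : 1 < (moebius (δ * γ) z).im := by rwa [moebius_mul _ _ hz]
      rw [hval z hz _ hδ', pull0_mul _ _ _ hz, pull0, hval _ (moebius_mem γ hz) δ hδ]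
      rfl
    · have hle : ∀ δ, (moebius δ (moebius γ z)).im ≤ 1 := fun δ => not_lt.1 fun hδ => hex ⟨δ, hδ⟩
      rw [pull0, hzero _ hle, map_zero, hzero z fun δ => ?_]
      have := hle (δ * γ⁻¹)
      rwa [← moebius_mul _ _ hz, inv_mul_cancel_right] at this
  · have hz' : z ∈ UHP := show 0 < z.im by linarith
    rw [hval z hz' 1 (by rwa [moebius_one]), pull0, moebius_one, inv_one, toR_one, act_one]

/-! ### Compactly supported representatives -/

lemma IsForm1.sub_fderiv {k : ℕ} {a : Form1 k} {μ : Form0 k} (ha : IsForm1 a) (hμ : IsForm0 μ) :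
    IsForm1 fun z => a z - fderiv ℝ μ z := by
  have hd : ∀ z ∈ UHP, HasFDerivAt μ (fderiv ℝ μ z) z := fun z hz =>
    ((hμ.smooth.differentiableOn (by simp)).differentiableAt (isOpen_UHP.mem_nhds hz)).hasFDerivAt
  refine ⟨fun z hz w => ?_, ha.smooth.sub (hμ.smooth.fderiv_of_isOpen isOpen_UHP (by simp)),
    fun γ z hz => ?_⟩
  · refine (harm k).sub_mem (ha.mem z hz w) ?_
    have h1 : HasFDerivAt μ ((harmProjR k).comp (fderiv ℝ μ z)) z :=
      ((harmProjR k).hasFDerivAt.comp z (hd z hz)).congr_of_eventuallyEq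
        (Filter.eventually_of_mem (isOpen_UHP.mem_nhds hz) fun y hy =>
          (harmProj_of_mem (hμ.mem y hy)).symm)
    rw [(hd z hz).unique h1]
    exact harmProj_mem k _
  · have h1 := hasFDerivAt_pull0 γ hz (hd _ (moebius_mem γ hz))
    have h2 : HasFDerivAt μ (pull1 γ (fderiv ℝ μ) z) z := h1.congr_of_eventuallyEq
      (Filter.eventually_of_mem (isOpen_UHP.mem_nhds hz) fun y hy => (hμ.inv γ y hy).symm)
    refine ContinuousLinearMap.ext fun w => ?_
    rw [sub_apply, ← ha.inv γ z hz, (hd z hz).unique h2, pull1_apply _ _ hz,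
      pull1_apply _ _ hz, pull1_apply _ _ hz, sub_apply, map_sub]

lemma IsClosed1.sub_fderiv {k : ℕ} {a : Form1 k} {μ : Form0 k} (ha : IsForm1 a) (hc : IsClosed1 a)
    (hμ : IsForm0 μ) : IsClosed1 fun z => a z - fderiv ℝ μ z := by
  obtain ⟨f, hf⟩ := exists_primitive hc (ha.smooth.differentiableOn (by simp))
  refine isClosed1_of_primitive ((ha.sub_fderiv hμ).smooth.differentiableOn (by simp))
    fun z hz => ⟨fun z => f z - μ z, ?_⟩
  filter_upwards [isOpen_UHP.mem_nhds hz] with y hy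
  exact (hf y hy).sub ((hμ.smooth.differentiableOn (by simp)).differentiableAt
    (isOpen_UHP.mem_nhds hy)).hasFDerivAt

lemma exists_moebius_im_gt {C : Set ℂ} {Y : ℝ}
    (hC : ∀ z : ℂ, |z.re| ≤ 1 → 1 / 2 ≤ z.im → z.im ≤ Y → z ∈ C) {z : ℂ} (hz : z ∈ UHP)
    (h : ∀ γ, moebius γ z ∉ C) : ∃ γ, Y < (moebius γ z).im := by
  obtain ⟨γ, hγ⟩ := ModularGroup.exists_smul_mem_fd ⟨z, hz⟩
  have e : ((γ • (⟨z, hz⟩ : ℍ) : ℍ) : ℂ) = moebius γ z := (moebius_eq_smul γ ⟨z, hz⟩).symm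
  have h1 := ModularGroup.three_le_four_mul_im_sq_of_mem_fd hγ
  have h2 : |(moebius γ z).re| ≤ 1 / 2 := by rw [← e]; exact hγ.2
  have h3 : 3 ≤ 4 * (moebius γ z).im ^ 2 := by rw [← e]; exact h1
  have h4 : 0 < (moebius γ z).im := moebius_mem γ hz
  refine ⟨γ, not_le.1 fun hle => h γ (hC _ (by linarith) ?_ hle)⟩
  by_contra hlt
  push Not at hlt
  nlinarith

/-- The class of a cocycle of the mapping cone has a compactly supported representative. -/
lemma IsConeCocycle.exists_represents {k : ℕ} {a : Form1 k} {b : ℝ → Tens k}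
    (h : IsConeCocycle a b) : ∃ α, Represents α a b := by
  obtain ⟨f, M, hf, ⟨hM1, hM2⟩, hMb, hfm, hfT⟩ := h.exists_primitive
  obtain ⟨ha, hcl, hb, -⟩ := h
  have hfs : ContDiffOn ℝ ∞ f UHP := by
    rw [contDiffOn_infty_iff_fderiv_of_isOpen isOpen_UHP]
    exact ⟨fun z hz => (hf z hz).differentiableAt.differentiableWithinAt,
      ha.smooth.congr fun z hz => (hf z hz).fderiv⟩
  -- cut off the primitive near the cusp, extend it by equivariance and subtract its derivative:
  -- nothing is left above height `3`
  have hχ : ContDiff ℝ ∞ fun z : ℂ => Real.smoothTransition (z.im - 2) :=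
    Real.smoothTransition.contDiff.comp (Complex.imCLM.contDiff.sub contDiff_const)
  obtain ⟨μ, hμ, hμ1⟩ := exists_isForm0_of_cusp (k := k)
    (φ := fun z => Real.smoothTransition (z.im - 2) • f z)
    (fun z hz => (harm k).smul_of_tower_mem _ (hfm z hz)) (hχ.contDiffOn.smul hfs)
    (fun z hz => by simp [hfT z hz]) fun z _ hz2 => by
      rw [Real.smoothTransition.zero_of_nonpos (by linarith), zero_smul]
  have hμf : ∀ z : ℂ, 3 ≤ z.im → μ z = f z := fun z hz => by
    rw [hμ1 z (by linarith), Real.smoothTransition.one_of_one_le (by linarith), one_smul]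
  have hform := ha.sub_fderiv hμ
  refine ⟨fun z => a z - fderiv ℝ μ z, hform, IsClosed1.sub_fderiv ha hcl hμ,
    ⟨Set.Icc (-1) 1 ×ℂ Set.Icc (1 / 2) 4, isCompact_Icc.reProdIm isCompact_Icc, fun z hz => ?_,
      fun z hz hC => ?_⟩, μ, fun q => if 0 < q.2 then μ (cuspChart q) else M q, hμ,
    ⟨fun q hq => ?_, fun q hq => by simp [hq]⟩, fun z hz => by simp, fun x => by simp [hMb]⟩
  · have := (Complex.mem_reProdIm.1 hz).2.1
    exact show 0 < z.im by linarith
  · obtain ⟨γ, hγ⟩ := exists_moebius_im_gt (Y := 4)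
      (C := Set.Icc (-1) 1 ×ℂ Set.Icc (1 / 2) 4) (fun z h1 h2 h3 =>
      Complex.mem_reProdIm.2 ⟨abs_le.1 h1, h2, h3⟩) hz hC
    have h0 : a (moebius γ z) - fderiv ℝ μ (moebius γ z) = 0 := by
      have hev : μ =ᶠ[nhds (moebius γ z)] f := by
        filter_upwards [(isOpen_lt continuous_const Complex.continuous_im).mem_nhds
          (show 3 < (moebius γ z).im by linarith)] with y hy
        exact hμf y (le_of_lt hy)
      rw [hev.fderiv_eq, (hf _ (moebius_mem γ hz)).fderiv, sub_self]
    have h1 := hform.inv γ z hz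
    beta_reduce at h1 ⊢
    rw [← h1]
    refine ContinuousLinearMap.ext fun w => ?_
    rw [pull1_apply _ _ hz, h0]
    simp
  · rcases lt_or_ge q.2 (1 / 3) with hq3 | hq3
    · refine (hM1 q hq).congr_of_eventuallyEq_of_mem ?_ hq
      have hlt : ∀ᶠ p in nhds q, p.2 < 1 / 3 :=
        continuous_snd.continuousAt.eventually (gt_mem_nhds hq3)
      filter_upwards [mem_nhdsWithin_of_mem_nhds hlt] with p hp
      split_ifs with hp0
      · rw [hM2 p hp0]
        refine hμf _ ?_
        rw [cuspChart_im, le_inv_comm₀ (by norm_num) hp0]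
        norm_num at hp ⊢
        exact hp.le
      · rfl
    · have hq0 : 0 < q.2 := by linarith
      have hch : ContDiffAt ℝ ∞ cuspChart q := by
        have h1 : ContDiffAt ℝ ∞ (fun q : ℝ × ℝ => (q.1 : ℂ) + Complex.I * ((q.2⁻¹ : ℝ) : ℂ)) q :=
          (Complex.ofRealCLM.contDiff.contDiffAt.comp q contDiffAt_fst).add
            (contDiffAt_const.mul (Complex.ofRealCLM.contDiff.contDiffAt.comp q
              (contDiffAt_snd.inv hq0.ne')))
        refine h1.congr_of_eventuallyEq (Filter.Eventually.of_forall fun p => ?_)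
        simp [cuspChart, div_eq_mul_inv]
      have hcomp := (hμ.smooth.contDiffAt (isOpen_UHP.mem_nhds (cuspChart_mem hq0))).comp q hch
      refine (hcomp.congr_of_eventuallyEq ?_).contDiffWithinAt
      filter_upwards [isOpen_cuspPos.mem_nhds hq0] with p hp
      rw [if_pos hp]
      rfl

/-! ### Unfolding an integral over the fundamental domain -/

section Unfolding

open MeasureTheory ModularGroup

lemma setIntegral_image_coe (F : ℂ → ℂ) {s : Set ℍ} (hs : MeasurableSet s) :
    ∫ z in ((fun w : ℍ => (w : ℂ)) '' s), F z = ∫ z in s, ((z.im : ℂ) ^ 2) * F z := by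
  have hm : Measurable fun z : ℍ => (1 / NNReal.mk z.im z.im_pos.le) ^ 2 := by
    have : Measurable fun z : ℍ => NNReal.mk z.im z.im_pos.le :=
      (UpperHalfPlane.continuous_im.measurable).subtype_mk
    exact (measurable_const.div this).pow_const 2
  have h1 : ∫ z in s, ((z.im : ℂ) ^ 2) * F z =
      ∫ z in s, F z ∂(volume.comap UpperHalfPlane.coe) := by
    rw [UpperHalfPlane.volume_def, setIntegral_withDensity_eq_setIntegral_smul hm _ hs]
    refine setIntegral_congr_fun hs fun z _ => ?_
    have hz : (z.im : ℂ) ≠ 0 := by exact_mod_cast z.im_ne_zero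
    change (((1 / NNReal.mk z.im z.im_pos.le) ^ 2 : NNReal) : ℝ) • (((z.im : ℂ) ^ 2) * F z) = F z
    rw [Complex.real_smul]
    push_cast
    field_simp
  have h2 := UpperHalfPlane.measurableEmbedding_coe.setIntegral_map
    (μ := volume.comap UpperHalfPlane.coe) F (UpperHalfPlane.coe '' s)
  rw [Set.preimage_image_eq _ UpperHalfPlane.measurableEmbedding_coe.injective,
    UpperHalfPlane.measurableEmbedding_coe.map_comap, Measure.restrict_restrict
      (UpperHalfPlane.measurableEmbedding_coe.measurableSet_image.2 hs),
    Set.inter_eq_self_of_subset_left (Set.image_subset_range _ _)] at h2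
  rw [h1, ← h2]

lemma integrableOn_of_image_coe {F : ℂ → ℂ} {s : Set ℍ} (hs : MeasurableSet s)
    (hF : IntegrableOn F ((fun w : ℍ => (w : ℂ)) '' s)) :
    IntegrableOn (fun z : ℍ => ((z.im : ℂ) ^ 2) * F z) s := by
  have hm : Measurable fun z : ℍ => (1 / NNReal.mk z.im z.im_pos.le) ^ 2 := by
    have : Measurable fun z : ℍ => NNReal.mk z.im z.im_pos.le :=
      (UpperHalfPlane.continuous_im.measurable).subtype_mk
    exact (measurable_const.div this).pow_const 2
  have h2 := UpperHalfPlane.measurableEmbedding_coe.integrableOn_map_iff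
    (μ := volume.comap UpperHalfPlane.coe) (f := F) (s := UpperHalfPlane.coe '' s)
  rw [Set.preimage_image_eq _ UpperHalfPlane.measurableEmbedding_coe.injective,
    UpperHalfPlane.measurableEmbedding_coe.map_comap, IntegrableOn, Measure.restrict_restrict
      (UpperHalfPlane.measurableEmbedding_coe.measurableSet_image.2 hs),
    Set.inter_eq_self_of_subset_left (Set.image_subset_range _ _)] at h2
  have h3 := h2.1 hF
  rw [UpperHalfPlane.volume_def, IntegrableOn, restrict_withDensity hs,
    integrable_withDensity_iff_integrable_smul hm]
  refine h3.congr (Filter.Eventually.of_forall fun z => ?_)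
  have hz : (z.im : ℂ) ≠ 0 := by exact_mod_cast z.im_ne_zero
  change F z = (((1 / NNReal.mk z.im z.im_pos.le) ^ 2 : NNReal) : ℝ) • (((z.im : ℂ) ^ 2) * F z)
  rw [Complex.real_smul]
  push_cast
  field_simp

lemma volume_re_eq (c : ℝ) : volume {z : ℂ | z.re = c} = 0 := by
  have h := Complex.volume_preserving_equiv_real_prod.measure_preimage_equiv
    (({c} : Set ℝ) ×ˢ (Set.univ : Set ℝ))
  rw [Measure.volume_eq_prod, Measure.prod_prod] at h
  have h2 : {z : ℂ | z.re = c} =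
      Complex.measurableEquivRealProd ⁻¹' (({c} : Set ℝ) ×ˢ (Set.univ : Set ℝ)) := by
    ext z; simp [Complex.measurableEquivRealProd]
  rw [h2, h]; simp

lemma volume_fd_diff_fdo : volume (fd \ fdo) = 0 := by
  rw [UpperHalfPlane.volume_eq_lintegral]
  apply setLIntegral_measure_zero
  refine measure_mono_null (t := {z : ℂ | z.re = 1 / 2} ∪ {z : ℂ | z.re = -(1 / 2)} ∪
    Metric.sphere (0 : ℂ) 1) ?_ ?_
  · rintro _ ⟨z, ⟨⟨h1, h2⟩, h3⟩, rfl⟩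
    by_cases ha : 1 < Complex.normSq (z : ℂ)
    · have hb : ¬ |z.re| < 1 / 2 := fun hb => h3 ⟨ha, hb⟩
      have hc : |z.re| = 1 / 2 := le_antisymm h2 (not_lt.1 hb)
      rcases (abs_eq (by norm_num)).1 hc with h | h
      · exact Or.inl (Or.inl h)
      · exact Or.inl (Or.inr h)
    · refine Or.inr ?_
      have : Complex.normSq (z : ℂ) = 1 := le_antisymm (not_lt.1 ha) h1
      rw [mem_sphere_zero_iff_norm, ← sq_eq_sq₀ (norm_nonneg _) zero_le_one,
        ← Complex.normSq_eq_norm_sq, this, one_pow]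
  · rw [measure_union_null_iff, measure_union_null_iff]
    exact ⟨⟨volume_re_eq _, volume_re_eq _⟩, Measure.addHaar_sphere _ _ _⟩

instance : Countable SL(2, ℤ) :=
  Function.Injective.countable (f := fun γ : SL(2, ℤ) => fun i j : Fin 2 => γ i j)
    fun γ δ h => Subtype.ext (Matrix.ext fun i j => congrFun (congrFun h i) j)

lemma measurePreserving_sl (γ : SL(2, ℤ)) :
    MeasurePreserving (fun z : ℍ => γ • z) volume volume :=
  measurePreserving_smul (γ : GL (Fin 2) ℝ) (volume : Measure ℍ)

lemma measurableEmbedding_sl (γ : SL(2, ℤ)) : MeasurableEmbedding fun z : ℍ => γ • z :=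
  (Homeomorph.smul (γ : GL (Fin 2) ℝ) : ℍ ≃ₜ ℍ).measurableEmbedding

lemma measurableSet_fd : MeasurableSet fd := isClosed_fd.measurableSet

/-- Almost every point lies in exactly two of the translates of the fundamental domain, namely in
those by `γ` and `-γ` for one `γ`. -/
lemma ae_translates : ∀ᵐ w : ℍ, ∃ γ₀ : SL(2, ℤ), ∀ γ : SL(2, ℤ),
    γ⁻¹ • w ∈ fd ↔ γ = γ₀ ∨ γ = -γ₀ := by
  have h0 : volume (⋃ γ : SL(2, ℤ), (fun z : ℍ => γ • z) ⁻¹' (fd \ fdo)) = 0 := by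
    rw [measure_iUnion_null_iff]
    intro γ
    rw [(measurePreserving_sl γ).measure_preimage_emb (measurableEmbedding_sl γ),
      volume_fd_diff_fdo]
  filter_upwards [measure_eq_zero_iff_ae_notMem.1 h0] with w hw
  simp only [Set.mem_iUnion, Set.mem_preimage, not_exists] at hw
  obtain ⟨g, hg⟩ := exists_smul_mem_fd w
  have hgo : g • w ∈ fdo := by
    by_contra h
    exact hw g ⟨hg, h⟩
  refine ⟨g⁻¹, fun γ => ⟨fun h => ?_, ?_⟩⟩
  · have h1 : (γ⁻¹ * g⁻¹) • (g • w) ∈ fd := by rwa [mul_smul, inv_smul_smul]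
    rcases eq_one_or_neg_one_of_mem_fdo_mem_fd hgo h1 with h2 | h2
    · left
      rw [← mul_inv_rev, inv_eq_one] at h2
      exact (inv_eq_of_mul_eq_one_right h2).symm
    · right
      have h3 : γ⁻¹ = -g := by rw [mul_inv_eq_iff_eq_mul.1 h2, neg_one_mul]
      rw [← inv_inv γ, h3]
      exact inv_eq_of_mul_eq_one_right (by simp)
  · rintro (rfl | rfl)
    · simpa using hg
    · have : (-g⁻¹)⁻¹ = -g := inv_eq_of_mul_eq_one_right (by simp)
      rw [this, ModularGroup.SL_neg_smul]
      exact hg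

/-- Every element of `SL₂(ℤ)` is uniquely a power of `T` times a chosen representative. -/
def repEquiv : CuspCosets × ℤ ≃ SL(2, ℤ) :=
  Equiv.ofBijective (fun p => T ^ p.2 * p.1.out) <| by
    have hmk : ∀ (q : CuspCosets) (m : ℤ),
        (Quotient.mk (QuotientGroup.rightRel (Subgroup.zpowers T)) (T ^ m * q.out)) = q := by
      intro q m
      conv_rhs => rw [← Quotient.out_eq q]
      rw [Quotient.eq, QuotientGroup.rightRel_apply]
      exact ⟨-m, by simp⟩
    constructor
    · rintro ⟨q, m⟩ ⟨q', m'⟩ h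
      have h1 := hmk q m
      simp only at h
      rw [h, hmk] at h1
      subst h1
      have h2 := mul_right_cancel h
      have h3 := congrArg (fun γ : SL(2, ℤ) => γ 0 1) h2
      simp only [ModularGroup.coe_T_zpow] at h3
      simpa using h3
    · intro γ
      have h := Quotient.mk_out (s := QuotientGroup.rightRel (Subgroup.zpowers T)) γ
      obtain ⟨m, hm⟩ := QuotientGroup.rightRel_apply.1 h
      refine ⟨⟨Quotient.mk _ γ, m⟩, ?_⟩
      simp only at hm ⊢
      rw [hm, inv_mul_cancel_right]

lemma repEquiv_apply (q : CuspCosets) (m : ℤ) : repEquiv (q, m) = T ^ m * q.out := rfl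

/-- The strip `0 ≤ x < 1`. -/
def strip : Set ℍ := {z | z.re ∈ Set.Ico (0 : ℝ) 1}

lemma measurableSet_strip : MeasurableSet strip :=
  UpperHalfPlane.continuous_re.measurable measurableSet_Ico

lemma tsum_strip {f : ℍ → ℂ} (hf : ∀ z : ℍ, f (T • z) = f z) (w : ℍ) :
    ∑' m : ℤ, strip.indicator f (T ^ m • w) = f w := by
  have hz : ∀ (m : ℤ) (z : ℍ), f (T ^ m • z) = f z := by
    intro m
    induction m with
    | zero => simp
    | succ m ih => intro z; rw [zpow_add, mul_smul, ih, zpow_one, hf]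
    | pred m ih => intro z; rw [zpow_sub, mul_smul, ih, zpow_one]; rw [← hf (T⁻¹ • z), smul_inv_smul]
  rw [tsum_eq_single (-⌊w.re⌋)]
  · rw [Set.indicator_of_mem, hz]
    change (T ^ (-⌊w.re⌋) • w).re ∈ Set.Ico (0 : ℝ) 1
    rw [ModularGroup.re_T_zpow_smul]
    push_cast
    exact ⟨by linarith [Int.floor_le w.re], by linarith [Int.lt_floor_add_one w.re]⟩
  · intro m hm
    apply Set.indicator_of_notMem
    intro h
    change (T ^ m • w).re ∈ Set.Ico (0 : ℝ) 1 at h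
    rw [ModularGroup.re_T_zpow_smul] at h
    apply hm
    have : ⌊w.re⌋ = -m := by
      rw [Int.floor_eq_iff]
      push_cast
      exact ⟨by linarith [h.1], by linarith [h.2]⟩
    rw [this, neg_neg]

/-- The factor `2` is due to `-1`, which acts trivially, while the cosets are taken modulo the powers of
`T` only. -/
theorem integral_unfold {f : ℍ → ℂ} (hf : ∀ z : ℍ, f (T • z) = f z) (hint : IntegrableOn f strip) :
    ∫ z in fd, ∑' q : CuspCosets, f (q.out • z) = 2 * ∫ z in strip, f z := by
  set g : ℍ → ℂ := strip.indicator f with hg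
  have hgi : Integrable g := (integrable_indicator_iff measurableSet_strip).2 hint
  -- both sides of the exchange below are controlled by the same integral
  have hcount : ∀ᵐ w : ℍ, ∀ (E : Type) [AddCommMonoid E] [TopologicalSpace E] [T2Space E] (c : E),
      ∑' γ : SL(2, ℤ), ((fun z : ℍ => γ⁻¹ • z) ⁻¹' fd).indicator (fun _ => c) w = c + c := by
    filter_upwards [ae_translates] with w ⟨γ₀, h⟩ E _ _ _ c
    have hne : γ₀ ≠ -γ₀ := by
      intro h
      have h1 := congrArg (fun γ : SL(2, ℤ) => γ.1) h
      simp only [Matrix.SpecialLinearGroup.coe_neg] at h1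
      have h2 : ∀ i j, γ₀.1 i j = 0 := fun i j => by
        have := congrFun (congrFun h1 i) j
        simp only [Matrix.neg_apply] at this
        omega
      have h3 := γ₀.2
      rw [Matrix.det_fin_two, h2 0 0, h2 0 1] at h3
      simp at h3
    rw [tsum_eq_sum (s := {γ₀, -γ₀}), Finset.sum_pair hne, Set.indicator_of_mem,
      Set.indicator_of_mem]
    · exact (h _).2 (Or.inr rfl)
    · exact (h _).2 (Or.inl rfl)
    · intro γ hγ
      apply Set.indicator_of_notMem
      intro h2
      exact hγ (by simpa using (h γ).1 h2)
  have hpre : ∀ γ : SL(2, ℤ), fd = (fun z : ℍ => γ • z) ⁻¹' ((fun z : ℍ => γ⁻¹ • z) ⁻¹' fd) := by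
    intro γ; ext z; simp
  have hmeas : ∀ γ : SL(2, ℤ), MeasurableSet ((fun z : ℍ => γ⁻¹ • z) ⁻¹' fd) := fun γ =>
    (measurableEmbedding_sl γ⁻¹).measurable measurableSet_fd
  have hchange : ∀ γ : SL(2, ℤ), ∫ z in fd, g (γ • z) =
      ∫ w, ((fun z : ℍ => γ⁻¹ • z) ⁻¹' fd).indicator g w := by
    intro γ
    rw [integral_indicator (hmeas γ)]
    conv_lhs => rw [hpre γ]
    exact (measurePreserving_sl γ).setIntegral_preimage_emb (measurableEmbedding_sl γ) g _
  have hlchange : ∀ γ : SL(2, ℤ), ∫⁻ z in fd, ‖g (γ • z)‖ₑ =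
      ∫⁻ w, ‖((fun z : ℍ => γ⁻¹ • z) ⁻¹' fd).indicator g w‖ₑ := by
    intro γ
    simp_rw [enorm_indicator_eq_indicator_enorm]
    rw [lintegral_indicator (hmeas γ)]
    conv_lhs => rw [hpre γ]
    exact (measurePreserving_sl γ).setLIntegral_comp_preimage_emb (measurableEmbedding_sl γ)
      (fun w => ‖g w‖ₑ) _
  have hsm : ∀ γ : SL(2, ℤ),
      AEStronglyMeasurable (((fun z : ℍ => γ⁻¹ • z) ⁻¹' fd).indicator g) volume := fun γ =>
    hgi.1.indicator (hmeas γ)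
  have hfin : ∑' γ : SL(2, ℤ), ∫⁻ w, ‖((fun z : ℍ => γ⁻¹ • z) ⁻¹' fd).indicator g w‖ₑ ≠ ⊤ := by
    rw [← lintegral_tsum fun γ => (hsm γ).enorm]
    have : ∫⁻ w, ∑' γ : SL(2, ℤ), ‖((fun z : ℍ => γ⁻¹ • z) ⁻¹' fd).indicator g w‖ₑ =
        ∫⁻ w, 2 * ‖g w‖ₑ := by
      refine lintegral_congr_ae ?_
      filter_upwards [hcount] with w hw
      rw [two_mul, ← hw _ ‖g w‖ₑ]
      refine tsum_congr fun γ => ?_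
      rw [enorm_indicator_eq_indicator_enorm]
      rfl
    rw [this, lintegral_const_mul' _ _ (by simp)]
    exact ENNReal.mul_ne_top (by simp) hgi.2.ne
  have hsm' : ∀ γ : SL(2, ℤ), AEStronglyMeasurable (fun z : ℍ => g (γ • z)) (volume.restrict fd) :=
    fun γ => ((hgi.1.comp_quasiMeasurePreserving
      (measurePreserving_sl γ).quasiMeasurePreserving)).restrict
  have hfin' : ∑' γ : SL(2, ℤ), ∫⁻ z in fd, ‖g (γ • z)‖ₑ ≠ ⊤ := by simpa only [hlchange] using hfin
  have hsum : ∀ᵐ z ∂(volume.restrict fd), Summable fun γ : SL(2, ℤ) => g (γ • z) := by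
    rw [← lintegral_tsum fun γ => (hsm' γ).enorm] at hfin'
    filter_upwards [ae_lt_top' (AEMeasurable.tsum fun γ => (hsm' γ).enorm) hfin'] with z hz
    have h1 : Summable fun γ : SL(2, ℤ) => ‖g (γ • z)‖₊ := ENNReal.tsum_coe_ne_top_iff_summable.1 hz.ne
    exact Summable.of_nnnorm h1
  calc ∫ z in fd, ∑' q : CuspCosets, f (q.out • z)
      = ∫ z in fd, ∑' γ : SL(2, ℤ), g (γ • z) := by
        refine integral_congr_ae ?_
        filter_upwards [hsum] with z hz
        rw [← repEquiv.tsum_eq, Summable.tsum_prod (f := fun c => g (repEquiv c • z)) ((repEquiv.summable_iff).2 hz)]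
        refine tsum_congr fun q => ?_
        rw [← tsum_strip hf]
        refine tsum_congr fun m => ?_
        rw [repEquiv_apply, mul_smul]
    _ = ∑' γ : SL(2, ℤ), ∫ z in fd, g (γ • z) := integral_tsum hsm' hfin'
    _ = ∫ w, ∑' γ : SL(2, ℤ), ((fun z : ℍ => γ⁻¹ • z) ⁻¹' fd).indicator g w := by
        rw [integral_tsum hsm hfin]
        exact tsum_congr hchange
    _ = ∫ w, 2 * g w := by
        refine integral_congr_ae ?_
        filter_upwards [hcount] with w hw
        rw [two_mul, ← hw _ (g w)]
        rfl
    _ = 2 * ∫ z in strip, f z := by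
        rw [integral_const_mul, hg, integral_indicator measurableSet_strip]

end Unfolding

/-! ### The pairing as an integral over the strip -/

section Strip

open MeasureTheory ModularGroup

/-- Pairing with a fixed tensor. -/
def formL (k : ℕ) (S : Tens k) : Tens k →L[ℝ] ℂ :=
  (form k S).toContinuousLinearMap.restrictScalars ℝ

lemma formL_apply (k : ℕ) (S T : Tens k) : formL k S T = form k S T := rfl

lemma continuousOn_form {k : ℕ} {Z : Type*} [TopologicalSpace Z] {s : Set Z} {S T : Z → Tens k}
    (hS : ContinuousOn S s) (hT : ContinuousOn T s) :
    ContinuousOn (fun z => form k (S z) (T z)) s := by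
  simp only [form_apply]
  exact continuousOn_finsetSum _ fun β _ => (continuousOn_const.mul (continuousOn_pi.1 hS β)).mul
    (continuousOn_pi.1 hT β)

lemma norm_form_le (k : ℕ) (S T : Tens k) :
    ‖form k S T‖ ≤ (Fintype.card (Fin k → Fin 3) : ℝ) * (‖S‖ * ‖T‖) := by
  rw [form_apply]
  refine (norm_sum_le _ _).trans ?_
  rw [← nsmul_eq_mul, ← Finset.card_univ]
  refine Finset.sum_le_card_nsmul _ _ _ fun β _ => ?_
  have h1 : ‖∏ i, ((ε (β i) : ℝ) : ℂ)‖ = 1 := by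
    rw [norm_prod]
    refine Finset.prod_eq_one fun i _ => ?_
    have : ∀ a : Fin 3, ‖((ε a : ℝ) : ℂ)‖ = 1 := by intro a; fin_cases a <;> simp [ε]
    exact this _
  rw [norm_mul, norm_mul, h1, one_mul]
  exact mul_le_mul (norm_le_pi_norm _ _) (norm_le_pi_norm _ _) (norm_nonneg _) (norm_nonneg _)

/-- The isotropic tensor `n(x) u'^k`. -/
def isoTens (k : ℕ) (x : ℝ) : Tens k := act k (n x) (power k u')

lemma continuous_isoTens (k : ℕ) : Continuous (isoTens k) := (contDiff_act_n k _).continuous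

lemma isoTens_add (k : ℕ) (x y : ℝ) : isoTens k (x + y) = act k (n x) (isoTens k y) := by
  rw [isoTens, isoTens, act_n_add]

/-- The density of `η ∧ ξ` with respect to `dx dy`. -/
def wedge {k : ℕ} (η ξ : Form1 k) (z : ℂ) : ℂ :=
  form k (η z 1) (ξ z Complex.I) - form k (η z Complex.I) (ξ z 1)

lemma clm_apply_eq {E : Type*} [NormedAddCommGroup E] [NormedSpace ℝ E] (A : ℂ →L[ℝ] E) (w : ℂ) :
    A w = w.re • A 1 + w.im • A Complex.I := by
  conv_lhs => rw [← Complex.re_add_im w]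
  rw [map_add, ← map_smul, ← map_smul, Complex.real_smul, Complex.real_smul, mul_one]

lemma form_real_smul_left (k : ℕ) (r : ℝ) (S T : Tens k) :
    form k (r • S) T = (r : ℂ) * form k S T := by
  rw [← Complex.coe_smul, map_smul, LinearMap.smul_apply, smul_eq_mul]

lemma form_real_smul_right (k : ℕ) (r : ℝ) (S T : Tens k) :
    form k S (r • T) = (r : ℂ) * form k S T := by
  rw [← Complex.coe_smul, map_smul, smul_eq_mul]

lemma wedge_pull1 {k : ℕ} (γ : SL(2, ℤ)) (η ξ : Form1 k) {z : ℂ} (hz : z ∈ UHP) :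
    ((z.im : ℂ) ^ 2) * wedge (pull1 γ η) (pull1 γ ξ) z =
      (((moebius γ z).im : ℂ) ^ 2) * wedge η ξ (moebius γ z) := by
  have h0 := row_denom_ne_zero γ hz
  set j : ℂ := (γ 1 0 : ℂ) * z + γ 1 1 with hj
  have hdet : (toR γ⁻¹).det ≠ 0 := det_toR_ne _
  have him : (moebius γ z).im = z.im / ‖j‖ ^ 2 := im_moebius γ hz
  rw [wedge, pull1_apply γ η hz, pull1_apply γ η hz, pull1_apply γ ξ hz, pull1_apply γ ξ hz,
    form_act _ _ hdet, form_act _ _ hdet, ← hj, him]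
  rw [clm_apply_eq (η _) (1 / j ^ 2), clm_apply_eq (η _) (Complex.I / j ^ 2),
    clm_apply_eq (ξ _) (1 / j ^ 2), clm_apply_eq (ξ _) (Complex.I / j ^ 2), wedge]
  have e1 : (Complex.I / j ^ 2).re = -(1 / j ^ 2).im := by
    rw [show Complex.I / j ^ 2 = Complex.I * (1 / j ^ 2) by ring]; simp
  have e2 : (Complex.I / j ^ 2).im = (1 / j ^ 2).re := by
    rw [show Complex.I / j ^ 2 = Complex.I * (1 / j ^ 2) by ring]; simp
  rw [e1, e2]
  have e3 : (1 / j ^ 2).re ^ 2 + (1 / j ^ 2).im ^ 2 = (1 / ‖j‖ ^ 2) ^ 2 := by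
    have := Complex.sq_norm (1 / j ^ 2)
    rw [Complex.normSq_apply, norm_div, norm_pow, norm_one] at this
    rw [this]; ring
  have e4 : (((1 / j ^ 2).re : ℂ)) ^ 2 + ((1 / j ^ 2).im : ℂ) ^ 2 = (1 / (‖j‖ : ℂ) ^ 2) ^ 2 := by
    exact_mod_cast congrArg (Complex.ofReal) e3
  simp only [map_add, LinearMap.add_apply, form_real_smul_left, form_real_smul_right]
  push_cast
  rw [show ((z.im : ℂ) / (‖j‖ : ℂ) ^ 2) ^ 2 = (z.im : ℂ) ^ 2 * (1 / (‖j‖ : ℂ) ^ 2) ^ 2 by ring, ← e4]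
  ring

/-- The value on `∂/∂y` of a form, paired with `n(x) u'^k`; this is the density of
`(dx ⊗ u'^k) ∧ ξ`. -/
def stripFun {k : ℕ} (ξ : Form1 k) (z : ℂ) : ℂ := form k (isoTens k z.re) (ξ z Complex.I)

lemma wedge_eisBase {k : ℕ} (ξ : Form1 k) (z : ℂ) : wedge (eisBase k) ξ z = stripFun ξ z := by
  simp [wedge, eisBase, stripFun, isoTens]

lemma wedge_eisForm {k : ℕ} (hk : k ≠ 0) {ξ : Form1 k} (hξ : IsForm1 ξ) {z : ℂ} (hz : z ∈ UHP) :
    ((z.im : ℂ) ^ 2) * wedge (eisForm k) ξ z =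
      1 / 2 * ∑' q : CuspCosets, (((moebius q.out z).im : ℂ) ^ 2) * stripFun ξ (moebius q.out z) := by
  have hs := summable_eisTerm hk hz
  have h1 : ∀ v : ℂ, eisForm k z v = (1 / 2 : ℂ) • ∑' q : CuspCosets, eisTerm k q z v := fun v => by
    rw [eisForm, smul_apply]
    congr 1
    exact (ContinuousLinearMap.apply ℝ (Tens k) v).map_tsum hs
  have hs' : ∀ v : ℂ, Summable fun q : CuspCosets => eisTerm k q z v := fun v =>
    hs.mapL (ContinuousLinearMap.apply ℝ (Tens k) v)
  have h2 : ∀ v w : ℂ, form k (eisForm k z v) (ξ z w) =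
      1 / 2 * ∑' q : CuspCosets, form k (eisTerm k q z v) (ξ z w) := by
    intro v w
    rw [h1, map_smul, LinearMap.smul_apply, smul_eq_mul, form_comm, ← formL_apply,
      (formL k (ξ z w)).map_tsum (hs' v)]
    simp only [formL_apply, form_comm k (ξ z w)]
  have hs2 : ∀ v w : ℂ, Summable fun q : CuspCosets => form k (eisTerm k q z v) (ξ z w) := by
    intro v w
    have := (hs' v).mapL (formL k (ξ z w))
    simpa only [formL_apply, form_comm k (ξ z w)] using this
  rw [wedge, h2, h2, ← mul_sub, ← (hs2 _ _).tsum_sub (hs2 _ _), mul_left_comm, ← tsum_mul_left]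
  congr 1
  refine tsum_congr fun q => ?_
  rw [← wedge_eisBase, ← wedge_pull1 _ _ _ hz, wedge, hξ.inv _ z hz]
  rfl

lemma isoTens_act {k : ℕ} {γ : SL(2, ℤ)} (x : ℝ) : act k (toR γ) (isoTens k x) =
    power k (isoVec (γ 0 0 * x + γ 0 1) (γ 1 0 * x + γ 1 1)) := by
  rw [isoTens, act_n_power_u', act_power_isoVec _ (det_toR _)]
  simp [toR]

lemma form_isoTens_act {k : ℕ} (γ : SL(2, ℤ)) (x : ℝ) (T : Tens k) :
    form k (isoTens k x) (act k (toR γ⁻¹) T) =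
      form k (power k (isoVec (γ 0 0 * x + γ 0 1) (γ 1 0 * x + γ 1 1))) T := by
  rw [← isoTens_act, ← form_act k (toR γ) (det_toR_ne _), ← act_mul k _ _ (det_toR_ne _),
    ← toR_mul, mul_inv_cancel, toR_one, act_one]

lemma norm_form_isoTens_act_le {k : ℕ} (γ : SL(2, ℤ)) (x : ℝ) (T : Tens k) :
    ‖form k (isoTens k x) (act k (toR γ⁻¹) T)‖ ≤ (Fintype.card (Fin k → Fin 3) : ℝ) *
      ((2 * ((γ 0 0 * x + γ 0 1) ^ 2 + (γ 1 0 * x + γ 1 1) ^ 2)) ^ k * ‖T‖) := by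
  rw [form_isoTens_act]
  refine (norm_form_le _ _ _).trans ?_
  gcongr
  exact (norm_power_le _ _).trans (pow_le_pow_left₀ (norm_nonneg _) (norm_coord_isoVec_le _ _) _)

lemma re_denom_sq_le (γ : SL(2, ℤ)) (z : ℂ) (i : Fin 2) :
    (γ i 0 * z.re + γ i 1) ^ 2 ≤ ‖(γ i 0 : ℂ) * z + γ i 1‖ ^ 2 := by
  have h := Complex.sq_norm ((γ i 0 : ℂ) * z + γ i 1)
  rw [Complex.normSq_apply] at h
  simp only [Complex.add_re, Complex.mul_re, Complex.intCast_re, Complex.intCast_im, zero_mul,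
    sub_zero] at h
  nlinarith [sq_nonneg (((γ i 0 : ℂ) * z + γ i 1).im)]

/-- The form is bounded although its support is compact only modulo `SL₂(ℤ)`: where `γ z` lies in the
compact set, `|c z + d|²` is comparable to `y`, which makes the pairing `O(y^{k-1})`. -/
lemma exists_norm_stripFun_le {k : ℕ} (hk : k ≠ 0) {α : Form1 k} (hα : IsForm1 α)
    (hc : HasCompactSupp α) : ∃ K Y : ℝ, 0 ≤ K ∧ ∀ z ∈ UHP,
      ‖stripFun α z‖ ≤ K ∧ (Y < z.im → stripFun α z = 0) := by
  obtain ⟨C, hC, hCU, hsupp⟩ := hc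
  obtain ⟨A, hA⟩ := hC.exists_bound_of_continuousOn (hα.smooth.continuousOn.mono hCU)
  obtain ⟨R, hR⟩ := hC.exists_bound_of_continuousOn (f := fun z : ℂ => z) continuousOn_id
  obtain ⟨δ, hδ0, hδ⟩ : ∃ δ : ℝ, 0 < δ ∧ ∀ z ∈ C, δ ≤ z.im := by
    rcases C.eq_empty_or_nonempty with rfl | hne
    · exact ⟨1, one_pos, by simp⟩
    · obtain ⟨z₀, h0, h⟩ := hC.exists_isMinOn hne Complex.continuous_im.continuousOn
      exact ⟨z₀.im, hCU h0, fun z hz => h hz⟩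
  have hA0 : ∀ z ∈ C, 0 ≤ A := fun z hz => (norm_nonneg _).trans (hA z hz)
  set N : ℝ := ((Fintype.card (Fin k → Fin 3) : ℕ) : ℝ) with hN
  set Y := max R (1 / δ) with hY
  have hheight : ∀ z ∈ UHP, ∀ γ, moebius γ z ∈ C → z.im ≤ Y := by
    intro z hz γ hγ
    have hz0 : 0 < z.im := hz
    have him := im_moebius γ hz
    have hd := hδ _ hγ
    have hRim : (moebius γ z).im ≤ R := ((le_abs_self _).trans (Complex.abs_im_le_norm _)).trans (hR _ hγ)
    have hden : 0 < ‖(γ 1 0 : ℂ) * z + γ 1 1‖ ^ 2 :=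
      by have := norm_pos_iff.2 (row_denom_ne_zero γ hz); positivity
    rw [eq_div_iff hden.ne'] at him
    have hsq := Complex.sq_norm ((γ 1 0 : ℂ) * z + γ 1 1)
    rw [Complex.normSq_apply] at hsq
    simp only [Complex.add_re, Complex.mul_re, Complex.intCast_re, Complex.intCast_im, zero_mul,
      sub_zero, Complex.add_im, Complex.mul_im, add_zero] at hsq
    by_cases hc : γ 1 0 = 0
    · have hd1 := det_eq γ
      rw [hc, mul_zero, sub_zero] at hd1
      have h2 : ((γ 1 1 : ℤ) : ℝ) * γ 1 1 = 1 := by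
        rcases Int.eq_one_or_neg_one_of_mul_eq_one' hd1 with h | h <;> rw [h.2] <;> norm_num
      rw [hsq, hc] at him
      simp only [Int.cast_zero, zero_mul, zero_add, mul_zero, add_zero, h2, mul_one] at him
      rw [← him]
      exact hRim.trans (le_max_left _ _)
    · have h1 : (1 : ℝ) ≤ (γ 1 0 : ℝ) ^ 2 := by
        have : (1 : ℤ) ≤ (γ 1 0) ^ 2 := by have := sq_pos_of_ne_zero hc; omega
        exact_mod_cast this
      have h2 : z.im ^ 2 ≤ ‖(γ 1 0 : ℂ) * z + γ 1 1‖ ^ 2 := by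
        rw [hsq]; nlinarith [mul_self_nonneg ((γ 1 0 : ℝ) * z.re + γ 1 1), sq_nonneg z.im]
      have h3 : δ * z.im ^ 2 ≤ z.im := by
        rw [← him]
        rw [him]
        calc δ * z.im ^ 2 ≤ (moebius γ z).im * ‖(γ 1 0 : ℂ) * z + γ 1 1‖ ^ 2 :=
              mul_le_mul hd h2 (sq_nonneg _) (hδ0.le.trans hd)
          _ = z.im := him
      refine le_trans ?_ (le_max_right _ _)
      rw [le_div_iff₀ hδ0]
      nlinarith
  refine ⟨N * ((2 * (R ^ 2 + 1)) ^ k * max A 0) * (Y / δ) ^ (k - 1), Y, ?_, fun z hz => ?_⟩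
  · have : 0 ≤ Y := (by positivity : (0 : ℝ) ≤ 1 / δ).trans (le_max_right _ _)
    positivity
  have hz0 : 0 < z.im := hz
  by_cases hex : ∃ γ, moebius γ z ∈ C
  · obtain ⟨γ, hγ⟩ := hex
    have hzY := hheight z hz γ hγ
    refine ⟨?_, fun h => absurd h (not_lt.2 hzY)⟩
    have him := im_moebius γ hz
    have hden : 0 < ‖(γ 1 0 : ℂ) * z + γ 1 1‖ := norm_pos_iff.2 (row_denom_ne_zero γ hz)
    set j := ‖(γ 1 0 : ℂ) * z + γ 1 1‖ with hj
    have hnum : ‖(γ 0 0 : ℂ) * z + γ 0 1‖ ≤ R * j := by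
      have h := hR _ hγ
      rwa [moebius, norm_div, div_le_iff₀ hden] at h
    have h1 := re_denom_sq_le γ z 0
    have h2 := re_denom_sq_le γ z 1
    have h3 : 2 * ((γ 0 0 * z.re + γ 0 1) ^ 2 + (γ 1 0 * z.re + γ 1 1) ^ 2) ≤
        2 * (R ^ 2 + 1) * j ^ 2 := by
      have : ‖(γ 0 0 : ℂ) * z + γ 0 1‖ ^ 2 ≤ (R * j) ^ 2 := pow_le_pow_left₀ (norm_nonneg _) hnum 2
      nlinarith
    have hj2 : j ^ 2 ≤ Y / δ := by
      rw [le_div_iff₀ hδ0]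
      have h4 := hδ _ hγ
      rw [him, le_div_iff₀ (by positivity)] at h4
      nlinarith
    rw [stripFun, ← hα.inv γ z hz, pull1_apply γ α hz]
    refine (norm_form_isoTens_act_le _ _ _).trans ?_
    have h5 : ‖α (moebius γ z) (Complex.I / ((γ 1 0 : ℂ) * z + γ 1 1) ^ 2)‖ ≤ max A 0 * (j ^ 2)⁻¹ := by
      refine ((α (moebius γ z)).le_opNorm _).trans ?_
      rw [norm_div, Complex.norm_I, norm_pow, ← hj, one_div]
      gcongr
      exact (hA _ hγ).trans (le_max_left _ _)
    calc N * ((2 * ((γ 0 0 * z.re + γ 0 1) ^ 2 + (γ 1 0 * z.re + γ 1 1) ^ 2)) ^ k *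
          ‖α (moebius γ z) (Complex.I / ((γ 1 0 : ℂ) * z + γ 1 1) ^ 2)‖)
        ≤ N * ((2 * (R ^ 2 + 1) * j ^ 2) ^ k * (max A 0 * (j ^ 2)⁻¹)) := by gcongr
      _ = N * ((2 * (R ^ 2 + 1)) ^ k * max A 0) * (j ^ 2) ^ (k - 1) := by
          obtain ⟨m, rfl⟩ := Nat.exists_eq_succ_of_ne_zero hk
          rw [mul_pow, Nat.succ_sub_one, pow_succ (j ^ 2)]
          field_simp
      _ ≤ _ := by gcongr
  · push Not at hex
    have h0 : stripFun α z = 0 := by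
      rw [stripFun, hsupp z hz hex]; simp
    refine ⟨?_, fun _ => h0⟩
    rw [h0, norm_zero]
    have : 0 ≤ Y := (by positivity : (0 : ℝ) ≤ 1 / δ).trans (le_max_right _ _)
    positivity

lemma continuousOn_stripFun {k : ℕ} {ξ : Form1 k} (hξ : ContDiffOn ℝ ∞ ξ UHP) :
    ContinuousOn (stripFun ξ) UHP := by
  have h1 : ContinuousOn (fun z : ℂ => isoTens k z.re) UHP :=
    ((continuous_isoTens k).comp Complex.continuous_re).continuousOn
  have h2 : ContinuousOn (fun z : ℂ => ξ z Complex.I) UHP :=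
    hξ.continuousOn.clm_apply continuousOn_const
  exact continuousOn_form h1 h2

lemma stripFun_T {k : ℕ} {ξ : Form1 k} (hξ : IsForm1 ξ) {z : ℂ} (hz : z ∈ UHP) :
    stripFun ξ (z + 1) = stripFun ξ z := by
  have h1 := hξ.inv T z hz
  have h2 : ξ z Complex.I = act k (toR T⁻¹) (ξ (z + 1) Complex.I) := by
    have hd : ((T 1 0 : ℤ) : ℂ) * z + ((T 1 1 : ℤ) : ℂ) = 1 := by simp [ModularGroup.T]
    rw [← h1, pull1_apply _ _ hz, moebius_T, hd, one_pow, div_one]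
  have h3 : isoTens k (z + 1).re = act k (toR T) (isoTens k z.re) := by
    rw [toR_T, add_comm z 1, Complex.add_re, Complex.one_re, isoTens_add]
  rw [stripFun, stripFun, h2, form_isoTens_act, ← isoTens_act, ← h3]

lemma coe_strip : (fun w : ℍ => (w : ℂ)) '' strip = {z | z.re ∈ Set.Ico (0 : ℝ) 1 ∧ 0 < z.im} := by
  ext z
  constructor
  · rintro ⟨w, hw, rfl⟩; exact ⟨hw, w.im_pos⟩
  · rintro ⟨h1, h2⟩; exact ⟨⟨z, h2⟩, h1, rfl⟩

lemma integrableOn_stripFun {k : ℕ} (hk : k ≠ 0) {α : Form1 k} (hα : IsForm1 α)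
    (hc : HasCompactSupp α) : IntegrableOn (stripFun α) ((fun w : ℍ => (w : ℂ)) '' strip) := by
  obtain ⟨K, Y, hK, h⟩ := exists_norm_stripFun_le hk hα hc
  have hm : MeasurableSet ((fun w : ℍ => (w : ℂ)) '' strip) :=
    UpperHalfPlane.measurableEmbedding_coe.measurableSet_image.2 measurableSet_strip
  set B : Set ℂ := ((fun w : ℍ => (w : ℂ)) '' strip) ∩ {z | z.im ≤ Y} with hB
  have hBm : MeasurableSet B := hm.inter (measurableSet_le Complex.measurable_im measurable_const)
  have hsub : B ⊆ UHP := by rintro _ ⟨⟨w, -, rfl⟩, -⟩; exact w.im_pos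
  have h1 : IntegrableOn (stripFun α) B := by
    refine IntegrableOn.of_bound ?_ ?_ K ?_
    · refine (measure_mono (t := Set.Icc 0 1 ×ℂ Set.Icc 0 Y) ?_).trans_lt
        (isCompact_Icc.reProdIm isCompact_Icc).measure_lt_top
      rintro _ ⟨⟨w, hw, rfl⟩, hw2⟩
      exact ⟨⟨hw.1, hw.2.le⟩, ⟨w.im_pos.le, hw2⟩⟩
    · exact ((continuousOn_stripFun hα.smooth).mono hsub).aestronglyMeasurable hBm
    · exact (ae_restrict_iff' hBm).2 (Filter.Eventually.of_forall fun z hz => (h z (hsub hz)).1)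
  refine h1.of_forall_sdiff_eq_zero hm ?_
  rintro z ⟨hz, hz2⟩
  have hzU : z ∈ UHP := by obtain ⟨w, -, rfl⟩ := hz; exact w.im_pos
  exact (h z hzU).2 (not_le.1 fun h => hz2 ⟨hz, h⟩)

/-- Unfolding: the pairing of the Eisenstein form with a compactly supported form is an integral
over the strip `0 ≤ x < 1`. -/
theorem integralX_eisForm {k : ℕ} (hk : k ≠ 0) {α : Form1 k} (hα : IsForm1 α)
    (hc : HasCompactSupp α) :
    integralX (eisForm k) α = ∫ z in ((fun w : ℍ => (w : ℂ)) '' strip), stripFun α z := by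
  have h1 : integralX (eisForm k) α = ∫ z in ((fun w : ℍ => (w : ℂ)) '' fd), wedge (eisForm k) α z :=
    rfl
  -- the measure on `ℍ` is `dx dy / y²`
  set f : ℍ → ℂ := fun z => ((z.im : ℂ) ^ 2) * stripFun α z with hf
  have hT : ∀ z : ℍ, f (T • z) = f z := by
    intro z
    have h2 : ((T • z : ℍ) : ℂ) = (z : ℂ) + 1 := by
      rw [← moebius_eq_smul, moebius_T]
    have h3 : (T • z : ℍ).im = z.im := by
      rw [← UpperHalfPlane.coe_im, h2]; simp
    simp only [hf]
    rw [h2, h3, stripFun_T hα z.im_pos]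
  have hint := integrableOn_of_image_coe measurableSet_strip (integrableOn_stripFun hk hα hc)
  rw [h1, setIntegral_image_coe _ measurableSet_fd, setIntegral_image_coe _ measurableSet_strip]
  have h4 := integral_unfold hT hint
  have h5 : ∀ z : ℍ, ((z.im : ℂ) ^ 2) * wedge (eisForm k) α z =
      1 / 2 * ∑' q : CuspCosets, f (q.out • z) := by
    intro z
    rw [show (z.im : ℂ) = ((z : ℂ).im : ℂ) from rfl, wedge_eisForm hk hα z.im_pos]
    simp only [hf, moebius_eq_smul]
    rfl
  simp only [h5]
  rw [integral_const_mul, h4]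
  simp only [hf]
  ring

lemma integral_strip {F : ℂ → ℂ} (hF : IntegrableOn F ((fun w : ℍ => (w : ℂ)) '' strip)) :
    IntegrableOn (fun y : ℝ => ∫ x in (0 : ℝ)..1, F (x + y * Complex.I)) (Set.Ioi 0) ∧
    ∫ z in ((fun w : ℍ => (w : ℂ)) '' strip), F z =
      ∫ y in Set.Ioi (0 : ℝ), ∫ x in (0 : ℝ)..1, F (x + y * Complex.I) := by
  have hmp := Complex.volume_preserving_equiv_real_prod.symm
  have hme := Complex.measurableEquivRealProd.symm.measurableEmbedding
  have hset : Complex.measurableEquivRealProd.symm ⁻¹' ((fun w : ℍ => (w : ℂ)) '' strip) =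
      Set.Ico (0 : ℝ) 1 ×ˢ Set.Ioi (0 : ℝ) := by
    rw [coe_strip]; ext p; rfl
  have hI := (hmp.integrableOn_comp_preimage hme).2 hF
  rw [hset, IntegrableOn, Measure.volume_eq_prod, ← Measure.prod_restrict] at hI
  have e1 := hmp.setIntegral_preimage_emb hme F ((fun w : ℍ => (w : ℂ)) '' strip)
  rw [hset, Measure.volume_eq_prod, ← Measure.prod_restrict, integral_prod_symm (fun p => F (Complex.measurableEquivRealProd.symm p)) hI] at e1
  have hpt : ∀ x y : ℝ, Complex.measurableEquivRealProd.symm (x, y) = x + y * Complex.I := by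
    intro x y
    exact Complex.ext (by simp [Complex.measurableEquivRealProd])
      (by simp [Complex.measurableEquivRealProd])
  have hii : ∀ y : ℝ, ∫ x in (0 : ℝ)..1, F (x + y * Complex.I) =
      ∫ x in Set.Ico (0 : ℝ) 1, F (Complex.measurableEquivRealProd.symm (x, y)) := by
    intro y
    rw [intervalIntegral.integral_of_le zero_le_one, integral_Ico_eq_integral_Ioo,
      integral_Ioc_eq_integral_Ioo]
    simp only [hpt]
  simp only [hii]
  exact ⟨hI.integral_prod_right, e1.symm⟩

end Strip

/-! ### The boundary terms of the strip -/

section StripBoundary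

open MeasureTheory Filter Topology ModularGroup

/-- A `0`-form on the compactification, paired with `n(x) u'^k`, is controlled near the real line by
the height of the translate of `z` in the fundamental domain. -/
lemma exists_norm_form_isoTens_le {k : ℕ} {μ : Form0 k} {m : ℝ × ℝ → Tens k} (hμ : IsForm0 μ)
    (hm : Extends0 μ m) : ∃ C : ℝ, 0 ≤ C ∧ ∀ z ∈ UHP, ∃ c d : ℤ, (c ≠ 0 ∨ d ≠ 0) ∧
      ‖form k (isoTens k z.re) (μ z)‖ ≤ C * (z.im ^ 2 / ‖(c : ℂ) * z + d‖ ^ 2) ^ k := by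
  -- in the coordinates `(x, t)` the fundamental domain, completed by the cusp, is bounded
  obtain ⟨B, hB⟩ := (isCompact_Icc.prod isCompact_Icc :
    IsCompact (Set.Icc (-(1 / 2) : ℝ) (1 / 2) ×ˢ Set.Icc (0 : ℝ) 2)).exists_bound_of_continuousOn
    (hm.1.continuousOn.mono fun p hp => hp.2.1)
  have hB0 : 0 ≤ B := (norm_nonneg _).trans (hB (0, 0) ⟨by norm_num, by norm_num⟩)
  set N : ℝ := ((Fintype.card (Fin k → Fin 3) : ℕ) : ℝ) with hN
  refine ⟨N * (10 ^ k * B), by positivity, fun z hz => ?_⟩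
  obtain ⟨γ, hγ⟩ := exists_smul_mem_fd ⟨z, hz⟩
  have hz0 : 0 < z.im := hz
  have hne := row_denom_ne_zero γ hz
  refine ⟨γ 1 0, γ 1 1, ?_, ?_⟩
  · by_contra! h
    simp [h.1, h.2] at hne
  have hzγ : ((γ • (⟨z, hz⟩ : ℍ) : ℍ) : ℂ) = moebius γ z := (moebius_eq_smul γ ⟨z, hz⟩).symm
  set w := moebius γ z with hw
  have hwU : w ∈ UHP := moebius_mem γ hz
  have hw0 : 0 < w.im := hwU
  have h3 : 3 ≤ 4 * w.im ^ 2 := by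
    have := three_le_four_mul_im_sq_of_mem_fd hγ
    rwa [← UpperHalfPlane.coe_im, hzγ] at this
  have hre : |w.re| ≤ 1 / 2 := by
    have := hγ.2
    rwa [← UpperHalfPlane.coe_re, hzγ] at this
  have him : w.im = z.im / ‖(γ 1 0 : ℂ) * z + γ 1 1‖ ^ 2 := im_moebius γ hz
  have hj : 0 < ‖(γ 1 0 : ℂ) * z + γ 1 1‖ := norm_pos_iff.2 hne
  have hnum : (γ 0 0 : ℂ) * z + γ 0 1 = w * ((γ 1 0 : ℂ) * z + γ 1 1) := by
    rw [hw, moebius, div_mul_cancel₀ _ hne]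
  have hbd : ‖μ w‖ ≤ B := by
    rw [← cuspChart_cuspCoord w, ← hm.2 _ (by exact inv_pos.2 hw0)]
    refine hB _ ⟨⟨(abs_le.1 hre).1, (abs_le.1 hre).2⟩, (inv_pos.2 hw0).le, ?_⟩
    change w.im⁻¹ ≤ 2
    rw [inv_le_comm₀ hw0 two_pos]
    nlinarith
  have hsq := Complex.sq_norm ((γ 1 0 : ℂ) * z + γ 1 1)
  have hnre := congrArg Complex.re hnum
  set j := ‖(γ 1 0 : ℂ) * z + γ 1 1‖ with hjdef
  rw [Complex.normSq_apply] at hsq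
  rw [Complex.mul_re] at hnre
  simp only [Complex.add_re, Complex.mul_re, Complex.intCast_re, Complex.intCast_im, zero_mul,
    sub_zero, Complex.add_im, Complex.mul_im, add_zero] at hsq hnre
  have hq : z.im ^ 2 / j ^ 2 = w.im ^ 2 * j ^ 2 := by rw [him]; field_simp
  have hkey : 2 * ((γ 0 0 * z.re + γ 0 1) ^ 2 + (γ 1 0 * z.re + γ 1 1) ^ 2) ≤
      10 * (z.im ^ 2 / j ^ 2) := by
    rw [hnre, hq]
    set A := (γ 1 0 : ℝ) * z.re + γ 1 1
    set D := (γ 1 0 : ℝ) * z.im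
    have h4 : w.re ^ 2 ≤ 1 / 4 := by nlinarith [abs_le.1 hre]
    have h5 : (w.re * A - w.im * D) ^ 2 ≤ 2 * (w.re * A) ^ 2 + 2 * (w.im * D) ^ 2 := by
      nlinarith [sq_nonneg (w.re * A + w.im * D)]
    have h6 : (w.re * A) ^ 2 ≤ 1 / 4 * A ^ 2 := by
      rw [mul_pow]; exact mul_le_mul_of_nonneg_right h4 (sq_nonneg _)
    have h7 : A ^ 2 ≤ 4 / 3 * w.im ^ 2 * A ^ 2 := by nlinarith [sq_nonneg A]
    nlinarith [sq_nonneg (w.im * A), sq_nonneg (w.im * D)]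
  rw [← hμ.inv γ z hz, pull0]
  refine (norm_form_isoTens_act_le _ _ _).trans ?_
  calc N * ((2 * ((γ 0 0 * z.re + γ 0 1) ^ 2 + (γ 1 0 * z.re + γ 1 1) ^ 2)) ^ k * ‖μ w‖)
      ≤ N * ((10 * (z.im ^ 2 / j ^ 2)) ^ k * B) := by gcongr
    _ = N * (10 ^ k * B) * (z.im ^ 2 / j ^ 2) ^ k := by rw [mul_pow]; ring

lemma sq_norm_denom (c d : ℤ) (x y : ℝ) :
    ‖(c : ℂ) * (x + y * Complex.I) + d‖ ^ 2 = (c * x + d) ^ 2 + c ^ 2 * y ^ 2 := by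
  rw [Complex.sq_norm, Complex.normSq_apply]
  simp
  ring

lemma one_le_sq_of_ne_zero {c : ℤ} (hc : c ≠ 0) : (1 : ℝ) ≤ (c : ℝ) ^ 2 := by
  have : (1 : ℤ) ≤ c ^ 2 := by have := sq_pos_of_ne_zero hc; omega
  exact_mod_cast this

lemma sq_div_denom_le_one {c d : ℤ} (h : c ≠ 0 ∨ d ≠ 0) (x : ℝ) {y : ℝ} (hy : 0 < y) (hy1 : y ≤ 1) :
    y ^ 2 / ‖(c : ℂ) * (x + y * Complex.I) + d‖ ^ 2 ≤ 1 := by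
  rw [sq_norm_denom]
  refine div_le_one_of_le₀ ?_ (by positivity)
  by_cases hc : c = 0
  · have h2 := one_le_sq_of_ne_zero (h.resolve_left (not_not.2 hc))
    simp only [hc, Int.cast_zero, zero_mul, zero_add]
    nlinarith
  · have h2 := one_le_sq_of_ne_zero hc
    nlinarith [sq_nonneg ((c : ℝ) * x + d), sq_nonneg y]

/-- Over an irrational number the translates of `x + i y` in the fundamental domain stay below
`δ / y`. -/
lemma eventually_sq_div_denom_le {x : ℝ} (hx : Irrational x) {δ : ℝ} (hδ : 0 < δ) :
    ∀ᶠ y : ℝ in 𝓝[>] 0, ∀ c d : ℤ, (c ≠ 0 ∨ d ≠ 0) →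
      y ^ 2 / ‖(c : ℂ) * (x + y * Complex.I) + d‖ ^ 2 ≤ δ := by
  obtain ⟨N, hN⟩ := exists_nat_gt (1 / δ)
  have hsq : Tendsto (fun y : ℝ => y ^ 2) (𝓝[>] 0) (𝓝 0) := by
    have : Tendsto (fun y : ℝ => y ^ 2) (𝓝 0) (𝓝 (0 ^ 2)) := (continuous_pow 2).tendsto 0
    rw [zero_pow two_ne_zero] at this
    exact this.mono_left nhdsWithin_le_nhds
  -- for the finitely many `c ≠ 0` with `|c| ≤ N` the numbers `c x + d` stay away from zero, and for
  -- the other `c ≠ 0` the summand `c² y²` of the denominator suffices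
  have h1 : ∀ᶠ y : ℝ in 𝓝[>] 0, ∀ c ∈ Finset.Icc (-(N : ℤ)) N, c ≠ 0 →
      y ^ 2 < δ * (c * x - round (c * x)) ^ 2 := by
    rw [eventually_all_finset]
    intro c _
    by_cases hc : c = 0
    · simp [hc]
    have : 0 < δ * (c * x - round (c * x)) ^ 2 := by
      have : (c : ℝ) * x - round (c * x) ≠ 0 := by
        intro h
        exact ((hx.intCast_mul hc).ne_int (round (c * x))) (sub_eq_zero.1 h)
      positivity
    filter_upwards [hsq.eventually (gt_mem_nhds this)] with y hy _ using hy
  filter_upwards [h1, hsq.eventually (gt_mem_nhds hδ), self_mem_nhdsWithin] with y h1 h2 h3 c d h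
  have hy : 0 < y := h3
  rw [sq_norm_denom]
  refine div_le_of_le_mul₀ (by positivity) hδ.le ?_
  by_cases hc : c = 0
  · have h2 := one_le_sq_of_ne_zero (h.resolve_left (not_not.2 hc))
    simp only [hc, Int.cast_zero, zero_mul, zero_add]
    nlinarith
  by_cases hcN : c ∈ Finset.Icc (-(N : ℤ)) N
  · have h4 := h1 c hcN hc
    have h5 : (c * x - round (c * x)) ^ 2 ≤ (c * x + d) ^ 2 := by
      rw [sq_le_sq]
      have := round_le ((c : ℝ) * x) (-d)
      simpa using this
    have h6 : 0 ≤ δ * ((c : ℝ) ^ 2 * y ^ 2) := by positivity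
    nlinarith
  · have h4 : (N : ℝ) ≤ (c : ℝ) ^ 2 := by
      have : (N : ℤ) ≤ c ^ 2 := by
        rw [Finset.mem_Icc, not_and_or, not_le, not_le] at hcN
        rcases hcN with h | h <;> nlinarith
      exact_mod_cast this
    have h5 : 1 < δ * (c : ℝ) ^ 2 := by
      rw [div_lt_iff₀ hδ] at hN
      nlinarith
    have h6 : 0 ≤ δ * ((c : ℝ) * x + d) ^ 2 := by positivity
    nlinarith [sq_nonneg y, mul_pos hy hy]

lemma line_mem_UHP {x y : ℝ} (hy : 0 < y) : (x + y * Complex.I : ℂ) ∈ UHP := by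
  change 0 < (x + y * Complex.I : ℂ).im
  simpa using hy

/-- The mean over a horizontal line of a `0`-form paired with `n(x) u'^k`. -/
def lineMean {k : ℕ} (μ : Form0 k) (y : ℝ) : ℂ :=
  ∫ x in (0 : ℝ)..1, form k (isoTens k x) (μ (x + y * Complex.I))

lemma continuous_line {k : ℕ} {f : ℂ → Tens k} (hf : ContinuousOn f UHP) {y : ℝ} (hy : 0 < y) :
    Continuous fun x : ℝ => form k (isoTens k x) (f (x + y * Complex.I)) := by
  rw [← continuousOn_univ]
  refine continuousOn_form (continuous_isoTens k).continuousOn ?_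
  exact hf.comp (by fun_prop) fun x _ => line_mem_UHP hy

/-- The integrand is bounded by reduction theory, and it tends to zero at every irrational number; the
rational numbers have measure zero. -/
lemma tendsto_lineMean_zero {k : ℕ} (hk : k ≠ 0) {μ : Form0 k} {m : ℝ × ℝ → Tens k}
    (hμ : IsForm0 μ) (hm : Extends0 μ m) : Tendsto (lineMean μ) (𝓝[>] 0) (𝓝 0) := by
  obtain ⟨C, hC, h⟩ := exists_norm_form_isoTens_le hμ hm
  have h' : ∀ x y : ℝ, 0 < y → ∃ c d : ℤ, (c ≠ 0 ∨ d ≠ 0) ∧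
      ‖form k (isoTens k x) (μ (x + y * Complex.I))‖ ≤
        C * (y ^ 2 / ‖(c : ℂ) * (x + y * Complex.I) + d‖ ^ 2) ^ k := by
    intro x y hy
    have := h _ (line_mem_UHP (x := x) hy)
    simpa using this
  have h0 : (0 : ℂ) = ∫ x in (0 : ℝ)..1, (0 : ℂ) := by simp
  rw [h0]
  refine intervalIntegral.tendsto_integral_filter_of_dominated_convergence (fun _ => C) ?_ ?_ ?_ ?_
  · filter_upwards [self_mem_nhdsWithin] with y hy
    exact (continuous_line hμ.smooth.continuousOn hy).aestronglyMeasurable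
  · filter_upwards [Ioc_mem_nhdsGT (zero_lt_one' ℝ)] with y hy
    refine Eventually.of_forall fun x _ => ?_
    obtain ⟨c, d, hcd, hle⟩ := h' x y hy.1
    refine hle.trans (mul_le_of_le_one_right hC (pow_le_one₀ (by positivity) ?_))
    exact sq_div_denom_le_one hcd x hy.1 hy.2
  · exact intervalIntegrable_const
  · have hirr : ∀ᵐ x : ℝ, Irrational x := by
      have : (Set.range ((↑) : ℚ → ℝ)).Countable := Set.countable_range _
      exact this.ae_notMem volume
    filter_upwards [hirr] with x hx _
    rw [tendsto_zero_iff_norm_tendsto_zero, Metric.tendsto_nhds]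
    intro δ hδ
    have hδ' : 0 < min (δ / (C + 1) / 2) 1 := by positivity
    filter_upwards [eventually_sq_div_denom_le hx hδ', self_mem_nhdsWithin] with y hy hy0
    obtain ⟨c, d, hcd, hle⟩ := h' x y hy0
    have h1 := hy c d hcd
    rw [dist_zero_right, norm_norm]
    have h2 : (y ^ 2 / ‖(c : ℂ) * (x + y * Complex.I) + d‖ ^ 2) ^ k ≤ δ / (C + 1) / 2 :=
      (pow_le_of_le_one (by positivity) (h1.trans (min_le_right _ _)) hk).trans
        (h1.trans (min_le_left _ _))
    calc _ ≤ C * (δ / (C + 1) / 2) := hle.trans (by gcongr)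
      _ ≤ (C + 1) * (δ / (C + 1) / 2) := by gcongr; linarith
      _ = δ / 2 := by field_simp
      _ < δ := by linarith

lemma cuspChart_inv {x y : ℝ} : cuspChart (x, y⁻¹) = x + y * Complex.I := by
  simp [cuspChart, mul_comm]

lemma tendsto_lineMean_atTop {k : ℕ} {μ : Form0 k} {m : ℝ × ℝ → Tens k} (hm : Extends0 μ m)
    (hb : ∀ x, form k (isoTens k x) (m (x, 0)) = 0) : Tendsto (lineMean μ) atTop (𝓝 0) := by
  have hc : Continuous fun p : ℝ × ℝ => form k (isoTens k p.2) (m (p.2, max p.1 0)) := by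
    rw [← continuousOn_univ]
    refine continuousOn_form ((continuous_isoTens k).comp continuous_snd).continuousOn ?_
    exact hm.1.continuousOn.comp (by fun_prop) fun p _ => le_max_right p.1 0
  have hc2 := intervalIntegral.continuous_parametric_intervalIntegral_of_continuous' (μ := volume)
    (f := fun t x : ℝ => form k (isoTens k x) (m (x, max t 0))) hc 0 1
  have h1 := (hc2.tendsto 0).comp tendsto_inv_atTop_zero
  simp only [max_self, hb, intervalIntegral.integral_zero] at h1
  refine h1.congr' ?_
  filter_upwards [eventually_gt_atTop 0] with y hy
  rw [lineMean]
  refine intervalIntegral.integral_congr fun x _ => ?_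
  simp only
  rw [max_eq_left (inv_pos.2 hy).le, hm.2 _ (by exact inv_pos.2 hy), cuspChart_inv]

lemma hasDerivAt_lineMean {k : ℕ} {μ : Form0 k} (hμ : ContDiffOn ℝ ∞ μ UHP) {y : ℝ} (hy : 0 < y) :
    HasDerivAt (lineMean μ)
      (∫ x in (0 : ℝ)..1, form k (isoTens k x) (fderiv ℝ μ (x + y * Complex.I) Complex.I)) y := by
  have hD : ContinuousOn (fun z => fderiv ℝ μ z Complex.I) UHP :=
    (hμ.continuousOn_fderiv_of_isOpen isOpen_UHP (by simp)).clm_apply continuousOn_const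
  have hlc : Continuous fun p : ℝ × ℝ => (p.1 + p.2 * Complex.I : ℂ) := by clear hD hμ μ; fun_prop
  have hF : ContinuousOn (fun p : ℝ × ℝ =>
      form k (isoTens k p.1) (fderiv ℝ μ (p.1 + p.2 * Complex.I) Complex.I)) {p | 0 < p.2} := by
    refine continuousOn_form ((continuous_isoTens k).comp continuous_fst).continuousOn ?_
    exact hD.comp (f := fun p : ℝ × ℝ => (p.1 + p.2 * Complex.I : ℂ)) hlc.continuousOn
      fun p hp => line_mem_UHP hp
  obtain ⟨B, hB⟩ := ((isCompact_Icc (a := (0 : ℝ)) (b := 1)).prod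
    (isCompact_Icc (a := y / 2) (b := 2 * y))).exists_bound_of_continuousOn
    (hF.mono fun p hp => (half_pos hy).trans_le hp.2.1)
  refine (intervalIntegral.hasDerivAt_integral_of_dominated_loc_of_deriv_le
    (F := fun (y x : ℝ) => form k (isoTens k x) (μ (x + y * Complex.I)))
    (F' := fun (y x : ℝ) => form k (isoTens k x) (fderiv ℝ μ (x + y * Complex.I) Complex.I))
    (s := Set.Ioo (y / 2) (2 * y)) (bound := fun _ => B)
    (Ioo_mem_nhds (by linarith) (by linarith)) ?_ ?_ ?_ ?_ intervalIntegrable_const ?_).2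
  · filter_upwards [lt_mem_nhds hy] with y' hy'
    exact (continuous_line hμ.continuousOn hy').aestronglyMeasurable
  · exact (continuous_line hμ.continuousOn hy).intervalIntegrable _ _
  · exact (continuous_line hD hy).aestronglyMeasurable
  · refine Eventually.of_forall fun x hx y' hy' => ?_
    rw [Set.uIoc_of_le zero_le_one] at hx
    exact hB (x, y') ⟨⟨hx.1.le, hx.2⟩, hy'.1.le, hy'.2.le⟩
  · refine Eventually.of_forall fun x _ y' hy' => ?_
    have hy0 : 0 < y' := (half_pos hy).trans hy'.1
    have h1 : HasFDerivAt μ (fderiv ℝ μ (x + y' * Complex.I)) (x + y' * Complex.I) :=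
      ((hμ.differentiableOn (by simp)).differentiableAt
        (isOpen_UHP.mem_nhds (line_mem_UHP hy0))).hasFDerivAt
    have h2 : HasDerivAt (fun t : ℝ => (x + t * Complex.I : ℂ)) Complex.I y' := by
      have := (Complex.ofRealCLM.hasDerivAt (x := y')).mul_const Complex.I
      simpa using this.const_add (x : ℂ)
    exact (formL k (isoTens k x)).hasFDerivAt.comp_hasDerivAt y' (h1.comp_hasDerivAt y' h2)

/-- The pairing of the Eisenstein form with a cocycle `(a, b)` of the mapping cone whose boundary
component is orthogonal to `n(x) u'^k`. -/
theorem integralX_of_represents {k : ℕ} (hk : k ≠ 0) {α a : Form1 k} {b : ℝ → Tens k}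
    (hα : Represents α a b) (hb : ∀ x, form k (isoTens k x) (b x) = 0)
    (hint : IntegrableOn (fun y : ℝ => ∫ x in (0 : ℝ)..1, stripFun a (x + y * Complex.I))
      (Set.Ioi 0)) :
    integralX (eisForm k) α =
      ∫ y in Set.Ioi (0 : ℝ), ∫ x in (0 : ℝ)..1, stripFun a (x + y * Complex.I) := by
  obtain ⟨hα1, -, hαc, μ, m, hμ, hm, hdiff, hbm⟩ := hα
  obtain ⟨hi, he⟩ := integral_strip (integrableOn_stripFun hk hα1 hαc)
  rw [integralX_eisForm hk hα1 hαc, he]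
  set g := fun y : ℝ => ∫ x in (0 : ℝ)..1, stripFun a (x + y * Complex.I)
  set g' := fun y : ℝ =>
    ∫ x in (0 : ℝ)..1, form k (isoTens k x) (fderiv ℝ μ (x + y * Complex.I) Complex.I)
  set f := fun y : ℝ => ∫ x in (0 : ℝ)..1, stripFun α (x + y * Complex.I)
  have hD : ContinuousOn (fun z => fderiv ℝ μ z Complex.I) UHP :=
    (hμ.smooth.continuousOn_fderiv_of_isOpen isOpen_UHP (by simp)).clm_apply continuousOn_const
  have hαI : ContinuousOn (fun z => α z Complex.I) UHP :=
    hα1.smooth.continuousOn.clm_apply continuousOn_const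
  have hline : ∀ (ξ : Form1 k) (x y : ℝ), stripFun ξ (x + y * Complex.I) =
      form k (isoTens k x) (ξ (x + y * Complex.I) Complex.I) := by
    intro ξ x y; simp [stripFun]
  have hrel : ∀ y ∈ Set.Ioi (0 : ℝ), g y = f y + g' y := by
    intro y hy
    simp only [g, f, g', hline]
    rw [← intervalIntegral.integral_add ((continuous_line hαI hy).intervalIntegrable _ _)
      ((continuous_line hD hy).intervalIntegrable _ _)]
    refine intervalIntegral.integral_congr fun x _ => ?_
    rw [← map_add, ← hdiff _ (line_mem_UHP hy)]
    simp
  have hg'i : IntegrableOn g' (Set.Ioi 0) := by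
    refine (hint.sub hi).congr_fun (fun y hy => ?_) measurableSet_Ioi
    change g y - f y = g' y
    rw [hrel y hy, add_sub_cancel_left]
  -- `g'` is the derivative of `lineMean μ`, which vanishes at both ends
  have hg' : ∫ y in Set.Ioi (0 : ℝ), g' y = 0 := by
    -- the limit at `0` is the value there once the junk value of `lineMean μ` at `0` is replaced
    set G : ℝ → ℂ := Function.update (lineMean μ) 0 0 with hG
    have hGe : ∀ y : ℝ, 0 < y → G =ᶠ[𝓝 y] lineMean μ := fun y hy => by
      filter_upwards [lt_mem_nhds hy] with t ht
      exact Function.update_of_ne ht.ne' _ _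
    have h := integral_Ioi_of_hasDerivAt_of_tendsto (f := G) (f' := g') (a := 0) (m := 0) ?_
      (fun y hy => (hasDerivAt_lineMean hμ.smooth hy).congr_of_eventuallyEq (hGe y hy)) hg'i ?_
    · rw [h, hG, Function.update_self, sub_zero]
    · rw [hG, continuousWithinAt_update_same, Set.Ici_sdiff_left]
      exact tendsto_lineMean_zero hk hμ hm
    · refine (tendsto_lineMean_atTop hm fun x => ?_).congr' ?_
      · rw [← hbm, hb]
      · filter_upwards [eventually_gt_atTop 0] with y hy
        exact (Function.update_of_ne hy.ne' _ _).symm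
  rw [setIntegral_congr_fun measurableSet_Ioi hrel, integral_add hi hg'i, hg', add_zero]

end StripBoundary

/-! ### The metaplectic group -/

namespace Mp2Z

/-- The element `(1, -1)`. -/
def negRoot : Mp2Z := ⟨1, fun _ => -1, continuous_const, fun τ => by simp⟩

lemma eq_or_eq_negRoot_mul {g g' : Mp2Z} (h : g.mat = g'.mat) : g = g' ∨ g = negRoot * g' := by
  rcases isPreconnected_univ.eq_or_eq_neg_of_sq_eq (𝕜 := ℂ) g.cont.continuousOn
    g'.cont.continuousOn (fun τ _ => by simp [g.sq, g'.sq, h])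
    (fun {τ} _ => g'.root_ne_zero τ) with h1 | h1
  · exact Or.inl (Mp2Z.ext h (funext fun τ => h1 (Set.mem_univ τ)))
  · refine Or.inr (Mp2Z.ext (by simp [negRoot, h]) (funext fun τ => ?_))
    rw [h1 (Set.mem_univ τ)]
    simp [negRoot]

lemma S_pow_four_mat : (S ^ 4).mat = 1 := by
  have h : (S ^ 4).mat = ModularGroup.S * ModularGroup.S * ModularGroup.S * ModularGroup.S := by
    simp only [pow_succ, pow_zero, one_mul, mul_mat]
    rfl
  rw [h]
  ext i j
  fin_cases i <;> fin_cases j <;> rfl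

lemma weilRep_S_pow_four : weilRep (S ^ 4) = -1 := by
  have h2 : ((√2 : ℝ) : ℂ) ^ 2 = 2 := by rw [← Complex.ofReal_pow]; simp
  have he : Complex.exp (-(Real.pi * Complex.I / 4)) ^ 4 = -1 := by
    rw [← Complex.exp_nat_mul, show ((4 : ℕ) : ℂ) * -(Real.pi * Complex.I / 4) =
      -(Real.pi * Complex.I) by push_cast; ring, Complex.exp_neg, Complex.exp_pi_mul_I]
    norm_num
  have hm : !![(1 : ℂ), 1; 1, -1] ^ 4 = (4 : ℂ) • 1 := by
    ext i j
    fin_cases i <;> fin_cases j <;>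
      simp [pow_succ, Matrix.mul_apply, Fin.sum_univ_two] <;> norm_num
  rw [map_pow, isWeilRep_weilRep.2, smul_pow, hm, div_pow, he,
    show ((√2 : ℝ) : ℂ) ^ 4 = (((√2 : ℝ) : ℂ) ^ 2) ^ 2 by ring, h2, smul_smul]
  norm_num

/-- The Weil representation tells `S⁴` from the identity, and only two elements lie over `1`. -/
lemma S_pow_four : S ^ 4 = negRoot := by
  rcases eq_or_eq_negRoot_mul (g := S ^ 4) (g' := 1) (by rw [S_pow_four_mat]; rfl) with h | h
  · have h1 := weilRep_S_pow_four
    rw [h, map_one] at h1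
    have := congrFun (congrFun h1 0) 0
    norm_num at this
  · rw [h, mul_one]

lemma weilRep_negRoot : weilRep negRoot = -1 := by rw [← S_pow_four, weilRep_S_pow_four]

lemma closure_S_T : Subgroup.closure {S, T} = (⊤ : Subgroup Mp2Z) := by
  let f : Mp2Z →* SL(2, ℤ) := ⟨⟨Mp2Z.mat, rfl⟩, fun _ _ => rfl⟩
  set H := Subgroup.closure {S, T} with hH
  have hS : S ∈ H := Subgroup.subset_closure (by simp)
  have hT : T ∈ H := Subgroup.subset_closure (by simp)
  have htop : H.map f = ⊤ := by
    rw [eq_top_iff, ← SpecialLinearGroup.SL2Z_generators, Subgroup.closure_le]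
    rintro x (rfl | rfl)
    · exact ⟨_, hS, rfl⟩
    · exact ⟨_, hT, rfl⟩
  rw [eq_top_iff]
  intro g _
  obtain ⟨g', h', hg'⟩ : g.mat ∈ H.map f := htop ▸ Subgroup.mem_top _
  rcases eq_or_eq_negRoot_mul (g := g) (g' := g') (by exact hg'.symm) with h | h
  · rwa [h]
  · rw [h, ← S_pow_four]
    exact H.mul_mem (H.pow_mem hS 4) h'

lemma exists_mat_eq (γ : SL(2, ℤ)) : ∃ g : Mp2Z, g.mat = γ := by
  let f : Mp2Z →* SL(2, ℤ) := ⟨⟨Mp2Z.mat, rfl⟩, fun _ _ => rfl⟩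
  have htop : f.range = ⊤ := by
    rw [eq_top_iff, ← SpecialLinearGroup.SL2Z_generators, Subgroup.closure_le]
    rintro x (rfl | rfl)
    · exact ⟨S, rfl⟩
    · exact ⟨T, rfl⟩
  exact (htop ▸ Subgroup.mem_top γ : γ ∈ f.range)

lemma T_zpow (m : ℤ) : (T ^ m).mat = ModularGroup.T ^ m ∧ ∀ τ, (T ^ m).root τ = 1 := by
  induction m with
  | zero => simp
  | succ m ih =>
    rw [zpow_add_one, mul_mat, ih.1, zpow_add_one]
    exact ⟨rfl, fun τ => by rw [mul_root, ih.2]; simp [T]⟩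
  | pred m ih =>
    rw [zpow_sub_one, mul_mat, ih.1, zpow_sub_one]
    exact ⟨rfl, fun τ => by rw [mul_root, ih.2]; simp [T]⟩

end Mp2Z

lemma weilRep_T_zpow (m : ℤ) :
    (weilRep (Mp2Z.T ^ m)).mulVec (Pi.single 0 1) = Pi.single 0 1 := by
  have hT : (weilRep Mp2Z.T).mulVec (Pi.single 0 1) = Pi.single 0 1 := by
    rw [isWeilRep_weilRep.1]
    ext i; fin_cases i <;> simp [Matrix.mulVec, dotProduct, Fin.sum_univ_two]
  have hT' : (weilRep Mp2Z.T⁻¹).mulVec (Pi.single 0 1) = Pi.single 0 1 := by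
    conv_lhs => rw [← hT]
    rw [Matrix.mulVec_mulVec, ← map_mul, inv_mul_cancel, map_one, Matrix.one_mulVec]
  induction m with
  | zero => rw [zpow_zero, map_one, Matrix.one_mulVec]
  | succ m ih => rw [zpow_add_one, map_mul, ← Matrix.mulVec_mulVec, hT, ih]
  | pred m ih => rw [zpow_sub_one, map_mul, ← Matrix.mulVec_mulVec, hT', ih]

lemma weilRep_mem_unitary (g : Mp2Z) : weilRep g ∈ Matrix.unitaryGroup (Fin 2) ℂ := by
  have hg : g ∈ Subgroup.closure {Mp2Z.S, Mp2Z.T} := Mp2Z.closure_S_T ▸ Subgroup.mem_top g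
  induction hg using Subgroup.closure_induction with
  | mem x hx =>
    rw [Matrix.mem_unitaryGroup_iff]
    rcases hx with rfl | rfl
    · have h2 : ((√2 : ℝ) : ℂ) * ((√2 : ℝ) : ℂ) = 2 := by
        rw [← Complex.ofReal_mul, Real.mul_self_sqrt (by norm_num)]; norm_num
      have he : Complex.exp (-(Real.pi * Complex.I / 4)) *
          (starRingEnd ℂ) (Complex.exp (-(Real.pi * Complex.I / 4))) = 1 := by
        rw [Complex.mul_conj, Complex.normSq_eq_norm_sq, Complex.norm_exp]
        simp
      have hc : Complex.exp (-(Real.pi * Complex.I / 4)) / (√2 : ℝ) *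
          star (Complex.exp (-(Real.pi * Complex.I / 4)) / (√2 : ℝ)) = 1 / 2 := by
        rw [Complex.star_def, map_div₀, Complex.conj_ofReal, div_mul_div_comm, he, h2]
      have hst : star !![(1 : ℂ), 1; 1, -1] = !![1, 1; 1, -1] := by
        ext i j
        fin_cases i <;> fin_cases j <;> simp [Matrix.star_apply]
      rw [isWeilRep_weilRep.2, star_smul, smul_mul_smul_comm, hc, hst]
      ext i j
      fin_cases i <;> fin_cases j <;> simp <;> norm_num
    · rw [isWeilRep_weilRep.1]
      ext i j
      fin_cases i <;> fin_cases j <;>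
        simp [Matrix.mul_apply, Fin.sum_univ_two, Matrix.star_eq_conjTranspose]
  | one => rw [map_one]; exact one_mem _
  | mul x y _ _ hx hy => rw [map_mul]; exact mul_mem hx hy
  | inv x _ hx =>
    have h1 : weilRep x⁻¹ = star (weilRep x) := by
      have h2 := (Matrix.mem_unitaryGroup_iff).1 hx
      have h3 : weilRep x⁻¹ * weilRep x = 1 := by rw [← map_mul, inv_mul_cancel, map_one]
      calc weilRep x⁻¹ = weilRep x⁻¹ * (weilRep x * star (weilRep x)) := by rw [h2, mul_one]
        _ = _ := by rw [← mul_assoc, h3, one_mul]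
    rw [h1]
    rw [Matrix.mem_unitaryGroup_iff, star_star]
    exact Matrix.mem_unitaryGroup_iff'.1 hx

lemma norm_weilRep_mulVec_le (g : Mp2Z) : ‖(weilRep g).mulVec (Pi.single 0 1)‖ ≤ 1 := by
  refine (pi_norm_le_iff_of_nonneg zero_le_one).2 fun i => ?_
  rw [Matrix.mulVec_single_one]
  exact entry_norm_bound_of_unitary (weilRep_mem_unitary g) i 0

/-! ### Theta functions with characteristics -/

/-- The theta function `∑_{r ∈ ℤ + h/2} exp (2πiτ (r - a)² + 4πi b r - 2πi a b)` of `K + h` with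
characteristics `a`, `b`. -/
def thetaAB (a b : ℝ) (τ : ℍ) (h : Fin 2) : ℂ :=
  Complex.exp (2 * Real.pi * Complex.I * (τ * ((h.val : ℂ) / 2 - a) ^ 2 + b * h.val - a * b)) *
    jacobiTheta₂ (2 * τ * ((h.val : ℂ) / 2 - a) + 2 * b) (2 * τ)

lemma hasSum_thetaAB (a b : ℝ) (τ : ℍ) (h : Fin 2) :
    HasSum (fun n : ℤ => Complex.exp (2 * Real.pi * Complex.I * (τ * (n + (h.val : ℂ) / 2 - a) ^ 2 +
      2 * b * (n + (h.val : ℂ) / 2) - a * b))) (thetaAB a b τ h) := by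
  have h2 : 0 < (2 * (τ : ℂ)).im := by simpa using τ.im_pos
  refine ((hasSum_jacobiTheta₂_term (2 * τ * ((h.val : ℂ) / 2 - a) + 2 * b) h2).mul_left _).congr_fun
    fun n => ?_
  rw [jacobiTheta₂_term, ← Complex.exp_add]
  congr 1
  ring

lemma thetaAB_T (a b : ℝ) (τ : ℍ) : thetaAB a b (ModularGroup.T • τ) =
    Matrix.mulVec !![1, 0; 0, Complex.I] (thetaAB a (b - a) τ) := by
  have h1 : ((ModularGroup.T • τ : ℍ) : ℂ) = τ + 1 := by
    rw [UpperHalfPlane.modular_T_smul]; simp [add_comm]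
  have key : ∀ h : Fin 2, thetaAB a b (ModularGroup.T • τ) h =
      Complex.exp (2 * Real.pi * Complex.I * ((h.val : ℂ) ^ 2 / 4)) * thetaAB a (b - a) τ h := by
    intro h
    refine (hasSum_thetaAB a b _ h).unique
      (((hasSum_thetaAB a (b - a) τ h).mul_left _).congr_fun fun n => ?_)
    rw [h1, ← Complex.exp_add, Complex.exp_eq_exp_iff_exists_int]
    refine ⟨n ^ 2 + n * h.val, ?_⟩
    push_cast
    ring
  funext i
  fin_cases i
  · rw [Fin.zero_eta, key]
    simp [Matrix.mulVec, dotProduct, Fin.sum_univ_two]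
  · rw [Fin.mk_one, key, show 2 * Real.pi * Complex.I * (((1 : Fin 2).val : ℂ) ^ 2 / 4) =
      Real.pi / 2 * Complex.I by simp; ring, Complex.exp_pi_div_two_mul_I]
    simp [Matrix.mulVec, dotProduct, Fin.sum_univ_two]

lemma thetaAB_S (a b : ℝ) (τ : ℍ) : thetaAB a b (ModularGroup.S • τ) = ((τ : ℂ) ^ (1 / 2 : ℂ)) •
    Matrix.mulVec ((Complex.exp (-(Real.pi * Complex.I / 4)) / (√2 : ℝ)) • !![1, 1; 1, -1])
      (thetaAB (-b) a τ) := by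
  have hτ : (τ : ℂ) ≠ 0 := τ.ne_zero
  have h1 : ((ModularGroup.S • τ : ℍ) : ℂ) = -1 / τ := by
    rw [UpperHalfPlane.modular_S_smul]; simp [neg_div, inv_neg]
  have hne : (-Complex.I * ((τ : ℂ) / 2)) ^ (1 / 2 : ℂ) ≠ 0 := by
    rw [Ne, Complex.cpow_eq_zero_iff]
    simp [hτ]
  have key : ∀ h : Fin 2, thetaAB a b (ModularGroup.S • τ) h =
      (-Complex.I * ((τ : ℂ) / 2)) ^ (1 / 2 : ℂ) *
        (thetaAB (-b) a τ 0 + (-1) ^ h.val * thetaAB (-b) a τ 1) := by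
    intro h
    set z : ℂ := -(h.val : ℂ) / 2 + τ * b + a with hz
    have hf := jacobiTheta₂_functional_equation z ((τ : ℂ) / 2)
    rw [jacobiTheta₂_split z τ.im_pos] at hf
    have e1 : -1 / ((τ : ℂ) / 2) = 2 * (-1 / τ) := by field_simp
    have e2 : z / ((τ : ℂ) / 2) = 2 * (-1 / τ) * ((h.val : ℂ) / 2 - a) + 2 * b := by
      rw [hz]; field_simp; ring
    rw [e1, e2] at hf
    -- integral shifts of the argument do not change `jacobiTheta₂`
    have hper : ∀ w t : ℂ, jacobiTheta₂ (-(h.val : ℂ) + w) t = jacobiTheta₂ w t := by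
      intro w t
      fin_cases h
      · simp
      · rw [← jacobiTheta₂_add_left]; simp
    have e3 : 2 * z = -(h.val : ℂ) + (2 * τ * b + 2 * a) := by rw [hz]; ring
    have e4 : 2 * z + τ = -(h.val : ℂ) + (2 * τ * (1 / 2 + b) + 2 * a) := by rw [hz]; ring
    rw [e4, e3, hper, hper] at hf
    have e5 : Complex.exp (2 * Real.pi * Complex.I * z + Real.pi * Complex.I * τ / 2) =
        (-1) ^ h.val * Complex.exp (2 * Real.pi * Complex.I * (τ * b + a + τ / 4)) := by
      rw [← Complex.exp_pi_mul_I, ← Complex.exp_nat_mul, ← Complex.exp_add,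
        Complex.exp_eq_exp_iff_exists_int]
      exact ⟨-(h.val : ℤ), by rw [hz]; push_cast; ring⟩
    rw [thetaAB, h1, thetaAB, thetaAB]
    simp only [Fin.val_zero, Fin.val_one, Nat.cast_zero, Nat.cast_one, Complex.ofReal_neg,
      zero_div, sub_neg_eq_add]
    rw [e5] at hf
    have e6 : jacobiTheta₂ (2 * (-1 / τ) * ((h.val : ℂ) / 2 - a) + 2 * b) (2 * (-1 / τ)) =
        (-Complex.I * ((τ : ℂ) / 2)) ^ (1 / 2 : ℂ) *
        Complex.exp (Real.pi * Complex.I * z ^ 2 / ((τ : ℂ) / 2)) *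
          (jacobiTheta₂ (2 * τ * b + 2 * a) (2 * τ) + (-1) ^ h.val *
            Complex.exp (2 * Real.pi * Complex.I * (τ * b + a + τ / 4)) *
              jacobiTheta₂ (2 * τ * (1 / 2 + b) + 2 * a) (2 * τ)) := by
      rw [hf, show -Real.pi * Complex.I * z ^ 2 / ((τ : ℂ) / 2) =
        -(Real.pi * Complex.I * z ^ 2 / ((τ : ℂ) / 2)) by ring, Complex.exp_neg]
      have := Complex.exp_ne_zero (Real.pi * Complex.I * z ^ 2 / ((τ : ℂ) / 2))
      field_simp
    have e7 : Complex.exp (2 * Real.pi * Complex.I *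
        (-1 / τ * ((h.val : ℂ) / 2 - a) ^ 2 + b * h.val - a * b)) *
        Complex.exp (Real.pi * Complex.I * z ^ 2 / ((τ : ℂ) / 2)) =
        Complex.exp (2 * Real.pi * Complex.I * (τ * b ^ 2 + b * a)) := by
      rw [← Complex.exp_add]
      congr 1
      rw [hz]
      field_simp
      ring
    have e8 : Complex.exp (2 * Real.pi * Complex.I * (τ * (1 / 2 + b) ^ 2 + a * 1 + b * a)) =
        Complex.exp (2 * Real.pi * Complex.I * (τ * b ^ 2 + b * a)) *
          Complex.exp (2 * Real.pi * Complex.I * (τ * b + a + τ / 4)) := by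
      rw [← Complex.exp_add]
      congr 1
      ring
    have e9 : (τ : ℂ) * b ^ 2 + a * 0 - -(b : ℂ) * a = τ * b ^ 2 + b * a := by ring
    have e10 : (τ : ℂ) * (1 / 2 + b) ^ 2 + a * 1 - -(b : ℂ) * a =
        τ * (1 / 2 + b) ^ 2 + a * 1 + b * a := by ring
    simp only [zero_add]
    rw [e6, e9, e10, e8, ← e7]
    ring
  rw [root_identity] at key
  funext i
  fin_cases i
  · rw [Fin.zero_eta, key]
    simp [dotProduct, Fin.sum_univ_two]; ring
  · rw [Fin.mk_one, key]
    simp [dotProduct, Fin.sum_univ_two]; ring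

/-- The theta functions with characteristics transform with the Weil representation, while the
characteristics transform like the coefficients of the linear form `b - a τ`. -/
lemma thetaAB_smul (g : Mp2Z) (a b : ℝ) (τ : ℍ) : thetaAB a b (g.mat • τ) =
    g.root τ • (weilRep g).mulVec
      (thetaAB (g.mat 0 0 * a - g.mat 1 0 * b) (g.mat 1 1 * b - g.mat 0 1 * a) τ) := by
  have hg : g ∈ Subgroup.closure {Mp2Z.S, Mp2Z.T} := Mp2Z.closure_S_T ▸ Subgroup.mem_top g
  induction hg using Subgroup.closure_induction generalizing a b τ with
  | mem x hx =>
    rcases hx with rfl | rfl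
    · rw [isWeilRep_weilRep.2]
      simpa [Mp2Z.S, ModularGroup.S] using thetaAB_S a b τ
    · rw [isWeilRep_weilRep.1]
      simpa [Mp2Z.T, ModularGroup.T] using thetaAB_T a b τ
  | one => simp
  | mul x y _ _ hx hy =>
    rw [Mp2Z.mul_mat, mul_smul, hx, hy, Matrix.mulVec_smul, Mp2Z.mul_root, smul_smul, map_mul,
      Matrix.mulVec_mulVec]
    congr 3
    · simp only [Matrix.SpecialLinearGroup.coe_mul, Matrix.mul_apply, Fin.sum_univ_two]
      push_cast
      ring
    · simp only [Matrix.SpecialLinearGroup.coe_mul, Matrix.mul_apply, Fin.sum_univ_two]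
      push_cast
      ring
  | inv x _ hx =>
    have hdet : ((x.mat 0 0 : ℤ) : ℝ) * x.mat 1 1 - x.mat 0 1 * x.mat 1 0 = 1 := by
      exact_mod_cast det_eq x.mat
    have h := hx (x.mat 1 1 * a + x.mat 1 0 * b) (x.mat 0 0 * b + x.mat 0 1 * a) (x.mat⁻¹ • τ)
    have e1 : (x.mat 0 0 : ℝ) * (x.mat 1 1 * a + x.mat 1 0 * b) -
        x.mat 1 0 * (x.mat 0 0 * b + x.mat 0 1 * a) = a := by linear_combination a * hdet
    have e2 : (x.mat 1 1 : ℝ) * (x.mat 0 0 * b + x.mat 0 1 * a) -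
        x.mat 0 1 * (x.mat 1 1 * a + x.mat 1 0 * b) = b := by linear_combination b * hdet
    rw [e1, e2, smul_inv_smul] at h
    have e3 : thetaAB ((x⁻¹.mat 0 0 : ℤ) * a - (x⁻¹.mat 1 0 : ℤ) * b)
        ((x⁻¹.mat 1 1 : ℤ) * b - (x⁻¹.mat 0 1 : ℤ) * a) τ =
        thetaAB (x.mat 1 1 * a + x.mat 1 0 * b) (x.mat 0 0 * b + x.mat 0 1 * a) τ := by
      rw [Mp2Z.inv_mat, Matrix.SpecialLinearGroup.SL2_inv_expl]
      simp
    rw [e3, h, Mp2Z.inv_mat, Mp2Z.inv_root, Matrix.mulVec_smul, smul_smul,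
      inv_mul_cancel₀ (x.root_ne_zero _), Matrix.mulVec_mulVec, ← map_mul, inv_mul_cancel,
      map_one, one_smul, Matrix.one_mulVec]

/-! ### The Eisenstein series of half integral weight as a sum over coprime pairs -/

lemma exists_mpLift (p : Cop) : ∃ g : Mp2Z, row g.mat = p.1 := by
  obtain ⟨γ, hγ⟩ := row_surj p
  obtain ⟨g, rfl⟩ := Mp2Z.exists_mat_eq γ
  exact ⟨g, hγ⟩

/-- A metaplectic element with given bottom row. -/
def mpLift (p : Cop) : Mp2Z := (exists_mpLift p).choose

lemma row_mpLift (p : Cop) : row (mpLift p).mat = p.1 := (exists_mpLift p).choose_spec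

/-- The contribution of `g` to the Eisenstein series. -/
def slashTerm (k : ℕ) (τ : ℍ) (g : Mp2Z) : Fin 2 → ℂ :=
  (g.root τ ^ (2 * k + 3))⁻¹ • (weilRep g⁻¹).mulVec (Pi.single 0 1)

lemma slashTerm_T_mul (k : ℕ) (τ : ℍ) (m : ℤ) (g : Mp2Z) :
    slashTerm k τ (Mp2Z.T ^ m * g) = slashTerm k τ g := by
  rw [slashTerm, mul_inv_rev, map_mul, ← Matrix.mulVec_mulVec, ← zpow_neg, weilRep_T_zpow,
    Mp2Z.mul_root, (Mp2Z.T_zpow m).2, one_mul, slashTerm]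

/-- `(1, -1)` changes the sign of both factors, since `2k + 3` is odd. -/
lemma slashTerm_negRoot_mul (k : ℕ) (τ : ℍ) (g : Mp2Z) :
    slashTerm k τ (Mp2Z.negRoot * g) = slashTerm k τ g := by
  have h : weilRep Mp2Z.negRoot⁻¹ = -1 := by
    have : Mp2Z.negRoot⁻¹ = Mp2Z.negRoot := by
      refine inv_eq_of_mul_eq_one_right (Mp2Z.ext (by simp [Mp2Z.negRoot]) (funext fun τ => ?_))
      simp [Mp2Z.negRoot]
    rw [this, Mp2Z.weilRep_negRoot]
  have h2 : (Odd (2 * k + 3)) := ⟨k + 1, by ring⟩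
  rw [slashTerm, mul_inv_rev, map_mul, h, Mp2Z.mul_root, slashTerm]
  simp only [Mp2Z.negRoot, neg_mul, one_mul, mul_neg, mul_one, h2.neg_pow, Matrix.neg_mulVec,
    inv_neg, neg_smul, smul_neg, neg_neg]

lemma mpTerm_mk (k : ℕ) (τ : ℍ) (g : Mp2Z) :
    mpTerm k τ (Quotient.mk (QuotientGroup.rightRel (Subgroup.zpowers Mp2Z.T)) g) =
      slashTerm k τ g := by
  have h := Quotient.mk_out (s := QuotientGroup.rightRel (Subgroup.zpowers Mp2Z.T)) g
  obtain ⟨m, hm⟩ := QuotientGroup.rightRel_apply.1 h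
  rw [← slashTerm_T_mul k τ (-m)]
  simp only at hm
  rw [zpow_neg, hm, mul_inv_rev, inv_inv, inv_mul_cancel_right]
  rfl

/-- A coset is determined by the bottom row and the sign of the root. -/
def mpEquiv : Cop × Bool ≃ MpCosets :=
  Equiv.ofBijective (fun x => Quotient.mk _ (bif x.2 then Mp2Z.negRoot * mpLift x.1 else mpLift x.1))
  <| by
    have hmat : ∀ x : Cop × Bool,
        (bif x.2 then Mp2Z.negRoot * mpLift x.1 else mpLift x.1).mat = (mpLift x.1).mat := by
      rintro ⟨p, _ | _⟩ <;> simp [Mp2Z.negRoot]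
    have hne : ∀ g : Mp2Z, Mp2Z.negRoot * g ≠ g := by
      intro g h
      have h1 : Mp2Z.negRoot = 1 := mul_eq_right.1 h
      have := congrFun (congrArg Mp2Z.root h1) UpperHalfPlane.I
      simp only [Mp2Z.negRoot, Mp2Z.one_root] at this
      norm_num at this
    constructor
    · intro x y h
      obtain ⟨m, hm⟩ := QuotientGroup.rightRel_apply.1 (Quotient.exact h)
      simp only at hm
      have h1 := eq_mul_inv_iff_mul_eq.1 hm
      have h2 := congrArg Mp2Z.mat h1
      rw [Mp2Z.mul_mat, hmat, hmat, (Mp2Z.T_zpow m).1] at h2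
      have h3 : x.1 = y.1 := Subtype.ext (by
        rw [← row_mpLift, ← row_mpLift]
        exact (row_eq_iff _ _).2 ⟨m, h2.symm⟩)
      rw [h3] at h2
      have h4 : m = 0 := by
        have h5 := congrArg (fun γ : SL(2, ℤ) => γ 0 1) (mul_eq_right.1 h2)
        simp only [ModularGroup.coe_T_zpow] at h5
        simpa using h5
      rw [h4, zpow_zero, one_mul, h3] at h1
      refine Prod.ext h3 ?_
      rcases x with ⟨p, _ | _⟩ <;> rcases y with ⟨q, _ | _⟩ <;> simp only [cond_true, cond_false] at h1
      · rfl
      · exact absurd h1.symm (hne _)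
      · exact absurd h1 (hne _)
      · rfl
    · intro q
      obtain ⟨g, rfl⟩ := q.exists_rep
      obtain ⟨m, hm⟩ := (row_eq_iff _ _).1 (row_mpLift ⟨row g.mat, row_coprime _⟩)
      set p : Cop := ⟨row g.mat, row_coprime _⟩
      have hq : ∀ g' : Mp2Z, g = Mp2Z.T ^ m * g' → (Quotient.mk (QuotientGroup.rightRel
          (Subgroup.zpowers Mp2Z.T)) g') = Quotient.mk _ g := by
        intro g' h
        rw [Quotient.eq, QuotientGroup.rightRel_apply]
        exact ⟨m, by simp only; rw [h, mul_inv_cancel_right]⟩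
      have hcomm : Mp2Z.negRoot * (Mp2Z.T ^ m * mpLift p) =
          Mp2Z.T ^ m * (Mp2Z.negRoot * mpLift p) :=
        Mp2Z.ext (by simp [Mp2Z.negRoot]) (funext fun τ => by simp [Mp2Z.negRoot])
      rcases Mp2Z.eq_or_eq_negRoot_mul (g := g) (g' := Mp2Z.T ^ m * mpLift p)
        (by rw [Mp2Z.mul_mat, (Mp2Z.T_zpow m).1, hm]) with h | h
      · exact ⟨(p, false), hq _ h⟩
      · exact ⟨(p, true), hq _ (h.trans hcomm)⟩

lemma mpTerm_mpEquiv (k : ℕ) (τ : ℍ) (x : Cop × Bool) :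
    mpTerm k τ (mpEquiv x) = slashTerm k τ (mpLift x.1) := by
  refine (mpTerm_mk k τ _).trans ?_
  rcases x with ⟨p, _ | _⟩
  · rfl
  · exact slashTerm_negRoot_mul k τ _

lemma norm_root_sq (p : Cop) (τ : ℍ) :
    ‖(mpLift p).root τ‖ ^ 2 = ‖(p.1 0 : ℂ) * τ + p.1 1‖ := by
  rw [← norm_pow, Mp2Z.sq, ← row_mpLift p]; rfl

/-- The Weil representation is unitary, so that the series converges even for `k = 1`. -/
lemma summable_norm_slashTerm {k : ℕ} (hk : k ≠ 0) (τ : ℍ) :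
    Summable fun p : Cop => ‖slashTerm k τ (mpLift p)‖ := by
  have hs : (2 : ℝ) < k + 3 / 2 := by
    have : (1 : ℝ) ≤ k := by exact_mod_cast Nat.one_le_iff_ne_zero.2 hk
    linarith
  refine Summable.of_nonneg_of_le (fun p => norm_nonneg _) (fun p => ?_)
    ((summable_cop hs).mul_left (EisensteinSeries.r τ ^ (-((k : ℝ) + 3 / 2))))
  refine le_trans ?_ (EisensteinSeries.summand_bound τ (by positivity) p.1)
  rw [slashTerm, norm_smul, ← norm_root_sq, norm_inv, norm_pow]
  refine (mul_le_of_le_one_right (by positivity) (norm_weilRep_mulVec_le _)).trans_eq ?_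
  rw [← Real.rpow_natCast ‖_‖ 2, ← Real.rpow_mul (norm_nonneg _), ← Real.rpow_natCast,
    ← Real.rpow_neg (norm_nonneg _)]
  congr 1
  push_cast
  ring

lemma summable_slashTerm_prod {k : ℕ} (hk : k ≠ 0) (τ : ℍ) :
    Summable fun x : Cop × Bool => slashTerm k τ (mpLift x.1) := by
  refine Summable.of_norm ?_
  have h := (summable_norm_slashTerm hk τ).mul_of_nonneg
    (g := fun _ : Bool => (1 : ℝ)) (Summable.of_finite) (fun _ => norm_nonneg _)
    (fun _ => zero_le_one)
  simpa using h

lemma summable_mpTerm {k : ℕ} (hk : k ≠ 0) (τ : ℍ) : Summable fun q => mpTerm k τ q := by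
  rw [← mpEquiv.summable_iff]
  exact (summable_slashTerm_prod hk τ).congr fun x => (mpTerm_mpEquiv k τ x).symm

lemma eisHalf_eq {k : ℕ} (hk : k ≠ 0) (τ : ℍ) :
    eisHalf k τ = ∑' p : Cop, slashTerm k τ (mpLift p) := by
  rw [eisHalf, ← mpEquiv.tsum_eq]
  simp only [mpTerm_mpEquiv]
  rw [(summable_slashTerm_prod hk τ).tsum_prod]
  simp only [tsum_bool, ← two_smul ℂ]
  rw [tsum_const_smul'', smul_smul]
  norm_num

/-! ### The Fourier coefficients of the theta series along horizontal lines -/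

section Coefficients

open MeasureTheory

lemma exists_norm_phase_le (h : Fin 2) (τ : ℍ) {A m : ℤ} (hA : ¬(A = 0 ∧ m = 0)) :
    ∃ u : ℤ → ℝ, Summable u ∧ ∀ B (x : ℝ), |x| ≤ 1 → ‖phase h τ A B m x‖ ≤ u B := by
  obtain ⟨u, hu, hb⟩ := exists_mixTerm_le 0 0 h τ one_pos one_pos
  have hinj : Function.Injective fun B : ℤ => ((A, B, m) : ℤ × ℤ × ℤ) := fun B C hBC => by
    simpa using hBC
  have hv : 0 < √τ.im := Real.sqrt_pos.2 τ.im_pos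
  refine ⟨fun B => √τ.im * Real.exp (rate τ A m) * u (A, B, m),
    (hu.comp_injective hinj).mul_left _, fun B x hx => ?_⟩
  have h1 := hb (A, B, m) (x + Complex.I) (by simpa using hx) (by simp)
  simp only [mixTerm, decays, if_neg hA, hp, Complex.add_re, Complex.ofReal_re, Complex.I_re,
    add_zero, Complex.add_im, Complex.ofReal_im, Complex.I_im, zero_add, Polynomial.eval_one,
    pow_zero, mul_one, Complex.ofReal_one, one_pow, norm_mul, norm_div, norm_one,
    Complex.norm_real, Real.norm_eq_abs, abs_of_pos hv,
    Real.exp_neg] at h1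
  have hE := Real.exp_pos (rate τ A m)
  calc ‖phase h τ A B m x‖ = √τ.im * Real.exp (rate τ A m) *
        (1 / √τ.im * (Real.exp (rate τ A m))⁻¹ * ‖phase h τ A B m x‖) := by field_simp
    _ ≤ _ := mul_le_mul_of_nonneg_left (by simpa using h1) (by positivity)

lemma continuous_phase (h : Fin 2) (τ : ℍ) (A B m : ℤ) : Continuous (phase h τ A B m) := by
  unfold phase torC
  fun_prop

lemma hasSum_phase_thetaAB (h : Fin 2) (τ : ℍ) (A m : ℤ) (x : ℝ) :
    HasSum (fun B : ℤ => phase h τ A B m x) (thetaAB (x * A) (x * m) τ h) := by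
  refine (hasSum_thetaAB (x * A) (x * m) τ h).congr_fun fun B => ?_
  rw [phase, torC]
  congr 1
  push_cast
  ring

lemma hasSum_integral_phase (h : Fin 2) (τ : ℍ) {A m : ℤ} (hA : ¬(A = 0 ∧ m = 0)) :
    HasSum (fun B : ℤ => ∫ x in (0 : ℝ)..1, phase h τ A B m x)
      (∫ x in (0 : ℝ)..1, thetaAB (x * A) (x * m) τ h) := by
  obtain ⟨u, hu, hb⟩ := exists_norm_phase_le h τ hA
  refine intervalIntegral.hasSum_integral_of_dominated_convergence (fun B _ => u B)
    (fun B => (continuous_phase h τ A B m).aestronglyMeasurable)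
    (fun B => Filter.Eventually.of_forall fun x hx => hb B x ?_)
    (Filter.Eventually.of_forall fun _ _ => hu) intervalIntegrable_const
    (Filter.Eventually.of_forall fun x _ => hasSum_phase_thetaAB h τ A m x)
  rw [Set.uIoc_of_le zero_le_one] at hx
  rw [abs_of_pos hx.1]
  exact hx.2

lemma integral_thetaAB_zero (h : Fin 2) (τ : ℍ) {N : ℤ} (hN : N ≠ 0) :
    ∫ x in (0 : ℝ)..1, thetaAB 0 (x * N) τ h = (Pi.single 0 1 : Fin 2 → ℂ) h := by
  have h1 := hasSum_integral_phase h τ (A := 0) (m := N) (by simp [hN])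
  simp only [Int.cast_zero, mul_zero] at h1
  have h2 : ∀ B : ℤ, 2 * B + h.val ≠ 0 → ∫ x in (0 : ℝ)..1, phase h τ 0 B N x = 0 := by
    intro B hB
    have hc : 2 * Real.pi * Complex.I * ((N * (2 * B + h.val) : ℤ) : ℂ) ≠ 0 :=
      mul_ne_zero Complex.two_pi_I_ne_zero (Int.cast_ne_zero.2 (mul_ne_zero hN hB))
    have h3 : ∀ x : ℝ, phase h τ 0 B N x =
        Complex.exp (2 * Real.pi * Complex.I * τ * (B + (h.val : ℂ) / 2) ^ 2) *
          Complex.exp (2 * Real.pi * Complex.I * ((N * (2 * B + h.val) : ℤ) : ℂ) * x) := by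
      intro x
      rw [phase, torC, ← Complex.exp_add]
      congr 1
      push_cast
      ring
    have h4 : Complex.exp (2 * Real.pi * Complex.I * ((N * (2 * B + h.val) : ℤ) : ℂ)) = 1 := by
      rw [mul_comm]
      exact Complex.exp_int_mul_two_pi_mul_I _
    simp only [h3]
    rw [intervalIntegral.integral_const_mul, integral_exp_mul_complex hc, Complex.ofReal_one,
      mul_one, Complex.ofReal_zero, mul_zero, Complex.exp_zero, h4,
      sub_self, zero_div, mul_zero]
  refine h1.unique ?_
  fin_cases h
  · have h3 : ∫ x in (0 : ℝ)..1, phase 0 τ 0 0 N x = 1 := by simp [phase, torC]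
    have := hasSum_single (f := fun B : ℤ => ∫ x in (0 : ℝ)..1, phase 0 τ 0 B N x) 0
      fun B hB => h2 B (by simpa using hB)
    simpa [h3] using this
  · have h4 : ∀ B : ℤ, ∫ x in (0 : ℝ)..1, phase 1 τ 0 B N x = 0 := fun B =>
      h2 B (by simp; omega)
    simp [h4]

lemma continuous_thetaAB (τ : ℍ) (h : Fin 2) (N : ℤ) :
    Continuous fun x : ℝ => thetaAB 0 (x * N) τ h := by
  have h2 : 0 < (2 * (τ : ℂ)).im := by simpa using τ.im_pos
  have h3 : Continuous fun z => jacobiTheta₂ z (2 * τ) :=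
    continuous_iff_continuousAt.2 fun z => (differentiableAt_jacobiTheta₂_fst z h2).continuousAt
  unfold thetaAB
  refine Continuous.mul (by fun_prop) (h3.comp ?_)
  fun_prop

/-- The mean of the theta function with characteristics proportional to a primitive vector is a
value of the summand of the Eisenstein series: a modular transformation brings the vector to
`(0, 1)`, and then only the term of `r = 0` survives. -/
lemma integral_thetaAB (g : Mp2Z) (τ : ℍ) {N : ℤ} (hN : N ≠ 0) (h : Fin 2) :
    ∫ x in (0 : ℝ)..1, thetaAB (x * ((-(N * g.mat 1 0) : ℤ) : ℝ)) (x * ((N * g.mat 1 1 : ℤ) : ℝ)) τ h =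
      (g.root τ)⁻¹ * (weilRep g⁻¹).mulVec (Pi.single 0 1) h := by
  have h1 : ∀ x : ℝ, thetaAB (x * ((-(N * g.mat 1 0) : ℤ) : ℝ)) (x * ((N * g.mat 1 1 : ℤ) : ℝ)) τ =
      (g.root τ)⁻¹ • (weilRep g⁻¹).mulVec (thetaAB 0 (x * N) (g.mat • τ)) := by
    intro x
    rw [thetaAB_smul, Matrix.mulVec_smul, smul_smul, inv_mul_cancel₀ (g.root_ne_zero τ), one_smul,
      Matrix.mulVec_mulVec, ← map_mul, inv_mul_cancel, map_one, Matrix.one_mulVec]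
    congr 1
    · push_cast; ring
    · push_cast; ring
  simp only [h1, Pi.smul_apply, smul_eq_mul, Matrix.mulVec, dotProduct]
  rw [intervalIntegral.integral_const_mul, intervalIntegral.integral_finsetSum fun i _ =>
    ((continuous_thetaAB _ _ N).intervalIntegrable _ _).const_mul _]
  simp only [intervalIntegral.integral_const_mul, integral_thetaAB_zero _ _ hN]

end Coefficients

/-! ### The Mellin transform of the constant term -/

section Mellin

open MeasureTheory Filter

lemma integrable_of_hasSum {Z ι : Type*} [MeasurableSpace Z] {μ : Measure Z} [Countable ι]
    {F : ι → Z → ℂ} {g : Z → ℂ} (hF : ∀ i, Integrable (F i) μ)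
    (hs : Summable fun i => ∫ a, ‖F i a‖ ∂μ) (hg : ∀ᵐ a ∂μ, HasSum (fun i => F i a) (g a)) :
    Integrable g μ ∧ HasSum (fun i => ∫ a, F i a ∂μ) (∫ a, g a ∂μ) := by
  constructor
  · refine ⟨aestronglyMeasurable_of_tendsto_ae atTop
      (f := fun (s : Finset ι) a => ∑ i ∈ s, F i a) (fun s => ?_) hg, ?_⟩
    · exact Finset.aestronglyMeasurable_fun_sum s fun i _ => (hF i).1
    · have h1 : ∫⁻ a, ‖g a‖ₑ ∂μ ≤ ∑' i, ∫⁻ a, ‖F i a‖ₑ ∂μ := by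
        rw [← lintegral_tsum fun i => (hF i).1.enorm]
        refine lintegral_mono_ae ?_
        filter_upwards [hg] with a ha
        rw [← ha.tsum_eq]
        exact enorm_tsum_le_tsum_enorm
      refine h1.trans_lt (lt_of_le_of_ne le_top ?_)
      simp_rw [← fun i => ofReal_integral_norm_eq_lintegral_enorm (hF i)]
      exact hs.tsum_ofReal_ne_top
  · have h := hasSum_integral_of_summable_integral_norm hF hs
    rwa [integral_congr_ae (hg.mono fun a ha => ha.tsum_eq)] at h

lemma integral_pow_mul_exp (k : ℕ) {b : ℝ} (hb : 0 < b) :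
    IntegrableOn (fun y : ℝ => y ^ (2 * k + 1) * Real.exp (-b * y ^ 2)) (Set.Ioi 0) ∧
    ∫ y in Set.Ioi (0 : ℝ), y ^ (2 * k + 1) * Real.exp (-b * y ^ 2) =
      k.factorial / (2 * b ^ (k + 1)) := by
  have hq : (-1 : ℝ) < ((2 * k + 1 : ℕ) : ℝ) := by
    have : (0 : ℝ) ≤ ((2 * k + 1 : ℕ) : ℝ) := Nat.cast_nonneg _
    linarith
  have h1 := integrableOn_rpow_mul_exp_neg_mul_rpow hq (p := 2) two_pos hb
  have h2 := integral_rpow_mul_exp_neg_mul_rpow (p := 2) two_pos hq hb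
  have e1 : (((2 * k + 1 : ℕ) : ℝ) + 1) / 2 = k + 1 := by push_cast; ring
  have e2 : -(((2 * k + 1 : ℕ) : ℝ) + 1) / 2 = -((k + 1 : ℕ) : ℝ) := by push_cast; ring
  rw [e1, e2, Real.Gamma_nat_eq_factorial, Real.rpow_neg hb.le, Real.rpow_natCast] at h2
  simp only [Real.rpow_natCast, Real.rpow_two] at h1 h2
  refine ⟨h1, h2.trans ?_⟩
  field_simp

/-- Up to the action of the torus `u'` is `(e₃ - e₁) / √2`, so `n(x) u'^k` is orthogonal to all tensors
of the frame but the power of the first vector. -/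
lemma form_isoTens_frame {k : ℕ} {z : ℂ} (hz : z ∈ UHP) (β : Fin k → Fin 2) :
    form k (isoTens k z.re) (act k (gMat z) (harmProj k (basisT β))) =
      ∏ i, (if β i = 0 then (-(z.im / √2) : ℂ) else 0) := by
  have hs : 0 < √z.im := Real.sqrt_pos.2 hz
  have hdet := det_gMat hz
  have h1 : isoTens k z.re = act k (gMat z) (power k (isoVec 0 √z.im)) := by
    rw [isoTens, act_n_power_u', act_power_isoVec _ hdet]
    congr 2
    · simp [gMat, hs.ne']
    · simp [gMat, hs.ne']
  have hmem : power k (isoVec 0 √z.im) ∈ harm k :=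
    power_mem_harm k (trace_isoVec _ _) (trace_isoVec_sq _ _)
  rw [h1, form_act _ _ (by rw [hdet]; exact one_ne_zero), form_harmProj hmem, form_apply,
    Finset.sum_eq_single fun i => (β i).castSucc]
  · rw [basisT, Pi.single_eq_same, mul_one, power, ← Finset.prod_mul_distrib]
    refine Finset.prod_congr rfl fun i _ => ?_
    have hv : coord (isoVec 0 √z.im) = ![-(z.im / √2), 0, z.im / √2 * 1] := by
      have := Real.sq_sqrt (le_of_lt hz : 0 ≤ z.im)
      rw [coord_apply]
      funext a
      fin_cases a <;> simp [isoVec, this] <;> ring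
    have : ∀ c : Fin 2, ((ε c.castSucc : ℝ) : ℂ) * ((coord (isoVec 0 √z.im) c.castSucc : ℝ) : ℂ) =
        if c = 0 then (-(z.im / √2) : ℂ) else 0 := by
      intro c
      rw [hv]
      fin_cases c <;> simp [ε]
    exact this (β i)
  · intro δ _ hδ
    rw [basisT, Pi.single_eq_of_ne hδ, mul_zero]
  · simp

/-- Only the component of the theta series with the highest Hermite degree in the first variable
pairs nontrivially with `n(x) u'^k`. -/
lemma stripFun_thetaV {k : ℕ} (h : Fin 2) (τ : ℍ) {z : ℂ} (hz : z ∈ UHP) :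
    stripFun (thetaV k h τ) z =
      thetaC k τ * ((1 / z.im) * (-(z.im / √2)) ^ k) * flatSum (k + 1) 0 h τ z := by
  have hsum : ∑' p, scTerm (k + 1) 0 h τ z p = flatSum (k + 1) 0 h τ z := by
    rw [tsum_scTerm _ _ _ _ hz, if_neg (Nat.succ_ne_zero k), zero_mul, zero_add]
  have hI : ∀ (α : Fin 2) (β : Fin k → Fin 2), form k (isoTens k z.re) (frameT k z α β Complex.I) =
      if α = 0 then (1 / z.im : ℂ) * ∏ i, (if β i = 0 then (-(z.im / √2) : ℂ) else 0) else 0 := by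
    intro α β
    rw [frameT, ContinuousLinearMap.smulRight_apply, form_real_smul_right, form_isoTens_frame hz]
    fin_cases α <;> simp [coframe]
  rw [stripFun, thetaV_eq _ _ _ hz]
  simp only [smul_apply, sum_apply, map_smul, map_sum, hI,
    smul_eq_mul]
  rw [Fin.sum_univ_two, Finset.sum_eq_single (fun _ => (0 : Fin 2))]
  · have h0 : deg 0 0 (fun _ : Fin k => (0 : Fin 2)) = k + 1 := by simp [deg, cnt, add_comm]
    have h1 : deg 1 0 (fun _ : Fin k => (0 : Fin 2)) = 0 := by simp [deg, cnt]
    rw [h0, h1, hsum]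
    simp only [one_ne_zero, if_true, if_false, mul_zero, Finset.sum_const_zero, add_zero,
      Finset.prod_const, Finset.card_univ, Fintype.card_fin, thetaC]
    ring
  · intro β _ hβ
    obtain ⟨i, hi⟩ : ∃ i, β i ≠ 0 := by
      by_contra! hc
      exact hβ (funext hc)
    rw [if_pos rfl, Finset.prod_eq_zero (Finset.mem_univ i) (if_neg hi), mul_zero, mul_zero]
  · simp

/-- The coefficient of `y^{2k+1} exp (-π |m - A τ|² y² / v)` in the constant term of the theta
series, paired with `u'^k`. -/
def modeC (k : ℕ) (h : Fin 2) (τ : ℍ) (A m : ℤ) : ℂ :=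
  thetaC k τ * (-(1 / √2 : ℂ)) ^ k / √τ.im * linC τ A m ^ (k + 1) *
    ∫ x in (0 : ℝ)..1, thetaAB (x * A) (x * m) τ h

lemma mixTerm_line (k : ℕ) (h : Fin 2) (τ : ℍ) (x y : ℝ) (A B m : ℤ) :
    mixTerm (k + 1) 0 h τ (x + y * Complex.I) (A, B, m) =
      (y / √τ.im * (linC τ A m * y) ^ (k + 1) * Real.exp (-rate τ A m * y ^ 2)) *
        phase h τ A B m x := by
  simp [mixTerm, hp]

/-- The equivalence `((A, m), B) ↦ (A, B, m)`. -/
def modeEquiv : (ℤ × ℤ) × ℤ ≃ ℤ × ℤ × ℤ where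
  toFun q := (q.1.1, q.2, q.1.2)
  invFun p := ((p.1, p.2.2), p.2.1)
  left_inv _ := rfl
  right_inv _ := rfl

lemma hasSum_constantTerm {k : ℕ} (h : Fin 2) (τ : ℍ) {y : ℝ} (hy : 0 < y) :
    HasSum (fun q : ℤ × ℤ => modeC k h τ q.1 q.2 *
        ((y ^ (2 * k + 1) * Real.exp (-rate τ q.1 q.2 * y ^ 2) : ℝ) : ℂ))
      (∫ x in (0 : ℝ)..1, stripFun (thetaV k h τ) (x + y * Complex.I)) := by
  obtain ⟨u, hu, hb⟩ := exists_mixTerm_le (k + 1) 0 h τ one_pos hy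
  have hy0 : (y : ℂ) ≠ 0 := by exact_mod_cast hy.ne'
  set c : ℂ := thetaC k τ * ((1 / y) * (-(y / √2)) ^ k) with hc
  have h1 : ∫ x in (0 : ℝ)..1, stripFun (thetaV k h τ) (x + y * Complex.I) =
      c * ∫ x in (0 : ℝ)..1, flatSum (k + 1) 0 h τ (x + y * Complex.I) := by
    rw [← intervalIntegral.integral_const_mul]
    refine intervalIntegral.integral_congr fun x _ => ?_
    rw [stripFun_thetaV h τ (line_mem_UHP hy)]
    simp [hc]
  have h2 : HasSum (fun p => ∫ x in (0 : ℝ)..1,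
      mixTerm (k + 1) 0 h τ (x + y * Complex.I) p * decays p)
      (∫ x in (0 : ℝ)..1, flatSum (k + 1) 0 h τ (x + y * Complex.I)) := by
    refine intervalIntegral.hasSum_integral_of_dominated_convergence (fun p _ => u p)
      (fun p => ?_) (fun p => Eventually.of_forall fun x hx => hb p _ ?_ (by simp))
      (Eventually.of_forall fun _ _ => hu) intervalIntegrable_const
      (Eventually.of_forall fun x _ =>
        (summable_mixTerm_decays _ _ h τ (line_mem_UHP hy)).hasSum)
    · obtain ⟨A, B, m⟩ := p
      simp only [mixTerm_line]
      exact ((continuous_const.mul (continuous_phase h τ A B m)).mul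
        continuous_const).aestronglyMeasurable
    · rw [Set.uIoc_of_le zero_le_one] at hx
      simpa [abs_of_pos hx.1] using hx.2
  rw [h1]
  refine HasSum.prod_fiberwise ((modeEquiv.hasSum_iff).2 (h2.mul_left c)) fun q => ?_
  obtain ⟨A, m⟩ := q
  simp only [modeEquiv, Equiv.coe_fn_mk, Function.comp_apply, decays]
  by_cases hA : A = 0 ∧ m = 0
  · have hl : linC τ 0 0 = 0 := by simp [linC]
    obtain ⟨rfl, rfl⟩ := hA
    simp [modeC, hl, hasSum_zero]
  · simp only [if_neg hA, mul_one, mixTerm_line, intervalIntegral.integral_const_mul]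
    convert ((hasSum_integral_phase h τ hA).mul_left
      (y / √τ.im * (linC τ A m * y) ^ (k + 1) * Real.exp (-rate τ A m * y ^ 2) : ℂ)).mul_left c
      using 1
    · rfl
    rw [modeC, hc]
    generalize ∫ x in (0 : ℝ)..1, thetaAB (x * A) (x * m) τ h = J
    push_cast
    rw [show (-(y / √2) : ℂ) ^ k = y ^ k * (-(1 / √2)) ^ k by rw [← mul_pow]; ring]
    field_simp
    ring

/-- The multiples of the primitive vectors exhaust the nonzero vectors. -/
def multVec (x : Cop × ℕ) : ℤ × ℤ := (-((x.2 + 1 : ℤ) * x.1.1 0), (x.2 + 1 : ℤ) * x.1.1 1)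

lemma gcd_multVec (x : Cop × ℕ) : Int.gcd (multVec x).1 (multVec x).2 = x.2 + 1 := by
  have h1 : Int.gcd (x.1.1 0) (x.1.1 1) = 1 := Int.isCoprime_iff_gcd_eq_one.1 x.1.2
  rw [multVec, Int.neg_gcd, Int.gcd_mul_left, h1, mul_one]
  omega

lemma multVec_injective : Function.Injective multVec := by
  intro x y hxy
  have h1 : x.2 = y.2 := by
    have h := gcd_multVec x
    rw [hxy, gcd_multVec] at h
    omega
  have h2 : (x.2 + 1 : ℤ) ≠ 0 := by omega
  simp only [multVec, ← h1, Prod.mk.injEq, neg_inj, mul_right_inj' h2] at hxy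
  refine Prod.ext (Subtype.ext (funext fun i => ?_)) h1
  fin_cases i
  exacts [hxy.1, hxy.2]

lemma exists_multVec {q : ℤ × ℤ} (hq : q ∉ Set.range multVec) : q = 0 := by
  by_contra h0
  have hg : 0 < Int.gcd q.1 q.2 := by
    rw [Int.gcd_pos_iff]
    by_contra! hc
    exact h0 (Prod.ext hc.1 hc.2)
  refine hq ⟨(⟨![-(q.1 / Int.gcd q.1 q.2), q.2 / Int.gcd q.1 q.2], ?_⟩, Int.gcd q.1 q.2 - 1), ?_⟩
  · exact (Int.isCoprime_iff_gcd_eq_one.2 (Int.gcd_ediv_gcd_ediv_gcd hg)).neg_left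
  · have e : ((Int.gcd q.1 q.2 - 1 : ℕ) : ℤ) + 1 = Int.gcd q.1 q.2 := by omega
    simp only [multVec, e, Matrix.cons_val_zero, Matrix.cons_val_one, mul_neg, neg_neg]
    exact Prod.ext (Int.mul_ediv_cancel' (Int.gcd_dvd_left ..))
      (Int.mul_ediv_cancel' (Int.gcd_dvd_right ..))

/-- The constant that relates the Mellin transforms of the modes to the Eisenstein series. -/
def mellinC (k : ℕ) (τ : ℍ) : ℂ :=
  thetaC k τ * (-(1 / √2 : ℂ)) ^ k / √τ.im * (-Complex.I * √2 * √τ.im / Real.pi) ^ (k + 1) *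
    (k.factorial / 2)

lemma modeC_mul (k : ℕ) (h : Fin 2) (τ : ℍ) (x : Cop × ℕ) :
    modeC k h τ (multVec x).1 (multVec x).2 *
      ((k.factorial / (2 * rate τ (multVec x).1 (multVec x).2 ^ (k + 1)) : ℝ) : ℂ) =
    mellinC k τ * (slashTerm k τ (mpLift x.1) h * (((x.2 : ℂ) + 1) ^ (k + 1))⁻¹) := by
  obtain ⟨p, N⟩ := x
  set g := mpLift p with hg
  have hN : ((N : ℤ) + 1) ≠ 0 := by omega
  have hNc : ((N : ℂ) + 1) ≠ 0 := by exact_mod_cast hN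
  have hr : g.root τ ≠ 0 := g.root_ne_zero τ
  have hc : p.1 0 = g.mat 1 0 := (congrFun (row_mpLift p) 0).symm
  have hd : p.1 1 = g.mat 1 1 := (congrFun (row_mpLift p) 1).symm
  have hv : (√τ.im : ℂ) ≠ 0 := by exact_mod_cast (Real.sqrt_pos.2 τ.im_pos).ne'
  have hvv : (τ.im : ℂ) = (√τ.im : ℂ) ^ 2 := by
    rw [← Complex.ofReal_pow, Real.sq_sqrt τ.im_pos.le]
  have hpi : (Real.pi : ℂ) ≠ 0 := by exact_mod_cast Real.pi_ne_zero
  set J : ℂ := g.root τ ^ 2 with hJ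
  have hJ0 : J ≠ 0 := pow_ne_zero 2 hr
  have hJc : (starRingEnd ℂ) J ≠ 0 := (map_ne_zero _).2 hJ0
  have hJe : J = (g.mat 1 0 : ℂ) * τ + g.mat 1 1 := g.sq τ
  set A := (multVec (p, N)).1 with hA
  set m := (multVec (p, N)).2 with hm
  have hAe : A = -(((N : ℤ) + 1) * g.mat 1 0) := by rw [hA, multVec, hc]
  have hme : m = ((N : ℤ) + 1) * g.mat 1 1 := by rw [hm, multVec, hd]
  have hint : ∫ x in (0 : ℝ)..1, thetaAB (x * A) (x * m) τ h =
      (g.root τ)⁻¹ * (weilRep g⁻¹).mulVec (Pi.single 0 1) h := by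
    rw [hAe, hme]; exact integral_thetaAB g τ hN h
  have hlin : linC τ A m = -Complex.I * √2 * (((N : ℂ) + 1) * (starRingEnd ℂ) J) / √τ.im := by
    rw [linC, hAe, hme, hJe, map_add, map_mul, map_intCast, map_intCast]
    push_cast
    ring
  have hrate : (rate τ A m : ℂ) =
      Real.pi * (((N : ℂ) + 1) ^ 2 * (J * (starRingEnd ℂ) J)) / (√τ.im : ℂ) ^ 2 := by
    have h1 : (m : ℂ) - A * τ = ((N : ℂ) + 1) * J := by
      rw [hAe, hme, hJe]; push_cast; ring
    rw [rate, h1, norm_mul, mul_pow, ← hvv]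
    push_cast
    rw [← Complex.mul_conj', ← Complex.mul_conj', map_add, map_one, Complex.conj_natCast]
    ring
  -- `linC` is a multiple of the conjugate of `m - A τ = (N + 1) J`, and `rate` of its square norm
  have hquot : linC τ A m = (-Complex.I * √2 * √τ.im / Real.pi) / (((N : ℂ) + 1) * J) *
      (rate τ A m : ℂ) := by
    rw [hlin, hrate]
    field_simp
  have hrne : (rate τ A m : ℂ) ≠ 0 := by
    rw [hrate]
    exact div_ne_zero (mul_ne_zero hpi (mul_ne_zero (pow_ne_zero 2 hNc) (mul_ne_zero hJ0 hJc)))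
      (pow_ne_zero 2 hv)
  rw [modeC, hint, hquot, mellinC, slashTerm]
  simp only [Pi.smul_apply, smul_eq_mul]
  rw [show g.root τ ^ (2 * k + 3) = g.root τ * J ^ (k + 1) by rw [hJ]; ring, mul_pow, div_pow,
    mul_pow ((N : ℂ) + 1)]
  push_cast
  field_simp

/-- Termwise Mellin transform of a series of Gaussians. -/
lemma integral_of_hasSum_gaussian {ι : Type*} [Countable ι] (k : ℕ) {a : ι → ℂ} {r : ι → ℝ}
    (hr : ∀ x, 0 < r x) {g : ℝ → ℂ}
    (hg : ∀ y : ℝ, 0 < y →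
      HasSum (fun x => a x * ((y ^ (2 * k + 1) * Real.exp (-r x * y ^ 2) : ℝ) : ℂ)) (g y))
    (hs : Summable fun x => a x * ((k.factorial / (2 * r x ^ (k + 1)) : ℝ) : ℂ)) :
    IntegrableOn g (Set.Ioi 0) ∧
    ∫ y in Set.Ioi (0 : ℝ), g y = ∑' x, a x * ((k.factorial / (2 * r x ^ (k + 1)) : ℝ) : ℂ) := by
  have hint : ∀ x, IntegrableOn (fun y : ℝ =>
      a x * ((y ^ (2 * k + 1) * Real.exp (-r x * y ^ 2) : ℝ) : ℂ)) (Set.Ioi 0) := fun x =>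
    ((integral_pow_mul_exp k (hr x)).1.ofReal).const_mul _
  have hval : ∀ x, ∫ y in Set.Ioi (0 : ℝ),
      a x * ((y ^ (2 * k + 1) * Real.exp (-r x * y ^ 2) : ℝ) : ℂ) =
      a x * ((k.factorial / (2 * r x ^ (k + 1)) : ℝ) : ℂ) := fun x => by
    rw [integral_const_mul, integral_complex_ofReal, (integral_pow_mul_exp k (hr x)).2]
  have hnorm : ∀ x, ∫ y in Set.Ioi (0 : ℝ),
      ‖a x * ((y ^ (2 * k + 1) * Real.exp (-r x * y ^ 2) : ℝ) : ℂ)‖ =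
      ‖a x * ((k.factorial / (2 * r x ^ (k + 1)) : ℝ) : ℂ)‖ := by
    intro x
    have h1 : ∀ y ∈ Set.Ioi (0 : ℝ), ‖a x * ((y ^ (2 * k + 1) * Real.exp (-r x * y ^ 2) : ℝ) : ℂ)‖ =
        ‖a x‖ * (y ^ (2 * k + 1) * Real.exp (-r x * y ^ 2)) := by
      intro y hy
      have hy0 : (0 : ℝ) < y := hy
      rw [norm_mul, Complex.norm_real, Real.norm_of_nonneg (by positivity)]
    have h2 : 0 ≤ (k.factorial / (2 * r x ^ (k + 1)) : ℝ) := by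
      have := hr x
      positivity
    rw [setIntegral_congr_fun measurableSet_Ioi h1, integral_const_mul,
      (integral_pow_mul_exp k (hr x)).2, norm_mul, Complex.norm_real, Real.norm_of_nonneg h2]
  obtain ⟨h1, h2⟩ := integrable_of_hasSum (μ := volume.restrict (Set.Ioi 0)) hint
    (by simp only [hnorm]; exact hs.norm)
    ((ae_restrict_iff' measurableSet_Ioi).2 (Eventually.of_forall hg))
  refine ⟨h1, ?_⟩
  simp only [hval] at h2
  exact h2.tsum_eq.symm

lemma summable_slashTerm_mul {k : ℕ} (hk : k ≠ 0) (h : Fin 2) (τ : ℍ) :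
    (Summable fun x : Cop × ℕ =>
      slashTerm k τ (mpLift x.1) h * (((x.2 : ℂ) + 1) ^ (k + 1))⁻¹) ∧
    ∑' x : Cop × ℕ, slashTerm k τ (mpLift x.1) h * (((x.2 : ℂ) + 1) ^ (k + 1))⁻¹ =
      eisHalf k τ h * ∑' N : ℕ, (((N : ℂ) + 1) ^ (k + 1))⁻¹ := by
  have hs1 : Summable fun p : Cop => ‖slashTerm k τ (mpLift p) h‖ :=
    Summable.of_nonneg_of_le (fun _ => norm_nonneg _) (fun p => norm_le_pi_norm _ h)
      (summable_norm_slashTerm hk τ)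
  have hs2 : Summable fun N : ℕ => ‖(((N : ℂ) + 1) ^ (k + 1))⁻¹‖ := by
    have h1 := (summable_nat_add_iff 1).2
      (Real.summable_nat_pow_inv.2 (by omega : 1 < k + 1))
    refine h1.congr fun N => ?_
    rw [norm_inv, norm_pow, ← Nat.cast_one (R := ℂ), ← Nat.cast_add, Complex.norm_natCast]
  have h3 : eisHalf k τ h = ∑' p : Cop, slashTerm k τ (mpLift p) h := by
    rw [eisHalf_eq hk]
    exact tsum_apply (summable_norm_slashTerm hk τ).of_norm
  rw [h3]
  exact ⟨summable_mul_of_summable_norm (f := fun p => slashTerm k τ (mpLift p) h)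
      (g := fun N : ℕ => (((N : ℂ) + 1) ^ (k + 1))⁻¹) hs1 hs2,
    (tsum_mul_tsum_of_summable_norm (f := fun p => slashTerm k τ (mpLift p) h)
      (g := fun N : ℕ => (((N : ℂ) + 1) ^ (k + 1))⁻¹) hs1 hs2).symm⟩

lemma hasSum_constantTerm_multVec {k : ℕ} (h : Fin 2) (τ : ℍ) {y : ℝ} (hy : 0 < y) :
    HasSum (fun x : Cop × ℕ => modeC k h τ (multVec x).1 (multVec x).2 *
        ((y ^ (2 * k + 1) * Real.exp (-rate τ (multVec x).1 (multVec x).2 * y ^ 2) : ℝ) : ℂ))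
      (∫ x in (0 : ℝ)..1, stripFun (thetaV k h τ) (x + y * Complex.I)) := by
  have h1 := hasSum_constantTerm (k := k) h τ hy
  rw [← multVec_injective.hasSum_iff] at h1
  · exact h1
  · intro q hq
    have hl : linC τ 0 0 = 0 := by simp [linC]
    rw [exists_multVec hq, Prod.fst_zero, Prod.snd_zero, modeC, hl, zero_pow (Nat.succ_ne_zero k),
      mul_zero, zero_mul, zero_mul]

lemma integral_constantTerm {k : ℕ} (hk : k ≠ 0) (h : Fin 2) (τ : ℍ) :
    IntegrableOn (fun y : ℝ => ∫ x in (0 : ℝ)..1, stripFun (thetaV k h τ) (x + y * Complex.I))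
      (Set.Ioi 0) ∧
    ∫ y in Set.Ioi (0 : ℝ), ∫ x in (0 : ℝ)..1, stripFun (thetaV k h τ) (x + y * Complex.I) =
      mellinC k τ * (eisHalf k τ h * ∑' N : ℕ, (((N : ℂ) + 1) ^ (k + 1))⁻¹) := by
  have hrate : ∀ x : Cop × ℕ, 0 < rate τ (multVec x).1 (multVec x).2 := by
    intro x
    refine rate_pos τ fun h0 => ?_
    have := gcd_multVec x
    rw [h0.1, h0.2, Int.gcd_zero_left] at this
    simp at this
  obtain ⟨hs, hv⟩ := summable_slashTerm_mul hk h τ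
  have hm := integral_of_hasSum_gaussian k hrate
    (fun y hy => hasSum_constantTerm_multVec (k := k) h τ hy)
    ((hs.mul_left (mellinC k τ)).congr fun x => (modeC_mul k h τ x).symm)
  refine ⟨hm.1, hm.2.trans ?_⟩
  rw [tsum_congr (modeC_mul k h τ), tsum_mul_left, hv]

lemma rpow_neg_half {v : ℝ} (hv : 0 < v) (k : ℕ) : v ^ (-(k : ℝ) / 2) = (√v ^ k)⁻¹ := by
  rw [neg_div, Real.rpow_neg hv.le, Real.sqrt_eq_rpow, ← Real.rpow_natCast, ← Real.rpow_mul hv.le]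
  ring_nf

/-- For odd `k` the constants of the Mellin transform cancel against those in Euler's formula for
`ζ(k + 1)`. -/
lemma mellinC_mul_zeta {k : ℕ} (hk : Odd k) (τ : ℍ) :
    mellinC k τ * ∑' N : ℕ, (((N : ℂ) + 1) ^ (k + 1))⁻¹ =
      1 / 2 * ((bernoulli (k + 1) : ℂ) / ((k : ℂ) + 1)) := by
  obtain ⟨i, rfl⟩ := hk
  have hz : ∑' N : ℕ, (((N : ℂ) + 1) ^ (2 * i + 1 + 1))⁻¹ =
      (((-1 : ℝ) ^ (i + 1 + 1) * (2 : ℝ) ^ (2 * (i + 1) - 1) * Real.pi ^ (2 * (i + 1)) *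
        bernoulli (2 * (i + 1)) / (2 * (i + 1)).factorial : ℝ) : ℂ) := by
    have h1 := hasSum_zeta_nat (k := i + 1) (Nat.succ_ne_zero i)
    have h2 := (hasSum_nat_add_iff' 1).2 h1
    rw [Finset.sum_range_one, Nat.cast_zero, zero_pow (by omega), div_zero, sub_zero] at h2
    rw [← h2.tsum_eq, Complex.ofReal_tsum]
    refine tsum_congr fun N => ?_
    push_cast
    rw [one_div]
    rfl
  have hv : (√τ.im : ℂ) ≠ 0 := by exact_mod_cast (Real.sqrt_pos.2 τ.im_pos).ne'
  have h2 : ((√2 : ℝ) : ℂ) ≠ 0 := by simp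
  have h22 : ((√2 : ℝ) : ℂ) ^ 2 = 2 := by rw [← Complex.ofReal_pow]; simp
  have hpi : (Real.pi : ℂ) ≠ 0 := by exact_mod_cast Real.pi_ne_zero
  have e1 : ((2 : ℝ) ^ (((2 * i + 1 : ℕ) : ℝ) + 1 / 2) : ℝ) = 2 ^ (2 * i + 1) * √2 := by
    rw [Real.rpow_add two_pos, Real.rpow_natCast, ← Real.sqrt_eq_rpow]
  have e2 : (-Complex.I * √2 * √τ.im / Real.pi) ^ (2 * i + 1 + 1) =
      (-1) ^ (i + 1) * 2 ^ (i + 1) * (√τ.im : ℂ) ^ (2 * i + 2) / (Real.pi : ℂ) ^ (2 * i + 2) := by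
    rw [div_pow, mul_pow, mul_pow, show 2 * i + 1 + 1 = 2 * (i + 1) by ring, pow_mul (-Complex.I),
      pow_mul ((√2 : ℝ) : ℂ), h22, neg_sq, Complex.I_sq]
  have e3 : (-(1 / √2 : ℂ)) ^ (2 * i + 1) = -(1 / (2 ^ i * √2)) := by
    rw [Odd.neg_pow ⟨i, rfl⟩, div_pow, one_pow, pow_succ, pow_mul, h22]
  have hfac : ((2 * (i + 1)).factorial : ℂ) = (2 * i + 2) * (2 * i + 1).factorial := by
    rw [show 2 * (i + 1) = 2 * i + 1 + 1 by ring, Nat.factorial_succ]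
    push_cast
    ring
  have hf0 : ((2 * i + 1).factorial : ℂ) ≠ 0 := by exact_mod_cast Nat.factorial_ne_zero _
  have hi0 : (2 * (i : ℂ) + 2) ≠ 0 := by norm_cast
  rw [hz, mellinC, thetaC, rpow_neg_half τ.im_pos, e1, e2, e3]
  push_cast
  rw [hfac, show 2 * (i + 1) - 1 = 2 * i + 1 by omega, show 2 * (i + 1) = 2 * i + 1 + 1 by ring,
    show (2 * (i : ℂ) + 1 + 1) = 2 * i + 2 by ring]
  have hs : ((-1 : ℂ) ^ (i + 1)) * (-1) ^ (i + 1) = 1 := by rw [← mul_pow]; simp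
  field_simp
  rw [h22]
  linear_combination (2 ^ (i + 1) * (√τ.im : ℂ) ^ (2 * i + 2) *
    bernoulli (2 * i + 1 + 1) : ℂ) * hs

lemma form_isoTens_thetaN {k : ℕ} (hk : k ≠ 0) (h : Fin 2) (τ : ℍ) (x : ℝ) :
    form k (isoTens k x) (thetaN k h τ x) = 0 := by
  rw [thetaN_eq hk, map_smul, isoTens, form_act _ _ (by rw [det_n]; exact one_ne_zero),
    form_u'_vNegTwo hk, smul_zero]

end Mellin

end EisLift

end

theorem mainTheorem4 (k : ℕ) (hk : Odd k) (τ : ℍ) :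
    (∀ z ∈ EisLift.UHP, Summable fun q => EisLift.eisTerm k q z) ∧
    (∀ h : Fin 2, ∀ z ∈ EisLift.UHP, Summable fun p => EisLift.thetaTerm k h τ p z) ∧
    (∀ (h : Fin 2) (x : ℝ), Summable fun b => EisLift.bdryTerm k h τ x b) ∧
    (Summable fun q => EisLift.mpTerm k τ q) ∧
    ∀ h : Fin 2, EisLift.HasPairing (EisLift.eisForm k) (EisLift.thetaV k h τ)
      (EisLift.thetaN k h τ)
      (1 / 2 * ((bernoulli (k + 1) : ℂ) / ((k : ℂ) + 1)) * EisLift.eisHalf k τ h) := by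
  have hk0 : k ≠ 0 := hk.pos.ne'
  refine ⟨fun z hz => EisLift.summable_eisTerm hk0 hz,
    fun h z hz => EisLift.summable_thetaTerm k h τ hz, fun h x => EisLift.summable_bdryTerm k h τ x,
    EisLift.summable_mpTerm hk0 τ, fun h => ?_⟩
  have hcone := EisLift.isConeCocycle_theta hk0 h τ
  refine ⟨EisLift.isForm1_eisForm hk0, EisLift.isClosed1_eisForm hk0, hcone,
    hcone.exists_represents, fun α hα => ?_⟩
  obtain ⟨hint, hval⟩ := EisLift.integral_constantTerm hk0 h τ
  rw [EisLift.integralX_of_represents hk0 hα (EisLift.form_isoTens_thetaN hk0 h τ) hint, hval,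
    ← EisLift.mellinC_mul_zeta hk τ]
  ring
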